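/- Let $M$ be a smooth supermanifold of dimension $(n|m)$ with $n-m\neq 1$ and $n-m\neq -1$, let $\nabla$ be a torsion-free superconnection on $M$ with Christoffel symbols $\Gamma_{ij}^k$ in graded coordinates $(x^1,\dots,x^{n+m})$, and let $\delta\in\mathbb R$. Let $p(i)$ be the parity of $x^i$. Let $\mathcal S^k_\delta=\mathcal F_\delta\otimes\vee^k\mathcal T_M$ be the symbols of degree $k$ (supersymmetric contravariant tensors with values in $\delta$-densities) and let $\mathrm{Div}=\sum_j(-1)^{p(j)}\,\mathrm i(dx^j)\nabla_{\partial_j}$ be the divergence of symbols. Let $\mathrm{Ric}(Z,Y)=\mathrm{str}\big(X\mapsto(-1)^{p(X)(p(Y)+p(Z))}R(X,Y)Z\big)$, let $$\mathrm r(X,Y)=\frac{1}{2(n-m-1)}\big(\mathrm{Ric}(Y,X)+(-1)^{p(X)p(Y)}\mathrm{Ric}(X,Y)\big),$$ and let $\mathrm i(\mathrm r)$ be the interior product by $\mathrm r$, normalized by $\mathrm i(\mathrm r)(X\vee Y)=\mathrm r(X,Y)$. Let $\tilde M$ be the Thomas bundle of $M$: it has an additional even coordinate $x^0$ in each graded coordinate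 system, which changes according to $\bar x^0=x^0+\log|\mathrm{Ber}(\partial\bar x^j/\partial x^i)|$. Put $\mathcal E=\partial_0$. Let $\tilde\nabla$ be the Thomas superconnection on $\tilde M$, with Christoffel symbols $$\tilde\Gamma_{ij}^k=\Pi_{ij}^k,\qquad \tilde\Gamma_{0a}^c=\tilde\Gamma_{a0}^c=\frac{-\delta_a^c}{n-m+1},\qquad \tilde\Gamma_{ij}^0=\frac{n-m+1}{n-m-1}\sum_q(-1)^{p(q)(p(q)+p(i)+p(j))}\Big(\partial_q\Pi_{ij}^q-\sum_p\Pi_{qi}^p\Pi_{pj}^q\Big)$$ for $i,j,k\in\{1,\dots,n+m\}$ and $a,c\in\{0,\dots,n+m\}$, where $$\Pi_{ij}^k=\Gamma_{ij}^k-\frac{1}{n-m+1}\sum_s(-1)^{p(s)}\big(\Gamma_{is}^s\delta_j^k+(-1)^{p(i)p(j)}\Gamma_{js}^s\delta_i^k\big),$$ and let $\widetilde{\mathrm{Div}}$ be the divergence of tensors on $\tilde M$ with respect to $\tilde\nabla$. The horizontal lift $A\mapsto A^h$ of symbols sends $\phi|Dx|^\delta\otimes\partial_{i_1}\vee\cdots\vee\partial_{i_k}$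 to $\phi\,e^{\delta x^0}\,\partial_{i_1}^h\vee\cdots\vee\partial_{i_k}^h$, where $\partial_i^h=\partial_i-\sum_s(-1)^{p(s)}\Gamma_{is}^s\,\partial_0$. A tensor $S$ on $\tilde M$ is $\delta$-equivariant if $L_{\mathcal E}S=\delta S$. The descent map $\Psi$ sends a $\delta$-equivariant supersymmetric contravariant tensor of degree $k$ on $\tilde M$, written in the frame $\partial_1^h,\dots,\partial_{n+m}^h,\mathcal E$, to the symbol of degree $k$ obtained by dropping all terms which contain $\mathcal E$, replacing $\partial_i^h$ by $\partial_i$ and a coefficient $\varphi$ by $\varphi\, e^{-\delta x^0}|Dx|^\delta$. Finally, let $$\gamma_s=\frac{n-m+s-(n-m+1)\delta}{n-m+1},$$ and call $\delta$ critical if $\gamma_{2k-l}=0$ for some integers $1\le l\le k$. (1) For all $j,l\in\mathbb N$ and $A\in\mathcal S^j_\delta(M)$, $$\widetilde{\mathrm{Div}}\big(A^h\vee\mathcal E^l\big)=(\mathrm{Div}\,A)^h\vee\mathcal E^l+2(n-m+1)\,(\mathrm i(\mathrm r)A)^h\vee\mathcal E^{l+1}-l\,\gamma_{2j+l}\,A^h\vee\mathcal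 E^{l-1},$$ where the last term is $0$ if $l=0$. (2) If $\delta$ is not critical, then for every $k\in\mathbb N$ the map $\Psi$ restricts to a bijection from the set of $\delta$-equivariant supersymmetric contravariant tensors $S$ of degree $k$ on $\tilde M$ with $\widetilde{\mathrm{Div}}\,S=0$ onto the set $\mathcal S^k_\delta(M)$ of symbols of degree $k$ on $M$. -/

import Mathlib

open scoped ContDiff Manifold
open TopologicalSpace CategoryTheory Opposite

set_option linter.unusedSectionVars false

universe u

noncomputable section

namespace SuperGeometry

/-! ## Signs and Grassmann algebras -/

/-- The Koszul sign `(-1)^(p q)` of two parities. -/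
def ksign (p q : ZMod 2) : ℤ := if p = 1 ∧ q = 1 then -1 else 1

theorem ksign_aux (p q s : ZMod 2) : ksign p s = ksign (q + p) s * ksign s q := by
  revert p q s; decide

theorem ksign_aux1 (p q s : ZMod 2) : ksign p (q + s) = ksign p q * ksign p s := by
  revert p q s; decide

theorem ksign_aux2 (p q s : ZMod 2) : ksign q (p + s) = ksign p q * ksign q s := by
  revert p q s; decide

theorem ksign_aux3 (p q s : ZMod 2) : ksign (p + q) s = ksign p s * ksign q s := by
  revert p q s; decide

theorem ksign_aux4 (p q : ZMod 2) : ksign p q * ksign p q = 1 := by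
  revert p q; decide

/-- The sign `θ^J θ^K = shuffleSign J K • θ^(J ∪ K)` of two disjoint ordered monomials in
anticommuting generators. -/
def shuffleSign {κ : Type*} [LinearOrder κ] (J K : Finset κ) : ℤ :=
  ∏ a ∈ J, ∏ b ∈ K, if b < a then -1 else 1

/-- The Grassmann (exterior) algebra over the commutative ring `R` on anticommuting generators
indexed by `κ`: the element `f` is `∑ K, f.coeff K • θ^K`, where `θ^K` is the product
of the generators `θ_a`, `a ∈ K`, in increasing order. -/
@[ext]
structure Grassmann (κ : Type*) (R : Type*) where
  coeff : Finset κ → R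

namespace Grassmann

section Algebra

variable {κ : Type*} [LinearOrder κ] {R : Type*} [CommRing R]

instance : Zero (Grassmann κ R) := ⟨⟨fun _ => 0⟩⟩
instance : One (Grassmann κ R) := ⟨⟨fun M => if M = ∅ then 1 else 0⟩⟩
instance : Add (Grassmann κ R) := ⟨fun f g => ⟨fun M => f.coeff M + g.coeff M⟩⟩
instance : Neg (Grassmann κ R) := ⟨fun f => ⟨fun M => -f.coeff M⟩⟩
instance : Sub (Grassmann κ R) := ⟨fun f g => ⟨fun M => f.coeff M - g.coeff M⟩⟩
instance {S : Type*} [SMul S R] : SMul S (Grassmann κ R) := ⟨fun s f => ⟨fun M => s • f.coeff M⟩⟩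
instance : Mul (Grassmann κ R) :=
  ⟨fun f g => ⟨fun M => ∑ J ∈ M.powerset,
    (shuffleSign J (M \ J) : R) * (f.coeff J * g.coeff (M \ J))⟩⟩

@[simp] theorem coeff_zero (M) : (0 : Grassmann κ R).coeff M = 0 := rfl
theorem coeff_one (M) : (1 : Grassmann κ R).coeff M = if M = ∅ then 1 else 0 := rfl
@[simp] theorem coeff_add (f g : Grassmann κ R) (M) :
    (f + g).coeff M = f.coeff M + g.coeff M := rfl
@[simp] theorem coeff_neg (f : Grassmann κ R) (M) : (-f).coeff M = -f.coeff M := rfl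
@[simp] theorem coeff_sub (f g : Grassmann κ R) (M) :
    (f - g).coeff M = f.coeff M - g.coeff M := rfl
@[simp] theorem coeff_smul {S : Type*} [SMul S R] (s : S) (f : Grassmann κ R) (M) :
    (s • f).coeff M = s • f.coeff M := rfl
theorem coeff_mul (f g : Grassmann κ R) (M) : (f * g).coeff M =
    ∑ J ∈ M.powerset, (shuffleSign J (M \ J) : R) * (f.coeff J * g.coeff (M \ J)) := rfl

theorem coeff_injective : Function.Injective (coeff : Grassmann κ R → Finset κ → R) :=
  fun _ _ h => Grassmann.ext h

instance : AddCommGroup (Grassmann κ R) :=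
  coeff_injective.addCommGroup coeff rfl (fun _ _ => rfl) (fun _ => rfl) (fun _ _ => rfl)
    (fun _ _ => rfl) (fun _ _ => rfl)

/-- The coefficients, as an additive map. -/
def coeffHom : Grassmann κ R →+ (Finset κ → R) := ⟨⟨coeff, rfl⟩, fun _ _ => rfl⟩

instance {S : Type*} [Semiring S] [Module S R] : Module S (Grassmann κ R) :=
  coeff_injective.module S coeffHom (fun _ _ => rfl)

theorem shuffleSign_union_left (J K L : Finset κ) (h : Disjoint J K) :
    shuffleSign (J ∪ K) L = shuffleSign J L * shuffleSign K L := by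
  simp [shuffleSign, Finset.prod_union h]

theorem shuffleSign_union_right (J K L : Finset κ) (h : Disjoint K L) :
    shuffleSign J (K ∪ L) = shuffleSign J K * shuffleSign J L := by
  simp [shuffleSign, Finset.prod_union h, Finset.prod_mul_distrib]

@[simp] theorem shuffleSign_empty_left (K : Finset κ) : shuffleSign ∅ K = 1 := by
  simp [shuffleSign]

@[simp] theorem shuffleSign_empty_right (K : Finset κ) : shuffleSign K ∅ = 1 := by
  simp [shuffleSign]

theorem mul_assoc_aux (f g h : Grassmann κ R) : f * g * h = f * (g * h) := by
  ext M
  simp only [coeff_mul, Finset.sum_mul, Finset.mul_sum]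
  rw [Finset.sum_sigma', Finset.sum_sigma']
  refine Finset.sum_bij' (fun x _ => ⟨x.2, x.1 \ x.2⟩) (fun x _ => ⟨x.1 ∪ x.2, x.1⟩) ?_ ?_ ?_ ?_ ?_
  · rintro ⟨N, J⟩ hx
    simp only [Finset.mem_sigma, Finset.mem_powerset] at hx ⊢
    exact ⟨hx.2.trans hx.1, Finset.sdiff_subset_sdiff hx.1 le_rfl⟩
  · rintro ⟨J, K⟩ hx
    simp only [Finset.mem_sigma, Finset.mem_powerset] at hx ⊢
    exact ⟨Finset.union_subset hx.1 (hx.2.trans Finset.sdiff_subset), Finset.subset_union_left⟩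
  · rintro ⟨N, J⟩ hx
    simp only [Finset.mem_sigma, Finset.mem_powerset] at hx
    simp [Finset.union_sdiff_of_subset hx.2]
  · rintro ⟨J, K⟩ hx
    simp only [Finset.mem_sigma, Finset.mem_powerset] at hx
    have hd : Disjoint J K := (Finset.disjoint_sdiff (s := J) (t := M)).mono_right hx.2
    simp [Finset.union_sdiff_cancel_left hd]
  · rintro ⟨N, J⟩ hx
    simp only [Finset.mem_sigma, Finset.mem_powerset] at hx
    obtain ⟨hN, hJ⟩ := hx
    have e1 : (M \ J) \ (N \ J) = M \ N := by
      ext a; simp only [Finset.mem_sdiff]; have := @hN a; have := @hJ a; tauto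
    have e2 : M \ J = (N \ J) ∪ (M \ N) := by
      ext a; simp only [Finset.mem_sdiff, Finset.mem_union]
      have := @hN a; have := @hJ a; tauto
    have d2 : Disjoint (N \ J) (M \ N) :=
      (Finset.disjoint_sdiff (s := N) (t := M)).mono_left Finset.sdiff_subset
    have e3 : shuffleSign N (M \ N) = shuffleSign J (M \ N) * shuffleSign (N \ J) (M \ N) := by
      rw [← shuffleSign_union_left _ _ _ Finset.disjoint_sdiff, Finset.union_sdiff_of_subset hJ]
    have e4 : shuffleSign J (M \ J) = shuffleSign J (N \ J) * shuffleSign J (M \ N) := by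
      rw [← shuffleSign_union_right _ _ _ d2, ← e2]
    simp only [e1, e3, e4]
    push_cast
    ring

theorem one_mul_aux (f : Grassmann κ R) : 1 * f = f := by
  ext M
  rw [coeff_mul, Finset.sum_eq_single ∅]
  · simp [coeff_one]
  · intro J _ hJ; simp [coeff_one, hJ]
  · simp

theorem mul_one_aux (f : Grassmann κ R) : f * 1 = f := by
  ext M
  rw [coeff_mul, Finset.sum_eq_single M]
  · simp [coeff_one]
  · intro J hJ hJM
    have : M \ J ≠ ∅ := by
      rw [Finset.mem_powerset] at hJ
      intro h; exact hJM (hJ.antisymm (Finset.sdiff_eq_empty_iff_subset.1 h))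
    simp [coeff_one, this]
  · simp

instance : Ring (Grassmann κ R) :=
  { (inferInstance : AddCommGroup (Grassmann κ R)) with
    mul := (· * ·)
    one := 1
    mul_assoc := mul_assoc_aux
    one_mul := one_mul_aux
    mul_one := mul_one_aux
    left_distrib := fun f g h => by
      ext M; simp only [coeff_mul, coeff_add, mul_add, Finset.sum_add_distrib]
    right_distrib := fun f g h => by
      ext M; simp only [coeff_mul, coeff_add, add_mul, mul_add, Finset.sum_add_distrib]
    zero_mul := fun f => by ext M; simp [coeff_mul]
    mul_zero := fun f => by ext M; simp [coeff_mul] }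

instance {S : Type*} [CommRing S] [Algebra S R] : Algebra S (Grassmann κ R) :=
  Algebra.ofModule
    (fun s f g => by ext M; simp [coeff_mul, Finset.smul_sum])
    (fun s f g => by ext M; simp [coeff_mul, Finset.smul_sum])

/-- The scalar `r`, as an element of the Grassmann algebra. -/
def ofScalar (r : R) : Grassmann κ R := ⟨fun K => if K = ∅ then r else 0⟩

/-- The generator `θ_a`. -/
def gen (a : κ) : Grassmann κ R := ⟨fun K => if K = {a} then 1 else 0⟩

/-- Homogeneous elements of parity `p`. -/
def IsParity (p : ZMod 2) (f : Grassmann κ R) : Prop :=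
  ∀ K, (K.card : ZMod 2) ≠ p → f.coeff K = 0

/-- The left derivative `∂/∂θ_a`: `∂/∂θ_a (θ_a θ^K) = θ^K` and `∂/∂θ_a (θ^K) = 0` for `a ∉ K`. -/
def leftDeriv (a : κ) : Grassmann κ R →ₗ[R] Grassmann κ R where
  toFun f := ⟨fun K => if a ∈ K then 0 else (shuffleSign {a} K : R) * f.coeff (insert a K)⟩
  map_add' f g := by ext K; by_cases h : a ∈ K <;> simp [h, mul_add]
  map_smul' r f := by ext K; by_cases h : a ∈ K <;> simp [h, mul_left_comm]

/-- Applying an additive map to all coefficients. -/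
def mapCoeff {S : Type*} [CommRing S] (φ : R →+ S) : Grassmann κ R →+ Grassmann κ S where
  toFun f := ⟨fun K => φ (f.coeff K)⟩
  map_zero' := by ext K; simp
  map_add' f g := by ext K; simp

theorem coeff_leftDeriv (a : κ) (f : Grassmann κ R) (K) : (leftDeriv a f).coeff K =
    if a ∈ K then 0 else (shuffleSign {a} K : R) * f.coeff (insert a K) := rfl

@[simp] theorem coeff_mapCoeff {S : Type*} [CommRing S] (φ : R →+ S) (f : Grassmann κ R) (K) :
    (mapCoeff φ f).coeff K = φ (f.coeff K) := rfl

theorem mapCoeff_mul {S : Type*} [CommRing S] (φ : R →+* S) (f g : Grassmann κ R) :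
    mapCoeff (φ : R →+ S) (f * g) = mapCoeff (φ : R →+ S) f * mapCoeff (φ : R →+ S) g := by
  ext K; simp [coeff_mul]

theorem IsParity.leftDeriv {a : κ} {p : ZMod 2} {f : Grassmann κ R} (hf : f.IsParity p) :
    (leftDeriv a f).IsParity (1 + p) := by
  intro K hK
  rw [coeff_leftDeriv]
  split_ifs with h
  · rfl
  · rw [hf, mul_zero]
    rw [Finset.card_insert_of_notMem h]
    push_cast
    rintro rfl
    apply hK
    generalize (K.card : ZMod 2) = c
    revert c; decide

theorem shuffleSign_singleton_right (J : Finset κ) (a : κ) (ha : a ∉ J) :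
    shuffleSign J {a} = (-1) ^ J.card * shuffleSign {a} J := by
  simp only [shuffleSign, Finset.prod_singleton]
  rw [← Finset.prod_const, ← Finset.prod_mul_distrib]
  refine Finset.prod_congr rfl fun b hb => ?_
  have hne : a ≠ b := fun h => ha (h ▸ hb)
  rcases lt_or_gt_of_ne hne with h | h
  · simp [h, h.not_gt]
  · simp [h, h.not_gt]

theorem neg_one_pow_eq_ksign (k : ℕ) : (-1 : ℤ) ^ k = ksign 1 (k : ZMod 2) := by
  induction k with
  | zero => simp [ksign]
  | succ k ih =>
    rw [pow_succ, ih]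
    push_cast
    generalize (k : ZMod 2) = c
    revert c; decide

/-- The graded Leibniz rule for left derivatives. -/
theorem leftDeriv_mul {p : ZMod 2} (a : κ) {f : Grassmann κ R} (hf : f.IsParity p)
    (g : Grassmann κ R) :
    leftDeriv a (f * g) = leftDeriv a f * g + ksign 1 p • (f * leftDeriv a g) := by
  have hε : ∀ J : Finset κ, f.coeff J ≠ 0 → ((-1 : ℤ) ^ J.card = ksign 1 p) := by
    intro J hJ
    rw [neg_one_pow_eq_ksign]
    by_contra h
    exact hJ (hf J fun h' => h (by rw [h']))
  have hsq : ∀ J K : Finset κ, (shuffleSign J K : R) * shuffleSign J K = 1 := by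
    intro J K
    rw [← Int.cast_mul, shuffleSign, ← Finset.prod_mul_distrib]
    simp_rw [← Finset.prod_mul_distrib]
    rw [Finset.prod_eq_one, Int.cast_one]
    intro x _
    refine Finset.prod_eq_one fun y _ => ?_
    split_ifs <;> simp
  ext M
  simp only [coeff_add, coeff_smul]
  by_cases ha : a ∈ M
  · obtain ⟨M, haM, rfl⟩ : ∃ M' : Finset κ, a ∉ M' ∧ insert a M' = M :=
      ⟨M.erase a, by simp, Finset.insert_erase ha⟩
    rw [coeff_leftDeriv, if_pos ha, coeff_mul, coeff_mul, Finset.sum_powerset_insert haM,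
      Finset.sum_powerset_insert haM, ← Finset.sum_add_distrib, ← Finset.sum_add_distrib,
      Finset.smul_sum, ← Finset.sum_add_distrib]
    refine (Finset.sum_eq_zero fun J hJ => ?_).symm
    rw [Finset.mem_powerset] at hJ
    have haJ : a ∉ J := fun h => haM (hJ h)
    have e1 : insert a M \ J = (M \ J) ∪ {a} := by
      rw [Finset.insert_sdiff_of_notMem _ haJ, Finset.union_comm, Finset.insert_eq]
    have e2 : insert a M \ insert a J = M \ J := by
      rw [Finset.insert_sdiff_insert, Finset.sdiff_insert_of_notMem haM]
    have hd : Disjoint (M \ J) {a} := by simp [haM]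
    have haK : a ∉ M \ J := by simp [haM]
    have e3 : insert a (M \ J) = (M \ J) ∪ {a} := by rw [Finset.union_comm, Finset.insert_eq]
    rw [e2, e1]
    simp only [coeff_leftDeriv, if_neg haJ, if_neg haK, if_pos (Finset.mem_insert_self a J), e3,
      Finset.mem_union, Finset.mem_singleton, or_true, if_true, zero_mul, mul_zero, add_zero,
      zero_add]
    rw [shuffleSign_union_right _ _ _ hd, shuffleSign_singleton_right J a haJ,
      Finset.insert_eq a J, shuffleSign_union_left {a} J _ (by simpa using haJ), ← Finset.insert_eq]
    by_cases h0 : f.coeff (insert a J) = 0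
    · simp [h0]
    · have h1 := hε _ h0
      rw [Finset.card_insert_of_notMem haJ] at h1
      rw [← h1, zsmul_eq_mul]
      push_cast
      have q1 := hsq {a} J
      have q2 := hsq {a} (M \ J)
      linear_combination ((-1 : R) ^ J.card * (shuffleSign J (M \ J) : R) * f.coeff (insert a J)
        * g.coeff (M \ J ∪ {a})) * (q1 - q2)
  · rw [coeff_leftDeriv, if_neg ha, coeff_mul, coeff_mul, coeff_mul,
      Finset.sum_powerset_insert ha, Finset.smul_sum, mul_add, Finset.mul_sum, Finset.mul_sum,
      add_comm]
    congr 1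
    · refine Finset.sum_congr rfl fun J hJ => ?_
      rw [Finset.mem_powerset] at hJ
      have haJ : a ∉ J := fun h => ha (hJ h)
      have e2 : insert a M \ insert a J = M \ J := by
        rw [Finset.insert_sdiff_insert, Finset.sdiff_insert_of_notMem ha]
      rw [e2, coeff_leftDeriv, if_neg haJ, Finset.insert_eq a J,
        shuffleSign_union_left {a} J _ (by simpa using haJ)]
      have e4 : shuffleSign {a} M = shuffleSign {a} J * shuffleSign {a} (M \ J) := by
        rw [← shuffleSign_union_right _ _ _ Finset.disjoint_sdiff, Finset.union_sdiff_of_subset hJ]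
      rw [e4]
      push_cast
      have q2 := hsq {a} (M \ J)
      linear_combination ((shuffleSign {a} J : R) * (shuffleSign J (M \ J) : R) * f.coeff ({a} ∪ J)
        * g.coeff (M \ J)) * q2
    · refine Finset.sum_congr rfl fun J hJ => ?_
      rw [Finset.mem_powerset] at hJ
      have haJ : a ∉ J := fun h => ha (hJ h)
      have haK : a ∉ M \ J := by simp [ha]
      have e1 : insert a M \ J = (M \ J) ∪ {a} := by
        rw [Finset.insert_sdiff_of_notMem _ haJ, Finset.union_comm, Finset.insert_eq]
      have e3 : insert a (M \ J) = (M \ J) ∪ {a} := by rw [Finset.union_comm, Finset.insert_eq]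
      have hd : Disjoint (M \ J) {a} := by simp [ha]
      have e4 : shuffleSign {a} M = shuffleSign {a} J * shuffleSign {a} (M \ J) := by
        rw [← shuffleSign_union_right _ _ _ Finset.disjoint_sdiff, Finset.union_sdiff_of_subset hJ]
      rw [coeff_leftDeriv, if_neg haK, e1, e3, shuffleSign_union_right _ _ _ hd,
        shuffleSign_singleton_right J a haJ, e4]
      by_cases h0 : f.coeff J = 0
      · simp [h0]
      · rw [← hε _ h0, zsmul_eq_mul]
        push_cast
        have q1 := hsq {a} J
        linear_combination ((-1 : R) ^ J.card * (shuffleSign {a} (M \ J) : R)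
          * (shuffleSign J (M \ J) : R) * f.coeff J * g.coeff (M \ J ∪ {a})) * q1

end Algebra

end Grassmann

/-! ## Smooth functions and superfunctions on superdomains -/

/-- The Euclidean space `ℝ^N`. -/
abbrev Eu (N : ℕ) := EuclideanSpace ℝ (Fin N)

/-- Extension by zero of a function on an open set. -/
def zeroExt {N : ℕ} {W : Opens (Eu N)} (f : W → ℝ) : Eu N → ℝ :=
  Function.extend Subtype.val f 0

theorem zeroExt_apply {N : ℕ} {W : Opens (Eu N)} (f : W → ℝ) (x : W) : zeroExt f x = f x :=
  Subtype.val_injective.extend_apply f 0 x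

theorem zeroExt_of_mem {N : ℕ} {W : Opens (Eu N)} (f : W → ℝ) {x : Eu N} (hx : x ∈ W) :
    zeroExt f x = f ⟨x, hx⟩ := zeroExt_apply f ⟨x, hx⟩

/-- The algebra `C^∞(W)` of smooth real functions on the open set `W` of `ℝ^N`. -/
def Smooth {N : ℕ} (W : Opens (Eu N)) : Subalgebra ℝ (W → ℝ) where
  carrier := {f | ContDiffOn ℝ ∞ (zeroExt f) W}
  mul_mem' {f g} hf hg := (hf.mul hg).congr fun x hx => by simp [zeroExt_of_mem _ hx]
  add_mem' {f g} hf hg := (hf.add hg).congr fun x hx => by simp [zeroExt_of_mem _ hx]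
  algebraMap_mem' r :=
    (contDiffOn_const (c := r)).congr fun x hx => by simp [zeroExt_of_mem _ hx]

namespace Smooth

variable {N : ℕ}

/-- The smooth function given by the restriction to `W` of a function on `ℝ^N`. -/
def mk' {W : Opens (Eu N)} (F : Eu N → ℝ) (hF : ContDiffOn ℝ ∞ F W) : Smooth W :=
  ⟨fun x => F x, hF.congr fun x hx => by simp [zeroExt_of_mem _ hx]⟩

/-- Evaluation at a point. -/
def eval {W : Opens (Eu N)} (x : W) : Smooth W →+* ℝ where
  toFun f := f.1 x
  map_one' := rfl
  map_mul' _ _ := rfl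
  map_zero' := rfl
  map_add' _ _ := rfl

/-- Composition with a smooth map which sends `V` to `W`. -/
def comp {N' : ℕ} {V : Opens (Eu N')} {W : Opens (Eu N)} (φ : Eu N' → Eu N)
    (hφ : ContDiff ℝ ∞ φ) (h : ∀ x ∈ V, φ x ∈ W) : Smooth W →+* Smooth V where
  toFun f := ⟨fun x => f.1 ⟨φ x, h x x.2⟩,
    (f.2.comp hφ.contDiffOn (fun x hx => h x hx)).congr fun x hx => by
      simp [zeroExt_of_mem _ hx, zeroExt_of_mem _ (h x hx)]⟩
  map_one' := rfl
  map_mul' _ _ := rfl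
  map_zero' := rfl
  map_add' _ _ := rfl

/-- Restriction to a smaller open set. -/
def res {V W : Opens (Eu N)} (h : V ≤ W) : Smooth W →+* Smooth V :=
  comp id contDiff_id (fun _ hx => h hx)

/-- The derivative of a function on `W` in the direction `v`. -/
def rawDeriv {W : Opens (Eu N)} (v : Eu N) (f : W → ℝ) : W → ℝ :=
  fun x => fderiv ℝ (zeroExt f) x v

theorem hasFDerivAt {W : Opens (Eu N)} (f : Smooth W) (x : W) :
    HasFDerivAt (zeroExt f.1) (fderiv ℝ (zeroExt f.1) x) x :=
  ((f.2.differentiableOn (by simp)).differentiableAt (W.isOpen.mem_nhds x.2)).hasFDerivAt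

theorem rawDeriv_eq {W : Opens (Eu N)} (v : Eu N) (f : W → ℝ) (x : W) {g : Eu N → ℝ}
    {L : Eu N →L[ℝ] ℝ} (hg : HasFDerivAt g L x) (h : ∀ y : W, f y = g y) :
    rawDeriv v f x = L v := by
  rw [rawDeriv, (hg.congr_of_eventuallyEq (f₁ := zeroExt f) _).fderiv]
  filter_upwards [W.isOpen.mem_nhds x.2] with y hy
  rw [zeroExt_of_mem _ hy, h]

/-- The directional derivative of smooth functions. -/
def dirDeriv {W : Opens (Eu N)} (v : Eu N) : Smooth W →ₗ[ℝ] Smooth W where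
  toFun f := ⟨rawDeriv v f.1, by
    have h : ContDiffOn ℝ ∞ (fun x => fderiv ℝ (zeroExt f.1) x v) W :=
      (f.2.fderiv_of_isOpen W.isOpen (by simp)).clm_apply contDiffOn_const
    exact h.congr fun x hx => by rw [zeroExt_of_mem _ hx]; rfl⟩
  map_add' f g := by
    ext x
    exact rawDeriv_eq v _ x ((hasFDerivAt f x).add (hasFDerivAt g x))
      (fun y => by simp [zeroExt_apply])
  map_smul' r f := by
    ext x
    exact rawDeriv_eq v _ x ((hasFDerivAt f x).const_smul r) (fun y => by simp [zeroExt_apply])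

theorem dirDeriv_mul {W : Opens (Eu N)} (v : Eu N) (f g : Smooth W) :
    dirDeriv v (f * g) = dirDeriv v f * g + f * dirDeriv v g := by
  ext x
  refine (rawDeriv_eq v _ x ((hasFDerivAt f x).mul (hasFDerivAt g x))
    (fun y => by simp [zeroExt_apply])).trans ?_
  simp [dirDeriv, rawDeriv, zeroExt_apply]
  ring

theorem dirDeriv_res {V W : Opens (Eu N)} (h : V ≤ W) (v : Eu N) (f : Smooth W) :
    dirDeriv v (res h f) = res h (dirDeriv v f) := by
  ext x
  exact rawDeriv_eq v _ x (hasFDerivAt f ⟨x, h x.2⟩)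
    (fun y => (zeroExt_apply f.1 ⟨y, h y.2⟩).symm)

end Smooth

/-- Indices of graded coordinates of a superdomain of dimension `(N|m)`: even, then odd. -/
abbrev Idx (N m : ℕ) := Fin N ⊕ Fin m

/-- The parity of an index. -/
def Idx.parity {N m : ℕ} : Idx N m → ZMod 2
  | .inl _ => 0
  | .inr _ => 1

/-- The sign `(-1)^p`. -/
def psign (p : ZMod 2) : ℤ := ksign 1 p

/-- Superfunctions on the superdomain of dimension `(N|m)` with body `W`, that is,
`C^∞(W) ⊗ Λ ℝ^m`, the Grassmann algebra over `C^∞(W)` on the odd coordinates. -/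
abbrev SuperFun (m : ℕ) {N : ℕ} (W : Opens (Eu N)) := Grassmann (Fin m) (Smooth W)

namespace SuperFun

variable {N m : ℕ}

/-- The graded coordinates, as superfunctions. -/
def coord {W : Opens (Eu N)} : Idx N m → SuperFun m W
  | .inl i => .ofScalar (Smooth.mk' (fun x => x i) (by fun_prop))
  | .inr j => .gen j

/-- The partial derivatives with respect to the graded coordinates. -/
def pd {W : Opens (Eu N)} : Idx N m → SuperFun m W →ₗ[ℝ] SuperFun m W
  | .inl i =>
    { toFun := Grassmann.mapCoeff (Smooth.dirDeriv (EuclideanSpace.single i 1)).toAddMonoidHom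
      map_add' := map_add _
      map_smul' := fun r f => by exact Grassmann.ext (funext fun K => by simp) }
  | .inr j =>
    { toFun := Grassmann.leftDeriv j
      map_add' := map_add _
      map_smul' := fun r f => by
        refine Grassmann.ext (funext fun K => ?_)
        simp only [Grassmann.coeff_leftDeriv, Grassmann.coeff_smul, RingHom.id_apply]
        split_ifs <;> simp }

/-- Pullback along a smooth map of bodies (acting on coefficients). -/
def comp {N' : ℕ} {V : Opens (Eu N')} {W : Opens (Eu N)} (φ : Eu N' → Eu N)
    (hφ : ContDiff ℝ ∞ φ) (h : ∀ x ∈ V, φ x ∈ W) : SuperFun m W →+ SuperFun m V :=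
  Grassmann.mapCoeff (Smooth.comp φ hφ h : Smooth W →+ Smooth V)

/-- Restriction to a smaller open set. -/
def res {V W : Opens (Eu N)} (h : V ≤ W) : SuperFun m W →+ SuperFun m V :=
  Grassmann.mapCoeff (Smooth.res h : Smooth W →+ Smooth V)

/-- The value in `Λ ℝ^m` of a superfunction at a point of the body. -/
def eval {W : Opens (Eu N)} (x : W) : SuperFun m W →+ Grassmann (Fin m) ℝ :=
  Grassmann.mapCoeff (Smooth.eval x : Smooth W →+ ℝ)

/-- Partial derivatives of an arbitrary function on `W` with values in `Λ ℝ^m`. -/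
def rawPd {W : Opens (Eu N)} (i : Idx N m) (f : W → Grassmann (Fin m) ℝ) (x : W) :
    Grassmann (Fin m) ℝ :=
  match i with
  | .inl i => ⟨fun K => Smooth.rawDeriv (EuclideanSpace.single i 1) (fun y => (f y).coeff K) x⟩
  | .inr j => Grassmann.leftDeriv j (f x)

theorem pd_res {V W : Opens (Eu N)} (h : V ≤ W) (i : Idx N m) (f : SuperFun m W) :
    pd i (res h f) = res h (pd i f) := by
  rcases i with i | j
  · refine Grassmann.ext (funext fun K => ?_)
    exact Smooth.dirDeriv_res h _ (f.coeff K)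
  · refine Grassmann.ext (funext fun K => ?_)
    show (Grassmann.leftDeriv j (res h f)).coeff K = Smooth.res h ((Grassmann.leftDeriv j f).coeff K)
    rw [Grassmann.coeff_leftDeriv, Grassmann.coeff_leftDeriv]
    split_ifs
    · simp
    · simp [res]

theorem pd_parity {W : Opens (Eu N)} (i : Idx N m) {p : ZMod 2} {f : SuperFun m W}
    (hf : f.IsParity p) : (pd i f).IsParity (i.parity + p) := by
  rcases i with i | j
  · intro K hK
    show Smooth.dirDeriv _ (f.coeff K) = 0
    rw [hf K (by simpa [Idx.parity] using hK), map_zero]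
  · exact hf.leftDeriv

theorem pd_mul {W : Opens (Eu N)} (i : Idx N m) {p : ZMod 2} {f : SuperFun m W}
    (hf : f.IsParity p) (g : SuperFun m W) :
    pd i (f * g) = pd i f * g + ksign i.parity p • (f * pd i g) := by
  rcases i with i | j
  · have h0 : ksign (Idx.parity (Sum.inl i : Idx N m)) p = 1 := by simp [ksign, Idx.parity]
    rw [h0, one_smul]
    refine Grassmann.ext (funext fun K => ?_)
    show Smooth.dirDeriv _ ((f * g).coeff K) = (pd (.inl i) f * g + f * pd (.inl i) g).coeff K
    rw [Grassmann.coeff_add, Grassmann.coeff_mul, Grassmann.coeff_mul, Grassmann.coeff_mul,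
      ← Finset.sum_add_distrib, map_sum]
    refine Finset.sum_congr rfl fun J _ => ?_
    rw [← zsmul_eq_mul, map_zsmul, Smooth.dirDeriv_mul, zsmul_eq_mul, mul_add]
    rfl
  · exact Grassmann.leftDeriv_mul j hf g

end SuperFun

/-! ## Supersymmetric contravariant tensors on superdomains -/

/-- Supersymmetric contravariant tensor fields in `N|m` graded coordinates, with coefficients
in `Grassmann (Fin m) B` (`B = C^∞(W)` for tensor fields on a superdomain, `B = ℝ` for their values
at a point). Writing `ξ_i` for the coordinate vector field `∂_i`, these are the superpolynomials in
the `ξ_i`: the even `ξ_i` are polynomial variables and the odd `ξ_i` are Grassmann generators which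
anticommute with each other and with the odd coordinates. The product is the supersymmetric
product `∨`. The Grassmann generators `Sum.inlₗ j` are the odd coordinates, the generators
`Sum.inrₗ j` are the odd `ξ`'s. -/
abbrev Symb (N m : ℕ) (B : Type*) [CommRing B] :=
  Grassmann (Fin m ⊕ₗ Fin m) (MvPolynomial (Fin N) B)

namespace Symb

variable {N m : ℕ} {B : Type*} [CommRing B]

/-- A superfunction, as a tensor of degree zero. -/
def ofBase (f : Grassmann (Fin m) B) : Symb N m B :=
  ⟨fun L => if ∀ k : Fin m, Sum.inrₗ k ∉ L then
    MvPolynomial.C (f.coeff {j | Sum.inlₗ j ∈ L}) else 0⟩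

/-- The coordinate vector field `∂_i`, as a tensor of degree one. -/
def xi : Idx N m → Symb N m B
  | .inl i => .ofScalar (MvPolynomial.X i)
  | .inr k => .gen (Sum.inrₗ k)

/-- The coefficient (a superfunction, written on the left) of the normally ordered monomial with
exponents `α` of the even `ξ`'s and set `K` of odd `ξ`'s. -/
def coef (S : Symb N m B) (α : Fin N →₀ ℕ) (K : Finset (Fin m)) : Grassmann (Fin m) B :=
  ⟨fun J => (S.coeff (J.image Sum.inlₗ ∪ K.image Sum.inrₗ)).coeff α⟩

/-- The exponents of the even `ξ`'s which occur in `S`. -/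
def exponents (S : Symb N m B) : Finset (Fin N →₀ ℕ) :=
  Finset.univ.biUnion fun L => (S.coeff L).support

/-- The normally ordered monomial with exponents `α` and `K` in given elements `η`. -/
def monom {N' : ℕ} {B' : Type*} [CommRing B'] (η : Idx N m → Symb N' m B') (α : Fin N →₀ ℕ)
    (K : Finset (Fin m)) : Symb N' m B' :=
  (List.ofFn fun i => η (.inl i) ^ α i).prod * ((K.sort (· ≤ ·)).map fun k => η (.inr k)).prod

/-- Transforms the coefficients of `S` by `g` and replaces `ξ_i` by `η i`. -/
def subst {N' : ℕ} {B' : Type*} [CommRing B'] (g : Grassmann (Fin m) B → Grassmann (Fin m) B')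
    (η : Idx N m → Symb N' m B') (S : Symb N m B) : Symb N' m B' :=
  ∑ α ∈ S.exponents, ∑ K : Finset (Fin m), ofBase (g (S.coef α K)) * monom η α K

/-- Tensors of degree `k`. -/
def IsHomog (k : ℕ) (S : Symb N m B) : Prop :=
  ∀ (α : Fin N →₀ ℕ) (K : Finset (Fin m)), S.coef α K ≠ 0 → α.degree + K.card = k

/-- The interior product `i(dx^a)`: the superderivation of the parity of `x^a` which kills
the superfunctions and sends `ξ_b` to `δ_b^a`. -/
def contr : Idx N m → Symb N m B →+ Symb N m B
  | .inl a => Grassmann.mapCoeff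
      ((MvPolynomial.pderiv a : Derivation B (MvPolynomial (Fin N) B) (MvPolynomial (Fin N) B)) :
        MvPolynomial (Fin N) B →ₗ[B] MvPolynomial (Fin N) B).toAddMonoidHom
  | .inr a => (Grassmann.leftDeriv (Sum.inrₗ a)).toAddMonoidHom

variable {W : Opens (Eu N)}

/-- The partial derivative `∂/∂x^i` acting on the coefficients of a tensor field. -/
def pd : Idx N m → Symb N m (Smooth W) →+ Symb N m (Smooth W)
  | .inl i => Grassmann.mapCoeff
      ⟨⟨AddMonoidAlgebra.map (Smooth.dirDeriv (EuclideanSpace.single i 1)).toAddMonoidHom,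
        AddMonoidAlgebra.map_zero _⟩, AddMonoidAlgebra.map_add _⟩
  | .inr j => (Grassmann.leftDeriv (Sum.inlₗ j)).toAddMonoidHom

end Symb

/-! ## Covariant derivative and divergence in graded coordinates -/

/-- Christoffel symbols: `Γ i j k` is `Γ_{ij}^k`, that is, `∇_{∂_i} ∂_j = ∑ k, Γ_{ij}^k ∂_k`. -/
abbrev Christoffel (m : ℕ) {N : ℕ} (W : Opens (Eu N)) :=
  Idx N m → Idx N m → Idx N m → SuperFun m W

namespace Christoffel

variable {N m : ℕ} {W : Opens (Eu N)}

/-- `∑ s, (-1)^{p(s)} Γ_{is}^s`. -/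
def trace (Γ : Christoffel m W) (i : Idx N m) : SuperFun m W :=
  ∑ s : Idx N m, psign s.parity • Γ i s s

/-- The covariant derivative `∇_{∂_i}` of a supersymmetric contravariant tensor field with values
in `δ`-densities. On the density coefficient, it is `∂_i - δ ∑ s, (-1)^{p(s)} Γ_{is}^s`. On a product
`φ ∂_{i_1} ∨ ⋯ ∨ ∂_{i_k}`, it moreover replaces each factor `∂_{i_r}` by
`∇_{∂_i} ∂_{i_r} = ∑ k, Γ_{i i_r}^k ∂_k`, with the sign which results from moving `∇_{∂_i}` past
`φ, ∂_{i_1}, …, ∂_{i_{r-1}}`: this second part is the superderivation `∑ j, (∇_{∂_i} ∂_j) ∨ i(dx^j)`. -/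
def covDer (Γ : Christoffel m W) (δ : ℝ) (i : Idx N m) (S : Symb N m (Smooth W)) :
    Symb N m (Smooth W) :=
  Symb.pd i S - δ • (Symb.ofBase (Γ.trace i) * S)
    + ∑ j : Idx N m, (∑ k : Idx N m, Symb.ofBase (Γ i j k) * Symb.xi k) * Symb.contr j S

/-- The divergence `∑ j, (-1)^{p(j)} i(dx^j) ∇_{∂_j}` on tensor fields with values in
`δ`-densities. -/
def div (Γ : Christoffel m W) (δ : ℝ) (S : Symb N m (Smooth W)) : Symb N m (Smooth W) :=
  ∑ j : Idx N m, psign j.parity • Symb.contr j (Γ.covDer δ j S)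

end Christoffel

/-! ## Supermanifolds -/

/-- A sheaf of (supercommutative) superalgebras over `ℝ`. -/
structure SuperalgebraSheaf (M₀ : TopCat.{u}) where
  sheaf : TopCat.Sheaf (AlgCat.{u} ℝ) M₀
  /-- the even (`0`) and odd (`1`) sections -/
  parity : ∀ U : Opens M₀, ZMod 2 → Submodule ℝ (sheaf.presheaf.obj (op U))
  graded : ∀ U, GradedAlgebra (parity U)
  map_parity : ∀ {U V : Opens M₀} (h : V ≤ U) (p : ZMod 2) (a : sheaf.presheaf.obj (op U)),
    a ∈ parity U p → (sheaf.presheaf.map (homOfLE h).op).hom a ∈ parity V p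
  supercomm : ∀ (U : Opens M₀) (p q : ZMod 2) (a b : sheaf.presheaf.obj (op U)),
    a ∈ parity U p → b ∈ parity U q → a * b = ksign p q • (b * a)

namespace SuperalgebraSheaf

variable {M₀ : TopCat.{u}} (A : SuperalgebraSheaf M₀)

/-- The superalgebra of sections over `U`. -/
abbrev sec (U : Opens M₀) : Type u := A.sheaf.presheaf.obj (op U)

/-- The restriction maps. -/
def res {U V : Opens M₀} (h : V ≤ U) : A.sec U →ₐ[ℝ] A.sec V :=
  (A.sheaf.presheaf.map (homOfLE h).op).hom

theorem res_parity {U V : Opens M₀} (h : V ≤ U) {p : ZMod 2} {a : A.sec U}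
    (ha : a ∈ A.parity U p) : A.res h a ∈ A.parity V p := A.map_parity h p a ha

theorem res_res {U V V' : Opens M₀} (h : V ≤ U) (h' : V' ≤ V) (a : A.sec U) :
    A.res h' (A.res h a) = A.res (h'.trans h) a := by
  have : A.sheaf.presheaf.map (homOfLE (h'.trans h)).op =
      A.sheaf.presheaf.map (homOfLE h).op ≫ A.sheaf.presheaf.map (homOfLE h').op := by
    rw [← Functor.map_comp]; rfl
  rw [res, res, res, this]
  rfl

theorem mul_parity {U : Opens M₀} {p q : ZMod 2} {a b : A.sec U} (ha : a ∈ A.parity U p)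
    (hb : b ∈ A.parity U q) : a * b ∈ A.parity U (p + q) :=
  (A.graded U).toGradedMonoid.toGradedMul.mul_mem ha hb

/-- Families of linear endomorphisms of the spaces of sections over the open subsets of `U`. -/
abbrev LinFamily (U : Opens M₀) := ∀ V : {V : Opens M₀ // V ≤ U}, A.sec V.1 →ₗ[ℝ] A.sec V.1

/-- The supervector fields on `U` which are homogeneous of parity `p`: superderivations of parity
`p` of the sheaf restricted to `U`. -/
def derivations (U : Opens M₀) (p : ZMod 2) : Submodule ℝ (A.LinFamily U) where
  carrier := {D |
    (∀ (V V' : {V : Opens M₀ // V ≤ U}) (h : V'.1 ≤ V.1) (a : A.sec V.1),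
      A.res h (D V a) = D V' (A.res h a)) ∧
    (∀ (V : {V : Opens M₀ // V ≤ U}) (q : ZMod 2) (a : A.sec V.1), a ∈ A.parity V.1 q →
      D V a ∈ A.parity V.1 (p + q)) ∧
    ∀ (V : {V : Opens M₀ // V ≤ U}) (q : ZMod 2) (a b : A.sec V.1), a ∈ A.parity V.1 q →
      D V (a * b) = D V a * b + ksign p q • (a * D V b)}
  add_mem' := by
    rintro D D' ⟨h1, h2, h3⟩ ⟨h1', h2', h3'⟩
    refine ⟨fun V V' h a => ?_, fun V q a ha => ?_, fun V q a b ha => ?_⟩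
    · simp [h1 V V' h, h1' V V' h]
    · exact add_mem (h2 V q a ha) (h2' V q a ha)
    · simp only [Pi.add_apply, LinearMap.add_apply, h3 V q a b ha, h3' V q a b ha, add_mul, mul_add,
        smul_add]
      abel
  zero_mem' := ⟨fun V V' h a => by simp, fun V q a _ => by simp, fun V q a b _ => by simp⟩
  smul_mem' := by
    rintro r D ⟨h1, h2, h3⟩
    refine ⟨fun V V' h a => ?_, fun V q a ha => ?_, fun V q a b ha => ?_⟩
    · simp [h1 V V' h]
    · exact Submodule.smul_mem _ _ (h2 V q a ha)
    · simp [h3 V q a b ha]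

/-- The space of supervector fields on `U`: sums of an even and an odd superderivation. -/
def vectorFields (U : Opens M₀) : Submodule ℝ (A.LinFamily U) := ⨆ p : ZMod 2, A.derivations U p

/-- A homogeneous supervector field is a supervector field. -/
def ofHomog {U : Opens M₀} {p : ZMod 2} (X : A.derivations U p) : A.vectorFields U :=
  ⟨X.1, le_iSup (A.derivations U) p X.2⟩

variable {A}

/-- The action of a supervector field on a superfunction. -/
def act {U : Opens M₀} (X : A.vectorFields U) (a : A.sec U) : A.sec U := X.1 ⟨U, le_rfl⟩ a

/-- The restriction of families to a smaller open set. -/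
def restrictFamily {U V : Opens M₀} (h : V ≤ U) : A.LinFamily U →ₗ[ℝ] A.LinFamily V where
  toFun D := fun V' => D ⟨V'.1, V'.2.trans h⟩
  map_add' _ _ := rfl
  map_smul' _ _ := rfl

/-- The restriction of supervector fields to a smaller open set. -/
def restrict {U V : Opens M₀} (h : V ≤ U) (X : A.vectorFields U) : A.vectorFields V :=
  ⟨restrictFamily h X.1, by
    have : A.vectorFields U ≤ (A.vectorFields V).comap (restrictFamily h) := by
      refine iSup_le fun p D hD => ?_
      refine le_iSup (A.derivations V) p ⟨fun V₁ V₂ h' a => ?_, fun V₁ q a ha => ?_,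
        fun V₁ q a b ha => ?_⟩
      · exact hD.1 ⟨V₁.1, V₁.2.trans h⟩ ⟨V₂.1, V₂.2.trans h⟩ h' a
      · exact hD.2.1 ⟨V₁.1, V₁.2.trans h⟩ q a ha
      · exact hD.2.2 ⟨V₁.1, V₁.2.trans h⟩ q a b ha
    exact this X.2⟩

/-- The product of a family by a superfunction. -/
def mulFamily {U : Opens M₀} : A.sec U →ₗ[ℝ] A.LinFamily U →ₗ[ℝ] A.LinFamily U :=
  LinearMap.mk₂ ℝ (fun f D => fun V => (LinearMap.mulLeft ℝ (A.res V.2 f)).comp (D V))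
    (fun f g D => by ext V a; simp [add_mul]) (fun r f D => by ext V a; simp)
    (fun f D D' => by ext V a; simp [mul_add]) (fun r f D => by ext V a; simp)

theorem mulFamily_mem {U : Opens M₀} {p q : ZMod 2} {f : A.sec U} {D : A.LinFamily U}
    (hf : f ∈ A.parity U q) (hD : D ∈ A.derivations U p) :
    mulFamily f D ∈ A.derivations U (q + p) := by
  obtain ⟨h1, h2, h3⟩ := hD
  refine ⟨fun V V' h a => ?_, fun V s a ha => ?_, fun V s a b ha => ?_⟩
  · show A.res h (A.res V.2 f * D V a) = A.res V'.2 f * D V' (A.res h a)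
    rw [map_mul, h1 V V' h, res_res]
  · rw [add_assoc]
    exact A.mul_parity (A.res_parity V.2 hf) (h2 V s a ha)
  · show A.res V.2 f * D V (a * b) =
      A.res V.2 f * D V a * b + ksign (q + p) s • (a * (A.res V.2 f * D V b))
    rw [h3 V s a b ha, ← mul_assoc a, A.supercomm V.1 s q a _ ha (A.res_parity V.2 hf)]
    rw [ksign_aux p q s, mul_add, mul_assoc, mul_smul_comm, smul_mul_assoc, smul_smul, mul_assoc]

/-- The product of a supervector field by a superfunction. -/
def fsmul {U : Opens M₀} (f : A.sec U) (X : A.vectorFields U) : A.vectorFields U :=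
  ⟨mulFamily f X.1, by
    have key : ∀ q, ∀ g ∈ A.parity U q,
        A.vectorFields U ≤ (A.vectorFields U).comap (mulFamily g) := fun q g hg =>
      iSup_le fun p D hD => le_iSup (A.derivations U) (q + p) (mulFamily_mem hg hD)
    let _ := A.graded U
    classical
    have hf : f = ∑ q : ZMod 2, (DirectSum.decompose (A.parity U) f q : A.sec U) :=
      (DirectSum.sum_support_decompose (A.parity U) f).symm.trans
        (Finset.sum_subset (Finset.subset_univ _) fun q _ hq => by
          simpa [DFinsupp.mem_support_toFun] using hq)
    rw [hf, map_sum, LinearMap.sum_apply]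
    exact sum_mem fun q _ => key q _ (SetLike.coe_mem _) X.2⟩

/-- The Lie bracket `[X, Y] = X Y - (-1)^{p(X) p(Y)} Y X` of homogeneous supervector fields. -/
def bracket {U : Opens M₀} {p q : ZMod 2} (X : A.derivations U p) (Y : A.derivations U q) :
    A.derivations U (p + q) :=
  ⟨fun V => (X.1 V).comp (Y.1 V) - ksign p q • (Y.1 V).comp (X.1 V), by
    obtain ⟨X, hX1, hX2, hX3⟩ := X
    obtain ⟨Y, hY1, hY2, hY3⟩ := Y
    refine ⟨fun V V' h a => ?_, fun V s a ha => ?_, fun V s a b ha => ?_⟩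
    · simp [hX1 V V' h, hY1 V V' h]
    · have e1 : X V (Y V a) ∈ A.parity V.1 (p + q + s) := by
        rw [add_assoc]; exact hX2 V _ _ (hY2 V _ _ ha)
      have e2 : Y V (X V a) ∈ A.parity V.1 (p + q + s) := by
        rw [add_comm p q, add_assoc]; exact hY2 V _ _ (hX2 V _ _ ha)
      exact sub_mem e1 (zsmul_mem e2 _)
    · simp only [LinearMap.sub_apply, LinearMap.comp_apply, LinearMap.smul_apply,
        hX3 V s a b ha, hY3 V s a b ha, map_add, map_zsmul,
        hX3 V _ _ b (hY2 V _ _ ha), hY3 V _ _ b (hX2 V _ _ ha), hX3 V s a _ ha, hY3 V s a _ ha,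
        ksign_aux1 p q s, ksign_aux2 p q s, ksign_aux3 p q s, sub_mul, mul_sub, smul_mul_assoc, mul_smul_comm, smul_add, smul_sub, smul_smul]
      have c5 : ksign p q * (ksign p q * ksign q s) = ksign q s := by
        rw [← mul_assoc, ksign_aux4, one_mul]
      rw [c5, mul_comm (ksign q s) (ksign p s), mul_comm (ksign p q) (ksign p s),
        mul_comm (ksign p s * ksign q s) (ksign p q)]
      abel⟩

end SuperalgebraSheaf

/-- The source of a chart of the body. -/
def bodyDomain {n : ℕ} {M₀ : TopCat.{u}} (e : OpenPartialHomeomorph M₀ (Eu n)) : Opens M₀ :=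
  ⟨e.source, e.open_source⟩

/-- The image under a chart of the body of an open set. -/
def bodyImage {n : ℕ} {M₀ : TopCat.{u}} (e : OpenPartialHomeomorph M₀ (Eu n)) (V : Opens M₀) :
    Opens (Eu n) :=
  ⟨e.target ∩ e.symm ⁻¹' V, e.isOpen_inter_preimage_symm V.isOpen⟩

theorem bodyImage_mono {n : ℕ} {M₀ : TopCat.{u}} (e : OpenPartialHomeomorph M₀ (Eu n))
    {V V' : Opens M₀} (h : V' ≤ V) : bodyImage e V' ≤ bodyImage e V :=
  fun _ hx => ⟨hx.1, h hx.2⟩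

/-- A local chart of dimension `(n|m)`: a chart `body` of the smooth manifold `M₀`, with domain `U`,
together with an isomorphism of sheaves of superalgebras over it, from the restriction to `U` of the
given sheaf to the sheaf `C^∞ ⊗ Λ ℝ^m` on an open set of `ℝ^n`. -/
structure SuperChart (n m : ℕ) {M₀ : TopCat.{u}} [ChartedSpace (Eu n) M₀]
    (A : SuperalgebraSheaf M₀) where
  body : OpenPartialHomeomorph M₀ (Eu n)
  body_mem : body ∈ IsManifold.maximalAtlas (𝓡 n) ∞ M₀
  iso : ∀ V : Opens M₀, V ≤ bodyDomain body → (A.sec V ≃ₐ[ℝ] SuperFun m (bodyImage body V))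
  iso_res : ∀ (V V' : Opens M₀) (hV : V ≤ bodyDomain body) (h : V' ≤ V) (a : A.sec V),
    iso V' (h.trans hV) (A.res h a) = SuperFun.res (bodyImage_mono body h) (iso V hV a)
  iso_parity : ∀ (V : Opens M₀) (hV : V ≤ bodyDomain body) (p : ZMod 2) (a : A.sec V),
    a ∈ A.parity V p ↔ (iso V hV a).IsParity p

/-- A supermanifold of dimension `(n|m)` with body the smooth manifold `M₀`: a sheaf of superalgebras
on `M₀` locally isomorphic to `C^∞ ⊗ Λ ℝ^m` on open sets of `ℝ^n`. -/
structure Supermanifold (n m : ℕ) (M₀ : TopCat.{u}) [ChartedSpace (Eu n) M₀]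
    extends SuperalgebraSheaf M₀ where
  exists_chart : ∀ x : M₀, ∃ c : SuperChart n m toSuperalgebraSheaf, x ∈ bodyDomain c.body

namespace SuperChart

variable {n m : ℕ} {M₀ : TopCat.{u}} [ChartedSpace (Eu n) M₀] {A : SuperalgebraSheaf M₀}
  (c : SuperChart n m A)

/-- The domain of the chart, an open set of `M₀`. -/
abbrev dom : Opens M₀ := bodyDomain c.body

/-- The image of the chart, an open set of `ℝ^n`. -/
abbrev range : Opens (Eu n) := bodyImage c.body c.dom

/-- The graded coordinates, as superfunctions on the domain of the chart. -/
def coordSec (i : Idx n m) : A.sec c.dom := (c.iso c.dom le_rfl).symm (SuperFun.coord i)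

/-- The coordinate supervector fields `∂_i` on the domain of the chart. -/
def coordField (i : Idx n m) : A.derivations c.dom i.parity :=
  ⟨fun V => ((c.iso V.1 V.2).symm.toLinearMap.comp (SuperFun.pd i)).comp
      (c.iso V.1 V.2).toLinearMap, by
    have hres : ∀ (V V' : Opens M₀) (hV : V ≤ c.dom) (h : V' ≤ V)
        (f : SuperFun m (bodyImage c.body V)), A.res h ((c.iso V hV).symm f) =
        (c.iso V' (h.trans hV)).symm (SuperFun.res (bodyImage_mono c.body h) f) := by
      intro V V' hV h f
      apply (c.iso V' (h.trans hV)).injective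
      rw [c.iso_res V V' hV h, AlgEquiv.apply_symm_apply, AlgEquiv.apply_symm_apply]
    refine ⟨fun V V' h a => ?_, fun V q a ha => ?_, fun V q a b ha => ?_⟩
    · show A.res h ((c.iso V.1 V.2).symm (SuperFun.pd i (c.iso V.1 V.2 a))) =
        (c.iso V'.1 V'.2).symm (SuperFun.pd i (c.iso V'.1 V'.2 (A.res h a)))
      rw [hres V.1 V'.1 V.2 h, c.iso_res V.1 V'.1 V.2 h, SuperFun.pd_res]
    · show (c.iso V.1 V.2).symm (SuperFun.pd i (c.iso V.1 V.2 a)) ∈ _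
      rw [c.iso_parity V.1 V.2, AlgEquiv.apply_symm_apply]
      exact SuperFun.pd_parity i ((c.iso_parity V.1 V.2 q a).1 ha)
    · show (c.iso V.1 V.2).symm (SuperFun.pd i (c.iso V.1 V.2 (a * b))) =
        (c.iso V.1 V.2).symm (SuperFun.pd i (c.iso V.1 V.2 a)) * b +
        ksign i.parity q • (a * (c.iso V.1 V.2).symm (SuperFun.pd i (c.iso V.1 V.2 b)))
      rw [map_mul, SuperFun.pd_mul i ((c.iso_parity V.1 V.2 q a).1 ha), map_add, map_zsmul,
        map_mul, map_mul, AlgEquiv.symm_apply_apply, AlgEquiv.symm_apply_apply]⟩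

/-- The component of index `k` of a supervector field, `X = ∑ k, X^k ∂_k`, in the chart. -/
def component (X : A.vectorFields c.dom) (k : Idx n m) : SuperFun m c.range :=
  c.iso c.dom le_rfl (SuperalgebraSheaf.act X (c.coordSec k))

end SuperChart

/-! ## Superconnections -/

open SuperalgebraSheaf in
/-- A superconnection: a morphism of sheaves of super vector spaces `T ⊗ T → T`, where `T` is the
tangent sheaf, with the usual rules for products by superfunctions. -/
structure Superconnection {M₀ : TopCat.{u}} (A : SuperalgebraSheaf M₀) where
  nabla : ∀ U : Opens M₀, A.vectorFields U →ₗ[ℝ] A.vectorFields U →ₗ[ℝ] A.vectorFields U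
  nabla_restrict : ∀ {U V : Opens M₀} (h : V ≤ U) (X Y : A.vectorFields U),
    restrict h (nabla U X Y) = nabla V (restrict h X) (restrict h Y)
  nabla_parity : ∀ (U : Opens M₀) (p q : ZMod 2) (X : A.derivations U p) (Y : A.derivations U q),
    (nabla U (A.ofHomog X) (A.ofHomog Y)).1 ∈ A.derivations U (p + q)
  nabla_fsmul_left : ∀ (U : Opens M₀) (f : A.sec U) (X Y : A.vectorFields U),
    nabla U (fsmul f X) Y = fsmul f (nabla U X Y)
  nabla_fsmul_right : ∀ (U : Opens M₀) (p q : ZMod 2) (f : A.sec U) (X : A.derivations U p)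
    (Y : A.vectorFields U), f ∈ A.parity U q →
    nabla U (A.ofHomog X) (fsmul f Y) =
      fsmul (act (A.ofHomog X) f) Y + ksign p q • fsmul f (nabla U (A.ofHomog X) Y)

namespace Superconnection

section Sheaf

variable {M₀ : TopCat.{u}} {A : SuperalgebraSheaf M₀} (D : Superconnection A)

/-- The torsion `T(X, Y) = ∇_X Y - (-1)^{p(X) p(Y)} ∇_Y X - [X, Y]`. -/
def torsion {U : Opens M₀} {p q : ZMod 2} (X : A.derivations U p) (Y : A.derivations U q) :
    A.vectorFields U :=
  D.nabla U (A.ofHomog X) (A.ofHomog Y) - ksign p q • D.nabla U (A.ofHomog Y) (A.ofHomog X)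
    - A.ofHomog (SuperalgebraSheaf.bracket X Y)

/-- Torsion-free superconnections. -/
def IsTorsionFree : Prop := ∀ (U : Opens M₀) (p q : ZMod 2) (X : A.derivations U p)
  (Y : A.derivations U q), D.torsion X Y = 0

/-- The curvature
`R(X, Y) Z = ∇_X ∇_Y Z - (-1)^{p(X) p(Y)} ∇_Y ∇_X Z - ∇_{[X, Y]} Z`. -/
def curvature {U : Opens M₀} {p q : ZMod 2} (X : A.derivations U p) (Y : A.derivations U q)
    (Z : A.vectorFields U) : A.vectorFields U :=
  D.nabla U (A.ofHomog X) (D.nabla U (A.ofHomog Y) Z)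
    - ksign p q • D.nabla U (A.ofHomog Y) (D.nabla U (A.ofHomog X) Z)
    - D.nabla U (A.ofHomog (SuperalgebraSheaf.bracket X Y)) Z

end Sheaf

variable {n m : ℕ} {M₀ : TopCat.{u}} [ChartedSpace (Eu n) M₀] {A : SuperalgebraSheaf M₀}
  (D : Superconnection A) (c : SuperChart n m A)

/-- The Christoffel symbols in a chart. -/
def christoffel : Christoffel m c.range := fun i j k =>
  c.component (D.nabla c.dom (A.ofHomog (c.coordField i)) (A.ofHomog (c.coordField j))) k

/-- The components `Ric(∂_i, ∂_j)` of the super-Ricci tensor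
`Ric(Z, Y) = ∑ q, (-1)^{p(q) (p(q) + p(Y) + p(Z))} (R(∂_q, Y) Z)^q`. -/
def ricci (i j : Idx n m) : SuperFun m c.range :=
  ∑ q : Idx n m, ksign q.parity (q.parity + j.parity + i.parity) •
    c.component (D.curvature (c.coordField q) (c.coordField j) (A.ofHomog (c.coordField i))) q

/-- The components `r(∂_i, ∂_j)` of the supersymmetric tensor
`r(X, Y) = (Ric(Y, X) + (-1)^{p(X) p(Y)} Ric(X, Y)) / (2 (n - m - 1))`. -/
def rTensor (i j : Idx n m) : SuperFun m c.range :=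
  (1 / (2 * ((n : ℝ) - m - 1))) •
    (D.ricci c j i + ksign i.parity j.parity • D.ricci c i j)

/-- The interior product `i(r)` in a chart, where
`r = (1/2) ∑ a b, r(∂_b, ∂_a) dx^a ∨ dx^b` and `i(dx^a ∨ dx^b) = i(dx^a) ∘ i(dx^b)`;
thus `i(r) (∂_i ∨ ∂_j) = r(∂_i, ∂_j)`. -/
def contrR (S : Symb n m (Smooth c.range)) : Symb n m (Smooth c.range) :=
  (1 / 2 : ℝ) • ∑ a : Idx n m, ∑ b : Idx n m,
    Symb.ofBase (D.rTensor c b a) * Symb.contr a (Symb.contr b S)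

/-- The divergence of symbols of weight `δ`, in a chart. -/
def div (δ : ℝ) (S : Symb n m (Smooth c.range)) : Symb n m (Smooth c.range) :=
  (D.christoffel c).div δ S

end Superconnection

/-! ## Berezinian, logarithms and powers in a Grassmann algebra -/

section Berezinian

variable {m : ℕ}

/-- The body (component of degree zero) of an element of `Λ ℝ^m`. -/
def gbody (a : Grassmann (Fin m) ℝ) : ℝ := a.coeff ∅

/-- The nilpotent part `a - body a`. -/
def gsoul (a : Grassmann (Fin m) ℝ) : Grassmann (Fin m) ℝ := a - .ofScalar (gbody a)

/-- The exponential of an even element of `Λ ℝ^m` (the Taylor expansion terminates). -/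
def gexp (a : Grassmann (Fin m) ℝ) : Grassmann (Fin m) ℝ :=
  Real.exp (gbody a) • ∑ k ∈ Finset.range (m + 1), (1 / (k.factorial : ℝ)) • gsoul a ^ k

/-- `log |a|` for an even invertible element of `Λ ℝ^m`: the Taylor expansion of `log |·|` at
the body of `a`. -/
def glogAbs (a : Grassmann (Fin m) ℝ) : Grassmann (Fin m) ℝ :=
  .ofScalar (Real.log |gbody a|) +
    ∑ k ∈ Finset.Icc 1 m, ((-1) ^ (k + 1) / (k : ℝ)) • ((gbody a)⁻¹ • gsoul a) ^ k

/-- `|a|^δ = exp (δ log |a|)` for an even invertible element of `Λ ℝ^m`. -/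
def gabsPow (a : Grassmann (Fin m) ℝ) (δ : ℝ) : Grassmann (Fin m) ℝ := gexp (δ • glogAbs a)

/-- The determinant of a matrix with commuting entries in a possibly noncommutative ring. -/
def evenDet {R : Type*} [Ring R] {k : ℕ} (P : Matrix (Fin k) (Fin k) R) : R :=
  ∑ σ : Equiv.Perm (Fin k), (Equiv.Perm.sign σ : ℤ) • (List.ofFn fun i => P (σ i) i).prod

/-- The Berezinian of an even invertible supermatrix `(P, Q; S, T)`:
`det (P - Q T⁻¹ S) det(T)⁻¹`. -/
def berezinian {R : Type*} [Ring R] {n : ℕ} (J : Matrix (Idx n m) (Idx n m) R) : R :=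
  evenDet (J.toBlocks₁₁ - J.toBlocks₁₂ * Ring.inverse J.toBlocks₂₂ * J.toBlocks₂₁) *
    Ring.inverse (evenDet J.toBlocks₂₂)

end Berezinian

/-! ## Symbols on a supermanifold -/

section Symbols

variable {n m : ℕ} {M₀ : TopCat.{u}} [ChartedSpace (Eu n) M₀] {A : SuperalgebraSheaf M₀}

namespace SuperChart

variable (c c' : SuperChart n m A)

/-- The image in the chart `c` of the intersection of the domains of `c` and `c'`. -/
abbrev overlap : Opens (Eu n) := bodyImage c.body (c.dom ⊓ c'.dom)

theorem overlap_le : c.overlap c' ≤ c.range := bodyImage_mono c.body inf_le_left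

/-- A superfunction written in the chart `c'`, rewritten in the chart `c` on the overlap. -/
def pull (f : SuperFun m c'.range) : SuperFun m (c.overlap c') :=
  c.iso (c.dom ⊓ c'.dom) inf_le_left
    (A.res inf_le_right ((c'.iso c'.dom le_rfl).symm f))

/-- The value at a point of the overlap of the matrix `∂x̄^j/∂x^i` (row `i`, column `j`) of the
change from the graded coordinates `x` of `c` to the graded coordinates `x̄` of `c'`. -/
def jacobian (x : c.overlap c') : Matrix (Idx n m) (Idx n m) (Grassmann (Fin m) ℝ) :=
  fun i j => SuperFun.eval x (SuperFun.pd i (c.pull c' (SuperFun.coord j)))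

end SuperChart

variable (A) in
/-- Families of local expressions of a `δ`-density-valued symbol: the expression `S` in the chart `c`
stands for `∑ φ |Dx|^δ ⊗ ∂_{i_1} ∨ ⋯ ∨ ∂_{i_k}`. -/
abbrev SymbolFamily := ∀ c : SuperChart n m A, Symb n m (Smooth c.range)

/-- Symbols of degree `k` and weight `δ`, that is, global sections of `F_δ ⊗ ∨^k T`: families of
local expressions of degree `k` which correspond to each other under changes of
graded coordinates, where `∂_i = ∑ j, (∂x̄^j/∂x^i) ∂̄_j` and `|Dx̄|^δ = |Ber (∂x̄^j/∂x^i)|^δ |Dx|^δ`. -/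
def IsSymbol (δ : ℝ) (k : ℕ) (S : SymbolFamily (n := n) (m := m) A) : Prop :=
  (∀ c, (S c).IsHomog k) ∧
  ∀ (c c' : SuperChart n m A) (x : c.overlap c'),
    (S c).subst (SuperFun.eval ⟨x, c.overlap_le c' x.2⟩)
        (fun i => ∑ j, Symb.ofBase (c.jacobian c' x i j) * Symb.xi j) =
      Symb.ofBase (gabsPow (berezinian (c.jacobian c' x)) δ) *
        (S c').subst (fun f => SuperFun.eval x (c.pull c' f)) Symb.xi

end Symbols

/-! ## The Thomas bundle

The supermanifold `M̃` has, for each chart `c` of `M` with range `W`, a chart with range `ℝ × W`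
and graded coordinates `(x^0, x^1, …, x^{n+m})`; the coordinate `x^0` changes according to
`x̄^0 = x^0 + log |Ber (∂x̄^j/∂x^i)|`. -/

section Thomas

/-- The projection `(x^0, x) ↦ x`. -/
def dropTime {n : ℕ} (y : Eu (n + 1)) : Eu n := WithLp.toLp 2 fun i => y i.succ

/-- The map `x ↦ (s, x)`. -/
def insertTime {n : ℕ} (s : ℝ) (x : Eu n) : Eu (n + 1) := WithLp.toLp 2 (Fin.cons s x.ofLp)

theorem contDiff_dropTime {n : ℕ} : ContDiff ℝ ∞ (dropTime (n := n)) := by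
  unfold dropTime; fun_prop

theorem contDiff_insertTime {n : ℕ} (s : ℝ) : ContDiff ℝ ∞ (insertTime (n := n) s) := by
  rw [contDiff_euclidean]
  intro i
  refine Fin.cases ?_ (fun i => ?_) i
  · exact contDiff_const
  · show ContDiff ℝ ∞ fun x : Eu n => x i
    fun_prop

theorem dropTime_insertTime {n : ℕ} (s : ℝ) (x : Eu n) : dropTime (insertTime s x) = x := rfl

/-- The cylinder `ℝ × W`. -/
def cyl {n : ℕ} (W : Opens (Eu n)) : Opens (Eu (n + 1)) :=
  ⟨dropTime ⁻¹' W, W.isOpen.preimage contDiff_dropTime.continuous⟩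

variable {n m : ℕ}

/-- A superfunction of `(x^1, …, x^{n+m})`, as a superfunction of `(x^0, …, x^{n+m})`. -/
def liftFun {W : Opens (Eu n)} : SuperFun m W →+ SuperFun m (cyl W) :=
  SuperFun.comp dropTime contDiff_dropTime fun _ hx => hx

/-- The restriction of a superfunction to the slice `x^0 = s`. -/
def slice {W : Opens (Eu n)} (s : ℝ) : SuperFun m (cyl W) →+ SuperFun m W :=
  SuperFun.comp (insertTime s) (contDiff_insertTime s) fun _ hx => hx

/-- The function `exp (δ x^0)`. -/
def expTime {W : Opens (Eu n)} (δ : ℝ) : SuperFun m (cyl W) :=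
  .ofScalar (Smooth.mk' (fun y => Real.exp (δ * y 0)) (by fun_prop))

/-- The index `0`, of the extra coordinate. -/
def timeIdx : Idx (n + 1) m := .inl 0

/-- The indices `1, …, n + m` among `0, …, n + m`. -/
def baseIdx : Idx n m → Idx (n + 1) m
  | .inl i => .inl i.succ
  | .inr j => .inr j

/-- The inverse of `baseIdx`; it gives `none` for the index `0`. -/
def toBase : Idx (n + 1) m → Option (Idx n m)
  | .inl a => Fin.cases none (fun i => some (.inl i)) a
  | .inr j => some (.inr j)

/-- The fundamental descriptive invariant `Π_{ij}^k` of Christoffel symbols. -/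
def Christoffel.descriptive {W : Opens (Eu n)} (Γ : Christoffel m W) : Christoffel m W :=
  fun i j k => Γ i j k - (1 / ((n : ℝ) - m + 1)) •
    ((if j = k then Γ.trace i else 0) +
      ksign i.parity j.parity • (if i = k then Γ.trace j else 0))

/-- The Christoffel symbols of the Thomas superconnection. -/
def Christoffel.thomas {W : Opens (Eu n)} (Γ : Christoffel m W) : Christoffel m (cyl W) :=
  fun a b c =>
    match toBase a, toBase b with
    | some i, some j =>
      match toBase c with
      | some k => liftFun (Γ.descriptive i j k)
      | none => liftFun ((((n : ℝ) - m + 1) / ((n : ℝ) - m - 1)) •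
          ∑ q : Idx n m, ksign q.parity (q.parity + i.parity + j.parity) •
            (SuperFun.pd q (Γ.descriptive i j q) -
              ∑ p : Idx n m, Γ.descriptive q i p * Γ.descriptive p j q))
    | none, _ => if b = c then (-1 / ((n : ℝ) - m + 1)) • 1 else 0
    | some _, none => if a = c then (-1 / ((n : ℝ) - m + 1)) • 1 else 0

/-- The horizontal lift of a symbol of weight `δ`: `φ |Dx|^δ` becomes `φ exp (δ x^0)` and `∂_i`
becomes `∂_i^h = ∂_i - (∑ s, (-1)^{p(s)} Γ_{is}^s) ∂_0`. -/
def Christoffel.hlift {W : Opens (Eu n)} (Γ : Christoffel m W) (δ : ℝ)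
    (S : Symb n m (Smooth W)) : Symb (n + 1) m (Smooth (cyl W)) :=
  Symb.ofBase (expTime δ) * S.subst liftFun fun i =>
    Symb.xi (baseIdx i) - Symb.ofBase (liftFun (Γ.trace i)) * Symb.xi timeIdx

/-- Rewrites a tensor on the cylinder in the frame `∂_1^h, …, ∂_{n+m}^h, ∂_0`: in the result,
the variable `ξ_i` stands for `∂_i^h` if `i ≠ 0`, and `ξ_0` for `∂_0`. -/
def Christoffel.toHorizontalFrame {W : Opens (Eu n)} (Γ : Christoffel m W)
    (S : Symb (n + 1) m (Smooth (cyl W))) : Symb (n + 1) m (Smooth (cyl W)) :=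
  S.subst id fun a =>
    match toBase a with
    | none => Symb.xi timeIdx
    | some i => Symb.xi a + Symb.ofBase (liftFun (Γ.trace i)) * Symb.xi timeIdx

/-- The descent map, in a chart: the terms which contain `ℰ = ∂_0` (in the frame `∂_i^h, ∂_0`) are
dropped, `∂_i^h` becomes `∂_i` and a coefficient `φ` becomes `φ exp (- δ x^0)` (at `x^0 = 0`). -/
def Christoffel.descent {W : Opens (Eu n)} (Γ : Christoffel m W) (δ : ℝ)
    (S : Symb (n + 1) m (Smooth (cyl W))) : Symb n m (Smooth W) :=
  (Γ.toHorizontalFrame S).subst (fun f => slice 0 (expTime (-δ) * f)) fun a =>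
    match toBase a with
    | none => 0
    | some i => Symb.xi i

variable {M₀ : TopCat.{u}} [ChartedSpace (Eu n) M₀] {A : SuperalgebraSheaf M₀}

namespace SuperChart

variable (c c' : SuperChart n m A)

/-- The superfunction `log |Ber (∂x̄^j/∂x^i)|` on the overlap of two charts. -/
def logBer (x : c.overlap c') : Grassmann (Fin m) ℝ := glogAbs (berezinian (c.jacobian c' x))

/-- The point of the overlap below a point of the cylinder. -/
def basePoint (y : cyl (c.overlap c')) : c.overlap c' := ⟨dropTime y.1, y.2⟩

/-- A superfunction `f(x̄^0, x̄)` on the cylinder over `c'`, rewritten at a point `y` of the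
cylinder over `c` by means of `x̄^0 = x^0 + log |Ber (∂x̄^j/∂x^i)|` and of the change of coordinates
from `x` to `x̄`; the dependence on `x̄^0` is expanded in a Taylor series at
the body of `x^0 + log |Ber|`. -/
def pullCyl (y : cyl (c.overlap c')) (f : SuperFun m (cyl c'.range)) : Grassmann (Fin m) ℝ :=
  ∑ k ∈ Finset.range (m + 1), (1 / (k.factorial : ℝ)) •
    (gsoul (c.logBer c' (c.basePoint c' y)) ^ k *
      SuperFun.eval (c.basePoint c' y) (c.pull c'
        (slice (y.1 0 + gbody (c.logBer c' (c.basePoint c' y))) ((SuperFun.pd timeIdx)^[k] f))))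

/-- The matrix `∂x̄^b/∂x^a` (row `a`, column `b`) for `a, b = 0, …, n + m`. -/
def jacobianCyl (y : cyl (c.overlap c')) (a b : Idx (n + 1) m) : Grassmann (Fin m) ℝ :=
  match toBase a, toBase b with
  | none, none => 1
  | none, some _ => 0
  | some i, none => SuperFun.rawPd i (c.logBer c') (c.basePoint c' y)
  | some i, some j => c.jacobian c' (c.basePoint c' y) i j

theorem cyl_overlap_le : cyl (c.overlap c') ≤ cyl c.range := fun _ hy => c.overlap_le c' hy

end SuperChart

variable (A) in
/-- Families of local expressions of a tensor field on the Thomas bundle. -/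
abbrev TensorFamily := ∀ c : SuperChart n m A, Symb (n + 1) m (Smooth (cyl c.range))

/-- Global supersymmetric contravariant tensor fields of degree `k` on the Thomas bundle:
families of local expressions which correspond to each other under changes of coordinates. -/
def IsTensor (k : ℕ) (S : TensorFamily (n := n) (m := m) A) : Prop :=
  (∀ c, (S c).IsHomog k) ∧
  ∀ (c c' : SuperChart n m A) (y : cyl (c.overlap c')),
    (S c).subst (SuperFun.eval ⟨y, c.cyl_overlap_le c' y.2⟩)
        (fun a => ∑ b, Symb.ofBase (c.jacobianCyl c' y a b) * Symb.xi b) =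
      (S c').subst (c.pullCyl c' y) Symb.xi

/-- `δ`-equivariance `L_ℰ S = δ S`, where `ℰ = ∂_0`; as `ℰ` commutes with the coordinate
vector fields, the Lie derivative acts on the coefficients by `∂/∂x^0`. -/
def IsEquivariant (δ : ℝ) (S : TensorFamily (n := n) (m := m) A) : Prop :=
  ∀ c, Symb.pd timeIdx (S c) = δ • S c

namespace Superconnection

variable (D : Superconnection A) (c : SuperChart n m A)

/-- The divergence with respect to the Thomas superconnection, in a chart. -/
def thomasDiv (S : Symb (n + 1) m (Smooth (cyl c.range))) : Symb (n + 1) m (Smooth (cyl c.range)) :=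
  (D.christoffel c).thomas.div 0 S

/-- The horizontal lift of symbols of weight `δ`, in a chart. -/
def hlift (δ : ℝ) (S : Symb n m (Smooth c.range)) : Symb (n + 1) m (Smooth (cyl c.range)) :=
  (D.christoffel c).hlift δ S

/-- The descent map from `δ`-equivariant tensor fields to symbols of weight `δ`. -/
def descent (δ : ℝ) (S : TensorFamily (n := n) (m := m) A) : SymbolFamily (n := n) (m := m) A :=
  fun c => (D.christoffel c).descent δ (S c)

/-- The `δ`-equivariant tensor fields of degree `k` on the Thomas bundle whose divergence with respect
to the Thomas superconnection vanishes. -/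
def divergenceFree (n m : ℕ) [ChartedSpace (Eu n) M₀] (D : Superconnection A) (δ : ℝ) (k : ℕ) :
    Set (TensorFamily (n := n) (m := m) A) :=
  {S | IsTensor k S ∧ IsEquivariant δ S ∧ ∀ c, D.thomasDiv c (S c) = 0}

end Superconnection

end Thomas

/-- The Euler supervector field `ℰ = ∂_0` of the Thomas bundle, in a chart. -/
def eulerField {n m : ℕ} {W : Opens (Eu n)} : Symb (n + 1) m (Smooth (cyl W)) := Symb.xi timeIdx

/-- The number `γ_s = (n - m + s - (n - m + 1) δ) / (n - m + 1)`. -/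
def gammaCoeff (n m : ℕ) (δ : ℝ) (s : ℤ) : ℝ :=
  ((n : ℝ) - m + s - ((n : ℝ) - m + 1) * δ) / ((n : ℝ) - m + 1)

/-- Critical values of `δ`: those with `γ_{2k-l} = 0` for some `1 ≤ l ≤ k`. -/
def IsCritical (n m : ℕ) (δ : ℝ) : Prop :=
  ∃ k l : ℕ, 1 ≤ l ∧ l ≤ k ∧ gammaCoeff n m δ (2 * (k : ℤ) - l) = 0

end SuperGeometry

end

open SuperGeometry

/-!
The symmetric tensors in graded coordinates are superpolynomials `Symb` in the vector fields
`ξ_i = ∂_i`, with superfunctions as coefficients. Covariant derivatives, interior products and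
curvatures are superderivations of this algebra, and lifts and changes of coordinates are
homomorphisms. Therefore all identities between such operations need to be checked on functions and
on the `ξ_i` only (`Symb.superDer_ext`, `Symb.ringHom_ext`).

For the formula of the divergence, both sides are computed in one graded coordinate system, in the
frame `∂_1^h, …, ∂_{n+m}^h, ℰ`. Here `∇̃_0` multiplies a tensor by a constant depending on its degree
and its weight, `∇̃^h_j ℰ` is a multiple of `∂_j^h`, and `∇̃^h_j ∂_i^h = (∇_j ∂_i)^h + Q_{ji} ℰ` for
certain functions `Q_{ji}` (`Christoffel.defect`). The operator `∇̃^h_j` of a lift is thus the lift of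
`∇_j` plus the lift of the superderivation `∑ i, Q_{ji} i(dx^i)` times `ℰ`. In the divergence only
the supersymmetric part of `Q` is left, because interior products supercommute, and this part is
`2 (n - m + 1) r` up to the factor of the symmetrization (`Christoffel.IsSymmetric.defect_symm`): the
function `Γ̃_{ij}^0` was chosen for this. The result is
`Christoffel.IsSymmetric.thomas_div_hliftPow`; the numbers `γ` collect the contributions of `∇̃_0`
and of `∇̃^h_j ℰ`.

For the bijectivity of the descent, an equivariant tensor of degree `k` is a unique sum
`∑ l, A_l^h ∨ ℰ^l` with `A_l` of degree `k - l`, and its descent is `A_0`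
(`Christoffel.IsSymmetric.eq_sum_hliftPow`). By the formula, its divergence vanishes if and only if
`(l + 1) γ_{2k-l-1} A_{l+1} = Div A_l + 2 (n - m + 1) i(r) A_{l-1}` for all `l`. If `δ` is not
critical, `A_0` determines the tensor, which gives injectivity
(`Christoffel.IsSymmetric.eq_zero_of_div_eq_zero`), and the recursion can be solved in each
coordinate system, which gives the tensor `divergenceFreeLift`.

It remains to see that descents and lifts respect changes of coordinates. On `M` this requires that
`Div` and `i(r)` map symbols to symbols. The Christoffel symbols obey the usual transformation law
(`SuperChart.chartChange`), since a supervector field is determined by its action on the coordinates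
(`SuperChart.vectorField_ext`, a consequence of Hadamard's lemma). Covariant derivatives, the
curvature, and `r` are natural by this law (`ChartChange.nabla_tensor`,
`ChartChange.contrR_tensor`). For the weight `δ` one needs that the trace `∑ s, (-1)^{p(s)} Γ_{is}^s`
transforms like a connection on densities (`ChartChange.trace_eq`): the logarithmic derivative of the
Berezinian is the supertrace of the logarithmic derivative of the Jacobian matrix
(`Grassmann.berezinian_spec`, `SuperChart.exists_logBer`). The same law of the trace makes the
vectors `∂_i^h` transform like the `∂_i` (`SuperChart.pushCylHom_shiftHom`), and the factor
`exp (δ x^0)` is multiplied by `|Ber|^δ` (`SuperChart.pullCyl_expTime_mul_lift`), so that the gluing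
of tensors `A^h ∨ ℰ^l` on the Thomas bundle is the gluing of symbols (`SuperChart.glue_hliftPow`).
-/


noncomputable section

namespace SuperGeometry

/-! ### Parity calculus in Grassmann algebras -/

theorem ksign_comm (p q : ZMod 2) : ksign p q = ksign q p := by
  revert p q; decide

@[simp] theorem ksign_zero_left (q : ZMod 2) : ksign 0 q = 1 := by
  revert q; decide

@[simp] theorem ksign_zero_right (q : ZMod 2) : ksign q 0 = 1 := by
  revert q; decide

theorem ksign_mul_self (p q : ZMod 2) : ksign p q * ksign p q = 1 := ksign_aux4 p q

theorem ksign_add_right (p q s : ZMod 2) : ksign p (q + s) = ksign p q * ksign p s :=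
  ksign_aux1 p q s

theorem ksign_add_left (p q s : ZMod 2) : ksign (p + q) s = ksign p s * ksign q s :=
  ksign_aux3 p q s

namespace Grassmann

variable {κ : Type*} [LinearOrder κ] {R : Type*} [CommRing R]

/-- The monomial `r • θ^K`. -/
def mono (K : Finset κ) (r : R) : Grassmann κ R := ⟨fun M => if M = K then r else 0⟩

theorem coeff_mono (K M : Finset κ) (r : R) : (mono K r).coeff M = if M = K then r else 0 := rfl

theorem ofScalar_eq_mono (r : R) : (ofScalar r : Grassmann κ R) = mono ∅ r := rfl

theorem one_eq_mono : (1 : Grassmann κ R) = mono ∅ 1 := rfl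

theorem mono_add (K : Finset κ) (r s : R) : mono K (r + s) = mono K r + mono K s := by
  ext M; simp only [coeff_mono, coeff_add]; split_ifs <;> simp

@[simp] theorem mono_zero (K : Finset κ) : mono K (0 : R) = 0 := by
  ext M; simp [coeff_mono]

theorem mono_mul_mono (J K : Finset κ) (r s : R) : mono J r * mono K s =
    if Disjoint J K then mono (J ∪ K) ((shuffleSign J K : R) * (r * s)) else 0 := by
  ext M
  rw [coeff_mul]
  simp only [coeff_mono]
  split_ifs with h
  · rw [coeff_mono]
    split_ifs with hM
    · subst hM
      rw [Finset.sum_eq_single J]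
      · simp [Finset.union_sdiff_cancel_left h]
      · intro J' _ hne; simp [hne]
      · intro hJ; exact absurd (Finset.mem_powerset.2 Finset.subset_union_left) hJ
    · refine Finset.sum_eq_zero fun J' hJ' => ?_
      split_ifs with h1 h2
      · subst h1
        rw [Finset.mem_powerset] at hJ'
        exact absurd (by rw [← h2, Finset.union_sdiff_of_subset hJ']) hM
      all_goals simp
  · rw [coeff_zero]
    refine Finset.sum_eq_zero fun J' hJ' => ?_
    split_ifs with h1 h2
    · subst h1; subst h2; exact absurd Finset.disjoint_sdiff h
    all_goals simp

theorem sum_mono [Fintype κ] (f : Grassmann κ R) : ∑ K, mono K (f.coeff K) = f := by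
  ext M
  change coeffHom (∑ K, mono K (f.coeff K)) M = _
  rw [map_sum, Finset.sum_apply, Finset.sum_eq_single M]
  · simp [coeffHom, coeff_mono]
  · intro K _ hK; simp [coeffHom, coeff_mono, hK.symm]
  · simp

theorem coeff_sum {ι : Type*} (s : Finset ι) (f : ι → Grassmann κ R) (M : Finset κ) :
    (∑ i ∈ s, f i).coeff M = ∑ i ∈ s, (f i).coeff M := by
  change coeffHom (∑ i ∈ s, f i) M = _
  rw [map_sum, Finset.sum_apply]; rfl

theorem mono_induction [Fintype κ] {P : Grassmann κ R → Prop}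
    (hadd : ∀ f g, P f → P g → P (f + g)) (hmono : ∀ K r, P (mono K r)) (f : Grassmann κ R) :
    P f := by
  rw [← sum_mono f]
  refine Finset.sum_induction _ P hadd ?_ fun K _ => hmono K _
  simpa using hmono ∅ 0

/-- An additive map of Grassmann algebras which is multiplicative on monomials is
multiplicative. -/
theorem map_mul_of_mono [Fintype κ] {A : Type*} [Ring A] (F : Grassmann κ R →+ A)
    (h : ∀ J K r s, F (mono J r * mono K s) = F (mono J r) * F (mono K s))
    (f g : Grassmann κ R) : F (f * g) = F f * F g := by
  induction f using mono_induction with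
  | hadd f f' hf hf' => rw [add_mul, map_add, map_add, add_mul, hf, hf']
  | hmono J r =>
    induction g using mono_induction with
    | hadd g g' hg hg' => rw [mul_add, map_add, map_add, mul_add, hg, hg']
    | hmono K s => exact h J K r s

/-- The ring automorphism which multiplies elements of parity `q` by `(-1)^(p q)`. -/
def invol (p : ZMod 2) : Grassmann κ R →+* Grassmann κ R where
  toFun f := ⟨fun K => ksign p K.card • f.coeff K⟩
  map_zero' := by ext K; simp
  map_add' f g := by ext K; simp
  map_one' := by
    ext K; simp only [coeff_one]; split_ifs with h <;> simp [h]
  map_mul' f g := by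
    ext M
    simp only [coeff_mul, Finset.smul_sum]
    refine Finset.sum_congr rfl fun J hJ => ?_
    have hc : (M.card : ZMod 2) = J.card + (M \ J).card := by
      rw [← Finset.card_sdiff_add_card_eq_card (Finset.mem_powerset.1 hJ)]; push_cast; ring
    rw [hc, ksign_add_right]
    simp only [zsmul_eq_mul]
    push_cast
    ring

theorem coeff_invol (p : ZMod 2) (f : Grassmann κ R) (K : Finset κ) :
    (invol p f).coeff K = ksign p K.card • f.coeff K := rfl

@[simp] theorem invol_zero (f : Grassmann κ R) : invol 0 f = f := by
  ext K; simp [coeff_invol]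

theorem invol_invol (p q : ZMod 2) (f : Grassmann κ R) :
    invol p (invol q f) = invol (p + q) f := by
  ext K; simp [coeff_invol, ksign_add_left, mul_smul]

@[simp] theorem invol_invol_self (p : ZMod 2) (f : Grassmann κ R) :
    invol p (invol p f) = f := by
  rw [invol_invol, CharTwo.add_self_eq_zero, invol_zero]

theorem IsParity.invol {q : ZMod 2} {f : Grassmann κ R} (hf : f.IsParity q) (p : ZMod 2) :
    Grassmann.invol p f = ksign p q • f := by
  ext K
  rw [coeff_invol, coeff_smul]
  by_cases h : (K.card : ZMod 2) = q
  · rw [h]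
  · rw [hf K h, smul_zero, smul_zero]

theorem isParity_mono (K : Finset κ) (r : R) : (mono K r).IsParity K.card := by
  intro M hM
  rw [coeff_mono, if_neg]
  rintro rfl; exact hM rfl

theorem isParity_zero (p : ZMod 2) : (0 : Grassmann κ R).IsParity p := fun _ _ => rfl

theorem isParity_one : (1 : Grassmann κ R).IsParity 0 := by
  simpa [one_eq_mono] using isParity_mono (κ := κ) ∅ (1 : R)

theorem isParity_ofScalar (r : R) : (ofScalar r : Grassmann κ R).IsParity 0 := by
  simpa [ofScalar_eq_mono] using isParity_mono (κ := κ) ∅ r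

theorem isParity_gen (a : κ) : (gen a : Grassmann κ R).IsParity 1 := by
  simpa [show (gen a : Grassmann κ R) = mono {a} 1 from rfl] using isParity_mono (κ := κ) {a} (1 : R)

theorem IsParity.add {p : ZMod 2} {f g : Grassmann κ R} (hf : f.IsParity p) (hg : g.IsParity p) :
    (f + g).IsParity p := fun K hK => by rw [coeff_add, hf K hK, hg K hK, add_zero]

theorem IsParity.neg {p : ZMod 2} {f : Grassmann κ R} (hf : f.IsParity p) :
    (-f).IsParity p := fun K hK => by rw [coeff_neg, hf K hK, neg_zero]

theorem IsParity.sub {p : ZMod 2} {f g : Grassmann κ R} (hf : f.IsParity p) (hg : g.IsParity p) :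
    (f - g).IsParity p := fun K hK => by rw [coeff_sub, hf K hK, hg K hK, sub_zero]

theorem IsParity.smul {S : Type*} [Semiring S] [Module S R] {p : ZMod 2} {f : Grassmann κ R}
    (hf : f.IsParity p) (s : S) : (s • f).IsParity p :=
  fun K hK => by rw [coeff_smul, hf K hK, smul_zero]

theorem IsParity.zsmul {p : ZMod 2} {f : Grassmann κ R}
    (hf : f.IsParity p) (s : ℤ) : (s • f).IsParity p :=
  hf.smul s

theorem isParity_sum {ι : Type*} {p : ZMod 2} (s : Finset ι) {f : ι → Grassmann κ R}
    (hf : ∀ i ∈ s, (f i).IsParity p) : (∑ i ∈ s, f i).IsParity p := by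
  intro K hK
  rw [coeff_sum]
  exact Finset.sum_eq_zero fun i hi => hf i hi K hK

theorem IsParity.mul {p q : ZMod 2} {f g : Grassmann κ R} (hf : f.IsParity p)
    (hg : g.IsParity q) : (f * g).IsParity (p + q) := by
  intro M hM
  rw [coeff_mul]
  refine Finset.sum_eq_zero fun J hJ => ?_
  by_cases h1 : (J.card : ZMod 2) = p
  · rw [hg (M \ J), mul_zero, mul_zero]
    rintro rfl
    apply hM
    rw [← h1, ← Finset.card_sdiff_add_card_eq_card (Finset.mem_powerset.1 hJ)]
    push_cast; ring
  · rw [hf J h1, zero_mul, mul_zero]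

theorem IsParity.congr {p q : ZMod 2} {f : Grassmann κ R} (hf : f.IsParity p) (h : p = q) :
    f.IsParity q := h ▸ hf

/-- The component of parity `p`. -/
def part (p : ZMod 2) (f : Grassmann κ R) : Grassmann κ R :=
  ⟨fun K => if (K.card : ZMod 2) = p then f.coeff K else 0⟩

theorem isParity_part (p : ZMod 2) (f : Grassmann κ R) : (part p f).IsParity p :=
  fun _ hK => if_neg hK

theorem part_add_part (f : Grassmann κ R) : part 0 f + part 1 f = f := by
  ext K
  simp only [part, coeff_add]
  generalize (K.card : ZMod 2) = c
  have : c = 0 ∨ c = 1 := by revert c; decide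
  rcases this with rfl | rfl <;> simp

theorem parity_induction {P : Grassmann κ R → Prop} (hadd : ∀ f g, P f → P g → P (f + g))
    (h : ∀ p f, f.IsParity p → P f) (f : Grassmann κ R) : P f := by
  rw [← part_add_part f]
  exact hadd _ _ (h 0 _ (isParity_part 0 f)) (h 1 _ (isParity_part 1 f))

theorem shuffleSign_swap {J K : Finset κ} (h : Disjoint J K) :
    shuffleSign J K = ksign J.card K.card * shuffleSign K J := by
  induction J using Finset.induction_on with
  | empty => simp
  | insert a J ha ih =>
    rw [Finset.disjoint_insert_left] at h
    have ha' : Disjoint {a} J := by simpa using ha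
    rw [Finset.insert_eq, shuffleSign_union_left _ _ _ ha', shuffleSign_union_right _ _ _ ha',
      ih h.2, shuffleSign_singleton_right K a h.1, Finset.card_union_of_disjoint ha',
      neg_one_pow_eq_ksign]
    push_cast
    rw [ksign_add_left]
    have := ksign_mul_self 1 (K.card : ZMod 2)
    simp only [Finset.card_singleton, Nat.cast_one]
    linear_combination (-(ksign J.card K.card * shuffleSign K J * shuffleSign {a} K)) * this

/-- Supercommutativity. -/
theorem IsParity.mul_comm' [Fintype κ] {q : ZMod 2} {f : Grassmann κ R} (hf : f.IsParity q)
    (g : Grassmann κ R) : f * g = Grassmann.invol q g * f := by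
  have key : ∀ (J K : Finset κ) (r s : R), mono J r * mono K s =
      ksign J.card K.card • (mono K s * mono J r) := by
    intro J K r s
    rw [mono_mul_mono, mono_mul_mono]
    simp only [disjoint_comm (a := K)]
    split_ifs with h
    · rw [shuffleSign_swap h, Finset.union_comm]
      ext M
      rw [coeff_smul, coeff_mono, coeff_mono]
      split_ifs
      · rw [zsmul_eq_mul]; push_cast; ring
      · simp
    · simp
  rw [← sum_mono f, Finset.sum_mul, Finset.mul_sum]
  refine Finset.sum_congr rfl fun J _ => ?_
  by_cases hJ : (J.card : ZMod 2) = q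
  · induction g using mono_induction with
    | hadd g g' hg hg' => rw [mul_add, map_add, add_mul, hg, hg']
    | hmono K s =>
      rw [key, (isParity_mono K s).invol, hJ, smul_mul_assoc]
  · rw [hf J hJ, mono_zero, zero_mul, mul_zero]

theorem IsParity.comm [Fintype κ] {p q : ZMod 2} {f g : Grassmann κ R} (hf : f.IsParity p)
    (hg : g.IsParity q) : f * g = ksign p q • (g * f) := by
  rw [hf.mul_comm' g, hg.invol, smul_mul_assoc]

theorem isParity_iff_invol_one [Module ℝ R] {p : ZMod 2} {f : Grassmann κ R} :
    f.IsParity p ↔ Grassmann.invol 1 f = ksign 1 p • f := by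
  refine ⟨fun h => h.invol 1, fun h K hK => ?_⟩
  have h' : (Grassmann.invol 1 f).coeff K = (ksign 1 p • f).coeff K := by rw [h]
  rw [coeff_invol, coeff_smul] at h'
  have h2 : (2 : ℝ) • f.coeff K = 0 := by
    generalize (K.card : ZMod 2) = c at hK h'
    have e : (c = 0 ∧ p = 1) ∨ (c = 1 ∧ p = 0) := by
      clear h' h; revert c p; decide
    have k1 : ksign 1 1 = -1 := by decide
    rcases e with ⟨rfl, rfl⟩ | ⟨rfl, rfl⟩
    · rw [ksign_zero_right, k1, one_smul, neg_smul, one_smul] at h'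
      rw [two_smul]; nth_rewrite 1 [h']; simp
    · rw [ksign_zero_right, k1, one_smul, neg_smul, one_smul] at h'
      rw [two_smul]; nth_rewrite 1 [← h']; simp
  exact (smul_eq_zero_iff_right (two_ne_zero)).1 h2

theorem IsParity.sq_eq_zero [Fintype κ] [Module ℝ R] {f : Grassmann κ R} (hf : f.IsParity 1) :
    f * f = 0 := by
  have h := hf.comm hf
  have k1 : ksign 1 1 = -1 := by decide
  rw [k1, neg_smul, one_smul] at h
  have h2 : (2 : ℝ) • (f * f) = 0 := by rw [two_smul]; nth_rewrite 1 [h]; simp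
  exact (smul_eq_zero_iff_right (two_ne_zero)).1 h2

theorem leftDeriv_mul' (a : κ) (f g : Grassmann κ R) :
    leftDeriv a (f * g) = leftDeriv a f * g + Grassmann.invol 1 f * leftDeriv a g := by
  induction f using parity_induction with
  | hadd f f' hf hf' => rw [add_mul, map_add, hf, hf']; simp only [map_add, add_mul]; abel
  | h p f hf => rw [leftDeriv_mul a hf g, hf.invol, smul_mul_assoc]

theorem mapCoeff_mul_of_leibniz (d : R →+ R) (hd : ∀ a b, d (a * b) = d a * b + a * d b)
    (f g : Grassmann κ R) : mapCoeff d (f * g) = mapCoeff d f * g + f * mapCoeff d g := by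
  ext M
  rw [coeff_mapCoeff, coeff_add, coeff_mul, coeff_mul, coeff_mul, ← Finset.sum_add_distrib,
    map_sum]
  refine Finset.sum_congr rfl fun J _ => ?_
  rw [← zsmul_eq_mul, map_zsmul, hd, zsmul_eq_mul, mul_add]
  rfl

theorem shuffleSign_singleton_insert {a b : κ} {K : Finset κ} (hb : b ∉ K) :
    shuffleSign {a} (insert b K) = (if b < a then -1 else 1) * shuffleSign {a} K := by
  simp [shuffleSign, Finset.prod_insert hb]

theorem leftDeriv_leftDeriv (a b : κ) (f : Grassmann κ R) :
    leftDeriv a (leftDeriv b f) = -leftDeriv b (leftDeriv a f) := by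
  ext K
  simp only [coeff_neg, coeff_leftDeriv, Finset.mem_insert]
  by_cases hab : a = b
  · subst hab; simp
  by_cases ha : a ∈ K
  · simp [ha]
  by_cases hb : b ∈ K
  · simp [hb]
  have hba : ¬ b = a := fun h => hab h.symm
  simp only [ha, hb, hab, hba, or_self, if_false]
  rw [shuffleSign_singleton_insert ha, shuffleSign_singleton_insert hb, Finset.insert_comm b a]
  rcases lt_or_gt_of_ne hab with h | h
  · simp only [h, h.not_gt, if_true, if_false]; push_cast; ring
  · simp only [h, h.not_gt, if_true, if_false]; push_cast; ring

theorem leftDeriv_mapCoeff (a : κ) (d : R →+ R) (f : Grassmann κ R) :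
    leftDeriv a (mapCoeff d f) = mapCoeff d (leftDeriv a f) := by
  ext K
  simp only [coeff_leftDeriv, coeff_mapCoeff]
  split_ifs
  · simp
  · rw [← zsmul_eq_mul, ← zsmul_eq_mul, map_zsmul]

theorem invol_leftDeriv (p : ZMod 2) (a : κ) (f : Grassmann κ R) :
    Grassmann.invol p (leftDeriv a f) = ksign p 1 • leftDeriv a (Grassmann.invol p f) := by
  ext K
  simp only [coeff_invol, coeff_leftDeriv, coeff_smul]
  split_ifs with h
  · simp
  · rw [Finset.card_insert_of_notMem h]
    push_cast
    rw [ksign_add_right]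
    simp only [zsmul_eq_mul]
    push_cast
    have h := ksign_mul_self p 1
    have h' : (ksign p 1 : R) * ksign p 1 = 1 := by exact_mod_cast congrArg (Int.cast (R := R)) h
    linear_combination (-((ksign p K.card : R) * (shuffleSign {a} K) * f.coeff (insert a K))) * h'

theorem invol_mapCoeff {S : Type*} [CommRing S] (p : ZMod 2) (d : R →+ S) (f : Grassmann κ R) :
    Grassmann.invol p (mapCoeff d f) = mapCoeff d (Grassmann.invol p f) := by
  ext K
  rw [coeff_invol, coeff_mapCoeff, coeff_mapCoeff, coeff_invol, map_zsmul]

theorem IsParity.mapCoeff {S : Type*} [CommRing S] {p : ZMod 2} {f : Grassmann κ R}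
    (hf : f.IsParity p) (d : R →+ S) : (Grassmann.mapCoeff d f).IsParity p :=
  fun K hK => by rw [coeff_mapCoeff, hf K hK, map_zero]

theorem leftDeriv_mono (a : κ) (K : Finset κ) (r : R) : leftDeriv a (mono K r) =
    if a ∈ K then mono (K.erase a) ((shuffleSign {a} (K.erase a) : R) * r) else 0 := by
  ext M
  rw [coeff_leftDeriv, coeff_mono]
  by_cases hK : a ∈ K
  · rw [if_pos hK, coeff_mono]
    by_cases hM : a ∈ M
    · rw [if_pos hM, if_neg]; rintro rfl; simp at hM
    · rw [if_neg hM]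
      by_cases h : insert a M = K
      · subst h; simp [hM]
      · rw [if_neg h, if_neg, mul_zero]
        rintro rfl; exact h (Finset.insert_erase hK)
  · rw [if_neg hK, coeff_zero]
    split_ifs with hM h
    · rfl
    · exact absurd (h ▸ Finset.mem_insert_self a M) hK
    · rw [mul_zero]

end Grassmann

/-! ### Normal forms of supersymmetric tensors -/

namespace Symb

open Grassmann

variable {N m : ℕ} {B : Type*} [CommRing B]

theorem shuffleSign_image {κ κ' : Type*} [LinearOrder κ] [LinearOrder κ'] [DecidableEq κ'] {φ : κ → κ'}
    (hφ : StrictMono φ) (J K : Finset κ) :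
    shuffleSign (J.image φ) (K.image φ) = shuffleSign J K := by
  simp [shuffleSign, Finset.prod_image hφ.injective.injOn, hφ.lt_iff_lt]

theorem inl_strictMono : StrictMono (Sum.inlₗ : Fin m → Fin m ⊕ₗ Fin m) := Sum.Lex.inl_strictMono

theorem inr_strictMono : StrictMono (Sum.inrₗ : Fin m → Fin m ⊕ₗ Fin m) := Sum.Lex.inr_strictMono

theorem lex_cases (x : Fin m ⊕ₗ Fin m) : (∃ j, Sum.inlₗ j = x) ∨ ∃ k, Sum.inrₗ k = x := by
  induction x using Lex.rec with
  | _ x => rcases x with j | k; exacts [Or.inl ⟨j, rfl⟩, Or.inr ⟨k, rfl⟩]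

theorem inl_ne_inr (j k : Fin m) : (Sum.inlₗ j : Fin m ⊕ₗ Fin m) ≠ Sum.inrₗ k :=
  (Sum.Lex.inl_lt_inr j k).ne

/-- The union of a set of odd coordinates and a set of odd `ξ`'s. -/
def joinSet (J K : Finset (Fin m)) : Finset (Fin m ⊕ₗ Fin m) :=
  J.image Sum.inlₗ ∪ K.image Sum.inrₗ

theorem inl_mem_joinSet {J K : Finset (Fin m)} {j : Fin m} : Sum.inlₗ j ∈ joinSet J K ↔ j ∈ J := by
  simp [joinSet]

theorem inr_mem_joinSet {J K : Finset (Fin m)} {k : Fin m} : Sum.inrₗ k ∈ joinSet J K ↔ k ∈ K := by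
  simp [joinSet]

theorem joinSet_inj {J K J' K' : Finset (Fin m)} :
    joinSet J K = joinSet J' K' ↔ J = J' ∧ K = K' := by
  refine ⟨fun h => ⟨?_, ?_⟩, by rintro ⟨rfl, rfl⟩; rfl⟩
  · ext j; rw [← inl_mem_joinSet (K := K), h, inl_mem_joinSet]
  · ext j; rw [← inr_mem_joinSet (J := J), h, inr_mem_joinSet]

theorem exists_joinSet (M : Finset (Fin m ⊕ₗ Fin m)) : ∃ J K, M = joinSet J K := by
  refine ⟨Finset.univ.filter fun j => Sum.inlₗ j ∈ M,
    Finset.univ.filter fun k => Sum.inrₗ k ∈ M, ?_⟩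
  ext x
  rcases lex_cases x with ⟨j, rfl⟩ | ⟨k, rfl⟩
  · simp [inl_mem_joinSet]
  · simp [inr_mem_joinSet]

theorem card_joinSet (J K : Finset (Fin m)) : (joinSet J K).card = J.card + K.card := by
  rw [joinSet, Finset.card_union_of_disjoint, Finset.card_image_of_injective _ inl_strictMono.injective,
    Finset.card_image_of_injective _ inr_strictMono.injective]
  simp [Finset.disjoint_left, (inl_ne_inr _ _).symm]

theorem coeff_ofBase (f : Grassmann (Fin m) B) (J K : Finset (Fin m)) :
    (ofBase f : Symb N m B).coeff (joinSet J K) =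
      if K = ∅ then MvPolynomial.C (f.coeff J) else 0 := by
  have h1 : (∀ k : Fin m, Sum.inrₗ k ∉ joinSet J K) ↔ K = ∅ := by
    simp [inr_mem_joinSet, Finset.eq_empty_iff_forall_notMem]
  have h2 : ({j | Sum.inlₗ j ∈ joinSet J K} : Finset (Fin m)) = J := by
    ext j; simp [inl_mem_joinSet]
  simp only [ofBase, h1, h2]

theorem ext_coef {S T : Symb N m B} (h : ∀ α K, S.coef α K = T.coef α K) : S = T := by
  refine Grassmann.ext (funext fun M => ?_)
  obtain ⟨J, K, rfl⟩ := exists_joinSet M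
  ext α
  exact congrFun (congrArg coeff (h α K)) J

theorem coef_add (S T : Symb N m B) (α K) : (S + T).coef α K = S.coef α K + T.coef α K := rfl

theorem coef_eq_zero_of_notMem {S : Symb N m B} {α : Fin N →₀ ℕ} (h : α ∉ S.exponents)
    (K : Finset (Fin m)) : S.coef α K = 0 := by
  ext J
  by_contra h'
  apply h
  simp only [exponents, Finset.mem_biUnion, Finset.mem_univ, true_and]
  exact ⟨_, MvPolynomial.mem_support_iff.2 h'⟩

theorem ofBase_mono (J : Finset (Fin m)) (b : B) :
    (ofBase (mono J b) : Symb N m B) = mono (joinSet J ∅) (MvPolynomial.C b) := by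
  refine Grassmann.ext (funext fun M => ?_)
  obtain ⟨J', K', rfl⟩ := exists_joinSet M
  rw [coeff_ofBase, coeff_mono, coeff_mono]
  simp only [joinSet_inj]
  by_cases hK : K' = ∅ <;> by_cases hJ : J' = J <;> simp [hK, hJ]

theorem ofBase_add (f g : Grassmann (Fin m) B) :
    (ofBase (f + g) : Symb N m B) = ofBase f + ofBase g := by
  refine Grassmann.ext (funext fun M => ?_)
  obtain ⟨J', K', rfl⟩ := exists_joinSet M
  rw [coeff_add, coeff_ofBase, coeff_ofBase, coeff_ofBase]
  split_ifs <;> simp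

@[simp] theorem ofBase_zero : (ofBase 0 : Symb N m B) = 0 := by
  refine Grassmann.ext (funext fun M => ?_)
  obtain ⟨J', K', rfl⟩ := exists_joinSet M
  rw [coeff_ofBase]
  split_ifs <;> simp

theorem joinSet_union {inst : DecidableEq (Fin m ⊕ₗ Fin m)} (J J' K K' : Finset (Fin m)) :
    joinSet J K ∪ joinSet J' K' = joinSet (J ∪ J') (K ∪ K') := by
  ext x
  rcases lex_cases x with ⟨j, rfl⟩ | ⟨k, rfl⟩
  · simp only [Finset.mem_union, inl_mem_joinSet]
  · simp only [Finset.mem_union, inr_mem_joinSet]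

theorem joinSet_disjoint_left {J J' : Finset (Fin m)} :
    Disjoint (joinSet J ∅) (joinSet J' ∅) ↔ Disjoint J J' := by
  simp [joinSet, Finset.disjoint_image inl_strictMono.injective]

theorem joinSet_disjoint_left_right (J K : Finset (Fin m)) :
    Disjoint (joinSet J ∅) (joinSet ∅ K) := by
  simp [joinSet, Finset.disjoint_left, (inl_ne_inr _ _).symm]

theorem shuffleSign_left_right (J K : Finset (Fin m)) :
    shuffleSign (joinSet J ∅) (joinSet ∅ K) = 1 := by
  simp only [shuffleSign]
  refine Finset.prod_eq_one fun a ha => Finset.prod_eq_one fun b hb => if_neg ?_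
  simp only [joinSet, Finset.image_empty, Finset.union_empty, Finset.empty_union,
    Finset.mem_image] at ha hb
  obtain ⟨a, -, rfl⟩ := ha
  obtain ⟨b, -, rfl⟩ := hb
  exact (Sum.Lex.inl_lt_inr a b).not_gt

/-- Superfunctions form a subring of the ring of supersymmetric tensors. -/
def ofBaseHom : Grassmann (Fin m) B →+* Symb N m B where
  toFun := ofBase
  map_zero' := ofBase_zero
  map_add' := ofBase_add
  map_one' := by rw [one_eq_mono, ofBase_mono]; rfl
  map_mul' := by
    refine map_mul_of_mono ⟨⟨ofBase, ofBase_zero⟩, ofBase_add⟩ fun J K r s => ?_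
    change ofBase (mono J r * mono K s) = (ofBase (mono J r) * ofBase (mono K s) : Symb N m B)
    rw [ofBase_mono, ofBase_mono, mono_mul_mono, mono_mul_mono]
    simp only [joinSet_disjoint_left]
    split_ifs
    · rw [ofBase_mono]
      have : shuffleSign (joinSet J ∅) (joinSet K ∅) = shuffleSign J K := by
        simp [joinSet, shuffleSign_image inl_strictMono]
      rw [this, joinSet_union]
      simp
    · simp

theorem ofBase_mul (f g : Grassmann (Fin m) B) :
    (ofBase (f * g) : Symb N m B) = ofBase f * ofBase g := map_mul ofBaseHom f g

theorem ofBase_one : (ofBase 1 : Symb N m B) = 1 := map_one ofBaseHom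

theorem ofBase_neg (f : Grassmann (Fin m) B) : (ofBase (-f) : Symb N m B) = -ofBase f :=
  map_neg ofBaseHom f

theorem ofBase_sub (f g : Grassmann (Fin m) B) :
    (ofBase (f - g) : Symb N m B) = ofBase f - ofBase g := map_sub ofBaseHom f g

theorem ofBase_zsmul (k : ℤ) (f : Grassmann (Fin m) B) :
    (ofBase (k • f) : Symb N m B) = k • ofBase f := map_zsmul ofBaseHom k f

theorem ofBase_sum {ι : Type*} (s : Finset ι) (f : ι → Grassmann (Fin m) B) :
    (ofBase (∑ i ∈ s, f i) : Symb N m B) = ∑ i ∈ s, ofBase (f i) := map_sum ofBaseHom f s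

theorem ofBase_smul [Algebra ℝ B] (r : ℝ) (f : Grassmann (Fin m) B) :
    (ofBase (r • f) : Symb N m B) = r • ofBase f := by
  refine Grassmann.ext (funext fun M => ?_)
  obtain ⟨J', K', rfl⟩ := exists_joinSet M
  rw [coeff_smul, coeff_ofBase, coeff_ofBase]
  split_ifs
  · rw [coeff_smul, MvPolynomial.C_eq_smul_one, MvPolynomial.C_eq_smul_one, smul_assoc]
  · simp

theorem isParity_ofBase {p : ZMod 2} {f : Grassmann (Fin m) B} (hf : f.IsParity p) :
    (ofBase f : Symb N m B).IsParity p := by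
  intro M hM
  obtain ⟨J, K, rfl⟩ := exists_joinSet M
  rw [coeff_ofBase]
  split_ifs with hK
  · subst hK
    rw [hf J, map_zero]
    rwa [card_joinSet, Finset.card_empty, add_zero] at hM
  · rfl

theorem invol_ofBase (p : ZMod 2) (f : Grassmann (Fin m) B) :
    invol p (ofBase f : Symb N m B) = ofBase (invol p f) := by
  induction f using parity_induction with
  | hadd f g hf hg => simp only [ofBase_add, map_add, hf, hg]
  | h q f hf => rw [(isParity_ofBase hf).invol, hf.invol, ofBase_zsmul]

theorem isParity_xi (i : Idx N m) : (xi i : Symb N m B).IsParity i.parity := by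
  rcases i with i | k
  · exact isParity_ofScalar _
  · exact isParity_gen _

/-- The normally ordered monomial with exponents `α` and `K` in the `ξ_i`. -/
def nmon (α : Fin N →₀ ℕ) (K : Finset (Fin m)) : Symb N m B :=
  mono (joinSet ∅ K) (MvPolynomial.monomial α 1)

theorem ofBase_mono_mul_nmon (J : Finset (Fin m)) (b : B) (α : Fin N →₀ ℕ) (K : Finset (Fin m)) :
    (ofBase (mono J b) * nmon α K : Symb N m B) = mono (joinSet J K) (MvPolynomial.monomial α b) := by
  rw [ofBase_mono, nmon, mono_mul_mono, if_pos (joinSet_disjoint_left_right J K),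
    shuffleSign_left_right, MvPolynomial.C_mul_monomial, mul_one, Int.cast_one, one_mul,
    joinSet_union]
  simp

theorem coef_ofBase_mul_nmon (f : Grassmann (Fin m) B) (α α' : Fin N →₀ ℕ) (K K' : Finset (Fin m)) :
    (ofBase f * nmon α K : Symb N m B).coef α' K' = if α = α' ∧ K = K' then f else 0 := by
  induction f using mono_induction with
  | hadd f g hf hg => rw [ofBase_add, add_mul, coef_add, hf, hg]; split_ifs <;> simp
  | hmono J b =>
    rw [ofBase_mono_mul_nmon]
    ext J'
    change ((mono (joinSet J K) (MvPolynomial.monomial α b)).coeff (joinSet J' K')).coeff α' = _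
    rw [coeff_mono]
    simp only [joinSet_inj, eq_comm (a := K')]
    by_cases hJ : J' = J <;> by_cases hK : K = K' <;> by_cases hα : α = α' <;>
      simp [hJ, hK, hα, coeff_mono, MvPolynomial.coeff_monomial]

theorem nmon_induction {P : Symb N m B → Prop} (hadd : ∀ S T, P S → P T → P (S + T))
    (h : ∀ f α K, P (ofBase f * nmon α K)) (S : Symb N m B) : P S := by
  induction S using mono_induction with
  | hadd S T hS hT => exact hadd S T hS hT
  | hmono M p =>
    obtain ⟨J, K, rfl⟩ := exists_joinSet M
    induction p using MvPolynomial.induction_on' with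
    | monomial α b => rw [← ofBase_mono_mul_nmon]; exact h _ _ _
    | add p q hp hq => rw [mono_add]; exact hadd _ _ hp hq

section Monom

variable {N' : ℕ} {B' : Type*} [CommRing B']

/-- A central factor of one of the terms can be moved to the end of an ordered product. -/
theorem prod_ofFn_mul_central {A : Type*} [Ring A] {c : A} (hc : ∀ x, c * x = x * c) :
    ∀ {k : ℕ} (f g : Fin k → A) (j : Fin k), f j = g j * c → (∀ i, i ≠ j → f i = g i) →
      (List.ofFn f).prod = (List.ofFn g).prod * c
  | 0, _, _, j, _, _ => j.elim0
  | k + 1, f, g, j, hj, h => by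
    rw [List.ofFn_succ, List.ofFn_succ, List.prod_cons, List.prod_cons]
    induction j using Fin.cases with
    | zero =>
      rw [hj, mul_assoc, hc, ← mul_assoc]
      have : (fun i => f (Fin.succ i)) = fun i => g (Fin.succ i) :=
        funext fun i => h _ (Fin.succ_ne_zero i)
      rw [this]
    | succ j =>
      rw [h 0 (Fin.succ_ne_zero j).symm, mul_assoc]
      congr 1
      exact prod_ofFn_mul_central hc _ _ j hj fun i hi => h _ fun h' => hi (Fin.succ_injective _ h')

variable (η : Idx N m → Symb N' m B')

/-- The ordered product of the elements `η_k`, `k ∈ K`. -/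
def oddProd (K : Finset (Fin m)) : Symb N' m B' :=
  ((K.sort (· ≤ ·)).map fun k => η (.inr k)).prod

theorem oddProd_insert_max {K : Finset (Fin m)} {k : Fin m} (hk : ∀ x ∈ K, x < k) :
    oddProd η (insert k K) = oddProd η K * η (.inr k) := by
  have : (insert k K).sort (· ≤ ·) = K.sort (· ≤ ·) ++ [k] := by
    refine List.Perm.eq_of_pairwise' (r := (· ≤ ·)) (Finset.pairwise_sort _ _) ?_ ?_
    · rw [List.pairwise_append]
      refine ⟨Finset.pairwise_sort _ _, List.pairwise_singleton _ _, ?_⟩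
      intro a ha b hb
      rw [List.mem_singleton] at hb
      subst hb
      exact (hk a (by simpa using ha)).le
    · rw [List.perm_ext_iff_of_nodup (Finset.sort_nodup _ _)]
      · intro a; simp [or_comm]
      · rw [List.nodup_append]
        refine ⟨Finset.sort_nodup _ _, by simp, ?_⟩
        intro a ha b hb
        rw [List.mem_singleton] at hb
        subst hb
        exact (hk a (by simpa using ha)).ne
  rw [oddProd, oddProd, this]
  simp

variable {η}

theorem isParity_oddProd (hη : ∀ i, (η i).IsParity i.parity) (K : Finset (Fin m)) :
    (oddProd η K).IsParity K.card := by
  induction K using Finset.induction_on_max with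
  | empty => simpa [oddProd] using isParity_one
  | insert k K hk ih =>
    rw [oddProd_insert_max η hk, Finset.card_insert_of_notMem fun h => lt_irrefl _ (hk k h)]
    push_cast
    exact ih.mul (hη (.inr k))

/-- The ordered products of odd elements multiply like the monomials of a Grassmann algebra, since odd
elements anticommute and have square zero. -/
theorem oddProd_mul [Module ℝ B'] (hη : ∀ i, (η i).IsParity i.parity) (K : Finset (Fin m))
    (k : Fin m) : oddProd η K * η (.inr k) =
      if k ∈ K then 0 else shuffleSign K {k} • oddProd η (insert k K) := by
  induction K using Finset.induction_on_max with
  | empty => simp [oddProd]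
  | insert l K hl ih =>
    have hlK : l ∉ K := fun h => lt_irrefl _ (hl l h)
    have hsq : η (.inr k) * η (.inr k) = 0 := (hη (.inr k)).sq_eq_zero
    have hanti : η (.inr l) * η (.inr k) = -(η (.inr k) * η (.inr l)) := by
      have := (hη (.inr l)).comm (hη (.inr k))
      have k1 : ksign (Idx.parity (.inr l : Idx N m)) (Idx.parity (.inr k : Idx N m)) = -1 := by
        rw [Idx.parity, Idx.parity]; decide
      rw [this, k1, neg_smul, one_smul]
    have hs : shuffleSign (insert l K) {k} = shuffleSign {l} {k} * shuffleSign K {k} := by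
      rw [Finset.insert_eq, shuffleSign_union_left _ _ _ (by simpa using hlK)]
    have hs1 : shuffleSign {l} {k} = if k < l then -1 else 1 := by simp [shuffleSign]
    rcases lt_trichotomy k l with h | h | h
    · rw [oddProd_insert_max η hl, mul_assoc, hanti, mul_neg, ← mul_assoc, ih, hs, hs1, if_pos h]
      by_cases hk : k ∈ K
      · simp [hk]
      · rw [if_neg hk, if_neg (by simp [hk, h.ne]), smul_mul_assoc, Finset.insert_comm,
          oddProd_insert_max η (K := insert k K) (k := l)]
        · simp
        · intro x hx
          rcases Finset.mem_insert.1 hx with rfl | hx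
          exacts [h, hl x hx]
    · subst h
      rw [oddProd_insert_max η hl, mul_assoc, hsq, mul_zero, if_pos (Finset.mem_insert_self _ _)]
    · have hmax : ∀ x ∈ insert l K, x < k := by
        intro x hx
        rcases Finset.mem_insert.1 hx with rfl | hx
        exacts [h, (hl x hx).trans h]
      have hs2 : shuffleSign (insert l K) {k} = 1 := by
        simp only [shuffleSign, Finset.prod_singleton]
        exact Finset.prod_eq_one fun a ha => if_neg (hmax a ha).not_gt
      rw [if_neg fun h' => lt_irrefl _ (hmax k h'), hs2, one_smul, oddProd_insert_max η hmax]

/-- The elements `η_i` of even index are central. -/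
theorem central_of_even (hη : ∀ i, (η i).IsParity i.parity) (i : Fin N) (x : Symb N' m B') :
    η (.inl i) * x = x * η (.inl i) := by
  have := (hη (.inl i)).mul_comm' x
  rwa [show Idx.parity (.inl i : Idx N m) = 0 from rfl, invol_zero] at this

theorem monom_mul_even (hη : ∀ i, (η i).IsParity i.parity) (α : Fin N →₀ ℕ)
    (K : Finset (Fin m)) (i : Fin N) :
    monom η α K * η (.inl i) = monom η (α + Finsupp.single i 1) K := by
  have hc := central_of_even hη i
  have e : (List.ofFn fun j => η (.inl j) ^ ((α + Finsupp.single i 1 : Fin N →₀ ℕ) j)).prod =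
      (List.ofFn fun j => η (.inl j) ^ α j).prod * η (.inl i) :=
    prod_ofFn_mul_central hc _ _ i (by simp [pow_succ])
      (fun j hj => by simp [hj.symm])
  rw [monom, monom, mul_assoc, ← hc, ← mul_assoc, e]

theorem monom_mul_odd [Module ℝ B'] (hη : ∀ i, (η i).IsParity i.parity) (α : Fin N →₀ ℕ)
    (K : Finset (Fin m)) (k : Fin m) :
    monom η α K * η (.inr k) =
      if k ∈ K then 0 else shuffleSign K {k} • monom η α (insert k K) := by
  rw [monom, monom, mul_assoc]
  change _ * (oddProd η K * η (.inr k)) = _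
  rw [oddProd_mul hη]
  split_ifs
  · rw [mul_zero]
  · rw [mul_smul_comm]; rfl

theorem monom_zero_empty : monom η 0 ∅ = 1 := by
  simp [monom]

theorem isParity_pow_even {x : Symb N' m B'} (hx : x.IsParity 0) (k : ℕ) :
    (x ^ k).IsParity 0 := by
  induction k with
  | zero => simpa using isParity_one
  | succ k ih => rw [pow_succ]; simpa using ih.mul hx

theorem isParity_monom (hη : ∀ i, (η i).IsParity i.parity) (α : Fin N →₀ ℕ)
    (K : Finset (Fin m)) : (monom η α K).IsParity K.card := by
  have h1 : ((List.ofFn fun i => η (.inl i) ^ α i).prod).IsParity 0 := by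
    refine List.prod_induction (fun x => Grassmann.IsParity 0 x) ?_ isParity_one ?_
    · intro a b ha hb; simpa using ha.mul hb
    · intro x hx
      rw [List.mem_ofFn] at hx
      obtain ⟨i, rfl⟩ := hx
      exact isParity_pow_even (hη (.inl i)) _
  exact (h1.mul (isParity_oddProd hη K)).congr (zero_add _)

theorem nmon_mul_even (α : Fin N →₀ ℕ) (K : Finset (Fin m)) (i : Fin N) :
    (nmon α K * xi (.inl i) : Symb N m B) = nmon (α + Finsupp.single i 1) K := by
  change mono _ _ * mono ∅ _ = _
  rw [mono_mul_mono, if_pos (Finset.disjoint_empty_right _)]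
  simp [nmon, MvPolynomial.X, MvPolynomial.monomial_mul]

theorem nmon_mul_odd (α : Fin N →₀ ℕ) (K : Finset (Fin m)) (k : Fin m) :
    (nmon α K * xi (.inr k) : Symb N m B) =
      if k ∈ K then 0 else shuffleSign K {k} • nmon α (insert k K) := by
  have h0 : ({Sum.inrₗ k} : Finset (Fin m ⊕ₗ Fin m)) = joinSet ∅ {k} := by simp [joinSet]
  change mono _ _ * mono {Sum.inrₗ k} 1 = _
  rw [mono_mul_mono]
  simp only [Finset.disjoint_singleton_right, inr_mem_joinSet, ite_not]
  split_ifs with h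
  · rfl
  · have hs : shuffleSign (joinSet ∅ K) (joinSet ∅ {k}) = shuffleSign K {k} := by
      simp only [joinSet, Finset.image_empty, Finset.empty_union]
      exact shuffleSign_image inr_strictMono _ _
    rw [h0, joinSet_union, hs]
    ext M
    rw [Finset.union_comm K, ← Finset.insert_eq, Finset.union_empty]
    simp only [coeff_smul, nmon, coeff_mono]
    split_ifs <;> simp

/-- Induction on the normally ordered monomials: each of them arises from `1` by right multiplication
by odd `ξ`'s in increasing order and then by even `ξ`'s. -/
theorem index_induction {P : (Fin N →₀ ℕ) → Finset (Fin m) → Prop} (h0 : P 0 ∅)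
    (hodd : ∀ K k, (∀ x ∈ K, x < k) → P 0 K → P 0 (insert k K))
    (heven : ∀ α K i, P α K → P (α + Finsupp.single i 1) K) (α : Fin N →₀ ℕ)
    (K : Finset (Fin m)) : P α K := by
  have hK : P 0 K := by
    induction K using Finset.induction_on_max with
    | empty => exact h0
    | insert k K hk ih => exact hodd K k hk ih
  suffices ∀ β, P β K → P (β + α) K by simpa using this 0 hK
  induction α using Finsupp.induction_linear with
  | zero => intro β h; simpa using h
  | add f g hf hg => intro β h; rw [← add_assoc]; exact hg _ (hf _ h)
  | single i n =>
    intro β h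
    induction n with
    | zero => simpa using h
    | succ n ih =>
      rw [Finsupp.single_add, ← add_assoc]
      exact heven _ _ _ ih

theorem monom_insert_max [Module ℝ B'] (hη : ∀ i, (η i).IsParity i.parity) (α : Fin N →₀ ℕ)
    {K : Finset (Fin m)} {k : Fin m} (hk : ∀ x ∈ K, x < k) :
    monom η α (insert k K) = monom η α K * η (.inr k) := by
  have hs : shuffleSign K {k} = 1 := by
    simp only [shuffleSign, Finset.prod_singleton]
    exact Finset.prod_eq_one fun a ha => if_neg (hk a ha).not_gt
  rw [monom_mul_odd hη, if_neg fun h => lt_irrefl _ (hk k h), hs, one_smul]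

theorem nmon_insert_max (α : Fin N →₀ ℕ) {K : Finset (Fin m)} {k : Fin m}
    (hk : ∀ x ∈ K, x < k) :
    (nmon α (insert k K) : Symb N m B) = nmon α K * xi (.inr k) := by
  have hs : shuffleSign K {k} = 1 := by
    simp only [shuffleSign, Finset.prod_singleton]
    exact Finset.prod_eq_one fun a ha => if_neg (hk a ha).not_gt
  rw [nmon_mul_odd, if_neg fun h => lt_irrefl _ (hk k h), hs, one_smul]

theorem monom_xi [Module ℝ B] (α : Fin N →₀ ℕ) (K : Finset (Fin m)) :
    monom (xi : Idx N m → Symb N m B) α K = nmon α K := by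
  induction α, K using index_induction with
  | h0 =>
    rw [monom_zero_empty]
    simp only [nmon, joinSet, Finset.image_empty, Finset.empty_union, one_eq_mono]
    rfl
  | hodd K k hk ih => rw [monom_insert_max isParity_xi 0 hk, ih, nmon_insert_max 0 hk]
  | heven α K i ih => rw [← monom_mul_even isParity_xi, ih, nmon_mul_even]

end Monom
end Symb

/-! ### Substitution homomorphisms -/

namespace Grassmann

/-- Parity-preserving ring homomorphisms between Grassmann algebras. -/
def PreservesParity {κ κ' R R' : Type*} [LinearOrder κ] [LinearOrder κ'] [CommRing R] [CommRing R']
    (g : Grassmann κ R →+* Grassmann κ' R') : Prop :=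
  ∀ p f, f.IsParity p → (g f).IsParity p

variable {κ κ' κ'' R R' R'' : Type*} [LinearOrder κ] [LinearOrder κ'] [LinearOrder κ'']
  [CommRing R] [CommRing R'] [CommRing R'']

theorem PreservesParity.invol {g : Grassmann κ R →+* Grassmann κ' R'} (hg : PreservesParity g)
    (p : ZMod 2) (f : Grassmann κ R) : g (Grassmann.invol p f) = Grassmann.invol p (g f) := by
  induction f using parity_induction with
  | hadd f f' hf hf' => simp only [map_add, hf, hf']
  | h q f hf => rw [hf.invol, (hg q f hf).invol, map_zsmul]

theorem PreservesParity.comp {h : Grassmann κ' R' →+* Grassmann κ'' R''}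
    {g : Grassmann κ R →+* Grassmann κ' R'} (hh : PreservesParity h) (hg : PreservesParity g) :
    PreservesParity (h.comp g) := fun p f hf => hh p _ (hg p f hf)

theorem preservesParity_id : PreservesParity (RingHom.id (Grassmann κ R)) := fun _ _ hf => hf

/-- Applying a ring homomorphism to all coefficients. -/
def mapHom (φ : R →+* R') : Grassmann κ R →+* Grassmann κ R' where
  toFun := mapCoeff (φ : R →+ R')
  map_zero' := map_zero _
  map_add' := map_add _
  map_one' := by
    ext K; rw [coeff_mapCoeff, coeff_one, coeff_one]; split_ifs <;> simp
  map_mul' := mapCoeff_mul φ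

theorem preservesParity_mapHom (φ : R →+* R') :
    PreservesParity (mapHom (κ := κ) φ) := fun _ _ hf => hf.mapCoeff (φ : R →+ R')

end Grassmann

namespace Symb

open Grassmann

variable {N m : ℕ} {B : Type*} [CommRing B] [Module ℝ B]
variable {N' : ℕ} {B' : Type*} [CommRing B'] [Module ℝ B']
variable {N'' : ℕ} {B'' : Type*} [CommRing B''] [Module ℝ B'']

theorem subst_eq_sum {g : Grassmann (Fin m) B → Grassmann (Fin m) B'} (hg : g 0 = 0)
    (η : Idx N m → Symb N' m B') (S : Symb N m B) {s : Finset (Fin N →₀ ℕ)} (hs : S.exponents ⊆ s) :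
    S.subst g η = ∑ α ∈ s, ∑ K : Finset (Fin m), ofBase (g (S.coef α K)) * monom η α K := by
  refine Finset.sum_subset hs fun α _ hα => Finset.sum_eq_zero fun K _ => ?_
  rw [coef_eq_zero_of_notMem hα, hg, ofBase_zero, zero_mul]

theorem subst_add (g : Grassmann (Fin m) B →+ Grassmann (Fin m) B')
    (η : Idx N m → Symb N' m B') (S T : Symb N m B) :
    (S + T).subst g η = S.subst g η + T.subst g η := by
  classical
  set s := (S + T).exponents ∪ (S.exponents ∪ T.exponents)
  rw [subst_eq_sum (map_zero g) η (S + T) (s := s) Finset.subset_union_left,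
    subst_eq_sum (map_zero g) η S (s := s) (Finset.subset_union_left.trans Finset.subset_union_right),
    subst_eq_sum (map_zero g) η T (s := s) (Finset.subset_union_right.trans Finset.subset_union_right),
    ← Finset.sum_add_distrib]
  refine Finset.sum_congr rfl fun α _ => ?_
  rw [← Finset.sum_add_distrib]
  refine Finset.sum_congr rfl fun K _ => ?_
  rw [coef_add, map_add, ofBase_add, add_mul]

theorem subst_zero (g : Grassmann (Fin m) B →+ Grassmann (Fin m) B')
    (η : Idx N m → Symb N' m B') : (0 : Symb N m B).subst g η = 0 := by
  have := subst_add g η 0 0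
  simpa using this

theorem subst_ofBase_mul_nmon (g : Grassmann (Fin m) B →+ Grassmann (Fin m) B')
    (η : Idx N m → Symb N' m B') (f : Grassmann (Fin m) B) (α : Fin N →₀ ℕ) (K : Finset (Fin m)) :
    (ofBase f * nmon α K).subst g η = ofBase (g f) * monom η α K := by
  classical
  rw [subst_eq_sum (map_zero g) η _ (s := insert α (ofBase f * nmon α K : Symb N m B).exponents)
    (Finset.subset_insert _ _), Finset.sum_eq_single α, Finset.sum_eq_single K]
  · rw [coef_ofBase_mul_nmon, if_pos ⟨rfl, rfl⟩]
  · intro K' _ hK'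
    rw [coef_ofBase_mul_nmon, if_neg fun h => hK' h.2.symm, map_zero, ofBase_zero, zero_mul]
  · simp
  · intro α' _ hα'
    refine Finset.sum_eq_zero fun K' _ => ?_
    rw [coef_ofBase_mul_nmon, if_neg fun h => hα' h.1.symm, map_zero, ofBase_zero, zero_mul]
  · simp

/-- The additive map `Symb.subst`. -/
def substAdd (g : Grassmann (Fin m) B →+ Grassmann (Fin m) B') (η : Idx N m → Symb N' m B') :
    Symb N m B →+ Symb N' m B' := ⟨⟨subst g η, subst_zero g η⟩, subst_add g η⟩

theorem nmon_zero : (nmon 0 ∅ : Symb N m B) = 1 := by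
  rw [← monom_xi, monom_zero_empty]

/-- Supersymmetric tensors are generated, under sums and right multiplications by the `ξ_i`, by the
superfunctions. -/
theorem xi_induction {P : Symb N m B → Prop} (hadd : ∀ S T, P S → P T → P (S + T))
    (hbase : ∀ f, P (ofBase f)) (hmul : ∀ S i, P S → P (S * xi i)) (S : Symb N m B) : P S := by
  refine nmon_induction hadd (fun f α K => ?_) S
  induction α, K using index_induction with
  | h0 => rw [nmon_zero, mul_one]; exact hbase f
  | hodd K k hk ih => rw [nmon_insert_max 0 hk, ← mul_assoc]; exact hmul _ _ ih
  | heven α K i ih => rw [← nmon_mul_even, ← mul_assoc]; exact hmul _ _ ih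

section SubstAdd

variable (g : Grassmann (Fin m) B →+* Grassmann (Fin m) B') {η : Idx N m → Symb N' m B'}

theorem substAdd_ofBase_mul_nmon (f : Grassmann (Fin m) B) (α : Fin N →₀ ℕ) (K : Finset (Fin m)) :
    substAdd g.toAddMonoidHom η (ofBase f * nmon α K) = ofBase (g f) * monom η α K :=
  subst_ofBase_mul_nmon g.toAddMonoidHom η f α K

theorem substAdd_ofBase (f : Grassmann (Fin m) B) :
    substAdd g.toAddMonoidHom η (ofBase f) = ofBase (g f) := by
  have := substAdd_ofBase_mul_nmon g (η := η) f 0 ∅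
  rwa [nmon_zero, monom_zero_empty, mul_one, mul_one] at this

theorem substAdd_ofBase_mul (f : Grassmann (Fin m) B) (S : Symb N m B) :
    substAdd g.toAddMonoidHom η (ofBase f * S) = ofBase (g f) * substAdd g.toAddMonoidHom η S := by
  induction S using nmon_induction with
  | hadd S T hS hT => rw [mul_add, map_add, map_add, mul_add, hS, hT]
  | h f' α K =>
    rw [← mul_assoc, ← ofBase_mul, substAdd_ofBase_mul_nmon, substAdd_ofBase_mul_nmon, map_mul,
      ofBase_mul, mul_assoc]

theorem substAdd_mul_xi (hη : ∀ i, (η i).IsParity i.parity) (S : Symb N m B) (i : Idx N m) :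
    substAdd g.toAddMonoidHom η (S * xi i) = substAdd g.toAddMonoidHom η S * η i := by
  induction S using nmon_induction with
  | hadd S T hS hT => rw [add_mul, map_add, map_add, add_mul, hS, hT]
  | h f α K =>
    rw [mul_assoc, substAdd_ofBase_mul_nmon, mul_assoc]
    rcases i with i | k
    · rw [nmon_mul_even, substAdd_ofBase_mul_nmon, monom_mul_even hη]
    · rw [nmon_mul_odd, monom_mul_odd hη]
      split_ifs with hk
      · rw [mul_zero, mul_zero, map_zero]
      · rw [mul_smul_comm, mul_smul_comm, map_zsmul, substAdd_ofBase_mul_nmon]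

theorem substAdd_invol (hη : ∀ i, (η i).IsParity i.parity) (hg : PreservesParity g) (p : ZMod 2)
    (S : Symb N m B) :
    substAdd g.toAddMonoidHom η (invol p S) = invol p (substAdd g.toAddMonoidHom η S) := by
  induction S using nmon_induction with
  | hadd S T hS hT => rw [map_add, map_add, map_add, map_add, hS, hT]
  | h f α K =>
    have hn : (nmon α K : Symb N m B).IsParity K.card := by
      rw [← monom_xi]; exact isParity_monom isParity_xi α K
    rw [map_mul (invol p), substAdd_ofBase_mul_nmon, map_mul (invol p), invol_ofBase, invol_ofBase,
      hn.invol,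
      (isParity_monom hη α K).invol, mul_smul_comm, mul_smul_comm, ← hg.invol, map_zsmul,
      substAdd_ofBase_mul_nmon]

theorem substAdd_mul (hη : ∀ i, (η i).IsParity i.parity) (hg : PreservesParity g) (S T : Symb N m B) :
    substAdd g.toAddMonoidHom η (S * T) =
      substAdd g.toAddMonoidHom η S * substAdd g.toAddMonoidHom η T := by
  induction T using xi_induction with
  | hadd T T' hT hT' => rw [mul_add, map_add, map_add, mul_add, hT, hT']
  | hmul T i hT =>
    rw [← mul_assoc, substAdd_mul_xi g hη, substAdd_mul_xi g hη, hT, mul_assoc]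
  | hbase f =>
    induction f using parity_induction with
    | hadd f f' hf hf' => rw [ofBase_add, mul_add, map_add, map_add, mul_add, hf, hf']
    | h p f hf =>
      have hS : S * ofBase f = ofBase f * invol p S := by
        rw [(isParity_ofBase hf).mul_comm', invol_invol_self]
      have hS' : ∀ S : Symb N' m B', S * ofBase (g f) = ofBase (g f) * invol p S := fun S => by
        rw [(isParity_ofBase (hg p f hf)).mul_comm', invol_invol_self]
      rw [hS, substAdd_ofBase_mul, substAdd_ofBase, hS', substAdd_invol g hη hg]

end SubstAdd

/-- Coefficients transform by the parity-preserving homomorphism `g`, and `ξ_i` is replaced by an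
element `η_i` of the same parity: `Symb.subst` is then a ring homomorphism. -/
def substHom (g : Grassmann (Fin m) B →+* Grassmann (Fin m) B') (hg : PreservesParity g)
    (η : Idx N m → Symb N' m B') (hη : ∀ i, (η i).IsParity i.parity) :
    Symb N m B →+* Symb N' m B' :=
  { substAdd g.toAddMonoidHom η with
    map_one' := by
      refine (congrArg _ (ofBase_one (N := N) (m := m) (B := B)).symm).trans ?_
      exact (substAdd_ofBase g 1).trans (by rw [map_one, ofBase_one])
    map_mul' := substAdd_mul g hη hg }

section SubstHom

variable {g : Grassmann (Fin m) B →+* Grassmann (Fin m) B'} {hg : PreservesParity g}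
    {η : Idx N m → Symb N' m B'} {hη : ∀ i, (η i).IsParity i.parity}

@[simp] theorem substHom_ofBase (f : Grassmann (Fin m) B) :
    substHom g hg η hη (ofBase f) = ofBase (g f) := substAdd_ofBase g f

@[simp] theorem substHom_xi (i : Idx N m) : substHom g hg η hη (xi i) = η i := by
  have h := substAdd_mul_xi g hη (ofBase 1) i
  rw [substAdd_ofBase, map_one, ofBase_one, ofBase_one, one_mul, one_mul] at h
  exact h

theorem preservesParity_substHom : PreservesParity (substHom g hg η hη) := by
  have hinv : ∀ S, substHom g hg η hη (invol 1 S) = invol 1 (substHom g hg η hη S) := by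
    intro S
    induction S using xi_induction with
    | hadd S T hS hT => simp only [map_add, hS, hT]
    | hbase f => rw [invol_ofBase, substHom_ofBase, substHom_ofBase, invol_ofBase, hg.invol]
    | hmul S i hS =>
      rw [map_mul, map_mul, map_mul, map_mul, hS, (isParity_xi i).invol, substHom_xi,
        (hη i).invol, map_zsmul, substHom_xi]
  intro p S hS
  rw [isParity_iff_invol_one, ← hinv, hS.invol, map_zsmul]

end SubstHom

/-- Ring homomorphisms which agree on the superfunctions and on the `ξ_i` are equal. -/
theorem ringHom_ext {A : Type*} [Ring A] {φ ψ : Symb N m B →+* A}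
    (hbase : ∀ f, φ (ofBase f) = ψ (ofBase f)) (hxi : ∀ i, φ (xi i) = ψ (xi i)) : φ = ψ := by
  refine RingHom.ext fun S => ?_
  induction S using xi_induction with
  | hadd S T hS hT => rw [map_add, map_add, hS, hT]
  | hbase f => exact hbase f
  | hmul S i hS => rw [map_mul, map_mul, hS, hxi]

/-- Left multiplication of the new coefficients by a fixed superfunction. -/
theorem subst_mul_left (a : Grassmann (Fin m) B') (g : Grassmann (Fin m) B → Grassmann (Fin m) B')
    (η : Idx N m → Symb N' m B') (S : Symb N m B) :
    S.subst (fun f => a * g f) η = ofBase a * S.subst g η := by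
  simp only [subst, ofBase_mul, mul_assoc, Finset.mul_sum]

/-- Composition of an additive change of coefficients with a tensor of the
form `a * S.subst g ξ`. -/
theorem subst_ofBase_mul_subst (h : Grassmann (Fin m) B' →+ Grassmann (Fin m) B'')
    (η : Idx N m → Symb N'' m B'') (a : Grassmann (Fin m) B')
    (g : Grassmann (Fin m) B →+ Grassmann (Fin m) B') (S : Symb N m B) :
    (ofBase a * S.subst g xi).subst h η = S.subst (fun f => h (a * g f)) η := by
  induction S using nmon_induction with
  | hadd S T hS hT =>
    have e := subst_add (h.comp ((AddMonoidHom.mulLeft a).comp g)) η S T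
    rw [subst_add, mul_add, subst_add, hS, hT]
    exact e.symm
  | h f α K =>
    have e := subst_ofBase_mul_nmon (h.comp ((AddMonoidHom.mulLeft a).comp g)) η f α K
    rw [subst_ofBase_mul_nmon, monom_xi, ← mul_assoc, ← ofBase_mul, subst_ofBase_mul_nmon]
    exact e.symm

end Symb

/-! ### Superderivations -/

namespace Grassmann

variable {κ κ' κ'' R R' R'' : Type*} [LinearOrder κ] [LinearOrder κ'] [LinearOrder κ'']
  [CommRing R] [CommRing R'] [CommRing R'']

/-- Superderivations of parity `p` along a ring homomorphism `φ`. The Koszul sign is expressed by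
the automorphism `invol p`, so that the Leibniz rule makes sense for inhomogeneous elements. -/
structure IsSuperDer (φ : Grassmann κ R →+* Grassmann κ' R') (p : ZMod 2)
    (D : Grassmann κ R →+ Grassmann κ' R') : Prop where
  leibniz : ∀ a b, D (a * b) = D a * φ b + φ (invol p a) * D b
  map_invol : ∀ q a, D (invol q a) = ksign q p • invol q (D a)

namespace IsSuperDer

variable {φ : Grassmann κ R →+* Grassmann κ' R'} {p q : ZMod 2}
  {D D' : Grassmann κ R →+ Grassmann κ' R'}

theorem add (hD : IsSuperDer φ p D) (hD' : IsSuperDer φ p D') : IsSuperDer φ p (D + D') where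
  leibniz a b := by
    simp only [AddMonoidHom.add_apply, hD.leibniz, hD'.leibniz, add_mul, mul_add]; abel
  map_invol q a := by
    simp only [AddMonoidHom.add_apply, hD.map_invol, hD'.map_invol, map_add, smul_add]

theorem zero : IsSuperDer φ p 0 where
  leibniz a b := by simp
  map_invol q a := by simp

theorem sum {ι : Type*} (s : Finset ι) {D : ι → Grassmann κ R →+ Grassmann κ' R'}
    (hD : ∀ i ∈ s, IsSuperDer φ p (D i)) : IsSuperDer φ p (∑ i ∈ s, D i) :=
  Finset.sum_induction D (IsSuperDer φ p) (fun _ _ => add) zero hD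

theorem mulLeft [Fintype κ'] (hD : IsSuperDer φ p D) (hφ : PreservesParity φ)
    {f : Grassmann κ' R'} (hf : f.IsParity q) :
    IsSuperDer φ (q + p) ((AddMonoidHom.mulLeft f).comp D) where
  leibniz a b := by
    simp only [AddMonoidHom.comp_apply, AddMonoidHom.coe_mulLeft, hD.leibniz, mul_add, ← mul_assoc]
    rw [hf.mul_comm' (φ (invol p a)), ← hφ.invol, invol_invol]
  map_invol s a := by
    simp only [AddMonoidHom.comp_apply, AddMonoidHom.coe_mulLeft, hD.map_invol, map_mul, hf.invol,
      ksign_add_right, mul_smul, mul_smul_comm, smul_mul_assoc]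
    rw [smul_comm (ksign s p), smul_smul (ksign s q), ksign_mul_self, one_smul]

theorem congr_parity (hD : IsSuperDer φ p D) (h : p = q) : IsSuperDer φ q D := h ▸ hD

theorem comp_hom {ψ : Grassmann κ'' R'' →+* Grassmann κ R} (hD : IsSuperDer φ p D)
    (hψ : PreservesParity ψ) : IsSuperDer (φ.comp ψ) p (D.comp ψ.toAddMonoidHom) where
  leibniz a b := by
    change D (ψ (a * b)) = D (ψ a) * φ (ψ b) + φ (ψ (invol p a)) * D (ψ b)
    rw [map_mul, hD.leibniz, hψ.invol]
  map_invol q a := by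
    change D (ψ (invol q a)) = _
    rw [hψ.invol, hD.map_invol]; rfl

theorem hom_comp {ψ : Grassmann κ' R' →+* Grassmann κ'' R''} (hD : IsSuperDer φ p D)
    (hψ : PreservesParity ψ) : IsSuperDer (ψ.comp φ) p (ψ.toAddMonoidHom.comp D) where
  leibniz a b := by
    change ψ (D (a * b)) = ψ (D a) * ψ (φ b) + ψ (φ (invol p a)) * ψ (D b)
    rw [hD.leibniz, map_add, map_mul, map_mul]
  map_invol q a := by
    change ψ (D (invol q a)) = ksign q p • invol q (ψ (D a))
    rw [hD.map_invol, map_zsmul, hψ.invol]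

/-- The Leibniz rule for a homogeneous first factor. -/
theorem leibniz_of_isParity (hD : IsSuperDer φ p D) {a : Grassmann κ R} (ha : a.IsParity q)
    (b : Grassmann κ R) : D (a * b) = D a * φ b + ksign p q • (φ a * D b) := by
  rw [hD.leibniz, ha.invol, map_zsmul, smul_mul_assoc]

theorem map_one (hD : IsSuperDer φ p D) : D 1 = 0 := by
  have := hD.leibniz 1 1
  simpa using this

theorem isParity [Module ℝ R'] (hD : IsSuperDer φ p D) {a : Grassmann κ R} (ha : a.IsParity q) :
    (D a).IsParity (p + q) := by
  have h := hD.map_invol 1 a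
  rw [ha.invol, map_zsmul] at h
  rw [isParity_iff_invol_one, ksign_add_right, mul_smul, h, smul_smul, ksign_mul_self, one_smul]

/-- The supercommutator of two superderivations is a superderivation. -/
theorem commutator {D D' : Grassmann κ R →+ Grassmann κ R}
    (hD : IsSuperDer (RingHom.id _) p D) (hD' : IsSuperDer (RingHom.id _) q D') :
    IsSuperDer (RingHom.id _) (p + q) (D.comp D' - ksign p q • D'.comp D) where
  leibniz a b := by
    simp only [AddMonoidHom.sub_apply, AddMonoidHom.comp_apply, AddMonoidHom.smul_apply,
      hD.leibniz, hD'.leibniz, map_add, hD.map_invol, hD'.map_invol, RingHom.id_apply,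
      invol_invol, smul_add, sub_mul, mul_sub, smul_mul_assoc, mul_smul_comm, smul_smul,
      ksign_comm q p, ksign_mul_self, one_smul, add_comm q p]
    abel
  map_invol s a := by
    simp only [AddMonoidHom.sub_apply, AddMonoidHom.comp_apply, AddMonoidHom.smul_apply,
      hD.map_invol, hD'.map_invol, map_zsmul, map_sub, smul_sub, smul_smul, ksign_add_right]
    ring_nf

end IsSuperDer

end Grassmann

namespace Symb

open Grassmann

variable {N m : ℕ} {B : Type*} [CommRing B] [Module ℝ B]

/-- Superderivations which agree on the superfunctions and on the `ξ_i` are equal. -/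
theorem superDer_ext {κ' R' : Type*} [LinearOrder κ'] [CommRing R'] {p : ZMod 2}
    {φ : Symb N m B →+* Grassmann κ' R'} {D D' : Symb N m B →+ Grassmann κ' R'}
    (hD : IsSuperDer φ p D) (hD' : IsSuperDer φ p D')
    (hbase : ∀ f, D (ofBase f) = D' (ofBase f)) (hxi : ∀ i, D (xi i) = D' (xi i)) : D = D' := by
  refine AddMonoidHom.ext fun S => ?_
  induction S using xi_induction with
  | hadd S T hS hT => rw [map_add, map_add, hS, hT]
  | hbase f => exact hbase f
  | hmul S i hS => rw [hD.leibniz, hD'.leibniz, hS, hxi]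

theorem mapCoeff_mono {κ R S : Type*} [LinearOrder κ] [CommRing R] [CommRing S] (φ : R →+ S)
    (K : Finset κ) (r : R) : mapCoeff φ (mono K r) = mono K (φ r) := by
  ext M; simp only [coeff_mapCoeff, coeff_mono]; split_ifs <;> simp

theorem isSuperDer_leftDeriv {κ R : Type*} [LinearOrder κ] [CommRing R] (a : κ) :
    IsSuperDer (RingHom.id (Grassmann κ R)) 1 (leftDeriv a).toAddMonoidHom where
  leibniz := leftDeriv_mul' a
  map_invol q f := by
    change leftDeriv a (invol q f) = ksign q 1 • invol q (leftDeriv a f)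
    rw [invol_leftDeriv, smul_smul, ksign_mul_self, one_smul]

theorem isSuperDer_mapCoeff {κ R : Type*} [LinearOrder κ] [CommRing R] (d : R →+ R)
    (hd : ∀ a b, d (a * b) = d a * b + a * d b) :
    IsSuperDer (RingHom.id (Grassmann κ R)) 0 (mapCoeff d) where
  leibniz a b := by rw [invol_zero]; exact mapCoeff_mul_of_leibniz d hd a b
  map_invol q f := by rw [ksign_zero_right, one_smul, invol_mapCoeff]

theorem isSuperDer_contr (i : Idx N m) :
    IsSuperDer (RingHom.id (Symb N m B)) i.parity (contr i) := by
  rcases i with i | k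
  · exact isSuperDer_mapCoeff _ fun a b => by
      simp only [LinearMap.toAddMonoidHom_coe, Derivation.coeFn_coe, Derivation.leibniz,
        smul_eq_mul]
      ring
  · exact isSuperDer_leftDeriv _

theorem leftDeriv_inr_ofBase (k : Fin m) (f : Grassmann (Fin m) B) :
    leftDeriv (Sum.inrₗ k) (ofBase f : Symb N m B) = 0 := by
  induction f using mono_induction with
  | hadd f g hf hg => rw [ofBase_add, map_add, hf, hg, add_zero]
  | hmono J b => rw [ofBase_mono, leftDeriv_mono, if_neg (by simp [inr_mem_joinSet])]

theorem erase_joinSet {inst : DecidableEq (Fin m ⊕ₗ Fin m)} (J : Finset (Fin m)) (j : Fin m) :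
    (joinSet J ∅).erase (Sum.inlₗ j) = joinSet (J.erase j) ∅ := by
  ext x
  rcases lex_cases x with ⟨i, rfl⟩ | ⟨k, rfl⟩
  · simp [inl_mem_joinSet]
  · simp [inr_mem_joinSet]

theorem leftDeriv_inl_ofBase (j : Fin m) (f : Grassmann (Fin m) B) :
    leftDeriv (Sum.inlₗ j) (ofBase f : Symb N m B) = ofBase (leftDeriv j f) := by
  induction f using mono_induction with
  | hadd f g hf hg => rw [ofBase_add, map_add, hf, hg, map_add, ofBase_add]
  | hmono J b =>
    rw [ofBase_mono, leftDeriv_mono, leftDeriv_mono]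
    simp only [inl_mem_joinSet]
    split_ifs with h
    · have hs : shuffleSign {Sum.inlₗ j} (joinSet (J.erase j) ∅) = shuffleSign {j} (J.erase j) := by
        have := shuffleSign_image inl_strictMono {j} (J.erase j)
        simpa [joinSet] using this
      rw [ofBase_mono, erase_joinSet, hs]
      simp
    · rw [ofBase_zero]

@[simp] theorem contr_ofBase (i : Idx N m) (f : Grassmann (Fin m) B) :
    contr i (ofBase f : Symb N m B) = 0 := by
  rcases i with i | k
  · induction f using mono_induction with
    | hadd f g hf hg => rw [ofBase_add, map_add, hf, hg, add_zero]
    | hmono J b =>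
      rw [ofBase_mono]
      exact (mapCoeff_mono _ _ _).trans (by simp)
  · exact leftDeriv_inr_ofBase k f

theorem contr_xi (i j : Idx N m) :
    contr i (xi j : Symb N m B) = if i = j then 1 else 0 := by
  rcases i with i | k <;> rcases j with j | l
  · refine (mapCoeff_mono _ ∅ (MvPolynomial.X j)).trans ?_
    simp only [LinearMap.toAddMonoidHom_coe, Derivation.coeFn_coe, MvPolynomial.pderiv_X,
      Sum.inl.injEq, Pi.single_apply]
    simp only [eq_comm (a := i)]
    split_ifs
    · rfl
    · simp
  · refine (mapCoeff_mono _ {Sum.inrₗ l} 1).trans ?_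
    simp
  · refine (leftDeriv_mono _ ∅ (MvPolynomial.X j)).trans ?_
    simp
  · refine (leftDeriv_mono _ {Sum.inrₗ l} 1).trans ?_
    by_cases h : k = l
    · subst h; simp [one_eq_mono]
    · simp [h]

/-- Interior products supercommute: their supercommutator is a superderivation which vanishes on the
superfunctions and on the `ξ_i`. -/
theorem contr_contr (i j : Idx N m) (S : Symb N m B) :
    contr i (contr j S) = ksign i.parity j.parity • contr j (contr i S) := by
  have h := (isSuperDer_contr (B := B) i).commutator (isSuperDer_contr j)
  have h0 := superDer_ext h IsSuperDer.zero (fun f => by simp) fun l => by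
    simp only [AddMonoidHom.sub_apply, AddMonoidHom.comp_apply, contr_xi, AddMonoidHom.smul_apply,
      AddMonoidHom.zero_apply, apply_ite (contr _ : Symb N m B →+ _), map_zero,
      (isSuperDer_contr _).map_one, ite_self, smul_zero, sub_zero]
  have := DFunLike.congr_fun h0 S
  exact sub_eq_zero.1 this

/-- The Euler operator `∑ i, ξ_i i(dx^i)`, which multiplies a tensor of degree `k` by `k`. -/
def euler : Symb N m B →+ Symb N m B :=
  ∑ i : Idx N m, (AddMonoidHom.mulLeft (xi i)).comp (contr i)

theorem isSuperDer_euler : IsSuperDer (RingHom.id (Symb N m B)) 0 euler :=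
  IsSuperDer.sum _ fun i _ => ((isSuperDer_contr i).mulLeft preservesParity_id
    (isParity_xi i)).congr_parity (CharTwo.add_self_eq_zero _)

theorem euler_apply (S : Symb N m B) : euler S = ∑ i : Idx N m, xi i * contr i S := by
  simp [euler]

@[simp] theorem euler_ofBase (f : Grassmann (Fin m) B) : euler (ofBase f : Symb N m B) = 0 := by
  simp [euler_apply]

@[simp] theorem euler_xi (i : Idx N m) : euler (xi i : Symb N m B) = xi i := by
  simp [euler_apply, contr_xi]

theorem euler_mul (S T : Symb N m B) : euler (S * T) = euler S * T + S * euler T := by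
  have := isSuperDer_euler.leibniz S T
  rwa [invol_zero] at this

theorem euler_nmon (α : Fin N →₀ ℕ) (K : Finset (Fin m)) :
    euler (nmon α K : Symb N m B) = (α.degree + K.card) • nmon α K := by
  induction α, K using index_induction with
  | h0 => rw [nmon_zero, isSuperDer_euler.map_one]; simp
  | hodd K k hk ih =>
    rw [nmon_insert_max 0 hk, euler_mul, ih, euler_xi,
      Finset.card_insert_of_notMem fun h => lt_irrefl _ (hk k h), ← add_assoc, succ_nsmul,
      smul_mul_assoc]
  | heven α K i ih =>
    rw [← nmon_mul_even, euler_mul, ih, euler_xi, map_add, Finsupp.degree_single, add_right_comm,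
      succ_nsmul, smul_mul_assoc]

theorem coef_smul {S : Type*} [Semiring S] [Module S B] (r : S) (T : Symb N m B) (α K) :
    (r • T).coef α K = r • T.coef α K := rfl

theorem coef_euler (S : Symb N m B) (α : Fin N →₀ ℕ) (K : Finset (Fin m)) :
    (euler S).coef α K = (α.degree + K.card) • S.coef α K := by
  induction S using nmon_induction with
  | hadd S T hS hT => rw [map_add, coef_add, coef_add, hS, hT, smul_add]
  | h f β L =>
    rw [euler_mul, euler_ofBase, zero_mul, zero_add, euler_nmon, mul_smul_comm]
    rw [coef_smul, coef_ofBase_mul_nmon]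
    split_ifs with h
    · rw [h.1, h.2]
    · rw [smul_zero, smul_zero]

theorem nsmul_eq_real_smul {M : Type*} [AddCommGroup M] [Module ℝ M] (k : ℕ) (x : M) :
    k • x = (k : ℝ) • x := (Nat.cast_smul_eq_nsmul ℝ k x).symm

theorem isHomog_iff {k : ℕ} {S : Symb N m B} : S.IsHomog k ↔ euler S = (k : ℝ) • S := by
  refine ⟨fun h => ext_coef fun α K => ?_, fun h α K hne => ?_⟩
  · rw [coef_euler, coef_smul]
    by_cases h0 : S.coef α K = 0
    · rw [h0, smul_zero, smul_zero]
    · rw [h α K h0, nsmul_eq_real_smul]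
  · have e := coef_euler S α K
    rw [h, coef_smul, nsmul_eq_real_smul, ← sub_eq_zero, ← sub_smul] at e
    rcases smul_eq_zero.1 e with h' | h'
    · exact_mod_cast (sub_eq_zero.1 h').symm
    · exact absurd h' hne

/-- There are no tensors of negative degree. -/
theorem eq_zero_of_euler_neg {r : ℝ} (hr : r < 0) {S : Symb N m B} (h : euler S = r • S) :
    S = 0 := by
  refine ext_coef fun α K => ?_
  have e := coef_euler S α K
  rw [h, coef_smul, nsmul_eq_real_smul, ← sub_eq_zero, ← sub_smul] at e
  refine (smul_eq_zero.1 e).resolve_left ?_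
  have : (0 : ℝ) ≤ ((α.degree + K.card : ℕ) : ℝ) := Nat.cast_nonneg _
  linarith

theorem euler_contr (i : Idx N m) (S : Symb N m B) :
    euler (contr i S) = contr i (euler S) - contr i S := by
  have h := (isSuperDer_contr (B := B) i).commutator isSuperDer_euler
  have h0 := superDer_ext (h.congr_parity (add_zero _)) (isSuperDer_contr i) (fun f => by simp)
    fun l => by
      simp only [AddMonoidHom.sub_apply, AddMonoidHom.comp_apply, AddMonoidHom.smul_apply, euler_xi,
        contr_xi]
      rw [apply_ite (euler : Symb N m B →+ _), isSuperDer_euler.map_one, map_zero]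
      simp
  have := DFunLike.congr_fun h0 S
  simp only [AddMonoidHom.sub_apply, AddMonoidHom.comp_apply, ksign_zero_right, one_smul] at this
  rw [eq_sub_iff_add_eq, add_comm]
  exact (sub_eq_iff_eq_add.1 this).symm

end Symb

/-! ### Partial derivatives -/

open Grassmann

theorem Smooth.dirDeriv_comm {N : ℕ} {W : Opens (Eu N)} (v w : Eu N) (f : Smooth W) :
    Smooth.dirDeriv v (Smooth.dirDeriv w f) = Smooth.dirDeriv w (Smooth.dirDeriv v f) := by
  ext x
  have hx : (W : Set (Eu N)) ∈ nhds (x : Eu N) := W.isOpen.mem_nhds x.2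
  have hd : DifferentiableAt ℝ (fderiv ℝ (zeroExt f.1)) x :=
    ((f.2.fderiv_of_isOpen (m := ∞) W.isOpen (by simp)).differentiableOn
      (by simp)).differentiableAt hx
  have key : ∀ v w : Eu N, (Smooth.dirDeriv v (Smooth.dirDeriv w f)).1 x =
      fderiv ℝ (fderiv ℝ (zeroExt f.1)) x v w := by
    intro v w
    refine (Smooth.rawDeriv_eq v _ x (hd.hasFDerivAt.clm_apply (hasFDerivAt_const w _))
      (fun y => rfl)).trans ?_
    simp
  have hs : IsSymmSndFDerivAt ℝ (zeroExt f.1) x :=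
    (f.2.contDiffAt hx).isSymmSndFDerivAt (by
      rw [minSmoothness_of_isRCLikeNormedField]; exact WithTop.coe_le_coe.2 le_top)
  rw [key, key]
  exact hs v w

namespace SuperFun

variable {N m : ℕ} {W : Opens (Eu N)}

theorem isSuperDer_pd (i : Idx N m) :
    IsSuperDer (RingHom.id (SuperFun m W)) i.parity (pd i).toAddMonoidHom := by
  rcases i with i | j
  · exact Symb.isSuperDer_mapCoeff _ (Smooth.dirDeriv_mul _)
  · exact Symb.isSuperDer_leftDeriv j

theorem pd_comm (i j : Idx N m) (f : SuperFun m W) :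
    pd i (pd j f) = ksign i.parity j.parity • pd j (pd i f) := by
  rcases i with i | i <;> rcases j with j | j
  · refine (Grassmann.ext (funext fun K => ?_)).trans (one_smul _ _).symm
    exact Smooth.dirDeriv_comm _ _ _
  · refine Eq.trans ?_ (one_smul _ _).symm
    exact (leftDeriv_mapCoeff _ _ _).symm
  · refine Eq.trans ?_ (one_smul _ _).symm
    exact leftDeriv_mapCoeff _ _ _
  · refine (leftDeriv_leftDeriv _ _ _).trans ?_
    have : ksign (Idx.parity (.inr i : Idx N m)) (Idx.parity (.inr j : Idx N m)) = -1 := by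
      rw [Idx.parity, Idx.parity]; decide
    rw [this, neg_smul, one_smul]; rfl

theorem pd_one (i : Idx N m) : pd i (1 : SuperFun m W) = 0 := (isSuperDer_pd i).map_one

theorem pd_mul' (i : Idx N m) (f g : SuperFun m W) :
    pd i (f * g) = pd i f * g + invol i.parity f * pd i g := (isSuperDer_pd i).leibniz f g

end SuperFun

namespace Symb

variable {N m : ℕ} {W : Opens (Eu N)}

theorem coeff_polyMap {σ R S : Type*} [CommRing R] [CommRing S] (d : R →+ S)
    (p : MvPolynomial σ R) (α : σ →₀ ℕ) :
    MvPolynomial.coeff α (AddMonoidAlgebra.map d p : MvPolynomial σ S) =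
      d (MvPolynomial.coeff α p) := rfl

theorem polyMap_mul {σ R : Type*} [CommRing R] (d : R →+ R)
    (hd : ∀ a b, d (a * b) = d a * b + a * d b) (p q : MvPolynomial σ R) :
    (AddMonoidAlgebra.map d (p * q) : MvPolynomial σ R) =
      (AddMonoidAlgebra.map d p : MvPolynomial σ R) * q +
        p * (AddMonoidAlgebra.map d q : MvPolynomial σ R) := by
  classical
  ext α
  rw [coeff_polyMap, MvPolynomial.coeff_add, MvPolynomial.coeff_mul, MvPolynomial.coeff_mul,
    MvPolynomial.coeff_mul, map_sum, ← Finset.sum_add_distrib]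
  simp only [hd, coeff_polyMap]

theorem isSuperDer_pd (i : Idx N m) :
    IsSuperDer (RingHom.id (Symb N m (Smooth W))) i.parity (pd i) := by
  rcases i with i | j
  · exact isSuperDer_mapCoeff _ fun a b => polyMap_mul _ (Smooth.dirDeriv_mul _) a b
  · exact isSuperDer_leftDeriv _

theorem pd_ofBase (i : Idx N m) (f : SuperFun m W) :
    pd i (ofBase f : Symb N m (Smooth W)) = ofBase (SuperFun.pd i f) := by
  rcases i with i | j
  · induction f using mono_induction with
    | hadd f g hf hg => rw [ofBase_add, map_add, hf, hg, map_add, ofBase_add]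
    | hmono J b =>
      have h1 : SuperFun.pd (.inl i : Idx N m) (mono J b) =
          mono J (Smooth.dirDeriv (EuclideanSpace.single i 1) b) := mapCoeff_mono _ _ _
      rw [ofBase_mono, h1, ofBase_mono]
      refine (mapCoeff_mono _ _ _).trans ?_
      congr 1
      ext1 α
      refine (coeff_polyMap _ _ _).trans ?_
      rw [MvPolynomial.coeff_C, MvPolynomial.coeff_C]
      split_ifs
      · rfl
      · exact map_zero _
  · exact leftDeriv_inl_ofBase j f

@[simp] theorem pd_xi (i j : Idx N m) : pd i (xi j : Symb N m (Smooth W)) = 0 := by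
  have h1 : ∀ v : Eu N, Smooth.dirDeriv v (1 : Smooth W) = 0 := fun v => by
    have := Smooth.dirDeriv_mul v (1 : Smooth W) 1
    rw [mul_one, mul_one, one_mul] at this
    exact left_eq_add.1 this
  rcases i with i | k <;> rcases j with j | l
  · refine (mapCoeff_mono _ ∅ (MvPolynomial.X j)).trans ?_
    rw [← mono_zero ∅]
    congr 1
    ext1 α
    refine (coeff_polyMap _ _ _).trans ?_
    rw [MvPolynomial.coeff_X]
    split_ifs
    · exact h1 _
    · exact map_zero _
  · refine (mapCoeff_mono _ {Sum.inrₗ l} 1).trans ?_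
    rw [← mono_zero {Sum.inrₗ l}]
    congr 1
    ext1 α
    refine (coeff_polyMap _ _ _).trans ?_
    rw [MvPolynomial.coeff_one]
    split_ifs
    · exact h1 _
    · exact map_zero _
  · refine (leftDeriv_mono _ ∅ (MvPolynomial.X j)).trans ?_
    simp
  · refine (leftDeriv_mono _ {Sum.inrₗ l} 1).trans ?_
    simp

end Symb

/-! ### Hadamard's lemma -/

open Grassmann

section Hadamard

open MeasureTheory

/-- The integral of a smooth function over `[0, 1]` depends smoothly on parameters. It is a
convolution of the indicator function of `[0, 1]` with a cut-off of the integrand. -/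
theorem contDiff_integral_param {E : Type*} [NormedAddCommGroup E] [NormedSpace ℝ E]
    {H : E × ℝ → ℝ} (hH : ContDiff ℝ ∞ H) :
    ContDiff ℝ ∞ fun x => ∫ t in (0 : ℝ)..1, H (x, t) := by
  let χ : ContDiffBump (0 : ℝ) := ⟨1, 2, one_pos, one_lt_two⟩
  -- The reflection `s ↦ -s` turns the convolution at `0` into the integral over `[0, 1]`.
  let f : ℝ → ℝ := Set.indicator (Set.Ioc 0 1) 1
  let g : E → ℝ → ℝ := fun p s => χ s * H (p, -s)
  have hf : LocallyIntegrable f volume := by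
    refine Integrable.locallyIntegrable ?_
    exact (integrable_indicator_iff measurableSet_Ioc).2 (integrableOn_const (by simp))
  have hg : ContDiff ℝ ∞ (Function.uncurry g) := by
    have h1 : ContDiff ℝ ∞ (χ : ℝ → ℝ) := χ.contDiff
    change ContDiff ℝ ∞ fun q : E × ℝ => χ q.2 * H (q.1, -q.2)
    fun_prop
  have h := contDiffOn_convolution_right_with_param_comp (n := ⊤) (μ := volume)
    (ContinuousLinearMap.mul ℝ ℝ) (v := fun _ : E => (0 : ℝ)) (s := Set.univ)
    contDiffOn_const (f := f) (g := g) (k := Metric.closedBall 0 2) isOpen_univ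
    (isCompact_closedBall _ _) (fun p x _ hx => by
      have : χ x = 0 := χ.zero_of_le_dist (by
        rw [Metric.mem_closedBall, not_le] at hx; exact hx.le)
      simp [g, this]) hf hg.contDiffOn
  rw [contDiffOn_univ] at h
  convert h using 1
  funext x
  rw [intervalIntegral.integral_of_le zero_le_one, convolution_def,
    ← integral_indicator measurableSet_Ioc]
  congr 1
  ext t
  by_cases ht : t ∈ Set.Ioc (0 : ℝ) 1
  · have h1 : χ (-t) = 1 := χ.one_of_mem_closedBall (by
      rw [mem_closedBall_zero_iff, norm_neg, Real.norm_of_nonneg ht.1.le]; exact ht.2)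
    simp [f, g, ht, h1]
  · simp [f, ht]

/-- Hadamard's lemma. -/
theorem hadamard {N : ℕ} {F : Eu N → ℝ} (hF : ContDiff ℝ ∞ F) (a : Eu N) :
    ∃ g : Fin N → Eu N → ℝ, (∀ i, ContDiff ℝ ∞ (g i)) ∧
      ∀ x, F x = F a + ∑ i, (x i - a i) * g i x := by
  refine ⟨fun i x => ∫ t in (0 : ℝ)..1, fderiv ℝ F (a + t • (x - a)) (EuclideanSpace.single i 1),
    fun i => ?_, fun x => ?_⟩
  · have h : ContDiff ℝ ∞ fun q : Eu N × ℝ =>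
        fderiv ℝ F (a + q.2 • (q.1 - a)) (EuclideanSpace.single i 1) := by
      have h1 : ContDiff ℝ ∞ (fderiv ℝ F) := hF.fderiv_right (by simp)
      exact (h1.comp (by fun_prop)).clm_apply contDiff_const
    exact contDiff_integral_param h
  -- The fundamental theorem of calculus along the segment from `a` to `x`.
  · have hd : ∀ t ∈ Set.uIcc (0 : ℝ) 1, HasDerivAt (fun t : ℝ => F (a + t • (x - a)))
        (fderiv ℝ F (a + t • (x - a)) (x - a)) t := by
      intro t _
      have h1 := (hF.differentiable (by simp) (a + t • (x - a))).hasFDerivAt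
      have h2 : HasDerivAt (fun t : ℝ => a + t • (x - a)) (x - a) t := by
        simpa using ((hasDerivAt_id t).smul_const (x - a)).const_add a
      exact h1.comp_hasDerivAt t h2
    have hc : ∀ v : Eu N, Continuous fun t : ℝ => fderiv ℝ F (a + t • (x - a)) v := by
      intro v
      have h1 : Continuous (fderiv ℝ F) := hF.continuous_fderiv (by simp)
      exact (h1.comp (by fun_prop)).clm_apply continuous_const
    have h := intervalIntegral.integral_eq_sub_of_hasDerivAt hd ((hc _).intervalIntegrable _ _)
    simp only [one_smul, add_sub_cancel, zero_smul, add_zero] at h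
    have hx : x - a = ∑ i, (x i - a i) • EuclideanSpace.single i (1 : ℝ) := by
      ext j
      simp [Finset.sum_apply, Pi.single_apply]
    have h2 : ∀ t : ℝ, fderiv ℝ F (a + t • (x - a)) (x - a) =
        ∑ i, (x i - a i) * fderiv ℝ F (a + t • (x - a)) (EuclideanSpace.single i 1) := by
      intro t
      conv_lhs => rw [hx]
      rw [map_sum]
      rw [← hx]
      simp
    simp only [h2] at h
    rw [intervalIntegral.integral_finsetSum fun i _ =>
      ((hc _).intervalIntegrable _ _).const_mul _] at h
    simp only [intervalIntegral.integral_const_mul] at h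
    rw [h]; ring

/-- A smooth function agrees near each point with a function which is smooth on the whole space. -/
theorem Smooth.exists_global {N : ℕ} {W : Opens (Eu N)} (f : Smooth W) (a : W) :
    ∃ F : Eu N → ℝ, ContDiff ℝ ∞ F ∧ ∃ V : Opens (Eu N), V ≤ W ∧ a.1 ∈ V ∧
      ∀ x : W, x.1 ∈ V → f.1 x = F x := by
  obtain ⟨r, hr, hrW⟩ := Metric.isOpen_iff.1 W.isOpen a a.2
  -- Multiply `f` by a cut-off function supported in a ball around `a` inside `W`.
  let χ : ContDiffBump a.1 := ⟨r / 3, r / 2, by positivity, by linarith⟩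
  refine ⟨fun x => χ x * zeroExt f.1 x, ?_, ⟨Metric.ball a (r / 3), Metric.isOpen_ball⟩,
    fun x hx => hrW (Metric.ball_subset_ball (by linarith) hx), Metric.mem_ball_self (by positivity),
    fun x hx => ?_⟩
  · refine contDiff_iff_contDiffAt.2 fun x => ?_
    by_cases hx : x ∈ tsupport fun x => χ x * zeroExt f.1 x
    swap
    · exact contDiffAt_const.congr_of_eventuallyEq (notMem_tsupport_iff_eventuallyEq.1 hx)
    have hx' : x ∈ tsupport χ := tsupport_mul_subset_left hx
    rw [χ.tsupport_eq] at hx'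
    have hW : x ∈ W := hrW (Metric.closedBall_subset_ball (by change r / 2 < r; linarith) hx')
    exact χ.contDiffAt.mul (f.2.contDiffAt (W.isOpen.mem_nhds hW))
  · have : χ x = 1 := χ.one_of_mem_closedBall (Metric.ball_subset_closedBall hx)
    change f.1 x = χ x * zeroExt f.1 x
    rw [this, one_mul, zeroExt_apply]

/-- Hadamard's lemma near a point, for smooth functions on an open set. -/
theorem Smooth.exists_hadamard {N : ℕ} {W : Opens (Eu N)} (f : Smooth W) (a : W) :
    ∃ (V : Opens (Eu N)) (hV : V ≤ W) (g : Fin N → Smooth V), a.1 ∈ V ∧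
      Smooth.res hV f = algebraMap ℝ (Smooth V) (f.1 a) +
        ∑ i, (Smooth.mk' (fun x => x i) (by fun_prop) - algebraMap ℝ (Smooth V) (a.1 i)) * g i := by
  obtain ⟨F, hF, V, hV, ha, hFV⟩ := Smooth.exists_global f a
  obtain ⟨g, hg, hFg⟩ := hadamard hF a.1
  refine ⟨V, hV, fun i => Smooth.mk' (g i) (hg i).contDiffOn, ha, ?_⟩
  ext x
  change f.1 ⟨x, hV x.2⟩ = _
  rw [hFV ⟨x, hV x.2⟩ x.2, hFg, ← hFV a ha]
  change _ = f.1 a + Smooth.eval x (∑ i, _)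
  rw [map_sum]
  rfl

end Hadamard

/-! ### Supervector fields in graded coordinates -/

open Grassmann SuperalgebraSheaf

namespace SuperFun

variable {N m : ℕ} {W : Opens (Eu N)}

theorem ofScalar_mul (s : Smooth W) (h : SuperFun m W) (L : Finset (Fin m)) :
    ((Grassmann.ofScalar s : SuperFun m W) * h).coeff L = s * h.coeff L := by
  rw [coeff_mul, Finset.sum_eq_single ∅]
  · simp [ofScalar]
  · intro J _ hJ; simp [ofScalar, hJ]
  · simp

theorem pd_coord (i j : Idx N m) :
    pd i (coord j : SuperFun m W) = if i = j then 1 else 0 := by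
  rcases i with i | k <;> rcases j with j | l
  · refine (Symb.mapCoeff_mono _ ∅ _).trans ?_
    have h : Smooth.dirDeriv (EuclideanSpace.single i (1 : ℝ))
        (Smooth.mk' (fun x => x j) (by fun_prop) : Smooth W) = if i = j then 1 else 0 := by
      ext x
      refine (Smooth.rawDeriv_eq _ _ x
        ((EuclideanSpace.proj (𝕜 := ℝ) j : Eu N →L[ℝ] ℝ).hasFDerivAt) (fun y => rfl)).trans ?_
      by_cases hij : i = j
      · subst hij; simp
      · simp [hij]
    refine (congrArg (mono ∅) h).trans ?_
    simp only [Sum.inl.injEq]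
    split_ifs
    · rfl
    · simp
  · have h1 : ∀ v : Eu N, Smooth.dirDeriv v (1 : Smooth W) = 0 := fun v => by
      have := Smooth.dirDeriv_mul v (1 : Smooth W) 1
      rw [mul_one, mul_one, one_mul] at this
      exact left_eq_add.1 this
    refine (Symb.mapCoeff_mono _ {l} 1).trans ?_
    refine (congrArg (mono {l}) (h1 _)).trans ?_
    simp
  · refine (leftDeriv_mono _ ∅ _).trans ?_
    simp
  · refine (leftDeriv_mono _ {l} 1).trans ?_
    by_cases h : k = l
    · subst h; simp [one_eq_mono]
    · simp [h]

theorem isParity_coord (i : Idx N m) : (coord i : SuperFun m W).IsParity i.parity := by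
  rcases i with i | k
  · exact isParity_ofScalar _
  · exact isParity_gen _

/-- The ring homomorphism `SuperFun.res`. -/
def resHom {V W : Opens (Eu N)} (h : V ≤ W) : SuperFun m W →+* SuperFun m V :=
  mapHom (Smooth.res h)

theorem res_coord {V W : Opens (Eu N)} (h : V ≤ W) (i : Idx N m) :
    res h (coord i : SuperFun m W) = coord i := by
  rcases i with i | k
  · refine (Symb.mapCoeff_mono _ ∅ _).trans ?_
    rfl
  · refine (Symb.mapCoeff_mono _ {k} 1).trans ?_
    rfl

theorem mono_eq_mul (K : Finset (Fin m)) (r : Smooth W) :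
    (mono K r : SuperFun m W) = Grassmann.ofScalar r * mono K 1 := by
  ext1
  funext L
  rw [ofScalar_mul, coeff_mono, coeff_mono]
  split_ifs <;> simp

theorem algebraMap_eq_ofScalar (r : ℝ) :
    (Grassmann.ofScalar (algebraMap ℝ (Smooth W) r) : SuperFun m W) = r • 1 := by
  ext1
  funext L
  change (if L = ∅ then _ else _) = _
  rw [coeff_smul, coeff_one]
  split_ifs
  · exact Algebra.algebraMap_eq_smul_one _
  · exact (smul_zero r).symm

end SuperFun

namespace SuperChart

variable {n m : ℕ} {M₀ : TopCat.{u}} [ChartedSpace (Eu n) M₀] {A : SuperalgebraSheaf M₀}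
  (c : SuperChart n m A) {U : Opens M₀} (hU : U ≤ c.dom)

theorem res_symm {V : Opens M₀} (h : V ≤ U) (f : SuperFun m (bodyImage c.body U)) :
    A.res h ((c.iso U hU).symm f) =
      (c.iso V (h.trans hU)).symm (SuperFun.res (bodyImage_mono c.body h) f) := by
  apply (c.iso V (h.trans hU)).injective
  rw [c.iso_res U V hU h, AlgEquiv.apply_symm_apply, AlgEquiv.apply_symm_apply]

/-- Near each point of the image of `V` there is a smaller open set, on whose image a given smooth
function has a first order expansion with smooth coefficients. -/
theorem exists_hadamard {V : Opens M₀} (r : Smooth (bodyImage c.body V))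
    (a : bodyImage c.body V) : ∃ (V' : Opens M₀) (h : V' ≤ V)
      (g : Fin n → Smooth (bodyImage c.body V')), a.1 ∈ bodyImage c.body V' ∧
      SuperFun.res (bodyImage_mono c.body h) (ofScalar r) =
        (r.1 a) • (1 : SuperFun m (bodyImage c.body V')) +
        ∑ i, (SuperFun.coord (.inl i) - (a.1 i) • 1) * ofScalar (g i) := by
  obtain ⟨V₀, hV₀, g, ha, hg⟩ := Smooth.exists_hadamard r a
  let V' : Opens M₀ := ⟨c.body.source ∩ c.body ⁻¹' V₀, c.body.isOpen_inter_preimage V₀.isOpen⟩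
  have hV' : V' ⊓ V ≤ V := inf_le_right
  have hle : bodyImage c.body (V' ⊓ V) ≤ V₀ := by
    rintro x ⟨hx1, hx2⟩
    have := hx2.1.2
    rwa [Set.mem_preimage, c.body.right_inv hx1] at this
  refine ⟨V' ⊓ V, hV', fun i => Smooth.res hle (g i), ⟨a.2.1, ?_, a.2.2⟩, ?_⟩
  · refine ⟨c.body.map_target a.2.1, ?_⟩
    rw [Set.mem_preimage, c.body.right_inv a.2.1]
    exact ha
  · have h1 : Smooth.res (bodyImage_mono c.body hV') r = Smooth.res hle (Smooth.res hV₀ r) := rfl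
    refine (Symb.mapCoeff_mono _ ∅ _).trans ?_
    change ofScalar (Smooth.res (bodyImage_mono c.body hV') r) = _
    rw [h1, hg, map_add, map_sum]
    ext1
    funext L
    rw [coeff_add, coeff_sum, ← SuperFun.algebraMap_eq_ofScalar]
    have h2 : ∀ i, (((SuperFun.coord (.inl i) - (a.1 i) • 1) * ofScalar (Smooth.res hle (g i)) :
        SuperFun m (bodyImage c.body (V' ⊓ V)))).coeff L = if L = ∅ then
          Smooth.res hle ((Smooth.mk' (fun x => x i) (by fun_prop) -
            algebraMap ℝ (Smooth V₀) (a.1 i)) * g i) else 0 := by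
      intro i
      rw [← SuperFun.algebraMap_eq_ofScalar]
      change ((ofScalar _ - ofScalar _) * ofScalar _ : SuperFun m _).coeff L = _
      rw [sub_mul, coeff_sub, SuperFun.ofScalar_mul, SuperFun.ofScalar_mul]
      simp only [ofScalar]
      split_ifs
      · rw [← sub_mul, map_mul]; rfl
      · simp
    rw [Finset.sum_congr rfl fun i _ => h2 i]
    change (if L = ∅ then _ else _) = (if L = ∅ then _ else _) + _
    split_ifs
    · rfl
    · rw [Finset.sum_const_zero, add_zero]

/-- A superderivation which kills the graded coordinates vanishes. -/
theorem derivation_eq_zero {p : ZMod 2} {X : A.LinFamily U} (hX : X ∈ A.derivations U p)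
    (h0 : ∀ k, X ⟨U, le_rfl⟩ ((c.iso U hU).symm (SuperFun.coord k)) = 0) : X = 0 := by
  obtain ⟨h1, h2, h3⟩ := hX
  -- The derivation, read in the coordinates.
  let E : ∀ V : {V : Opens M₀ // V ≤ U}, SuperFun m (bodyImage c.body V.1) →ₗ[ℝ]
      SuperFun m (bodyImage c.body V.1) := fun V =>
    (c.iso V.1 (V.2.trans hU)).toLinearMap ∘ₗ X V ∘ₗ (c.iso V.1 (V.2.trans hU)).symm.toLinearMap
  have hE : ∀ V f, E V f = c.iso V.1 (V.2.trans hU) (X V ((c.iso V.1 (V.2.trans hU)).symm f)) :=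
    fun _ _ => rfl
  have hres : ∀ (V V' : {V : Opens M₀ // V ≤ U}) (h : V'.1 ≤ V.1) f,
      SuperFun.res (bodyImage_mono c.body h) (E V f) =
        E V' (SuperFun.res (bodyImage_mono c.body h) f) := by
    intro V V' h f
    rw [hE, hE, ← c.iso_res V.1 V'.1 (V.2.trans hU) h, h1 V V' h, c.res_symm (V.2.trans hU) h]
  have hcoord : ∀ V k, E V (SuperFun.coord k) = 0 := by
    intro V k
    rw [← SuperFun.res_coord (bodyImage_mono c.body V.2), ← hres ⟨U, le_rfl⟩ V V.2, hE, h0, map_zero,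
      map_zero]
  have hmul : ∀ V q (f g : SuperFun m (bodyImage c.body V.1)), f.IsParity q →
      E V (f * g) = E V f * g + ksign p q • (f * E V g) := by
    intro V q f g hf
    rw [hE, map_mul, h3 V q _ _ ((c.iso_parity V.1 (V.2.trans hU) q _).2 (by
      rwa [AlgEquiv.apply_symm_apply])), map_add, map_zsmul, map_mul, map_mul,
      AlgEquiv.apply_symm_apply, AlgEquiv.apply_symm_apply]
    rfl
  have hone : ∀ V, E V 1 = 0 := by
    intro V
    have := hmul V 0 1 1 isParity_one
    rw [ksign_zero_right, one_smul, mul_one, mul_one, one_mul] at this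
    exact left_eq_add.1 this
  -- By Hadamard's lemma, `E r` is near the point `x` a combination of superfunctions whose
  -- coefficients vanish at `x`.
  have hscalar : ∀ V r, E V (ofScalar r) = 0 := by
    intro V r
    ext L x
    obtain ⟨V', h, g, ha, hg⟩ := c.exists_hadamard r x
    have e := hres V ⟨V', h.trans V.2⟩ h (ofScalar r)
    have e1 : ∀ s : ℝ, E ⟨V', h.trans V.2⟩ (s • 1) = 0 := fun s => by
      rw [map_smul, hone]; exact smul_zero (A := SuperFun m (bodyImage c.body V')) s
    rw [hg, map_add, e1, zero_add, map_sum] at e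
    have e' : ∀ i, E ⟨V', h.trans V.2⟩ ((SuperFun.coord (.inl i) - (x.1 i) • 1) * ofScalar (g i)) =
        (SuperFun.coord (.inl i) - (x.1 i) • 1) * E ⟨V', h.trans V.2⟩ (ofScalar (g i)) := by
      intro i
      rw [hmul _ 0 _ _ ((SuperFun.isParity_coord (.inl i)).sub (isParity_one.smul _)), map_sub,
        hcoord, e1, sub_zero, zero_mul, zero_add, ksign_zero_right, one_smul]
    simp only [e'] at e
    have e2 := congrArg (fun f => (f.coeff L).1 ⟨x.1, ha⟩) e
    refine e2.trans ?_
    change Smooth.eval ⟨x.1, ha⟩ ((∑ i, _ : SuperFun m _).coeff L) = 0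
    rw [coeff_sum, map_sum]
    refine Finset.sum_eq_zero fun i _ => ?_
    rw [← SuperFun.algebraMap_eq_ofScalar]
    change Smooth.eval _ (((ofScalar _ - ofScalar _) * _ : SuperFun m _).coeff L) = _
    rw [sub_mul, coeff_sub, SuperFun.ofScalar_mul, SuperFun.ofScalar_mul, ← sub_mul, map_mul]
    have : Smooth.eval (W := bodyImage c.body V') ⟨x.1, ha⟩
        (Smooth.mk' (fun y => y i) (by fun_prop) - algebraMap ℝ _ (x.1 i)) = 0 := by
      rw [map_sub]
      exact sub_self _
    rw [this, zero_mul]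
  -- The monomials are products of odd coordinates.
  have hmono : ∀ V K, E V (mono K 1) = 0 := by
    intro V K
    induction K using Finset.induction_on_max with
    | empty => exact hone V
    | insert k K hk ih =>
      have hkK : k ∉ K := fun h => lt_irrefl _ (hk k h)
      have hs : shuffleSign K {k} = 1 := by
        simp only [shuffleSign, Finset.prod_singleton]
        exact Finset.prod_eq_one fun a ha => if_neg (hk a ha).not_gt
      have : (mono (insert k K) 1 : SuperFun m (bodyImage c.body V.1)) =
          mono K 1 * SuperFun.coord (N := n) (.inr k) := by
        change _ = mono K 1 * mono {k} 1
        rw [mono_mul_mono, if_pos (by simpa using hkK), hs, Finset.union_comm, ← Finset.insert_eq]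
        simp
      rw [this, hmul V _ _ _ (isParity_mono K 1), ih, hcoord, zero_mul, mul_zero, smul_zero, add_zero]
  funext V
  refine LinearMap.ext fun a => ?_
  apply (c.iso V.1 (V.2.trans hU)).injective
  have : E V (c.iso V.1 (V.2.trans hU) a) = 0 := by
    rw [← sum_mono (c.iso V.1 (V.2.trans hU) a), map_sum]
    refine Finset.sum_eq_zero fun K _ => ?_
    rw [SuperFun.mono_eq_mul, hmul V 0 _ _ (isParity_ofScalar _), hscalar, hmono]
    simp
  rw [hE, AlgEquiv.symm_apply_apply] at this
  rw [this]
  simp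

/-- The component of index `k` of a supervector field on an open subset of the domain of `c`. -/
def compOn (X : A.vectorFields U) (k : Idx n m) : SuperFun m (bodyImage c.body U) :=
  c.iso U hU (act X ((c.iso U hU).symm (SuperFun.coord k)))

theorem compOn_add (X Y : A.vectorFields U) (k : Idx n m) :
    c.compOn hU (X + Y) k = c.compOn hU X k + c.compOn hU Y k := map_add (c.iso U hU) _ _

theorem compOn_zero (k : Idx n m) : c.compOn hU 0 k = 0 := map_zero (c.iso U hU)

theorem compOn_sub (X Y : A.vectorFields U) (k : Idx n m) :
    c.compOn hU (X - Y) k = c.compOn hU X k - c.compOn hU Y k := map_sub (c.iso U hU) _ _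

theorem compOn_zsmul (r : ℤ) (X : A.vectorFields U) (k : Idx n m) :
    c.compOn hU (r • X) k = r • c.compOn hU X k :=
  map_zsmul (⟨⟨fun X => c.compOn hU X k, c.compOn_zero hU k⟩,
    fun X Y => c.compOn_add hU X Y k⟩ : A.vectorFields U →+ SuperFun m (bodyImage c.body U)) r X

theorem compOn_sum {ι : Type*} (s : Finset ι) (X : ι → A.vectorFields U) (k : Idx n m) :
    c.compOn hU (∑ i ∈ s, X i) k = ∑ i ∈ s, c.compOn hU (X i) k :=
  map_sum (⟨⟨fun X => c.compOn hU X k, c.compOn_zero hU k⟩,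
    fun X Y => c.compOn_add hU X Y k⟩ : A.vectorFields U →+ SuperFun m (bodyImage c.body U)) X s

theorem act_fsmul (f : A.sec U) (X : A.vectorFields U) (a : A.sec U) :
    act (fsmul f X) a = f * act X a := by
  change A.res le_rfl f * _ = _
  congr 1
  change (A.sheaf.presheaf.map (homOfLE le_rfl).op).hom f = f
  rw [show (homOfLE (le_refl U)).op = 𝟙 (op U) from rfl, A.sheaf.presheaf.map_id]
  rfl

theorem compOn_fsmul (f : A.sec U) (X : A.vectorFields U) (k : Idx n m) :
    c.compOn hU (fsmul f X) k = c.iso U hU f * c.compOn hU X k := by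
  rw [compOn, act_fsmul, map_mul]; rfl

theorem compOn_restrict {V : Opens M₀} (h : V ≤ U) (X : A.vectorFields U) (k : Idx n m) :
    c.compOn (h.trans hU) (restrict h X) k =
      SuperFun.res (bodyImage_mono c.body h) (c.compOn hU X k) := by
  have key : ∀ a, A.res h (act X a) = act (restrict h X) (A.res h a) := by
    refine Submodule.iSup_induction (A.derivations U)
      (motive := fun Y => ∀ a, A.res h (Y ⟨U, le_rfl⟩ a) = Y ⟨V, h⟩ (A.res h a)) X.2 ?_ ?_ ?_
    · intro p Y hY a
      exact hY.1 ⟨U, le_rfl⟩ ⟨V, h⟩ h a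
    · intro a; exact map_zero _
    · intro Y Y' hY hY' a
      refine (map_add _ _ _).trans ?_
      rw [hY, hY']; rfl
  rw [compOn, compOn, ← c.iso_res U V hU h, key, c.res_symm hU h, SuperFun.res_coord]

theorem isParity_compOn {p : ZMod 2} {X : A.vectorFields U} (hX : X.1 ∈ A.derivations U p)
    (k : Idx n m) : (c.compOn hU X k).IsParity (p + k.parity) := by
  rw [compOn, ← c.iso_parity]
  refine hX.2.1 ⟨U, le_rfl⟩ _ _ ?_
  rw [c.iso_parity U hU, AlgEquiv.apply_symm_apply]
  exact SuperFun.isParity_coord k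

/-- A supervector field is determined by its components. -/
theorem vectorField_ext {X Y : A.vectorFields U}
    (h : ∀ k, c.compOn hU X k = c.compOn hU Y k) : X = Y := by
  suffices ∀ X : A.vectorFields U, (∀ k, c.compOn hU X k = 0) → X = 0 by
    refine sub_eq_zero.1 (this _ fun k => ?_)
    rw [compOn_sub, h, sub_self]
  rintro ⟨X, hX⟩ h0
  have hsup : A.vectorFields U = A.derivations U 0 ⊔ A.derivations U 1 := by
    refine le_antisymm (iSup_le fun p => ?_) (sup_le (le_iSup _ _) (le_iSup _ _))
    have : p = 0 ∨ p = 1 := by revert p; decide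
    rcases this with rfl | rfl
    exacts [le_sup_left, le_sup_right]
  -- The components of the even and of the odd part have different parities, so both vanish.
  rw [hsup] at hX
  obtain ⟨X₀, hX₀, X₁, hX₁, rfl⟩ := Submodule.mem_sup.1 hX
  have hk : ∀ k, c.compOn hU (A.ofHomog ⟨X₀, hX₀⟩) k = 0 ∧
      c.compOn hU (A.ofHomog ⟨X₁, hX₁⟩) k = 0 := by
    intro k
    have e : c.compOn hU (A.ofHomog ⟨X₀, hX₀⟩) k + c.compOn hU (A.ofHomog ⟨X₁, hX₁⟩) k = 0 := by
      rw [← compOn_add]; exact h0 k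
    have p0 := c.isParity_compOn hU (X := A.ofHomog (p := 0) ⟨X₀, hX₀⟩) hX₀ k
    have p1 := c.isParity_compOn hU (X := A.ofHomog (p := 1) ⟨X₁, hX₁⟩) hX₁ k
    have z : c.compOn hU (A.ofHomog ⟨X₀, hX₀⟩) k = 0 := by
      ext1
      funext K
      by_cases hK : (K.card : ZMod 2) = 0 + k.parity
      · rw [eq_neg_of_add_eq_zero_left e, coeff_neg, p1 K, neg_zero]; rfl
        rw [hK]; generalize k.parity = q; revert q; decide
      · exact p0 K hK
    rw [z, zero_add] at e
    exact ⟨z, e⟩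
  have z0 : X₀ = 0 := c.derivation_eq_zero hU hX₀ fun k => by
    have := (hk k).1
    exact (c.iso U hU).injective (this.trans (map_zero _).symm)
  have z1 : X₁ = 0 := c.derivation_eq_zero hU hX₁ fun k => by
    have := (hk k).2
    exact (c.iso U hU).injective (this.trans (map_zero _).symm)
  subst z0; subst z1
  exact Subtype.ext (add_zero 0)

/-- The coordinate supervector fields on an open subset of the domain of the chart. -/
def coordOn (hU : U ≤ c.dom) (i : Idx n m) : A.derivations U i.parity :=
  ⟨restrictFamily hU (c.coordField i).1,
    fun V V' h' a => (c.coordField i).2.1 ⟨V.1, V.2.trans hU⟩ ⟨V'.1, V'.2.trans hU⟩ h' a,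
    fun V q a ha => (c.coordField i).2.2.1 ⟨V.1, V.2.trans hU⟩ q a ha,
    fun V q a b ha => (c.coordField i).2.2.2 ⟨V.1, V.2.trans hU⟩ q a b ha⟩

theorem iso_act_coordOn (i : Idx n m) (a : A.sec U) :
    c.iso U hU (act (A.ofHomog (c.coordOn hU i)) a) = SuperFun.pd i (c.iso U hU a) := by
  change c.iso U hU ((c.iso U hU).symm (SuperFun.pd i (c.iso U hU a))) = _
  rw [AlgEquiv.apply_symm_apply]

theorem compOn_coordOn (i k : Idx n m) :
    c.compOn hU (A.ofHomog (c.coordOn hU i)) k = if i = k then 1 else 0 := by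
  rw [compOn, iso_act_coordOn, AlgEquiv.apply_symm_apply, SuperFun.pd_coord]

/-- The expansion of a supervector field in the coordinate frame. -/
theorem vectorField_eq_sum (X : A.vectorFields U) :
    X = ∑ k, fsmul ((c.iso U hU).symm (c.compOn hU X k)) (A.ofHomog (c.coordOn hU k)) := by
  refine c.vectorField_ext hU fun k => ?_
  rw [compOn_sum]
  simp [compOn_fsmul, compOn_coordOn]

theorem iso_act (X : A.vectorFields U) (a : A.sec U) :
    c.iso U hU (act X a) = ∑ k, c.compOn hU X k * SuperFun.pd k (c.iso U hU a) := by
  have act_sum : ∀ (s : Finset (Idx n m)) (Y : Idx n m → A.vectorFields U),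
      act (∑ k ∈ s, Y k) a = ∑ k ∈ s, act (Y k) a := fun s Y =>
    map_sum (⟨⟨fun X => act X a, rfl⟩, fun _ _ => rfl⟩ : A.vectorFields U →+ A.sec U) Y s
  conv_lhs => rw [c.vectorField_eq_sum hU X]
  rw [act_sum, map_sum]
  refine Finset.sum_congr rfl fun k _ => ?_
  rw [act_fsmul, map_mul, AlgEquiv.apply_symm_apply, iso_act_coordOn]

end SuperChart

/-! ### Superconnections in graded coordinates -/

open Grassmann SuperalgebraSheaf

namespace Christoffel

variable {N m : ℕ} {W : Opens (Eu N)}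

/-- The parity and symmetry properties of the Christoffel symbols of a torsion-free
superconnection. -/
structure IsSymmetric (Γ : Christoffel m W) : Prop where
  parity : ∀ i j k, (Γ i j k).IsParity (i.parity + j.parity + k.parity)
  symm : ∀ i j k, Γ i j k = ksign i.parity j.parity • Γ j i k

/-- The component `R(∂_q, ∂_j) ∂_i ^ k` of the curvature. -/
def curv (Γ : Christoffel m W) (q j i k : Idx N m) : SuperFun m W :=
  (SuperFun.pd q (Γ j i k) + ∑ l : Idx N m, invol q.parity (Γ j i l) * Γ q l k) -
    ksign q.parity j.parity •
      (SuperFun.pd j (Γ q i k) + ∑ l : Idx N m, invol j.parity (Γ q i l) * Γ j l k)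

/-- The components of the super-Ricci tensor. -/
def ricci (Γ : Christoffel m W) (i j : Idx N m) : SuperFun m W :=
  ∑ q : Idx N m, ksign q.parity (q.parity + j.parity + i.parity) • Γ.curv q j i q

/-- The components `r(∂_i, ∂_j)` of the supersymmetrized Ricci tensor. -/
def rTensor (Γ : Christoffel m W) (i j : Idx N m) : SuperFun m W :=
  (1 / (2 * ((N : ℝ) - m - 1))) • (Γ.ricci j i + ksign i.parity j.parity • Γ.ricci i j)

/-- The interior product `i(r)`. -/
def contrR (Γ : Christoffel m W) (S : Symb N m (Smooth W)) : Symb N m (Smooth W) :=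
  (1 / 2 : ℝ) • ∑ a : Idx N m, ∑ b : Idx N m,
    Symb.ofBase (Γ.rTensor b a) * Symb.contr a (Symb.contr b S)

end Christoffel

/-- The data of a change of graded coordinates from `x̄` on `W'` to `x` on `V`, compatible with
Christoffel symbols `Γ'` and `Γ`: the rewriting `pull` of superfunctions, the matrix
`J i a = ∂x̄^a/∂x^i` and its inverse `K`. -/
structure ChartChange {n m : ℕ} {W' V : Opens (Eu n)} (Γ' : Christoffel m W')
    (Γ : Christoffel m V) where
  pull : SuperFun m W' →+* SuperFun m V
  pull_parity : PreservesParity pull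
  pull_smul : ∀ (r : ℝ) f, pull (r • f) = r • pull f
  J : Idx n m → Idx n m → SuperFun m V
  K : Idx n m → Idx n m → SuperFun m V
  J_parity : ∀ i a, (J i a).IsParity (i.parity + a.parity)
  K_parity : ∀ a i, (K a i).IsParity (a.parity + i.parity)
  J_mul_K : ∀ i k, ∑ a, J i a * K a k = if i = k then 1 else 0
  K_mul_J : ∀ a b, ∑ i, K a i * J i b = if a = b then 1 else 0
  pd_pull : ∀ i f, SuperFun.pd i (pull f) = ∑ a, J i a * pull (SuperFun.pd a f)
  transform : ∀ i b k, SuperFun.pd i (K b k) + ∑ l, invol i.parity (K b l) * Γ i l k =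
    ∑ a, ∑ d, J i a * pull (Γ' a b d) * K d k

namespace SuperChart

variable {n m : ℕ} {M₀ : TopCat.{u}} [ChartedSpace (Eu n) M₀] {A : SuperalgebraSheaf M₀}
  (c : SuperChart n m A) {U : Opens M₀} (hU : U ≤ c.dom) (D : Superconnection A)

theorem fsmul_add (f g : A.sec U) (X : A.vectorFields U) :
    fsmul (f + g) X = fsmul f X + fsmul g X :=
  Subtype.ext (by
    change mulFamily (f + g) X.1 = mulFamily f X.1 + mulFamily g X.1
    rw [map_add]; rfl)

/-- Restricted to an open subset of the chart, the Christoffel symbols of a superconnection are the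
restrictions of its Christoffel symbols. -/
theorem compOn_nabla_coordOn (i l k : Idx n m) :
    c.compOn hU (D.nabla U (A.ofHomog (c.coordOn hU i)) (A.ofHomog (c.coordOn hU l))) k =
      SuperFun.res (bodyImage_mono c.body hU) (D.christoffel c i l k) := by
  have h := D.nabla_restrict hU (A.ofHomog (c.coordField i)) (A.ofHomog (c.coordField l))
  have h' : D.nabla U (A.ofHomog (c.coordOn hU i)) (A.ofHomog (c.coordOn hU l)) =
      restrict hU (D.nabla c.dom (A.ofHomog (c.coordField i)) (A.ofHomog (c.coordField l))) :=
    h.symm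
  rw [h']
  exact c.compOn_restrict le_rfl hU _ k

theorem compOn_nabla_fsmul (i l k : Idx n m) (F : SuperFun m (bodyImage c.body U)) :
    c.compOn hU (D.nabla U (A.ofHomog (c.coordOn hU i))
      (fsmul ((c.iso U hU).symm F) (A.ofHomog (c.coordOn hU l)))) k =
    SuperFun.pd i F * (if l = k then 1 else 0) + invol i.parity F *
      SuperFun.res (bodyImage_mono c.body hU) (D.christoffel c i l k) := by
  induction F using parity_induction with
  | hadd F G hF hG =>
    rw [map_add, fsmul_add, map_add, compOn_add, hF, hG, map_add, map_add, add_mul, add_mul]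
    abel
  | h q F hF =>
    rw [D.nabla_fsmul_right U i.parity q _ _ _ ((c.iso_parity U hU q _).2 (by
      rwa [AlgEquiv.apply_symm_apply])), compOn_add, compOn_zsmul, compOn_fsmul, compOn_fsmul,
      iso_act_coordOn, AlgEquiv.apply_symm_apply, compOn_coordOn, compOn_nabla_coordOn, hF.invol,
      smul_mul_assoc]

/-- The components of the covariant derivative of a supervector field. -/
theorem compOn_nabla (i k : Idx n m) (Y : A.vectorFields U) :
    c.compOn hU (D.nabla U (A.ofHomog (c.coordOn hU i)) Y) k =
    SuperFun.pd i (c.compOn hU Y k) + ∑ l, invol i.parity (c.compOn hU Y l) *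
      SuperFun.res (bodyImage_mono c.body hU) (D.christoffel c i l k) := by
  conv_lhs => rw [c.vectorField_eq_sum hU Y]
  rw [map_sum, compOn_sum]
  simp only [compOn_nabla_fsmul, Finset.sum_add_distrib]
  simp

theorem isParity_christoffel (i j k : Idx n m) :
    (D.christoffel c i j k).IsParity (i.parity + j.parity + k.parity) :=
  c.isParity_compOn le_rfl (D.nabla_parity c.dom _ _ _ _) k

theorem bracket_coordField (i j : Idx n m) :
    A.ofHomog (bracket (c.coordField i) (c.coordField j)) = 0 := by
  refine c.vectorField_ext le_rfl fun k => ?_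
  rw [compOn_zero]
  have h1 : ∀ i j : Idx n m, c.iso c.dom le_rfl (act (A.ofHomog (c.coordOn le_rfl i))
      (act (A.ofHomog (c.coordOn le_rfl j)) ((c.iso c.dom le_rfl).symm (SuperFun.coord k)))) = 0 := by
    intro i j
    rw [iso_act_coordOn, iso_act_coordOn, AlgEquiv.apply_symm_apply, SuperFun.pd_coord]
    split_ifs
    · exact SuperFun.pd_one i
    · exact map_zero _
  change c.iso c.dom le_rfl (_ - _) = 0
  rw [map_sub]
  refine (congrArg₂ _ (h1 i j) ?_).trans (sub_zero _)
  refine (map_zsmul (c.iso c.dom le_rfl) _ _).trans ?_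
  exact (congrArg _ (h1 j i)).trans (zsmul_zero _)

theorem isSymmetric_christoffel (hD : D.IsTorsionFree) : (D.christoffel c).IsSymmetric where
  parity := c.isParity_christoffel D
  symm i j k := by
    have h := hD c.dom _ _ (c.coordField i) (c.coordField j)
    have h2 := congrArg (fun X => c.compOn le_rfl X k) h
    simp only [Superconnection.torsion, bracket_coordField, compOn_sub, compOn_zsmul,
      compOn_zero, sub_zero, sub_eq_zero] at h2
    exact h2

theorem ricci_eq (i j : Idx n m) : D.ricci c i j = (D.christoffel c).ricci i j := by
  refine Finset.sum_congr rfl fun q _ => ?_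
  congr 1
  have e : ∀ (i k : Idx n m) (Y : A.vectorFields c.dom),
      c.compOn le_rfl (D.nabla c.dom (A.ofHomog (c.coordField i)) Y) k =
      SuperFun.pd i (c.compOn le_rfl Y k) + ∑ l, invol i.parity (c.compOn le_rfl Y l) *
        D.christoffel c i l k := fun i k Y => c.compOn_nabla le_rfl D i k Y
  change c.compOn le_rfl _ q = _
  rw [Superconnection.curvature, bracket_coordField, map_zero, LinearMap.zero_apply, compOn_sub,
    compOn_sub, compOn_zero, sub_zero, compOn_zsmul,
    e q q (D.nabla c.dom (A.ofHomog (c.coordField j)) (A.ofHomog (c.coordField i))),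
    e j q (D.nabla c.dom (A.ofHomog (c.coordField q)) (A.ofHomog (c.coordField i)))]
  rfl

theorem contrR_eq (S : Symb n m (Smooth c.range)) :
    D.contrR c S = (D.christoffel c).contrR S := by
  unfold Superconnection.contrR Christoffel.contrR Superconnection.rTensor Christoffel.rTensor
  simp only [ricci_eq]

variable (c' : SuperChart n m A)

/-- The Christoffel symbols of the chart `c` on the overlap with `c'`. -/
def overlapChristoffel : Christoffel m (c.overlap c') := fun i j k =>
  SuperFun.res (c.overlap_le c') (D.christoffel c i j k)

/-- `SuperChart.pull` as a ring homomorphism. -/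
def pullHom : SuperFun m c'.range →+* SuperFun m (c.overlap c') :=
  (((c.iso (c.dom ⊓ c'.dom) inf_le_left).toRingEquiv.toRingHom.comp
    (A.res (inf_le_right : c.dom ⊓ c'.dom ≤ c'.dom)).toRingHom).comp
      (c'.iso c'.dom le_rfl).symm.toRingEquiv.toRingHom)

theorem pullHom_apply (f : SuperFun m c'.range) : c.pullHom c' f = c.pull c' f := rfl

theorem pullHom_smul (r : ℝ) (f : SuperFun m c'.range) :
    c.pullHom c' (r • f) = r • c.pullHom c' f := by
  rw [pullHom_apply, pullHom_apply, pull, pull, map_smul, map_smul, map_smul]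

theorem preservesParity_pullHom : PreservesParity (c.pullHom c') := by
  intro p f hf
  have h1 : (c'.iso c'.dom le_rfl).symm f ∈ A.parity c'.dom p := by
    rw [c'.iso_parity c'.dom le_rfl, AlgEquiv.apply_symm_apply]; exact hf
  exact (c.iso_parity _ _ p _).1 (A.res_parity _ h1)

/-- The coordinate supervector field `∂̄_a` of `c'` on the overlap, and its components in `c`. -/
def overlapK (a i : Idx n m) : SuperFun m (c.overlap c') :=
  c.compOn inf_le_left
    (A.ofHomog (c'.coordOn (inf_le_right : c.dom ⊓ c'.dom ≤ c'.dom) a)) i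

/-- The entries `∂x̄^a/∂x^i` of the Jacobian matrix. -/
def overlapJ (i a : Idx n m) : SuperFun m (c.overlap c') :=
  SuperFun.pd i (c.pull c' (SuperFun.coord a))

/-- The vector field `∂̄_a` in the coordinates of `c`. -/
theorem pull_pd (a : Idx n m) (f : SuperFun m c'.range) :
    c.pull c' (SuperFun.pd a f) =
      ∑ i, c.overlapK c' a i * SuperFun.pd i (c.pull c' f) := by
  have h : A.res (inf_le_right : c.dom ⊓ c'.dom ≤ c'.dom)
      ((c'.iso c'.dom le_rfl).symm (SuperFun.pd a f)) =
      act (A.ofHomog (c'.coordOn (inf_le_right : c.dom ⊓ c'.dom ≤ c'.dom) a))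
        (A.res inf_le_right ((c'.iso c'.dom le_rfl).symm f)) := by
    apply (c'.iso (c.dom ⊓ c'.dom) inf_le_right).injective
    rw [iso_act_coordOn, c'.iso_res c'.dom _ le_rfl inf_le_right, c'.iso_res c'.dom _ le_rfl inf_le_right, AlgEquiv.apply_symm_apply,
      AlgEquiv.apply_symm_apply, SuperFun.pd_res]
  unfold pull
  rw [h, c.iso_act inf_le_left]
  rfl

theorem coordOn_eq_sum (i : Idx n m) :
    A.ofHomog (c.coordOn (inf_le_left : c.dom ⊓ c'.dom ≤ c.dom) i) =
      ∑ a, fsmul ((c.iso (c.dom ⊓ c'.dom) inf_le_left).symm (c.overlapJ c' i a))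
        (A.ofHomog (c'.coordOn (inf_le_right : c.dom ⊓ c'.dom ≤ c'.dom) a)) := by
  conv_lhs => rw [c'.vectorField_eq_sum inf_le_right
    (A.ofHomog (c.coordOn (inf_le_left : c.dom ⊓ c'.dom ≤ c.dom) i))]
  refine Finset.sum_congr rfl fun a _ => ?_
  congr 1
  rw [compOn, AlgEquiv.symm_apply_apply]
  apply (c.iso (c.dom ⊓ c'.dom) inf_le_left).injective
  rw [iso_act_coordOn, AlgEquiv.apply_symm_apply, overlapJ, pull, c'.res_symm le_rfl,
    SuperFun.res_coord]

theorem overlapJ_mul_overlapK (i k : Idx n m) :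
    ∑ a, c.overlapJ c' i a * c.overlapK c' a k = if i = k then 1 else 0 := by
  rw [← c.compOn_coordOn (inf_le_left : c.dom ⊓ c'.dom ≤ c.dom), coordOn_eq_sum c c', compOn_sum]
  refine Finset.sum_congr rfl fun a _ => ?_
  rw [compOn_fsmul, AlgEquiv.apply_symm_apply]
  rfl

/-- The chain rule, applied to the coordinates of `c'` themselves. -/
theorem overlapK_mul_overlapJ (a b : Idx n m) :
    ∑ i, c.overlapK c' a i * c.overlapJ c' i b = if a = b then 1 else 0 := by
  have h := c.pull_pd c' a (SuperFun.coord b)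
  rw [SuperFun.pd_coord] at h
  refine h.symm.trans ?_
  split_ifs
  · exact map_one (c.pullHom c')
  · exact map_zero (c.pullHom c')

theorem pd_pull (i : Idx n m) (f : SuperFun m c'.range) :
    SuperFun.pd i (c.pull c' f) = ∑ a, c.overlapJ c' i a * c.pull c' (SuperFun.pd a f) := by
  simp only [pull_pd, Finset.mul_sum, ← mul_assoc]
  rw [Finset.sum_comm]
  simp only [← Finset.sum_mul, overlapJ_mul_overlapK]
  simp

theorem fsmul_restrict {V : Opens M₀} (h : V ≤ U) (f : A.sec U) (X : A.vectorFields U) :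
    restrict h (fsmul f X) = fsmul (A.res h f) (restrict h X) := by
  refine Subtype.ext (funext fun V' => LinearMap.ext fun a => ?_)
  change A.res _ f * _ = A.res _ (A.res h f) * _
  rw [A.res_res]
  rfl

/-- The transformation law of the Christoffel symbols: the components in the coordinates of `c` of
`∇_{∂_i} ∂̄_b`, computed in two ways. -/
theorem transform_christoffel (i b k : Idx n m) :
    SuperFun.pd i (c.overlapK c' b k) + ∑ l, invol i.parity (c.overlapK c' b l) *
      c.overlapChristoffel D c' i l k =
    ∑ a, ∑ d, c.overlapJ c' i a * c.pull c' (D.christoffel c' a b d) * c.overlapK c' d k := by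
  have h := c.compOn_nabla (inf_le_left : c.dom ⊓ c'.dom ≤ c.dom) D i k
    (A.ofHomog (c'.coordOn (inf_le_right : c.dom ⊓ c'.dom ≤ c'.dom) b))
  refine h.symm.trans ?_
  rw [coordOn_eq_sum c c', map_sum, LinearMap.sum_apply, compOn_sum]
  refine Finset.sum_congr rfl fun a _ => ?_
  rw [D.nabla_fsmul_left, compOn_fsmul, AlgEquiv.apply_symm_apply]
  have h2 := D.nabla_restrict (inf_le_right : c.dom ⊓ c'.dom ≤ c'.dom)
    (A.ofHomog (c'.coordField a)) (A.ofHomog (c'.coordField b))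
  have h3 : D.nabla (c.dom ⊓ c'.dom) (A.ofHomog (c'.coordOn inf_le_right a))
      (A.ofHomog (c'.coordOn inf_le_right b)) = restrict inf_le_right
        (D.nabla c'.dom (A.ofHomog (c'.coordField a)) (A.ofHomog (c'.coordField b))) := h2.symm
  have res_sum : ∀ (s : Finset (Idx n m)) (Y : Idx n m → A.vectorFields c'.dom),
      restrict (inf_le_right : c.dom ⊓ c'.dom ≤ c'.dom) (∑ k ∈ s, Y k) =
        ∑ k ∈ s, restrict inf_le_right (Y k) := fun s Y =>
    map_sum (⟨⟨fun X => restrict inf_le_right X, rfl⟩, fun _ _ => rfl⟩ :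
      A.vectorFields c'.dom →+ A.vectorFields (c.dom ⊓ c'.dom)) Y s
  rw [h3, c'.vectorField_eq_sum le_rfl (D.nabla c'.dom (A.ofHomog (c'.coordField a))
    (A.ofHomog (c'.coordField b))), res_sum, compOn_sum, Finset.mul_sum]
  refine Finset.sum_congr rfl fun d _ => ?_
  rw [fsmul_restrict, compOn_fsmul, mul_assoc]
  rfl

theorem isParity_overlapK (a i : Idx n m) :
    (c.overlapK c' a i).IsParity (a.parity + i.parity) :=
  c.isParity_compOn inf_le_left (c'.coordOn inf_le_right a).2 i

theorem isParity_overlapJ (i a : Idx n m) :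
    (c.overlapJ c' i a).IsParity (i.parity + a.parity) :=
  SuperFun.pd_parity i (c.preservesParity_pullHom c' _ _ (SuperFun.isParity_coord a))

/-- The change of graded coordinates between two charts. -/
def chartChange : ChartChange (D.christoffel c') (c.overlapChristoffel D c') where
  pull := c.pullHom c'
  pull_parity := c.preservesParity_pullHom c'
  pull_smul := c.pullHom_smul c'
  J := c.overlapJ c'
  K := c.overlapK c'
  J_parity := c.isParity_overlapJ c'
  K_parity := c.isParity_overlapK c'
  J_mul_K := c.overlapJ_mul_overlapK c'
  K_mul_J := c.overlapK_mul_overlapJ c'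
  pd_pull := c.pd_pull c'
  transform := c.transform_christoffel D c'

end SuperChart

/-! ### Determinants and Berezinians of even supermatrices -/

/-- The derivation rule for a finite product. -/
theorem leibniz_prod {E M ι : Type*} [CommRing E] [AddCommGroup M] [Module E M] [DecidableEq ι]
    (D : E →+ M) (hD : ∀ a b, D (a * b) = a • D b + b • D a) (s : Finset ι) (f : ι → E) :
    D (∏ i ∈ s, f i) = ∑ i ∈ s, (∏ j ∈ s.erase i, f j) • D (f i) := by
  induction s using Finset.induction_on with
  | empty =>
    have := hD 1 1
    simp only [mul_one, one_smul, left_eq_add] at this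
    simpa using this
  | insert a s ha ih =>
    rw [Finset.prod_insert ha, hD, ih, Finset.sum_insert ha, Finset.erase_insert ha, add_comm,
      Finset.smul_sum]
    congr 1
    refine Finset.sum_congr rfl fun i hi => ?_
    have hai : a ≠ i := fun h => ha (h ▸ hi)
    rw [Finset.erase_insert_of_ne hai, Finset.prod_insert (by simp [ha]), smul_smul]

/-- Jacobi's formula for the derivative of a determinant. -/
theorem leibniz_det {E M ι : Type*} [CommRing E] [AddCommGroup M] [Module E M] [DecidableEq ι]
    [Fintype ι] (D : E →+ M) (hD : ∀ a b, D (a * b) = a • D b + b • D a) (A : Matrix ι ι E) :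
    D A.det = ∑ i, ∑ j, A.adjugate j i • D (A i j) := by
  have key : ∀ (σ : Equiv.Perm ι) (j : ι),
      ∑ i, (∏ k, A.updateRow i (Pi.single j 1) (σ k) k) • D (A i j) =
        (∏ k ∈ Finset.univ.erase j, A (σ k) k) • D (A (σ j) j) := by
    intro σ j
    rw [Finset.sum_eq_single (σ j)]
    · rw [← Finset.mul_prod_erase _ _ (Finset.mem_univ j), Matrix.updateRow_self, Pi.single_eq_same,
        one_mul]
      congr 1
      refine Finset.prod_congr rfl fun k hk => ?_
      rw [Matrix.updateRow_ne fun h => Finset.ne_of_mem_erase hk (σ.injective h)]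
    · intro i _ hi
      rw [Finset.prod_eq_zero (Finset.mem_univ (σ.symm i)), zero_smul]
      rw [Equiv.apply_symm_apply, Matrix.updateRow_self, Pi.single_eq_of_ne]
      rintro rfl
      exact hi (by simp)
    · simp
  rw [Matrix.det_apply, map_sum]
  simp only [Matrix.adjugate_apply, Matrix.det_apply, Finset.sum_smul]
  rw [Finset.sum_comm, Finset.sum_congr rfl fun j _ => Finset.sum_comm, Finset.sum_comm]
  refine Finset.sum_congr rfl fun σ _ => ?_
  simp only [Units.smul_def, smul_assoc, map_zsmul, ← Finset.smul_sum, key]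
  rw [leibniz_prod D hD]

namespace Grassmann

variable {κ R : Type*} [LinearOrder κ] [CommRing R]

/-- The body, as a ring homomorphism. -/
def bodyHom : Grassmann κ R →+* R where
  toFun f := f.coeff ∅
  map_one' := by simp [coeff_one]
  map_mul' f g := by simp [coeff_mul]
  map_zero' := rfl
  map_add' _ _ := rfl

theorem bodyHom_apply (f : Grassmann κ R) : bodyHom f = f.coeff ∅ := rfl

theorem IsParity.bodyHom_eq_zero {f : Grassmann κ R} (hf : f.IsParity 1) : bodyHom f = 0 :=
  hf ∅ (by simp)

/-- The subring of even elements. -/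
def evenSubring (κ R : Type*) [LinearOrder κ] [CommRing R] : Subring (Grassmann κ R) where
  carrier := {f | f.IsParity 0}
  mul_mem' hf hg := by simpa using hf.mul hg
  one_mem' := isParity_one
  add_mem' := IsParity.add
  zero_mem' := isParity_zero 0
  neg_mem' := IsParity.neg

theorem IsParity.comm_even [Fintype κ] {f : Grassmann κ R} (hf : f.IsParity 0)
    (g : Grassmann κ R) : g * f = f * g := by
  induction g using parity_induction with
  | hadd g h hg hh => rw [add_mul, mul_add, hg, hh]
  | h p g hg => rw [hg.comm hf, ksign_zero_right, one_smul]

instance [Fintype κ] : CommRing (evenSubring κ R) :=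
  { (inferInstance : Ring (evenSubring κ R)) with
    mul_comm := fun f g => Subtype.ext (g.2.comm_even f.1) }

/-- An element without body is nilpotent. -/
theorem pow_eq_zero_of_body [Fintype κ] {f : Grassmann κ R} (hf : f.coeff ∅ = 0) :
    f ^ (Fintype.card κ + 1) = 0 := by
  have key : ∀ (k : ℕ) (K : Finset κ), K.card < k → (f ^ k).coeff K = 0 := by
    intro k
    induction k with
    | zero => intro K hK; omega
    | succ k ih =>
      intro K hK
      rw [pow_succ, coeff_mul]
      refine Finset.sum_eq_zero fun J hJ => ?_
      rw [Finset.mem_powerset] at hJ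
      by_cases h : K \ J = ∅
      · rw [h, hf, mul_zero, mul_zero]
      · have h1 : J.card < k := by
          have h2 := Finset.card_sdiff_add_card_eq_card hJ
          have h3 := Finset.card_pos.2 (Finset.nonempty_iff_ne_empty.2 h)
          omega
        rw [ih J h1, zero_mul, mul_zero]
  ext K
  exact key _ K (Nat.lt_succ_of_le (Finset.card_le_univ K))

theorem ofScalar_mul_ofScalar (r s : R) :
    (ofScalar r * ofScalar s : Grassmann κ R) = ofScalar (r * s) := by
  rw [ofScalar_eq_mono, ofScalar_eq_mono, mono_mul_mono]
  simp [ofScalar_eq_mono]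

/-- An even element is invertible if and only if its body is. -/
theorem evenSubring.isUnit_iff [Fintype κ] {f : evenSubring κ R} :
    IsUnit f ↔ IsUnit (bodyHom f.1) := by
  refine ⟨fun h => h.map (bodyHom.comp (evenSubring κ R).subtype), fun h => ?_⟩
  obtain ⟨u, hu⟩ := h
  let s : evenSubring κ R := ⟨ofScalar (u : R), isParity_ofScalar _⟩
  have hs : IsUnit s := by
    refine IsUnit.of_mul_eq_one ⟨ofScalar ((u⁻¹ : Rˣ) : R), isParity_ofScalar _⟩ (Subtype.ext ?_)
    change ofScalar (u : R) * ofScalar ((u⁻¹ : Rˣ) : R) = (1 : Grassmann κ R)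
    rw [ofScalar_mul_ofScalar, Units.mul_inv]; rfl
  have hn : IsNilpotent (f - s) := by
    refine ⟨Fintype.card κ + 1, Subtype.ext ?_⟩
    refine pow_eq_zero_of_body (f := f.1 - ofScalar (u : R)) ?_
    rw [coeff_sub, ← bodyHom_apply f.1, ← hu]
    simp [ofScalar]
  have := hn.isUnit_add_left_of_commute hs (Commute.all _ _)
  simpa using this

section Matrices

variable {ι ι' ι'' : Type*} [Fintype ι] [Fintype ι'] [Fintype ι'']

theorem isParity_matrix_mul {p q : ZMod 2} {A : Matrix ι ι' (Grassmann κ R)}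
    {B : Matrix ι' ι'' (Grassmann κ R)} (hA : ∀ i j, (A i j).IsParity p)
    (hB : ∀ i j, (B i j).IsParity q) (i j) : ((A * B) i j).IsParity (p + q) := by
  rw [Matrix.mul_apply]
  exact isParity_sum _ fun k _ => (hA i k).mul (hB k j)

theorem trace_mul_comm_of_isParity [Fintype κ] {p q : ZMod 2} {A : Matrix ι ι' (Grassmann κ R)}
    {B : Matrix ι' ι (Grassmann κ R)} (hA : ∀ i j, (A i j).IsParity p)
    (hB : ∀ i j, (B i j).IsParity q) : (A * B).trace = ksign p q • (B * A).trace := by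
  simp only [Matrix.trace, Matrix.diag, Matrix.mul_apply, Finset.smul_sum]
  rw [Finset.sum_comm]
  exact Finset.sum_congr rfl fun j _ => Finset.sum_congr rfl fun i _ => (hA i j).comm (hB j i)

theorem IsSuperDer.map_matrix_mul {q : ZMod 2} {D : Grassmann κ R →+ Grassmann κ R}
    (hD : IsSuperDer (RingHom.id _) q D) {p : ZMod 2} {A : Matrix ι ι' (Grassmann κ R)}
    (hA : ∀ i j, (A i j).IsParity p) (B : Matrix ι' ι'' (Grassmann κ R)) :
    (A * B).map D = A.map D * B + ksign q p • (A * B.map D) := by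
  ext1 i j
  simp only [Matrix.map_apply, Matrix.add_apply, Matrix.smul_apply, Matrix.mul_apply, map_sum,
    Finset.smul_sum, ← Finset.sum_add_distrib]
  exact Finset.sum_congr rfl fun k _ => hD.leibniz_of_isParity (hA i k) _

/-- A matrix with even entries, as a matrix over the commutative ring of even elements. -/
def toEven (A : Matrix ι ι' (Grassmann κ R)) (hA : ∀ i j, (A i j).IsParity 0) :
    Matrix ι ι' (evenSubring κ R) := fun i j => ⟨A i j, hA i j⟩

theorem toEven_mul_eq_one [Fintype κ] [DecidableEq ι] {A B : Matrix ι ι (Grassmann κ R)}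
    (hA : ∀ i j, (A i j).IsParity 0) (hB : ∀ i j, (B i j).IsParity 0) (h : A * B = 1) :
    toEven A hA * toEven B hB = 1 := by
  ext1 i j
  apply Subtype.ext
  have h' := congrFun (congrFun h i) j
  rw [Matrix.mul_apply] at h' ⊢
  rw [AddSubmonoidClass.coe_finsetSum]
  refine h'.trans ?_
  rw [Matrix.one_apply, Matrix.one_apply]
  split_ifs <;> rfl

/-- The logarithmic derivative of the determinant of an even matrix `A` with inverse `B`. -/
theorem IsSuperDer.det [Fintype κ] [DecidableEq ι] {q : ZMod 2}
    {D : Grassmann κ R →+ Grassmann κ R} (hD : IsSuperDer (RingHom.id _) q D)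
    {A B : Matrix ι ι (Grassmann κ R)} (hA : ∀ i j, (A i j).IsParity 0)
    (hB : ∀ i j, (B i j).IsParity 0) (h : A * B = 1) :
    D ((toEven A hA).det : Grassmann κ R) = (toEven A hA).det * (A.map D * B).trace := by
  have h1 := leibniz_det (E := evenSubring κ R) (M := Grassmann κ R)
    (D.comp (evenSubring κ R).subtype.toAddMonoidHom) (fun a b => by
      refine (hD.leibniz a.1 b.1).trans ?_
      rw [a.2.invol, ksign_zero_right, one_smul, RingHom.id_apply, RingHom.id_apply,
        b.2.comm_even, add_comm]; rfl) (toEven A hA)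
  refine h1.trans ?_
  have hAB := toEven_mul_eq_one hA hB h
  have hu := Matrix.isUnit_det_of_right_inverse hAB
  have h2 : (toEven A hA).adjugate = (toEven A hA).det • toEven B hB := by
    rw [← Matrix.inv_eq_right_inv hAB, Matrix.inv_def, smul_smul, Ring.mul_inverse_cancel _ hu,
      one_smul]
  simp only [Matrix.trace, Matrix.diag, Matrix.mul_apply, Finset.mul_sum, h2]
  refine Finset.sum_congr rfl fun i _ => Finset.sum_congr rfl fun j _ => ?_
  change ((toEven A hA).det : Grassmann κ R) * B j i * D (A i j) = _
  rw [Matrix.map_apply, (hB j i).comm_even (D (A i j)), mul_assoc]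

end Matrices

/-- The determinant as an ordered sum of products, for a matrix with even entries. -/
theorem evenDet_eq [Fintype κ] {k : ℕ} {A : Matrix (Fin k) (Fin k) (Grassmann κ R)}
    (hA : ∀ i j, (A i j).IsParity 0) : evenDet A = ((toEven A hA).det : Grassmann κ R) := by
  rw [evenDet, Matrix.det_apply, AddSubmonoidClass.coe_finsetSum]
  refine Finset.sum_congr rfl fun σ _ => ?_
  rw [← List.prod_ofFn, Units.smul_def]
  change _ = (evenSubring κ R).subtype ((σ.sign : ℤ) • (List.ofFn fun i => toEven A hA (σ i) i).prod)
  rw [map_zsmul, map_list_prod, List.map_ofFn]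
  rfl

end Grassmann

namespace Grassmann

section BerezinianCalculus

variable {n m : ℕ} {B : Type*} [CommRing B]

/-- The diagonal block `T` of an invertible even supermatrix is invertible, with an even inverse. -/
theorem exists_inverse_of_odd_block {k l : ℕ} {T L : Matrix (Fin k) (Fin k) (Grassmann (Fin m) B)}
    {S : Matrix (Fin k) (Fin l) (Grassmann (Fin m) B)}
    {Q : Matrix (Fin l) (Fin k) (Grassmann (Fin m) B)} (hT : ∀ i j, (T i j).IsParity 0)
    (hS : ∀ i j, (S i j).IsParity 1) (h : S * Q + T * L = 1) :
    IsUnit (toEven T hT).det ∧ ∃ T' : Matrix (Fin k) (Fin k) (Grassmann (Fin m) B),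
      T * T' = 1 ∧ T' * T = 1 ∧ ∀ i j, (T' i j).IsParity 0 := by
  have hu : IsUnit (toEven T hT).det := by
    rw [evenSubring.isUnit_iff]
    -- Odd elements have no body: on bodies, `L` is a right inverse of `T`.
    have h1 := congrArg (fun M => M.map (bodyHom (κ := Fin m) (R := B))) h
    simp only [Matrix.map_add _ (map_add bodyHom), Matrix.map_mul] at h1
    have h2 : S.map (bodyHom (κ := Fin m) (R := B)) = 0 := by
      ext i j; exact (hS i j).bodyHom_eq_zero
    rw [h2, Matrix.zero_mul, zero_add, Matrix.map_one _ (map_zero _) (map_one _)] at h1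
    have h3 := Matrix.isUnit_det_of_right_inverse h1
    have h4 := RingHom.map_det ((bodyHom (κ := Fin m) (R := B)).comp (evenSubring _ B).subtype)
      (toEven T hT)
    exact h4 ▸ h3
  refine ⟨hu, fun i j => ((toEven T hT)⁻¹ i j : Grassmann (Fin m) B), ?_, ?_, fun i j =>
    ((toEven T hT)⁻¹ i j).2⟩
  · have h1 := congrArg (fun M => M.map (evenSubring (Fin m) B).subtype)
      (Matrix.mul_nonsing_inv _ hu)
    simp only [Matrix.map_mul] at h1
    rwa [Matrix.map_one _ (map_zero _) (map_one _)] at h1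
  · have h1 := congrArg (fun M => M.map (evenSubring (Fin m) B).subtype)
      (Matrix.nonsing_inv_mul _ hu)
    simp only [Matrix.map_mul] at h1
    rwa [Matrix.map_one _ (map_zero _) (map_one _)] at h1

theorem ringInverse_eq {R : Type*} [MonoidWithZero R] {a b : R} (h : a * b = 1) (h' : b * a = 1) :
    Ring.inverse a = b := Ring.inverse_unit ⟨a, b, h, h'⟩

/-- The Berezinian of an even invertible supermatrix `J` with inverse `K` is an even invertible
element, and its logarithmic derivative is a supertrace. -/
theorem berezinian_spec [Module ℝ B] {J K : Matrix (Idx n m) (Idx n m) (Grassmann (Fin m) B)}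
    (hJ : ∀ i j, (J i j).IsParity (i.parity + j.parity))
    (hK : ∀ i j, (K i j).IsParity (i.parity + j.parity)) (hJK : J * K = 1) (hKJ : K * J = 1) :
    IsUnit J.toBlocks₂₂ ∧ IsUnit (evenDet J.toBlocks₂₂) ∧
    ∃ b : evenSubring (Fin m) B, berezinian J = b ∧ IsUnit b ∧
    ∀ (q : ZMod 2) (D : Grassmann (Fin m) B →+ Grassmann (Fin m) B),
      IsSuperDer (RingHom.id _) q D →
        D b = b * ∑ i, ∑ j, psign i.parity • (D (J i j) * K j i) := by
  obtain ⟨P, Q, S, T, rfl⟩ : ∃ P Q S T, J = Matrix.fromBlocks P Q S T :=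
    ⟨_, _, _, _, J.fromBlocks_toBlocks.symm⟩
  obtain ⟨K₁, K₂, K₃, K₄, rfl⟩ : ∃ P Q S T, K = Matrix.fromBlocks P Q S T :=
    ⟨_, _, _, _, K.fromBlocks_toBlocks.symm⟩
  have hP : ∀ i j, (P i j).IsParity 0 := fun i j => hJ (.inl i) (.inl j)
  have hQ : ∀ i j, (Q i j).IsParity 1 := fun i j => hJ (.inl i) (.inr j)
  have hS : ∀ i j, (S i j).IsParity 1 := fun i j => hJ (.inr i) (.inl j)
  have hT : ∀ i j, (T i j).IsParity 0 := fun i j => hJ (.inr i) (.inr j)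
  have hK₁ : ∀ i j, (K₁ i j).IsParity 0 := fun i j => hK (.inl i) (.inl j)
  have hK₂ : ∀ i j, (K₂ i j).IsParity 1 := fun i j => hK (.inl i) (.inr j)
  rw [Matrix.fromBlocks_multiply, ← Matrix.fromBlocks_one, Matrix.fromBlocks_inj] at hJK hKJ
  obtain ⟨e1, e2, e3, e4⟩ := hJK
  obtain ⟨f1, f2, f3, f4⟩ := hKJ
  obtain ⟨hTu, Ti, hTi, hTi', hTi0⟩ := exists_inverse_of_odd_block hT hS e4
  -- The inverse of `J`, in terms of the inverse `K₁` of `P - Q T⁻¹ S`.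
  have k3 : K₃ = -(Ti * S * K₁) := by
    have : Ti * (S * K₁ + T * K₃) = 0 := by rw [e3, Matrix.mul_zero]
    rw [Matrix.mul_add, ← Matrix.mul_assoc, ← Matrix.mul_assoc, hTi', Matrix.one_mul] at this
    exact (neg_eq_of_add_eq_zero_right this).symm
  have k2 : K₂ = -(K₁ * Q * Ti) := by
    have : (K₁ * Q + K₂ * T) * Ti = 0 := by rw [f2, Matrix.zero_mul]
    rw [Matrix.add_mul, Matrix.mul_assoc K₂, hTi, Matrix.mul_one] at this
    exact (neg_eq_of_add_eq_zero_right this).symm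
  have k4 : K₄ = Ti - Ti * S * K₂ := by
    have : Ti * (S * K₂ + T * K₄) = Ti := by rw [e4, Matrix.mul_one]
    rw [Matrix.mul_add, ← Matrix.mul_assoc, ← Matrix.mul_assoc, hTi', Matrix.one_mul] at this
    exact eq_sub_of_add_eq' this
  have hQT : ∀ i j, ((Q * Ti) i j).IsParity 1 := fun i j =>
    (isParity_matrix_mul hQ hTi0 i j).congr (by decide)
  have hQTS : ∀ i j, ((Q * Ti * S) i j).IsParity 0 := fun i j =>
    (isParity_matrix_mul hQT hS i j).congr (by decide)
  have hW : ∀ i j, ((P - Q * Ti * S) i j).IsParity 0 := fun i j => (hP i j).sub (hQTS i j)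
  -- The factor `W = P - Q T⁻¹ S` of the Berezinian has the inverse `K₁`.
  have hWK : (P - Q * Ti * S) * K₁ = 1 := by
    rw [Matrix.sub_mul, ← e1, k3, Matrix.mul_neg, Matrix.mul_assoc, Matrix.mul_assoc,
      Matrix.mul_assoc, sub_eq_add_neg]
  have hWu := Matrix.isUnit_det_of_right_inverse (toEven_mul_eq_one hW hK₁ hWK)
  have hdT : evenDet T = ((toEven T hT).det : Grassmann (Fin m) B) := evenDet_eq hT
  have hber : berezinian (Matrix.fromBlocks P Q S T) =
      ((toEven _ hW).det * Ring.inverse (toEven T hT).det : evenSubring (Fin m) B) := by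
    rw [berezinian]
    simp only [Matrix.toBlocks_fromBlocks₁₁, Matrix.toBlocks_fromBlocks₁₂,
      Matrix.toBlocks_fromBlocks₂₁, Matrix.toBlocks_fromBlocks₂₂]
    rw [ringInverse_eq hTi hTi', hdT, evenDet_eq hW, ringInverse_eq
      (b := ((Ring.inverse (toEven T hT).det : evenSubring (Fin m) B) : Grassmann (Fin m) B))]
    · rfl
    · exact congrArg Subtype.val (Ring.mul_inverse_cancel _ hTu)
    · exact congrArg Subtype.val (Ring.inverse_mul_cancel _ hTu)
  refine ⟨⟨⟨T, Ti, hTi, hTi'⟩, rfl⟩, ?_, _, hber, hWu.mul hTu.ringInverse, fun q D hD => ?_⟩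
  · rw [Matrix.toBlocks_fromBlocks₂₂, hdT]
    exact hTu.map (evenSubring (Fin m) B).subtype
  have dW := hD.det hW hK₁ hWK
  have dT := hD.det hT hTi0 hTi
  set w := (toEven _ hW).det
  set t := (toEven T hT).det
  -- The derivative of the inverse of `t = det T`.
  have dTi : D (Ring.inverse t : evenSubring (Fin m) B) =
      -((Ring.inverse t : evenSubring (Fin m) B) * (T.map D * Ti).trace) := by
    have h1 : (t : Grassmann (Fin m) B) * (Ring.inverse t : evenSubring (Fin m) B) = 1 :=
      congrArg Subtype.val (Ring.mul_inverse_cancel _ hTu)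
    have h1' : ((Ring.inverse t : evenSubring (Fin m) B) : Grassmann (Fin m) B) * t = 1 :=
      congrArg Subtype.val (Ring.inverse_mul_cancel _ hTu)
    have h2 := congrArg D h1
    rw [hD.map_one, hD.leibniz_of_isParity t.2, ksign_zero_right, one_smul, dT, RingHom.id_apply,
      RingHom.id_apply, (Ring.inverse t).2.comm_even, ← mul_assoc, h1', one_mul] at h2
    have h3 := congrArg (fun x => ((Ring.inverse t : evenSubring (Fin m) B) :
      Grassmann (Fin m) B) * x) h2
    simp only [mul_add, mul_zero] at h3
    rw [← mul_assoc _ (t : Grassmann (Fin m) B), h1', one_mul] at h3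
    exact (neg_eq_of_add_eq_zero_right h3).symm
  change D ((w : Grassmann (Fin m) B) * (Ring.inverse t : evenSubring (Fin m) B)) = _
  rw [hD.leibniz_of_isParity w.2, ksign_zero_right, one_smul, dW, dTi, RingHom.id_apply,
    RingHom.id_apply, (Ring.inverse t).2.comm_even, mul_neg, ← mul_assoc, ← mul_assoc,
    ← sub_eq_add_neg]
  change ((Ring.inverse t * w : evenSubring (Fin m) B) : Grassmann (Fin m) B) * _ -
    ((w * Ring.inverse t : evenSubring (Fin m) B) : Grassmann (Fin m) B) * _ = _
  rw [mul_comm (Ring.inverse t) w, ← mul_sub]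
  congr 1
  -- The supertrace of `D J * K`, block by block.
  have hsum : ∑ i : Idx n m, ∑ j : Idx n m, psign i.parity • (D (Matrix.fromBlocks P Q S T i j) *
      Matrix.fromBlocks K₁ K₂ K₃ K₄ j i) = (P.map D * K₁).trace + (Q.map D * K₃).trace -
        (S.map D * K₂).trace - (T.map D * K₄).trace := by
    have p0 : ∀ i : Fin n, psign (Idx.parity (.inl i : Idx n m)) = 1 := fun _ => rfl
    have p1 : ∀ i : Fin m, psign (Idx.parity (.inr i : Idx n m)) = -1 := fun _ => rfl
    simp only [Fintype.sum_sum_type, p0, p1, Matrix.fromBlocks_apply₁₁, Matrix.fromBlocks_apply₁₂,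
      Matrix.fromBlocks_apply₂₁, Matrix.fromBlocks_apply₂₂, Matrix.trace, Matrix.diag,
      Matrix.mul_apply, Matrix.map_apply, one_smul, neg_smul, Finset.sum_add_distrib,
      Finset.sum_neg_distrib]
    abel
  have hDS : ∀ i j, (S.map D i j).IsParity (q + 1) := fun i j => hD.isParity (hS i j)
  have hDT : ∀ i j, (T.map D i j).IsParity (q + 0) := fun i j => hD.isParity (hT i j)
  have hTSK : ∀ i j, ((Ti * S * K₁) i j).IsParity 1 := fun i j =>
    (isParity_matrix_mul (isParity_matrix_mul hTi0 hS) hK₁ i j).congr (by decide)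
  have hDTTSK : ∀ i j, ((T.map D * (Ti * S * K₁)) i j).IsParity (q + 0 + 1) :=
    isParity_matrix_mul hDT hTSK
  have hDSK : ∀ i j, ((S.map D * K₁) i j).IsParity (q + 1 + 0) := isParity_matrix_mul hDS hK₁
  -- The derivative of `T⁻¹`, from `T⁻¹ T = 1`.
  have hdTi : Ti.map D = -(Ti * T.map D * Ti) := by
    have h1 : (Ti * T).map D = 0 := by
      rw [hTi']; ext i j
      rw [Matrix.map_apply, Matrix.one_apply]
      split_ifs
      · simp [hD.map_one]
      · simp
    rw [hD.map_matrix_mul hTi0, ksign_zero_right, one_smul] at h1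
    have h2 := congrArg (fun M => M * Ti) h1
    simp only [Matrix.add_mul, Matrix.zero_mul] at h2
    rw [Matrix.mul_assoc, hTi, Matrix.mul_one] at h2
    exact eq_neg_of_add_eq_zero_left h2
  have hdW : (P - Q * Ti * S).map D = P.map D - Q.map D * Ti * S +
      ksign q 1 • (Q * Ti * T.map D * Ti * S) - ksign q 1 • (Q * Ti * S.map D) := by
    rw [Matrix.map_sub _ (map_sub D), hD.map_matrix_mul hQT, hD.map_matrix_mul hQ, hdTi]
    simp only [Matrix.mul_neg, Matrix.add_mul, smul_neg, Matrix.neg_mul, Matrix.smul_mul,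
      Matrix.mul_assoc]
    abel
  -- Supercyclicity of the trace brings the products in `D W * K₁` to the form they have in the
  -- supertrace.
  have s1 : ∀ q : ZMod 2, ksign q 1 * ksign 1 (q + 0 + 1) = -1 := by decide
  have s2 : ∀ q : ZMod 2, ksign q 1 * ksign 1 (q + 1 + 0) = -1 := by decide
  have t1 : ksign q 1 • (Q * (Ti * (T.map D * (Ti * (S * K₁))))).trace =
      -(T.map D * (Ti * (S * (K₁ * (Q * Ti))))).trace := by
    have h := trace_mul_comm_of_isParity hQT hDTTSK
    simp only [Matrix.mul_assoc] at h
    rw [h, smul_smul, s1, neg_smul, one_smul]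
  have t2 : ksign q 1 • (Q * (Ti * (S.map D * K₁))).trace =
      -(S.map D * (K₁ * (Q * Ti))).trace := by
    have h := trace_mul_comm_of_isParity hQT hDSK
    simp only [Matrix.mul_assoc] at h
    rw [h, smul_smul, s2, neg_smul, one_smul]
  rw [hsum, hdW, k4, k3, k2]
  simp only [Matrix.sub_mul, Matrix.add_mul, Matrix.smul_mul, Matrix.trace_sub, Matrix.trace_add,
    Matrix.trace_smul, Matrix.mul_neg, Matrix.trace_neg, Matrix.mul_sub, Matrix.mul_assoc]
  rw [t1, t2]
  abel

end BerezinianCalculus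

theorem map_ringInverse {R R' : Type*} [Ring R] [Ring R'] (φ : R →+* R') {a : R} (h : IsUnit a) :
    Ring.inverse (φ a) = φ (Ring.inverse a) := by
  obtain ⟨u, rfl⟩ := h
  rw [Ring.inverse_unit]
  exact ringInverse_eq (by rw [← map_mul, Units.mul_inv, map_one])
    (by rw [← map_mul, Units.inv_mul, map_one])

/-- The Berezinian is compatible with ring homomorphisms. -/
theorem berezinian_map {n m : ℕ} {R R' : Type*} [Ring R] [Ring R'] (φ : R →+* R')
    {J : Matrix (Idx n m) (Idx n m) R} (h : IsUnit J.toBlocks₂₂)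
    (hd : IsUnit (evenDet J.toBlocks₂₂)) : berezinian (J.map φ) = φ (berezinian J) := by
  have hdet : ∀ {k : ℕ} (A : Matrix (Fin k) (Fin k) R), evenDet (A.map φ) = φ (evenDet A) := by
    intro k A
    simp only [evenDet, map_sum, map_zsmul, map_list_prod, List.map_ofFn]
    rfl
  have h22 : (J.map φ).toBlocks₂₂ = φ.mapMatrix J.toBlocks₂₂ := rfl
  rw [berezinian, berezinian, h22, map_ringInverse φ.mapMatrix h, RingHom.mapMatrix_apply,
    RingHom.mapMatrix_apply, hdet, map_ringInverse φ hd, map_mul, ← hdet]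
  congr 2
  rw [Matrix.map_sub _ (map_sub φ), Matrix.map_mul, Matrix.map_mul]
  rfl

end Grassmann

/-! ### Logarithms and exponentials of even superfunctions -/

open Grassmann

namespace Grassmann

variable {κ R : Type*} [LinearOrder κ] [CommRing R]

theorem IsParity.pow {f : Grassmann κ R} (hf : f.IsParity 0) (k : ℕ) : (f ^ k).IsParity 0 :=
  (evenSubring κ R).pow_mem hf k

theorem ofScalar_mul_eq_smul (r : R) (f : Grassmann κ R) : ofScalar r * f = r • f := by
  ext K
  rw [coeff_mul, Finset.sum_eq_single ∅]
  · simp [ofScalar]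
  · intro J _ hJ; simp [ofScalar, hJ]
  · simp

theorem IsSuperDer.map_pow {q : ZMod 2} {D : Grassmann κ R →+ Grassmann κ R}
    (hD : IsSuperDer (RingHom.id _) q D) [Fintype κ] {u : Grassmann κ R} (hu : u.IsParity 0) (k : ℕ) :
    D (u ^ (k + 1)) = (k + 1) • (u ^ k * D u) := by
  induction k with
  | zero => simp
  | succ k ih =>
    rw [pow_succ u (k + 1), hD.leibniz_of_isParity (hu.pow _), ih, ksign_zero_right, one_smul,
      RingHom.id_apply, RingHom.id_apply, smul_mul_assoc, mul_assoc, hu.comm_even, ← mul_assoc,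
      ← pow_succ, ← succ_nsmul]

/-- The top nonvanishing power of a nilpotent even element annihilates its differential. -/
theorem IsSuperDer.pow_card_mul [Fintype κ] [Module ℝ R] {q : ZMod 2}
    {D : Grassmann κ R →+ Grassmann κ R} (hD : IsSuperDer (RingHom.id _) q D) {u : Grassmann κ R}
    (hu : u.IsParity 0) (hu0 : u.coeff ∅ = 0) : u ^ Fintype.card κ * D u = 0 := by
  have h := hD.map_pow hu (Fintype.card κ)
  rw [pow_eq_zero_of_body hu0, map_zero, Symb.nsmul_eq_real_smul] at h
  have h0 : ((Fintype.card κ + 1 : ℕ) : ℝ) ≠ 0 := by positivity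
  rw [← inv_smul_smul₀ h0 (u ^ Fintype.card κ * D u), ← h, smul_zero]

/-- The logarithmic series in the nilpotent part of `b = s (1 + u)`, corrected by a logarithm `L` of
the body `s`, has the differential of the logarithm of `b`. -/
theorem IsSuperDer.mul_log [Fintype κ] [Algebra ℝ R] {q : ZMod 2}
    {D : Grassmann κ R →+ Grassmann κ R} (hD : IsSuperDer (RingHom.id _) q D)
    (hDr : ∀ (r : ℝ) f, D (r • f) = r • D f) {b u L : Grassmann κ R} {s : R} (hue : u.IsParity 0)
    (hu0 : u.coeff ∅ = 0) (hbu : b = ofScalar s * (1 + u))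
    (hL : ofScalar s * D L = D (ofScalar s)) :
    b * D (L + ∑ k ∈ Finset.range (Fintype.card κ),
      ((-1) ^ (k + 1 + 1) / ((k + 1 : ℕ) : ℝ)) • u ^ (k + 1)) = D b := by
  have hDu := hD.pow_card_mul hue hu0
  have hterm : ∀ k : ℕ, D (((-1) ^ (k + 1 + 1) / ((k + 1 : ℕ) : ℝ)) • u ^ (k + 1)) =
      (-u) ^ k * D u := by
    intro k
    have h0 : ((k + 1 : ℕ) : ℝ) ≠ 0 := by positivity
    rw [hDr, hD.map_pow hue k, Symb.nsmul_eq_real_smul, smul_smul, div_mul_cancel₀ _ h0, pow_succ,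
      pow_succ, mul_assoc, neg_mul_neg, one_mul, mul_one]
    rcases Nat.even_or_odd k with hk | hk
    · rw [hk.neg_one_pow, one_smul, hk.neg_pow]
    · rw [hk.neg_one_pow, neg_smul, one_smul, hk.neg_pow, neg_mul]
  rw [map_add, map_sum, Finset.sum_congr rfl fun k _ => hterm k, ← Finset.sum_mul, mul_add]
  have e1 : b * ((∑ k ∈ Finset.range (Fintype.card κ), (-u) ^ k) * D u) = ofScalar s * D u := by
    rw [hbu, mul_assoc, ← mul_assoc (1 + u), ← sub_neg_eq_add, mul_neg_geom_sum, sub_mul, one_mul,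
      neg_pow, mul_assoc, hDu, mul_zero, sub_zero]
  have hue1 : (1 + u).IsParity 0 := isParity_one.add hue
  have e2 : b * D L = D (ofScalar s) * (1 + u) := by
    rw [hbu, hue1.comm_even, mul_assoc, hL, ← hue1.comm_even]
  have e3 : D b = D (ofScalar s) * (1 + u) + ofScalar s * D u := by
    rw [hbu, hD.leibniz_of_isParity (isParity_ofScalar s), ksign_zero_right, one_smul, map_add D,
      hD.map_one, zero_add, RingHom.id_apply, RingHom.id_apply]
  rw [e1, e2, e3]

/-- The differential of the exponential series of a nilpotent element. -/
theorem IsSuperDer.map_exp [Fintype κ] [Algebra ℝ R] {q : ZMod 2}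
    {D : Grassmann κ R →+ Grassmann κ R} (hD : IsSuperDer (RingHom.id _) q D)
    (hDr : ∀ (r : ℝ) f, D (r • f) = r • D f) {u : Grassmann κ R} (hue : u.IsParity 0)
    (hu0 : u.coeff ∅ = 0) :
    D (∑ k ∈ Finset.range (Fintype.card κ + 1), (1 / (k.factorial : ℝ)) • u ^ k) =
      (∑ k ∈ Finset.range (Fintype.card κ + 1), (1 / (k.factorial : ℝ)) • u ^ k) * D u := by
  have hterm : ∀ k : ℕ, D ((1 / ((k + 1).factorial : ℝ)) • u ^ (k + 1)) =
      ((1 / (k.factorial : ℝ)) • u ^ k) * D u := by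
    intro k
    rw [hDr, hD.map_pow hue k, Symb.nsmul_eq_real_smul, smul_smul, smul_mul_assoc,
      Nat.factorial_succ]
    congr 1
    have h0 : ((k + 1 : ℕ) : ℝ) ≠ 0 := by positivity
    have h0' : (k.factorial : ℝ) ≠ 0 := by positivity
    push_cast at h0 ⊢
    field_simp
  rw [Finset.sum_range_succ, add_mul, smul_mul_assoc _ (u ^ Fintype.card κ),
    hD.pow_card_mul hue hu0, smul_zero, add_zero, Finset.sum_mul, ← Finset.sum_range_succ,
    Finset.sum_range_succ', map_add, map_sum, Finset.sum_congr rfl fun k _ => hterm k, pow_zero,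
    hDr, hD.map_one, smul_zero, add_zero]

end Grassmann

namespace Smooth

variable {N : ℕ} {W : Opens (Eu N)}

theorem exists_logAbs (f : Smooth W) (hf : ∀ x, f.1 x ≠ 0) :
    ∃ L : Smooth W, (∀ x, L.1 x = Real.log |f.1 x|) ∧ ∀ v, f * dirDeriv v L = dirDeriv v f := by
  have hc : ContDiffOn ℝ ∞ (zeroExt fun x => Real.log |f.1 x|) W :=
    (f.2.log fun x hx => by rw [zeroExt_of_mem _ hx]; exact hf _).congr fun x hx => by
      simp only [zeroExt_of_mem _ hx, Real.log_abs]
  refine ⟨⟨_, hc⟩, fun x => rfl, fun v => ?_⟩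
  ext x
  have h := rawDeriv_eq v (fun x => Real.log |f.1 x|) x
    ((hasFDerivAt f x).log (by rw [zeroExt_apply]; exact hf x))
    (fun y => by rw [zeroExt_apply, Real.log_abs])
  change f.1 x * rawDeriv v _ x = rawDeriv v f.1 x
  rw [h, rawDeriv, zeroExt_apply]
  simp [hf x]

theorem exists_exp (f : Smooth W) :
    ∃ L : Smooth W, (∀ x, L.1 x = Real.exp (f.1 x)) ∧ ∀ v, dirDeriv v L = L * dirDeriv v f := by
  have hc : ContDiffOn ℝ ∞ (zeroExt fun x => Real.exp (f.1 x)) W :=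
    f.2.exp.congr fun x hx => by simp only [zeroExt_of_mem _ hx]
  refine ⟨⟨_, hc⟩, fun x => rfl, fun v => ?_⟩
  ext x
  have h := rawDeriv_eq v (fun x => Real.exp (f.1 x)) x (hasFDerivAt f x).exp
    (fun y => by rw [zeroExt_apply])
  change rawDeriv v _ x = Real.exp (f.1 x) * rawDeriv v f.1 x
  rw [h, rawDeriv, zeroExt_apply]
  simp

end Smooth

namespace SuperFun

variable {N m : ℕ} {W : Opens (Eu N)}

/-- The ring homomorphism `SuperFun.eval`. -/
def evalHom (x : W) : SuperFun m W →+* Grassmann (Fin m) ℝ := mapHom (Smooth.eval x)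

theorem evalHom_apply (x : W) (f : SuperFun m W) : evalHom x f = eval x f := rfl

theorem eval_smul (x : W) (r : ℝ) (f : SuperFun m W) : eval x (r • f) = r • eval x f := rfl

theorem eval_ofScalar (x : W) (s : Smooth W) :
    eval x (ofScalar s : SuperFun m W) = ofScalar (s.1 x) := Symb.mapCoeff_mono _ ∅ s

theorem gbody_eval (x : W) (f : SuperFun m W) : gbody (eval x f) = (f.coeff ∅).1 x := rfl

theorem pd_ofScalar_inl (i : Fin N) (s : Smooth W) : pd (.inl i) (ofScalar s : SuperFun m W) =
    ofScalar (Smooth.dirDeriv (EuclideanSpace.single i 1) s) := Symb.mapCoeff_mono _ ∅ s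

theorem pd_ofScalar_inr (j : Fin m) (s : Smooth W) :
    pd (.inr j : Idx N m) (ofScalar s : SuperFun m W) = 0 :=
  (leftDeriv_mono _ ∅ _).trans (by simp)

theorem ext_eval {f g : SuperFun m W} (h : ∀ x, eval x f = eval x g) : f = g := by
  ext K x
  exact congrArg (fun a => a.coeff K) (h x)

/-- `log |b|` for an even invertible superfunction `b`. -/
theorem exists_logAbs {b : SuperFun m W} (hb : b.IsParity 0) (hu : IsUnit b) :
    ∃ ℓ : SuperFun m W, ℓ.IsParity 0 ∧ (∀ x, eval x ℓ = glogAbs (eval x b)) ∧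
      ∀ i, b * pd i ℓ = pd i b := by
  obtain ⟨v, hv⟩ := hu.map (bodyHom (κ := Fin m) (R := Smooth W))
  set s := b.coeff ∅ with hs
  have hvs : (v : Smooth W) = s := hv
  set s' : Smooth W := ((v⁻¹ : (Smooth W)ˣ) : Smooth W)
  have hss' : s * s' = 1 := by rw [← hvs, Units.mul_inv]
  have hss'x : ∀ x, s.1 x * s'.1 x = 1 := fun x => congrFun (congrArg Subtype.val hss') x
  obtain ⟨L, hL, hLd⟩ := Smooth.exists_logAbs s fun x => left_ne_zero_of_mul_eq_one (hss'x x)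
  set u : SuperFun m W := ofScalar s' * (b - ofScalar s) with hu'
  have hue : u.IsParity 0 :=
    ((isParity_ofScalar s').mul (hb.sub (isParity_ofScalar s))).congr (add_zero 0)
  have hu0 : u.coeff ∅ = 0 := by
    rw [hu', ofScalar_mul_eq_smul, coeff_smul, coeff_sub, ← hs]; simp [ofScalar]
  have hbu : b = ofScalar s * (1 + u) := by
    rw [mul_add, mul_one, hu', ← mul_assoc, ofScalar_mul_ofScalar, hss',
      show (ofScalar (1 : Smooth W) : SuperFun m W) = 1 from rfl, one_mul, add_sub_cancel]
  refine ⟨ofScalar L + ∑ k ∈ Finset.range m, ((-1) ^ (k + 1 + 1) / ((k + 1 : ℕ) : ℝ)) • u ^ (k + 1),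
    (isParity_ofScalar L).add (isParity_sum _ fun k _ => (hue.pow _).smul _), fun x => ?_,
    fun i => ?_⟩
  · have hux : eval x u = (gbody (eval x b))⁻¹ • gsoul (eval x b) := by
      have h1 : eval x u = evalHom x (ofScalar s') * (evalHom x b - evalHom x (ofScalar s)) := by
        rw [← map_sub, ← map_mul]; rfl
      rw [h1, evalHom_apply, evalHom_apply, evalHom_apply, eval_ofScalar, eval_ofScalar,
        ofScalar_mul_eq_smul, gsoul, gbody_eval, ← hs, eq_inv_of_mul_eq_one_right (hss'x x)]
    rw [glogAbs, map_add, eval_ofScalar, hL, map_sum, gbody_eval, ← hs, Finset.range_eq_Ico,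
      Finset.sum_Ico_add' (fun k => eval x (((-1) ^ (k + 1) / ((k : ℕ) : ℝ)) • u ^ k)) 0 m 1]
    congr 1
    refine Finset.sum_congr rfl fun k _ => ?_
    rw [eval_smul, ← evalHom_apply x (u ^ k), map_pow, evalHom_apply, hux, gbody_eval]
  · have hLi : ofScalar s * pd i (ofScalar L : SuperFun m W) = pd i (ofScalar s) := by
      rcases i with i | j
      · rw [pd_ofScalar_inl, pd_ofScalar_inl, ofScalar_mul_ofScalar, hLd]
      · rw [pd_ofScalar_inr, pd_ofScalar_inr, mul_zero]
    have h := (isSuperDer_pd (m := m) (W := W) i).mul_log (fun r f => map_smul (pd i) r f) hue hu0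
      hbu hLi
    rw [Fintype.card_fin] at h
    exact h

/-- The exponential of an even superfunction `a`. -/
theorem exists_exp {a : SuperFun m W} (ha : a.IsParity 0) :
    ∃ e : SuperFun m W, e.IsParity 0 ∧ (∀ x, eval x e = gexp (eval x a)) ∧
      ∀ i, pd i e = e * pd i a := by
  set s := a.coeff ∅ with hs
  obtain ⟨E, hE, hEd⟩ := Smooth.exists_exp s
  set u : SuperFun m W := a - ofScalar s with hu'
  have hue : u.IsParity 0 := ha.sub (isParity_ofScalar s)
  have hu0 : u.coeff ∅ = 0 := by rw [hu', coeff_sub, ← hs]; simp [ofScalar]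
  have hsum : (∑ k ∈ Finset.range (m + 1), (1 / (k.factorial : ℝ)) • u ^ k).IsParity 0 :=
    isParity_sum _ fun k _ => (hue.pow _).smul _
  refine ⟨ofScalar E * ∑ k ∈ Finset.range (m + 1), (1 / (k.factorial : ℝ)) • u ^ k,
    ((isParity_ofScalar E).mul hsum).congr (add_zero 0), fun x => ?_, fun i => ?_⟩
  · have hux : eval x u = gsoul (eval x a) := by
      rw [hu', map_sub, eval_ofScalar, gsoul, gbody_eval]
    rw [gexp, ← evalHom_apply, map_mul, evalHom_apply, eval_ofScalar, ofScalar_mul_eq_smul, hE,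
      gbody_eval, map_sum]
    congr 1
    refine Finset.sum_congr rfl fun k _ => ?_
    rw [evalHom_apply, eval_smul, ← evalHom_apply x (u ^ k), map_pow, evalHom_apply, hux]
  · have hEi : pd i (ofScalar E : SuperFun m W) = ofScalar E * pd i (ofScalar s) := by
      rcases i with i | j
      · rw [pd_ofScalar_inl, pd_ofScalar_inl, ofScalar_mul_ofScalar, hEd]
      · rw [pd_ofScalar_inr, pd_ofScalar_inr, mul_zero]
    have h := (isSuperDer_pd (m := m) (W := W) i).map_exp (fun r f => map_smul (pd i) r f) hue hu0
    rw [Fintype.card_fin] at h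
    have hd : pd i (∑ k ∈ Finset.range (m + 1), (1 / (k.factorial : ℝ)) • u ^ k) =
      (∑ k ∈ Finset.range (m + 1), (1 / (k.factorial : ℝ)) • u ^ k) * pd i u := h
    rw [pd_mul i (isParity_ofScalar E), ksign_zero_right, one_smul, hEi, hd, mul_assoc, mul_assoc,
      hsum.comm_even, ← mul_add, ← mul_add, ← map_add, hu', add_sub_cancel]

end SuperFun

/-! ### The Berezinian of a change of graded coordinates -/

open Grassmann

namespace SuperFun

variable {N m : ℕ} {W : Opens (Eu N)}

instance : IsScalarTower ℝ (SuperFun m W) (SuperFun m W) :=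
  ⟨fun r f g => Grassmann.ext (funext fun M => by
    simp only [smul_eq_mul, coeff_smul, coeff_mul, Finset.smul_sum, smul_mul_assoc, mul_smul_comm])⟩

instance : SMulCommClass ℝ (SuperFun m W) (SuperFun m W) :=
  ⟨fun r f g => Grassmann.ext (funext fun M => by
    simp only [smul_eq_mul, coeff_smul, coeff_mul, Finset.smul_sum, mul_smul_comm])⟩

end SuperFun

namespace ChartChange

variable {n m : ℕ} {W' V : Opens (Eu n)} {Γ' : Christoffel m W'} {Γ : Christoffel m V}
  (C : ChartChange Γ' Γ)

/-- The transformation law of the Christoffel symbols, solved for those of `x`. -/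
theorem christoffel_eq (i s k : Idx n m) : Γ i s k =
    ∑ b, SuperFun.pd i (C.J s b) * C.K b k +
      ∑ b, ∑ a, ∑ d, invol i.parity (C.J s b) * (C.J i a * C.pull (Γ' a b d)) * C.K d k := by
  -- Differentiate `J K = 1`.
  have h1 : ∑ b, SuperFun.pd i (C.J s b) * C.K b k +
      ∑ b, invol i.parity (C.J s b) * SuperFun.pd i (C.K b k) = 0 := by
    have := congrArg (SuperFun.pd i) (C.J_mul_K s k)
    rw [map_sum] at this
    simp only [SuperFun.pd_mul', Finset.sum_add_distrib] at this
    rw [this]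
    split_ifs
    · exact SuperFun.pd_one i
    · exact map_zero _
  -- Multiply the transformation law by `J`.
  have h2 : ∑ b, invol i.parity (C.J s b) * (∑ l, invol i.parity (C.K b l) * Γ i l k) =
      Γ i s k := by
    simp only [Finset.mul_sum, ← mul_assoc, ← map_mul]
    rw [Finset.sum_comm]
    simp only [← Finset.sum_mul, ← map_sum, C.J_mul_K]
    rw [Finset.sum_eq_single s]
    · simp
    · intro l _ hl; simp [hl.symm]
    · simp
  have h3 : ∑ b, invol i.parity (C.J s b) * (∑ a, ∑ d, C.J i a * C.pull (Γ' a b d) * C.K d k) =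
      ∑ b, invol i.parity (C.J s b) * SuperFun.pd i (C.K b k) + Γ i s k := by
    rw [← h2, ← Finset.sum_add_distrib]
    refine Finset.sum_congr rfl fun b _ => ?_
    rw [← C.transform, mul_add]
  have h4 : ∑ b, ∑ a, ∑ d, invol i.parity (C.J s b) * (C.J i a * C.pull (Γ' a b d)) * C.K d k =
      ∑ b, invol i.parity (C.J s b) * SuperFun.pd i (C.K b k) + Γ i s k := by
    rw [← h3]
    simp only [Finset.mul_sum, mul_assoc]
  rw [h4, ← add_assoc, h1, zero_add]

theorem ksign_trace_aux : ∀ i a b d s : ZMod 2,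
    psign s * ksign i (s + b) * ksign (s + b + (i + a + (a + b + d))) (d + s) =
      psign d * ksign i (b + d) := by
  unfold psign; decide

/-- The trace of the Christoffel symbols transforms like the connection coefficients of densities. -/
theorem trace_eq {ℓ : SuperFun m V} (hℓ : ∀ q, SuperFun.pd q ℓ =
      ∑ i, ∑ j, psign i.parity • (SuperFun.pd q (C.J i j) * C.K j i))
    (hΓ' : ∀ i j k, (Γ' i j k).IsParity (i.parity + j.parity + k.parity)) (i : Idx n m) :
    Γ.trace i = SuperFun.pd i ℓ + ∑ a, C.J i a * C.pull (Γ'.trace a) := by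
  -- Move `K` to the front, where the sum over `s` gives `K J = 1`.
  have key : ∀ a b d s : Idx n m, psign s.parity •
      (invol i.parity (C.J s b) * (C.J i a * C.pull (Γ' a b d)) * C.K d s) =
      (psign d.parity * ksign i.parity (b.parity + d.parity)) •
        (C.K d s * C.J s b * (C.J i a * C.pull (Γ' a b d))) := by
    intro a b d s
    have hX : (C.J i a * C.pull (Γ' a b d)).IsParity
        (i.parity + a.parity + (a.parity + b.parity + d.parity)) :=
      (C.J_parity i a).mul (C.pull_parity _ _ (hΓ' a b d))
    rw [(C.J_parity s b).invol, smul_mul_assoc, smul_mul_assoc,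
      ((C.J_parity s b).mul hX).comm (C.K_parity d s), smul_smul, smul_smul, ksign_trace_aux,
      mul_assoc]
  rw [Christoffel.trace, hℓ]
  simp only [C.christoffel_eq i, smul_add, Finset.sum_add_distrib, Finset.smul_sum, key]
  congr 1
  rw [Finset.sum_comm, Finset.sum_congr rfl fun b _ => Finset.sum_comm, Finset.sum_comm]
  refine Finset.sum_congr rfl fun a _ => ?_
  rw [Christoffel.trace, map_sum, Finset.mul_sum]
  refine Finset.sum_congr rfl fun b _ => ?_
  rw [Finset.sum_comm]
  simp only [← Finset.smul_sum, ← Finset.sum_mul, C.K_mul_J]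
  rw [Finset.sum_eq_single b]
  · have : ksign i.parity (b.parity + b.parity) = 1 := by
      rw [CharTwo.add_self_eq_zero, ksign_zero_right]
    rw [this, mul_one, if_pos rfl, one_mul, map_zsmul, mul_smul_comm]
  · intro d _ hd; simp [hd]
  · simp

end ChartChange

namespace SuperChart

variable {n m : ℕ} {M₀ : TopCat.{u}} [ChartedSpace (Eu n) M₀] {A : SuperalgebraSheaf M₀}
  (c c' : SuperChart n m A)

/-- The logarithm `ℓ` of the absolute value of the Berezinian of the Jacobian matrix, and its
exponentials `exp (δ ℓ)`, are superfunctions, whose differentials are given by the logarithmic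
derivative of the Berezinian. -/
theorem exists_logBer : ∃ ℓ : SuperFun m (c.overlap c'), ℓ.IsParity 0 ∧
    (∀ x, c.logBer c' x = SuperFun.eval x ℓ) ∧
    (∀ q, SuperFun.pd q ℓ = ∑ i, ∑ j, psign i.parity •
      (SuperFun.pd q (c.overlapJ c' i j) * c.overlapK c' j i)) ∧
    ∀ δ : ℝ, ∃ lam : SuperFun m (c.overlap c'), lam.IsParity 0 ∧
      (∀ x, gabsPow (berezinian (c.jacobian c' x)) δ = SuperFun.eval x lam) ∧
      ∀ q, SuperFun.pd q lam = δ • (lam * SuperFun.pd q ℓ) := by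
  obtain ⟨h22, hd, b, hb, hu, hder⟩ := berezinian_spec (J := Matrix.of (c.overlapJ c'))
    (K := Matrix.of (c.overlapK c')) (c.isParity_overlapJ c') (c.isParity_overlapK c')
    (by
      ext1 i k
      rw [Matrix.mul_apply, Matrix.one_apply]
      exact c.overlapJ_mul_overlapK c' i k)
    (by
      ext1 i k
      rw [Matrix.mul_apply, Matrix.one_apply]
      exact c.overlapK_mul_overlapJ c' i k)
  have hu' : IsUnit (b : SuperFun m (c.overlap c')) := hu.map (evenSubring _ _).subtype
  obtain ⟨ℓ, hℓ, hℓe, hℓd⟩ := SuperFun.exists_logAbs b.2 hu'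
  have hjac : ∀ x, berezinian (c.jacobian c' x) = SuperFun.eval x b := fun x => by
    have h := berezinian_map (SuperFun.evalHom x) h22 hd
    rw [hb] at h
    exact h
  refine ⟨ℓ, hℓ, fun x => ?_, fun q => ?_, fun δ => ?_⟩
  · rw [logBer, hℓe, hjac]
  · refine hu'.mul_left_cancel ?_
    rw [hℓd]
    exact hder q.parity _ (SuperFun.isSuperDer_pd q)
  · obtain ⟨e, he, hee, hed⟩ := SuperFun.exists_exp (hℓ.smul δ)
    refine ⟨e, he, fun x => ?_, fun q => ?_⟩
    · rw [gabsPow, hee, SuperFun.eval_smul, hℓe, hjac]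
    · rw [hed, map_smul, mul_smul_comm]

/-- The entries `∂_i log |Ber|` of the Jacobian matrix of the Thomas bundle. -/
theorem rawPd_logBer {ℓ : SuperFun m (c.overlap c')} (hℓ : ∀ x, c.logBer c' x = SuperFun.eval x ℓ)
    (i : Idx n m) (x : c.overlap c') :
    SuperFun.rawPd i (c.logBer c') x = SuperFun.eval x (SuperFun.pd i ℓ) := by
  have h : c.logBer c' = fun x => SuperFun.eval x ℓ := funext hℓ
  rw [h]
  rcases i with i | j
  · rfl
  · ext K
    change (leftDeriv j _).coeff K = ((leftDeriv j ℓ).coeff K).1 x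
    rw [coeff_leftDeriv, coeff_leftDeriv]
    split_ifs
    · rfl
    · refine Eq.trans ?_ (map_mul (Smooth.eval x) _ _).symm
      rw [map_intCast]
      rfl

end SuperChart

/-! ### The Ricci tensor and the Thomas Christoffel symbols -/

open Grassmann

namespace Christoffel

variable {n m : ℕ} {W : Opens (Eu n)} {Γ : Christoffel m W}

theorem IsSymmetric.isParity_trace (hΓ : Γ.IsSymmetric) (i : Idx n m) :
    (Γ.trace i).IsParity i.parity :=
  isParity_sum _ fun s _ => ((hΓ.parity i s s).congr (by
    rw [add_assoc, CharTwo.add_self_eq_zero, add_zero])).zsmul _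

/-- The contraction `∑ q, (-1)^{p(q) (p(q) + p(i) + p(j))} (∂_q Γ_{ij}^q - ∑ p, Γ_{qi}^p Γ_{pj}^q)`,
which enters both the Ricci tensor of `Γ` and the Thomas superconnection. -/
def contraction (Γ : Christoffel m W) (i j : Idx n m) : SuperFun m W :=
  ∑ q : Idx n m, ksign q.parity (q.parity + i.parity + j.parity) •
    (SuperFun.pd q (Γ i j q) - ∑ p : Idx n m, Γ q i p * Γ p j q)

theorem ksign_ricci_aux1 : ∀ q i j l : ZMod 2,
    ksign q (q + j + i) * ksign q (j + i + l) * ksign q l = psign q := by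
  unfold psign; decide

theorem ksign_ricci_aux2 : ∀ q i j : ZMod 2,
    ksign q (q + j + i) * ksign q j * ksign q i = psign q := by
  unfold psign; decide

theorem ksign_ricci_aux3 : ∀ q i j l : ZMod 2,
    ksign q (q + j + i) * ksign q j * ksign j (q + i + l) * ksign (q + i + l) (j + l + q) *
      ksign j l = ksign l (l + j + i) := by
  decide

/-- The Ricci tensor of a torsion-free superconnection, in terms of `contraction` and of the trace of
the Christoffel symbols. -/
theorem IsSymmetric.ricci_eq (hΓ : Γ.IsSymmetric) (i j : Idx n m) :
    Γ.ricci i j = Γ.contraction j i + ∑ k, Γ j i k * Γ.trace k - SuperFun.pd j (Γ.trace i) := by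
  have hB : ∑ q : Idx n m, ∑ l : Idx n m, ksign q.parity (q.parity + j.parity + i.parity) •
      (invol q.parity (Γ j i l) * Γ q l q) = ∑ k, Γ j i k * Γ.trace k := by
    rw [Finset.sum_comm]
    refine Finset.sum_congr rfl fun l _ => ?_
    rw [trace, Finset.mul_sum]
    refine Finset.sum_congr rfl fun q _ => ?_
    rw [(hΓ.parity j i l).invol, hΓ.symm q l q, smul_mul_assoc, mul_smul_comm, mul_smul_comm,
      smul_smul, smul_smul, ksign_ricci_aux1]
  have hC : ∑ q : Idx n m, ksign q.parity (q.parity + j.parity + i.parity) •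
      (ksign q.parity j.parity • SuperFun.pd j (Γ q i q)) = SuperFun.pd j (Γ.trace i) := by
    rw [trace, map_sum]
    refine Finset.sum_congr rfl fun q _ => ?_
    rw [hΓ.symm q i q, map_zsmul, map_zsmul, smul_smul, smul_smul, ksign_ricci_aux2]
  have hD : ∑ q : Idx n m, ∑ l : Idx n m, ksign q.parity (q.parity + j.parity + i.parity) •
      (ksign q.parity j.parity • (invol j.parity (Γ q i l) * Γ j l q)) =
      ∑ q : Idx n m, ∑ p : Idx n m, ksign q.parity (q.parity + j.parity + i.parity) •
        (Γ q j p * Γ p i q) := by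
    rw [Finset.sum_comm]
    refine Finset.sum_congr rfl fun l _ => Finset.sum_congr rfl fun q _ => ?_
    rw [(hΓ.parity q i l).invol, smul_mul_assoc, (hΓ.parity q i l).comm (hΓ.parity j l q),
      hΓ.symm j l q, smul_mul_assoc, smul_smul, smul_smul, smul_smul, smul_smul, ksign_ricci_aux3]
  rw [ricci, contraction, ← hB, ← hC]
  simp only [curv, smul_sub, smul_add, Finset.smul_sum, Finset.sum_sub_distrib,
    Finset.sum_add_distrib, hD]
  abel

theorem mul_expand {R : Type*} [Ring R] [Module ℝ R] [IsScalarTower ℝ R R] [SMulCommClass ℝ R R]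
    (r : ℝ) (x y a b a' b' : R) : (x - r • (a + b)) * (y - r • (a' + b')) =
      x * y - r • (a * y + b * y + x * a' + x * b') +
        r ^ 2 • (a * a' + a * b' + b * a' + b * b') := by
  simp only [sub_mul, mul_sub, add_mul, mul_add, smul_mul_assoc, mul_smul_comm]
  module

theorem sum_psign : ∑ q : Idx n m, psign q.parity = (n : ℤ) - m := by
  have p0 : ∀ i : Fin n, psign (Idx.parity (.inl i : Idx n m)) = 1 := fun _ => rfl
  have p1 : ∀ i : Fin m, psign (Idx.parity (.inr i : Idx n m)) = -1 := fun _ => rfl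
  simp [Fintype.sum_sum_type, p0, p1, sub_eq_add_neg]

section Quadratic

variable {κ R : Type*} [LinearOrder κ] [Fintype κ] [CommRing R] [Algebra ℝ R]
  {G : Idx n m → Idx n m → Idx n m → Grassmann κ R} {t : Idx n m → Grassmann κ R}

/-- The terms of the contraction of `Π Π` which are linear in the trace `t` of `G`. -/
theorem sum_mul_trace (hp : ∀ i j k, (G i j k).IsParity (i.parity + j.parity + k.parity))
    (hs : ∀ i j k, G i j k = ksign i.parity j.parity • G j i k)
    (ht : ∀ i, ∑ s : Idx n m, psign s.parity • G i s s = t i)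
    (htp : ∀ i, (t i).IsParity i.parity) (i j : Idx n m) :
    ∑ q : Idx n m, ∑ p : Idx n m, ksign q.parity (q.parity + i.parity + j.parity) •
      ((if i = p then t q else 0) * G p j q +
        (ksign q.parity i.parity • (if q = p then t i else 0)) * G p j q +
        G q i p * (if j = q then t p else 0) +
        G q i p * (ksign p.parity j.parity • (if p = q then t j else 0))) =
      (2 : ℝ) • ∑ k, G i j k * t k + (2 : ℝ) • (t i * t j) := by
  have h1 : ∑ q : Idx n m, ∑ p : Idx n m, ksign q.parity (q.parity + i.parity + j.parity) •
      ((if i = p then t q else 0) * G p j q) = ∑ k, G i j k * t k := by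
    refine Finset.sum_congr rfl fun q _ => ?_
    rw [Finset.sum_eq_single i (fun p _ hp => by rw [if_neg hp.symm, zero_mul, zsmul_zero])
      (by simp), if_pos rfl, (htp q).comm (hp i j q), smul_smul]
    have e : ∀ q i j : ZMod 2, ksign q (q + i + j) * ksign q (i + j + q) = 1 := by decide
    rw [e, one_smul]
  have h2 : ∑ q : Idx n m, ∑ p : Idx n m, ksign q.parity (q.parity + i.parity + j.parity) •
      ((ksign q.parity i.parity • (if q = p then t i else 0)) * G p j q) = t i * t j := by
    rw [← ht j, Finset.mul_sum]
    refine Finset.sum_congr rfl fun q _ => ?_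
    rw [Finset.sum_eq_single q (fun p _ hp => by
      rw [if_neg hp.symm, zsmul_zero, zero_mul, zsmul_zero]) (by simp), if_pos rfl, hs q j q,
      mul_smul_comm, smul_mul_assoc, mul_smul_comm, smul_smul, smul_smul]
    have e : ∀ q i j : ZMod 2, ksign q (q + i + j) * ksign q j * ksign q i = psign q := by
      unfold psign; decide
    rw [e]
  have h3 : ∑ q : Idx n m, ∑ p : Idx n m, ksign q.parity (q.parity + i.parity + j.parity) •
      (G q i p * (if j = q then t p else 0)) = ∑ k, G i j k * t k := by
    rw [Finset.sum_eq_single j (fun q _ hq => by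
      refine Finset.sum_eq_zero fun p _ => ?_
      rw [if_neg hq.symm, mul_zero, zsmul_zero]) (by simp)]
    refine Finset.sum_congr rfl fun p _ => ?_
    rw [if_pos rfl, hs j i p, smul_mul_assoc, smul_smul]
    have e : ∀ i j : ZMod 2, ksign j (j + i + j) * ksign j i = 1 := by decide
    rw [e, one_smul]
  have h4 : ∑ q : Idx n m, ∑ p : Idx n m, ksign q.parity (q.parity + i.parity + j.parity) •
      (G q i p * (ksign p.parity j.parity • (if p = q then t j else 0))) = t i * t j := by
    rw [← ht i, Finset.sum_mul]
    refine Finset.sum_congr rfl fun q _ => ?_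
    rw [Finset.sum_eq_single q (fun p _ hp => by
      rw [if_neg hp, zsmul_zero, mul_zero, zsmul_zero]) (by simp), if_pos rfl, hs q i q,
      mul_smul_comm, smul_mul_assoc, smul_mul_assoc, smul_smul, smul_smul]
    have e : ∀ q i j : ZMod 2, ksign q (q + i + j) * ksign q j * ksign q i = psign q := by
      unfold psign; decide
    rw [e]
  simp only [smul_add, Finset.sum_add_distrib, h1, h2, h3, h4]
  module

/-- The terms of the contraction of `Π Π` which are quadratic in the trace `t`. -/
theorem sum_trace_mul_trace (htp : ∀ i, (t i).IsParity i.parity) (i j : Idx n m) :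
    ∑ q : Idx n m, ∑ p : Idx n m, ksign q.parity (q.parity + i.parity + j.parity) •
      ((if i = p then t q else 0) * (if j = q then t p else 0) +
        (if i = p then t q else 0) * (ksign p.parity j.parity • (if p = q then t j else 0)) +
        (ksign q.parity i.parity • (if q = p then t i else 0)) * (if j = q then t p else 0) +
        (ksign q.parity i.parity • (if q = p then t i else 0)) *
          (ksign p.parity j.parity • (if p = q then t j else 0))) =
      ((n : ℝ) - m + 3) • (t i * t j) := by
  have h1 : ∑ q : Idx n m, ∑ p : Idx n m, ksign q.parity (q.parity + i.parity + j.parity) •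
      ((if i = p then t q else 0) * (if j = q then t p else 0)) = t i * t j := by
    rw [Finset.sum_eq_single j (fun q _ hq => by
      refine Finset.sum_eq_zero fun p _ => ?_
      rw [if_neg hq.symm, mul_zero, zsmul_zero]) (by simp), Finset.sum_eq_single i (fun p _ hp => by
        rw [if_neg hp.symm, zero_mul, zsmul_zero]) (by simp), if_pos rfl, if_pos rfl,
      (htp j).comm (htp i), smul_smul]
    have e : ∀ i j : ZMod 2, ksign j (j + i + j) * ksign j i = 1 := by decide
    rw [e, one_smul]
  have h2 : ∑ q : Idx n m, ∑ p : Idx n m, ksign q.parity (q.parity + i.parity + j.parity) •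
      ((if i = p then t q else 0) *
        (ksign p.parity j.parity • (if p = q then t j else 0))) = t i * t j := by
    rw [Finset.sum_comm, Finset.sum_eq_single i (fun p _ hp => by
      refine Finset.sum_eq_zero fun q _ => ?_
      rw [if_neg hp.symm, zero_mul, zsmul_zero]) (by simp), Finset.sum_eq_single i (fun q _ hq => by
        rw [if_neg hq.symm, zsmul_zero, mul_zero, zsmul_zero]) (by simp), if_pos rfl, if_pos rfl,
      mul_smul_comm, smul_smul]
    have e : ∀ i j : ZMod 2, ksign i (i + i + j) * ksign i j = 1 := by decide
    rw [e, one_smul]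
  have h3 : ∑ q : Idx n m, ∑ p : Idx n m, ksign q.parity (q.parity + i.parity + j.parity) •
      ((ksign q.parity i.parity • (if q = p then t i else 0)) *
        (if j = q then t p else 0)) = t i * t j := by
    rw [Finset.sum_eq_single j (fun q _ hq => by
      refine Finset.sum_eq_zero fun p _ => ?_
      rw [if_neg hq.symm, mul_zero, zsmul_zero]) (by simp), Finset.sum_eq_single j (fun p _ hp => by
        rw [if_neg hp.symm, zsmul_zero, zero_mul, zsmul_zero]) (by simp), if_pos rfl, if_pos rfl,
      smul_mul_assoc, smul_smul]
    have e : ∀ i j : ZMod 2, ksign j (j + i + j) * ksign j i = 1 := by decide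
    rw [e, one_smul]
  have h4 : ∑ q : Idx n m, ∑ p : Idx n m, ksign q.parity (q.parity + i.parity + j.parity) •
      ((ksign q.parity i.parity • (if q = p then t i else 0)) *
        (ksign p.parity j.parity • (if p = q then t j else 0))) =
        ((n : ℝ) - m) • (t i * t j) := by
    have h : ((n : ℝ) - m) • (t i * t j) = ((n : ℤ) - m) • (t i * t j) := by
      rw [← Int.cast_smul_eq_zsmul ℝ]; push_cast; rfl
    rw [h, ← sum_psign, Finset.sum_smul]
    refine Finset.sum_congr rfl fun q _ => ?_
    rw [Finset.sum_eq_single q (fun p _ hp => by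
      rw [if_neg hp.symm, zsmul_zero, zero_mul, zsmul_zero]) (by simp), if_pos rfl, if_pos rfl,
      smul_mul_assoc, mul_smul_comm, smul_smul, smul_smul]
    have e : ∀ q i j : ZMod 2, ksign q (q + i + j) * ksign q i * ksign q j = psign q := by
      unfold psign; decide
    rw [e]
  simp only [smul_add, Finset.sum_add_distrib, h1, h2, h3, h4]
  module

/-- The contraction of `Π Π`, where `Π` is `G` with a multiple `r` of its trace removed. -/
theorem sum_descriptive_mul (hp : ∀ i j k, (G i j k).IsParity (i.parity + j.parity + k.parity))
    (hs : ∀ i j k, G i j k = ksign i.parity j.parity • G j i k)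
    (ht : ∀ i, ∑ s : Idx n m, psign s.parity • G i s s = t i)
    (htp : ∀ i, (t i).IsParity i.parity) (r : ℝ) (i j : Idx n m) :
    ∑ q : Idx n m, ∑ p : Idx n m, ksign q.parity (q.parity + i.parity + j.parity) •
      ((G q i p - r • ((if i = p then t q else 0) +
          ksign q.parity i.parity • (if q = p then t i else 0))) *
        (G p j q - r • ((if j = q then t p else 0) +
          ksign p.parity j.parity • (if p = q then t j else 0)))) =
      ∑ q : Idx n m, ∑ p : Idx n m, ksign q.parity (q.parity + i.parity + j.parity) •
        (G q i p * G p j q) -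
      r • ((2 : ℝ) • ∑ k, G i j k * t k + (2 : ℝ) • (t i * t j)) +
      r ^ 2 • (((n : ℝ) - m + 3) • (t i * t j)) := by
  rw [← sum_mul_trace hp hs ht htp i j, ← sum_trace_mul_trace htp i j]
  simp only [Finset.smul_sum, ← Finset.sum_sub_distrib, ← Finset.sum_add_distrib]
  refine Finset.sum_congr rfl fun q _ => Finset.sum_congr rfl fun p _ => ?_
  rw [mul_expand]
  module

end Quadratic

/-- The contraction of the descriptive symbols `Π` in terms of the contraction and the trace of `Γ`. -/
theorem IsSymmetric.contraction_descriptive (hΓ : Γ.IsSymmetric) (i j : Idx n m) :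
    Γ.descriptive.contraction i j = Γ.contraction i j -
      (1 / ((n : ℝ) - m + 1)) • (SuperFun.pd i (Γ.trace j) +
        ksign i.parity j.parity • SuperFun.pd j (Γ.trace i)) +
      (1 / ((n : ℝ) - m + 1)) • ((2 : ℝ) • ∑ k, Γ i j k * Γ.trace k +
        (2 : ℝ) • (Γ.trace i * Γ.trace j)) -
      (1 / ((n : ℝ) - m + 1)) ^ 2 • (((n : ℝ) - m + 3) • (Γ.trace i * Γ.trace j)) := by
  -- The trace part of `Π`, differentiated.
  have hd : ∑ q : Idx n m, ksign q.parity (q.parity + i.parity + j.parity) •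
      SuperFun.pd q ((if j = q then Γ.trace i else 0) +
        ksign i.parity j.parity • (if i = q then Γ.trace j else 0)) =
      SuperFun.pd i (Γ.trace j) + ksign i.parity j.parity • SuperFun.pd j (Γ.trace i) := by
    simp only [map_add, map_zsmul, smul_add, Finset.sum_add_distrib]
    rw [Finset.sum_eq_single j (fun q _ hq => by rw [if_neg hq.symm, map_zero, zsmul_zero])
      (by simp), Finset.sum_eq_single i (fun q _ hq => by
        rw [if_neg hq.symm, map_zero, zsmul_zero, zsmul_zero]) (by simp), if_pos rfl, if_pos rfl,
      smul_smul, add_comm]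
    have e1 : ∀ i j : ZMod 2, ksign i (i + i + j) * ksign i j = 1 := by decide
    have e2 : ∀ i j : ZMod 2, ksign j (j + i + j) = ksign i j := by decide
    rw [e1, e2, one_smul]
  have hquad := sum_descriptive_mul hΓ.parity hΓ.symm (fun _ => rfl) hΓ.isParity_trace
    (1 / ((n : ℝ) - m + 1)) i j
  have hdd : ∑ q : Idx n m, ksign q.parity (q.parity + i.parity + j.parity) •
      SuperFun.pd q (Γ.descriptive i j q) =
      ∑ q : Idx n m, ksign q.parity (q.parity + i.parity + j.parity) • SuperFun.pd q (Γ i j q) -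
      (1 / ((n : ℝ) - m + 1)) • (SuperFun.pd i (Γ.trace j) +
        ksign i.parity j.parity • SuperFun.pd j (Γ.trace i)) := by
    rw [← hd, Finset.smul_sum, ← Finset.sum_sub_distrib]
    refine Finset.sum_congr rfl fun q _ => ?_
    rw [descriptive, map_sub, map_smul, smul_sub, smul_comm]
  have hc : ∀ G : Christoffel m W, G.contraction i j =
      ∑ q : Idx n m, ksign q.parity (q.parity + i.parity + j.parity) • SuperFun.pd q (G i j q) -
      ∑ q : Idx n m, ∑ p : Idx n m, ksign q.parity (q.parity + i.parity + j.parity) •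
        (G q i p * G p j q) := fun G => by
    simp only [contraction, smul_sub, Finset.sum_sub_distrib, Finset.smul_sum]
  rw [hc, hc, hdd, show (∑ q : Idx n m, ∑ p : Idx n m,
    ksign q.parity (q.parity + i.parity + j.parity) •
      (Γ.descriptive q i p * Γ.descriptive p j q)) = _ from hquad]
  abel

/-- The function `Q_{ji}` measuring the failure of `∇̃^h_j ∂_i^h = (∇_j ∂_i)^h + Q_{ji} ℰ` to be
horizontal. -/
def defect (Γ : Christoffel m W) (j i : Idx n m) : SuperFun m W :=
  (((n : ℝ) - m + 1) / ((n : ℝ) - m - 1)) • Γ.descriptive.contraction j i -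
    SuperFun.pd j (Γ.trace i) + ∑ k, Γ j i k * Γ.trace k -
      (1 / ((n : ℝ) - m + 1)) • (Γ.trace j * Γ.trace i)

/-- Up to a term which is super-antisymmetric in `j` and `i`, the defect is a multiple of the Ricci
tensor. -/
theorem IsSymmetric.defect_eq (hΓ : Γ.IsSymmetric) (h1 : (n : ℝ) - m - 1 ≠ 0)
    (h2 : (n : ℝ) - m + 1 ≠ 0) (j i : Idx n m) : Γ.defect j i =
      (((n : ℝ) - m + 1) / ((n : ℝ) - m - 1)) • Γ.ricci i j +
        (1 / ((n : ℝ) - m - 1)) • (SuperFun.pd j (Γ.trace i) -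
          ksign i.parity j.parity • SuperFun.pd i (Γ.trace j)) := by
  rw [defect, hΓ.contraction_descriptive, hΓ.ricci_eq, ksign_comm j.parity]
  generalize ksign i.parity j.parity • SuperFun.pd i (Γ.trace j) = X
  generalize SuperFun.pd j (Γ.trace i) = Y
  generalize ∑ k, Γ j i k * Γ.trace k = Z
  generalize Γ.trace j * Γ.trace i = T
  generalize Γ.contraction j i = F
  match_scalars <;> field_simp <;> ring

/-- The supersymmetrization of the defect is a multiple of the tensor `r`. -/
theorem IsSymmetric.defect_symm (hΓ : Γ.IsSymmetric) (h1 : (n : ℝ) - m - 1 ≠ 0)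
    (h2 : (n : ℝ) - m + 1 ≠ 0) (j i : Idx n m) :
    Γ.defect j i + ksign i.parity j.parity • Γ.defect i j =
      (2 * ((n : ℝ) - m + 1)) • Γ.rTensor j i := by
  rw [hΓ.defect_eq h1 h2, hΓ.defect_eq h1 h2, rTensor, ksign_comm j.parity]
  generalize SuperFun.pd i (Γ.trace j) = X
  generalize SuperFun.pd j (Γ.trace i) = Y
  generalize Γ.ricci i j = Z
  generalize Γ.ricci j i = Z'
  have hk : ksign i.parity j.parity = 1 ∨ ksign i.parity j.parity = -1 := by
    unfold ksign; split_ifs <;> simp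
  rcases hk with hk | hk <;> rw [hk] <;> match_scalars <;> field_simp <;> ring

end Christoffel

/-! ### Covariant derivatives as superderivations -/

open Grassmann

namespace Symb

variable {N m : ℕ} {B : Type*} [CommRing B] [Module ℝ B]

theorem contr_ofBase_mul (i : Idx N m) {f : Grassmann (Fin m) B} {p : ZMod 2} (hf : f.IsParity p)
    (S : Symb N m B) :
    contr i (ofBase f * S) = ksign i.parity p • (ofBase f * contr i S) := by
  have h := (isSuperDer_contr (B := B) i).leibniz_of_isParity (isParity_ofBase (N := N) hf) S
  simpa using h

theorem contr_xi_mul (i j : Idx N m) (S : Symb N m B) :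
    contr i (xi j * S) = (if i = j then S else 0) + ksign i.parity j.parity • (xi j * contr i S) := by
  have h := (isSuperDer_contr (B := B) i).leibniz_of_isParity (isParity_xi (N := N) j) S
  rw [contr_xi, RingHom.id_apply, RingHom.id_apply] at h
  rw [h, ite_mul, one_mul, zero_mul]

theorem _root_.SuperGeometry.psign_eq (p : ZMod 2) : psign p = ksign p p := by
  revert p; unfold psign; decide

/-- The divergence of `∑ j, ξ_j S`. -/
theorem sum_contr_xi_mul (S : Symb N m B) :
    ∑ j : Idx N m, psign j.parity • contr j (xi j * S) = ((N : ℝ) - m) • S + euler S := by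
  have h : ∀ j : Idx N m, psign j.parity • contr j (xi j * S) =
      psign j.parity • S + xi j * contr j S := fun j => by
    rw [contr_xi_mul, if_pos rfl, smul_add, psign_eq, smul_smul, ksign_mul_self, one_smul]
  rw [Finset.sum_congr rfl fun j _ => h j, Finset.sum_add_distrib, ← Finset.sum_smul,
    Christoffel.sum_psign, euler_apply, ← Int.cast_smul_eq_zsmul ℝ]
  push_cast
  rfl

end Symb

namespace Christoffel

variable {N m : ℕ} {W : Opens (Eu N)}

/-- The covariant derivative `∇_{∂_i}` of tensors, as an additive map. -/
def nabla (Γ : Christoffel m W) (i : Idx N m) : Symb N m (Smooth W) →+ Symb N m (Smooth W) :=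
  Symb.pd i + ∑ j : Idx N m,
    (AddMonoidHom.mulLeft (∑ k : Idx N m, Symb.ofBase (Γ i j k) * Symb.xi k)).comp (Symb.contr j)

theorem covDer_eq (Γ : Christoffel m W) (δ : ℝ) (i : Idx N m) (S : Symb N m (Smooth W)) :
    Γ.covDer δ i S = Γ.nabla i S - δ • (Symb.ofBase (Γ.trace i) * S) := by
  rw [covDer, nabla, AddMonoidHom.add_apply, AddMonoidHom.finsetSum_apply]
  simp only [AddMonoidHom.comp_apply, AddMonoidHom.coe_mulLeft]
  abel

variable {Γ : Christoffel m W}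

theorem isSuperDer_nabla (hΓ : ∀ i j k, (Γ i j k).IsParity (i.parity + j.parity + k.parity))
    (i : Idx N m) : IsSuperDer (RingHom.id (Symb N m (Smooth W))) i.parity (Γ.nabla i) := by
  refine (Symb.isSuperDer_pd i).add (IsSuperDer.sum _ fun j _ => ?_)
  refine ((Symb.isSuperDer_contr j).mulLeft (q := i.parity + j.parity) preservesParity_id
    (isParity_sum _ fun k _ => ?_)).congr_parity ?_
  · refine ((Symb.isParity_ofBase (hΓ i j k)).mul (Symb.isParity_xi k)).congr ?_
    rw [add_assoc, CharTwo.add_self_eq_zero, add_zero]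
  · rw [add_assoc, CharTwo.add_self_eq_zero, add_zero]

theorem nabla_ofBase (i : Idx N m) (f : SuperFun m W) :
    Γ.nabla i (Symb.ofBase f) = Symb.ofBase (SuperFun.pd i f) := by
  rw [nabla, AddMonoidHom.add_apply, AddMonoidHom.finsetSum_apply, Symb.pd_ofBase]
  simp

theorem nabla_xi (i j : Idx N m) :
    Γ.nabla i (Symb.xi j) = ∑ k : Idx N m, Symb.ofBase (Γ i j k) * Symb.xi k := by
  rw [nabla, AddMonoidHom.add_apply, AddMonoidHom.finsetSum_apply, Symb.pd_xi, zero_add]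
  simp [Symb.contr_xi]

theorem div_eq (Γ : Christoffel m W) (δ : ℝ) (S : Symb N m (Smooth W)) : Γ.div δ S =
    ∑ j : Idx N m, psign j.parity • Symb.contr j (Γ.nabla j S - δ • (Symb.ofBase (Γ.trace j) * S)) := by
  simp only [div, covDer_eq]

end Christoffel

/-! ### The Thomas superconnection in the horizontal frame -/

section Cylinder

variable {n m : ℕ} {W : Opens (Eu n)}

theorem parity_timeIdx : (timeIdx : Idx (n + 1) m).parity = 0 := rfl

theorem parity_baseIdx (i : Idx n m) : (baseIdx i).parity = i.parity := by cases i <;> rfl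

theorem toBase_timeIdx : toBase (timeIdx : Idx (n + 1) m) = none := rfl

theorem toBase_baseIdx (i : Idx n m) : toBase (baseIdx i) = some i := by cases i <;> rfl

theorem baseIdx_inj {i j : Idx n m} : baseIdx i = baseIdx j ↔ i = j := by
  refine ⟨fun h => ?_, fun h => h ▸ rfl⟩
  have := congrArg toBase h
  rwa [toBase_baseIdx, toBase_baseIdx, Option.some.injEq] at this

theorem baseIdx_ne_timeIdx (i : Idx n m) : baseIdx i ≠ timeIdx := fun h => by
  have := congrArg toBase h
  rw [toBase_baseIdx, toBase_timeIdx] at this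
  exact Option.some_ne_none _ this

theorem idx_cases {P : Idx (n + 1) m → Prop} (h0 : P timeIdx) (h : ∀ i : Idx n m, P (baseIdx i))
    (a : Idx (n + 1) m) : P a := by
  rcases a with a | j
  · exact Fin.cases h0 (fun i => h (.inl i)) a
  · exact h (.inr j)

theorem sum_idx {M : Type*} [AddCommMonoid M] (F : Idx (n + 1) m → M) :
    ∑ a, F a = F timeIdx + ∑ i : Idx n m, F (baseIdx i) := by
  rw [Fintype.sum_sum_type, Fintype.sum_sum_type, Fin.sum_univ_succ, add_assoc]
  rfl

/-- The ring homomorphism `liftFun`. -/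
def liftHom : SuperFun m W →+* SuperFun m (cyl W) :=
  mapHom (Smooth.comp dropTime contDiff_dropTime fun _ hx => hx)

theorem liftHom_apply (f : SuperFun m W) : liftHom f = liftFun f := rfl

theorem preservesParity_liftHom : PreservesParity (liftHom (m := m) (W := W)) :=
  preservesParity_mapHom _

theorem liftHom_smul (r : ℝ) (f : SuperFun m W) : liftHom (r • f) = r • liftHom f := rfl

theorem hasFDerivAt_dropTime (y : Eu (n + 1)) :
    ∃ L : Eu (n + 1) →L[ℝ] Eu n, HasFDerivAt (dropTime (n := n)) L y ∧
      L (EuclideanSpace.single 0 1) = 0 ∧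
      ∀ i : Fin n, L (EuclideanSpace.single i.succ 1) = EuclideanSpace.single i 1 := by
  let f : Eu (n + 1) →ₗ[ℝ] Eu n :=
    { toFun := dropTime
      map_add' := fun x y => rfl
      map_smul' := fun r x => rfl }
  refine ⟨LinearMap.toContinuousLinearMap f, (LinearMap.toContinuousLinearMap f).hasFDerivAt,
    ?_, fun i => ?_⟩
  · ext k
    change (EuclideanSpace.single (0 : Fin (n + 1)) (1 : ℝ)) k.succ = 0
    simp
  · ext k
    change (EuclideanSpace.single i.succ (1 : ℝ)) k.succ = (EuclideanSpace.single i (1 : ℝ)) k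
    simp [Fin.succ_inj]

theorem dirDeriv_comp_dropTime (v : Eu (n + 1)) (w : Eu n)
    (h : ∀ (y : Eu (n + 1)) (L : Eu (n + 1) →L[ℝ] Eu n), HasFDerivAt (dropTime (n := n)) L y →
      L v = w) (f : Smooth W) :
    Smooth.dirDeriv v (Smooth.comp dropTime contDiff_dropTime (fun _ hx => hx) f :
      Smooth (cyl W)) = Smooth.comp dropTime contDiff_dropTime (fun _ hx => hx)
        (Smooth.dirDeriv w f) := by
  ext y
  obtain ⟨L, hL, -, -⟩ := hasFDerivAt_dropTime (n := n) y.1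
  refine (Smooth.rawDeriv_eq v _ y
    ((Smooth.hasFDerivAt f ⟨dropTime y.1, y.2⟩).comp y.1 hL) (fun z => ?_)).trans ?_
  · exact (zeroExt_apply f.1 ⟨dropTime z.1, z.2⟩).symm
  · change fderiv ℝ (zeroExt f.1) (dropTime y.1) (L v) = _
    rw [h y.1 L hL]; rfl

theorem pd_time_lift (f : SuperFun m W) :
    SuperFun.pd timeIdx (liftHom f : SuperFun m (cyl W)) = 0 := by
  refine Grassmann.ext (funext fun K => ?_)
  refine (dirDeriv_comp_dropTime _ 0 (fun y L hL => ?_) (f.coeff K)).trans ?_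
  · obtain ⟨L', hL', h0, -⟩ := hasFDerivAt_dropTime (n := n) y
    rw [hL.unique hL', h0]
  · have : Smooth.dirDeriv (0 : Eu n) (f.coeff K) = 0 := by
      ext x
      exact (fderiv ℝ (zeroExt (f.coeff K).1) x).map_zero
    rw [this, map_zero]; rfl

theorem pd_base_lift (i : Idx n m) (f : SuperFun m W) :
    SuperFun.pd (baseIdx i) (liftHom f : SuperFun m (cyl W)) = liftHom (SuperFun.pd i f) := by
  rcases i with i | j
  · refine Grassmann.ext (funext fun K => ?_)
    refine dirDeriv_comp_dropTime _ _ (fun y L hL => ?_) (f.coeff K)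
    obtain ⟨L', hL', -, h1⟩ := hasFDerivAt_dropTime (n := n) y
    rw [hL.unique hL', h1]
  · refine Grassmann.ext (funext fun K => ?_)
    change (leftDeriv j (mapCoeff _ f)).coeff K = _
    change _ = (Smooth.comp dropTime contDiff_dropTime (fun _ hx => hx))
      ((leftDeriv j f).coeff K)
    rw [coeff_leftDeriv, coeff_leftDeriv]
    split_ifs
    · rw [map_zero]
    · rw [map_mul, map_intCast]; rfl

theorem isParity_expTime (δ : ℝ) : (expTime δ : SuperFun m (cyl W)).IsParity 0 :=
  isParity_ofScalar _

theorem hasFDerivAt_expTime (δ : ℝ) (y : Eu (n + 1)) :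
    HasFDerivAt (fun y : Eu (n + 1) => Real.exp (δ * y 0))
      (Real.exp (δ * y 0) • (δ • (EuclideanSpace.proj (𝕜 := ℝ) 0 : Eu (n + 1) →L[ℝ] ℝ))) y :=
  (((EuclideanSpace.proj (𝕜 := ℝ) 0 : Eu (n + 1) →L[ℝ] ℝ).hasFDerivAt).const_mul δ).exp

theorem pd_time_expTime (δ : ℝ) :
    SuperFun.pd timeIdx (expTime δ : SuperFun m (cyl W)) = δ • expTime δ := by
  refine (SuperFun.pd_ofScalar_inl _ _).trans ?_
  have h : Smooth.dirDeriv (EuclideanSpace.single (0 : Fin (n + 1)) (1 : ℝ))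
      (Smooth.mk' (fun y => Real.exp (δ * y 0)) (by fun_prop) : Smooth (cyl W)) =
        δ • Smooth.mk' (fun y => Real.exp (δ * y 0)) (by fun_prop) := by
    ext y
    refine (Smooth.rawDeriv_eq _ _ y (hasFDerivAt_expTime δ y.1) (fun z => rfl)).trans ?_
    change Real.exp (δ * y.1 0) * (δ * (EuclideanSpace.single (0 : Fin (n + 1)) (1 : ℝ)) 0) =
      δ * Real.exp (δ * y.1 0)
    simp [mul_comm]
  rw [h]
  ext K : 2
  simp only [ofScalar, expTime, coeff_smul]
  split_ifs
  · rfl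
  · rw [smul_zero]

theorem pd_base_expTime (δ : ℝ) (i : Idx n m) :
    SuperFun.pd (baseIdx i) (expTime δ : SuperFun m (cyl W)) = 0 := by
  rcases i with i | j
  · refine (SuperFun.pd_ofScalar_inl _ _).trans ?_
    have h : Smooth.dirDeriv (EuclideanSpace.single i.succ (1 : ℝ))
        (Smooth.mk' (fun y => Real.exp (δ * y 0)) (by fun_prop) : Smooth (cyl W)) = 0 := by
      ext y
      refine (Smooth.rawDeriv_eq _ _ y (hasFDerivAt_expTime δ y.1) (fun z => rfl)).trans ?_
      change Real.exp (δ * y.1 0) * (δ * (EuclideanSpace.single i.succ (1 : ℝ)) 0) = 0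
      simp
    rw [h]
    exact mono_zero ∅
  · exact SuperFun.pd_ofScalar_inr _ _

end Cylinder

open Grassmann

namespace Symb

theorem substHom_smul {N N' m : ℕ} {B B' : Type*} [CommRing B] [Algebra ℝ B] [CommRing B']
    [Algebra ℝ B'] {g : Grassmann (Fin m) B →+* Grassmann (Fin m) B'} {hg : PreservesParity g}
    {η : Idx N m → Symb N' m B'} {hη : ∀ i, (η i).IsParity i.parity}
    (h : ∀ (r : ℝ), g (r • 1) = r • 1) (r : ℝ) (S : Symb N m B) :
    substHom g hg η hη (r • S) = r • substHom g hg η hη S := by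
  have e (T : Symb N m B) : r • T = ofBase (r • 1) * T := by
    rw [ofBase_smul, ofBase_one, smul_mul_assoc, one_mul]
  rw [e, map_mul, substHom_ofBase, h, ofBase_smul, ofBase_one, smul_mul_assoc, one_mul]

end Symb

namespace Christoffel

variable {n m : ℕ} {W : Opens (Eu n)} (Γ : Christoffel m W)

theorem thomas_time (b c : Idx (n + 1) m) :
    Γ.thomas timeIdx b c = if b = c then (-1 / ((n : ℝ) - m + 1)) • 1 else 0 := by
  rw [thomas, toBase_timeIdx]

theorem thomas_base_time (i : Idx n m) (c : Idx (n + 1) m) :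
    Γ.thomas (baseIdx i) timeIdx c =
      if baseIdx i = c then (-1 / ((n : ℝ) - m + 1)) • 1 else 0 := by
  rw [thomas, toBase_timeIdx, toBase_baseIdx]

theorem thomas_base_base_base (i j k : Idx n m) :
    Γ.thomas (baseIdx i) (baseIdx j) (baseIdx k) = liftHom (Γ.descriptive i j k) := by
  rw [thomas, toBase_baseIdx, toBase_baseIdx, toBase_baseIdx]; rfl

theorem thomas_base_base_time (i j : Idx n m) : Γ.thomas (baseIdx i) (baseIdx j) timeIdx =
    liftHom ((((n : ℝ) - m + 1) / ((n : ℝ) - m - 1)) • Γ.descriptive.contraction i j) := by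
  rw [thomas, toBase_baseIdx, toBase_baseIdx, toBase_timeIdx]; rfl

variable {Γ}

theorem IsSymmetric.isParity_descriptive (hΓ : Γ.IsSymmetric) (i j k : Idx n m) :
    (Γ.descriptive i j k).IsParity (i.parity + j.parity + k.parity) := by
  refine (hΓ.parity i j k).sub (IsParity.smul (IsParity.add ?_ (IsParity.zsmul ?_ _)) _)
  · split_ifs with h
    · exact (hΓ.isParity_trace i).congr (by
        rw [h, add_assoc, CharTwo.add_self_eq_zero, add_zero])
    · exact isParity_zero _
  · split_ifs with h
    · exact (hΓ.isParity_trace j).congr (by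
        rw [h, add_comm k.parity, add_assoc, CharTwo.add_self_eq_zero, add_zero])
    · exact isParity_zero _

theorem isParity_contraction {G : Christoffel m W}
    (hG : ∀ i j k, (G i j k).IsParity (i.parity + j.parity + k.parity)) (i j : Idx n m) :
    (G.contraction i j).IsParity (i.parity + j.parity) := by
  refine isParity_sum _ fun q _ => IsParity.zsmul (IsParity.sub ?_ (isParity_sum _ fun p _ => ?_)) _
  · refine (SuperFun.pd_parity q (hG i j q)).congr ?_
    generalize q.parity = q; generalize i.parity = i; generalize j.parity = j
    revert q i j; decide
  · refine ((hG q i p).mul (hG p j q)).congr ?_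
    generalize q.parity = q; generalize i.parity = i; generalize j.parity = j
    generalize p.parity = p
    revert q i j p; decide

theorem IsSymmetric.isParity_thomas (hΓ : Γ.IsSymmetric) (a b c : Idx (n + 1) m) :
    (Γ.thomas a b c).IsParity (a.parity + b.parity + c.parity) := by
  have hconst : ∀ (p : ZMod 2), p = 0 →
      ((-1 / ((n : ℝ) - m + 1)) • (1 : SuperFun m (cyl W))).IsParity p := fun p hp =>
    (isParity_one.smul _).congr hp.symm
  induction a using idx_cases with
  | h0 =>
    rw [thomas_time]
    split_ifs with h
    · refine hconst _ ?_
      rw [h, parity_timeIdx, zero_add, CharTwo.add_self_eq_zero]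
    · exact isParity_zero _
  | h i =>
    induction b using idx_cases with
    | h0 =>
      rw [thomas_base_time]
      split_ifs with h
      · refine hconst _ ?_
        rw [h, parity_timeIdx, add_zero, CharTwo.add_self_eq_zero]
      · exact isParity_zero _
    | h j =>
      induction c using idx_cases with
      | h0 =>
        rw [thomas_base_base_time, parity_baseIdx, parity_baseIdx, parity_timeIdx, add_zero]
        exact preservesParity_liftHom _ _
          ((isParity_contraction hΓ.isParity_descriptive i j).smul _)
      | h k =>
        rw [thomas_base_base_base, parity_baseIdx, parity_baseIdx, parity_baseIdx]
        exact preservesParity_liftHom _ _ (hΓ.isParity_descriptive i j k)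

theorem sum_ite_xi (b : Idx (n + 1) m) (r : ℝ) :
    ∑ c, Symb.ofBase (if b = c then r • (1 : SuperFun m (cyl W)) else 0) * Symb.xi c =
      r • Symb.xi b := by
  rw [Finset.sum_eq_single b (fun c _ hc => by rw [if_neg hc.symm, Symb.ofBase_zero, zero_mul])
    (by simp), if_pos rfl, Symb.ofBase_smul, Symb.ofBase_one, smul_mul_assoc, one_mul]

theorem nabla_time_xi (b : Idx (n + 1) m) :
    Γ.thomas.nabla timeIdx (Symb.xi b) = (-1 / ((n : ℝ) - m + 1)) • Symb.xi b := by
  rw [nabla_xi]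
  simp only [thomas_time]
  exact sum_ite_xi b _

theorem nabla_base_time (j : Idx n m) :
    Γ.thomas.nabla (baseIdx j) (Symb.xi timeIdx) =
      (-1 / ((n : ℝ) - m + 1)) • Symb.xi (baseIdx j) := by
  rw [nabla_xi]
  simp only [thomas_base_time]
  exact sum_ite_xi _ _

theorem nabla_base_base (j i : Idx n m) :
    Γ.thomas.nabla (baseIdx j) (Symb.xi (baseIdx i)) =
      Symb.ofBase (liftHom ((((n : ℝ) - m + 1) / ((n : ℝ) - m - 1)) •
        Γ.descriptive.contraction j i)) * Symb.xi timeIdx +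
      ∑ k : Idx n m, Symb.ofBase (liftHom (Γ.descriptive j i k)) * Symb.xi (baseIdx k) := by
  rw [nabla_xi, sum_idx]
  simp only [thomas_base_base_time, thomas_base_base_base]

variable (Γ) in
/-- The horizontal frame vector `∂_i^h`. -/
def horiz (i : Idx n m) : Symb (n + 1) m (Smooth (cyl W)) :=
  Symb.xi (baseIdx i) - Symb.ofBase (liftFun (Γ.trace i)) * Symb.xi timeIdx

theorem isParity_eulerField : (eulerField : Symb (n + 1) m (Smooth (cyl W))).IsParity 0 :=
  Symb.isParity_xi timeIdx

theorem IsSymmetric.isParity_horiz (hΓ : Γ.IsSymmetric) (i : Idx n m) :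
    (Γ.horiz i).IsParity i.parity := by
  refine ((Symb.isParity_xi (baseIdx i)).congr (parity_baseIdx i)).sub ?_
  exact ((Symb.isParity_ofBase (preservesParity_liftHom _ _ (hΓ.isParity_trace i))).mul
    (Symb.isParity_xi timeIdx)).congr (add_zero _)

/-- The horizontal lift of tensors of weight zero, as a ring homomorphism. -/
def IsSymmetric.liftTensor (hΓ : Γ.IsSymmetric) :
    Symb n m (Smooth W) →+* Symb (n + 1) m (Smooth (cyl W)) :=
  Symb.substHom liftHom preservesParity_liftHom Γ.horiz hΓ.isParity_horiz

theorem IsSymmetric.liftTensor_ofBase (hΓ : Γ.IsSymmetric) (f : SuperFun m W) :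
    hΓ.liftTensor (Symb.ofBase f) = Symb.ofBase (liftHom f) := Symb.substHom_ofBase f

theorem IsSymmetric.liftTensor_xi (hΓ : Γ.IsSymmetric) (i : Idx n m) :
    hΓ.liftTensor (Symb.xi i) = Γ.horiz i := Symb.substHom_xi i

theorem IsSymmetric.liftTensor_smul (hΓ : Γ.IsSymmetric) (r : ℝ) (S : Symb n m (Smooth W)) :
    hΓ.liftTensor (r • S) = r • hΓ.liftTensor S :=
  Symb.substHom_smul (fun r => by rw [liftHom_smul, map_one]) r S

theorem IsSymmetric.preservesParity_liftTensor (hΓ : Γ.IsSymmetric) :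
    PreservesParity hΓ.liftTensor := Symb.preservesParity_substHom

/-! ### Vertical derivatives and interior products of horizontal lifts -/

theorem IsSymmetric.nabla_time_horiz (hΓ : Γ.IsSymmetric) (i : Idx n m) :
    Γ.thomas.nabla timeIdx (Γ.horiz i) = (-1 / ((n : ℝ) - m + 1)) • Γ.horiz i := by
  have hD := isSuperDer_nabla hΓ.isParity_thomas timeIdx
  rw [parity_timeIdx] at hD
  rw [horiz, map_sub, nabla_time_xi, hD.leibniz, ← liftHom_apply, nabla_ofBase, pd_time_lift,
    nabla_time_xi, invol_zero, Symb.ofBase_zero, zero_mul, zero_add, smul_sub]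
  simp only [RingHom.id_apply, mul_smul_comm]

/-- On horizontal lifts of tensors of degree `k`, `∇̃_0` is multiplication by `-k / (n - m + 1)`. -/
theorem IsSymmetric.nabla_time_liftTensor (hΓ : Γ.IsSymmetric) (S : Symb n m (Smooth W)) :
    Γ.thomas.nabla timeIdx (hΓ.liftTensor S) =
      (-1 / ((n : ℝ) - m + 1)) • hΓ.liftTensor (Symb.euler S) := by
  have hD := isSuperDer_nabla hΓ.isParity_thomas timeIdx
  rw [parity_timeIdx] at hD
  have h1 := hD.comp_hom hΓ.preservesParity_liftTensor
  have h2 := (Symb.isSuperDer_euler (B := Smooth W)).hom_comp hΓ.preservesParity_liftTensor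
  have h3 : IsSuperDer ((RingHom.id (Symb (n + 1) m (Smooth (cyl W)))).comp hΓ.liftTensor) 0
      ((AddMonoidHom.mulLeft ((-1 / ((n : ℝ) - m + 1)) • (1 : Symb (n + 1) m (Smooth (cyl W))))).comp
        (hΓ.liftTensor.toAddMonoidHom.comp Symb.euler)) :=
    (h2.mulLeft (q := 0) hΓ.preservesParity_liftTensor (isParity_one.smul _)).congr_parity
      (add_zero 0)
  have h := DFunLike.congr_fun (Symb.superDer_ext h1 h3 (fun f => ?_) fun i => ?_) S
  · refine h.trans ?_
    simp
  · change Γ.thomas.nabla timeIdx (hΓ.liftTensor (Symb.ofBase f)) = _ * hΓ.liftTensor (Symb.euler _)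
    rw [hΓ.liftTensor_ofBase, nabla_ofBase, pd_time_lift, Symb.euler_ofBase, map_zero, mul_zero,
      Symb.ofBase_zero]
  · change Γ.thomas.nabla timeIdx (hΓ.liftTensor (Symb.xi i)) = _ * hΓ.liftTensor (Symb.euler _)
    rw [hΓ.liftTensor_xi, hΓ.nabla_time_horiz, Symb.euler_xi, hΓ.liftTensor_xi, smul_mul_assoc,
      one_mul]

theorem contr_base_horiz (j i : Idx n m) :
    Symb.contr (baseIdx j) (Γ.horiz i) = if j = i then 1 else 0 := by
  have h := (Symb.isSuperDer_contr (B := Smooth (cyl W)) (baseIdx j : Idx (n + 1) m)).leibniz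
    (Symb.ofBase (liftFun (Γ.trace i))) (Symb.xi timeIdx)
  rw [Symb.contr_ofBase, zero_mul, zero_add, Symb.contr_xi, if_neg (baseIdx_ne_timeIdx j),
    mul_zero] at h
  rw [horiz, map_sub, h, Symb.contr_xi, sub_zero]
  simp only [baseIdx_inj]

theorem IsSymmetric.contr_base_liftTensor (hΓ : Γ.IsSymmetric) (j : Idx n m)
    (S : Symb n m (Smooth W)) :
    Symb.contr (baseIdx j) (hΓ.liftTensor S) = hΓ.liftTensor (Symb.contr j S) := by
  have h1 := ((Symb.isSuperDer_contr (B := Smooth (cyl W)) (baseIdx j)).comp_hom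
    hΓ.preservesParity_liftTensor).congr_parity (parity_baseIdx j)
  have h2 := (Symb.isSuperDer_contr (B := Smooth W) j).hom_comp hΓ.preservesParity_liftTensor
  refine DFunLike.congr_fun (Symb.superDer_ext h1 h2 (fun f => ?_) fun i => ?_) S
  · change Symb.contr _ (hΓ.liftTensor (Symb.ofBase f)) = hΓ.liftTensor (Symb.contr _ _)
    rw [hΓ.liftTensor_ofBase, Symb.contr_ofBase, Symb.contr_ofBase, map_zero]
  · change Symb.contr _ (hΓ.liftTensor (Symb.xi i)) = hΓ.liftTensor (Symb.contr _ _)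
    rw [hΓ.liftTensor_xi, contr_base_horiz, Symb.contr_xi]
    split_ifs
    · rw [map_one]
    · rw [map_zero]

variable (Γ) in
/-- The interior product by the coframe element dual to `ℰ` in the horizontal frame. -/
def contrVert : Symb (n + 1) m (Smooth (cyl W)) →+ Symb (n + 1) m (Smooth (cyl W)) :=
  Symb.contr timeIdx + ∑ j : Idx n m,
    (AddMonoidHom.mulLeft (Symb.ofBase (liftHom (Γ.trace j)))).comp (Symb.contr (baseIdx j))

theorem IsSymmetric.isSuperDer_contrVert (hΓ : Γ.IsSymmetric) :
    IsSuperDer (RingHom.id (Symb (n + 1) m (Smooth (cyl W)))) 0 Γ.contrVert := by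
  refine (Symb.isSuperDer_contr timeIdx).add (IsSuperDer.sum _ fun j _ => ?_)
  refine ((Symb.isSuperDer_contr (baseIdx j)).mulLeft preservesParity_id (Symb.isParity_ofBase
    (preservesParity_liftHom _ _ (hΓ.isParity_trace j)))).congr_parity ?_
  rw [parity_baseIdx, CharTwo.add_self_eq_zero, parity_timeIdx]

theorem contrVert_apply (S : Symb (n + 1) m (Smooth (cyl W))) : Γ.contrVert S =
    Symb.contr timeIdx S + ∑ j : Idx n m,
      Symb.ofBase (liftHom (Γ.trace j)) * Symb.contr (baseIdx j) S := by
  rw [contrVert, AddMonoidHom.add_apply, AddMonoidHom.finsetSum_apply]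
  rfl

theorem contrVert_ofBase (f : SuperFun m (cyl W)) : Γ.contrVert (Symb.ofBase f) = 0 := by
  simp [contrVert_apply]

theorem contrVert_time : Γ.contrVert (Symb.xi timeIdx) = 1 := by
  rw [contrVert_apply, Symb.contr_xi, if_pos rfl, Finset.sum_eq_zero, add_zero]
  intro j _
  rw [Symb.contr_xi, if_neg (baseIdx_ne_timeIdx j), mul_zero]

theorem contrVert_horiz (i : Idx n m) :
    Γ.contrVert (Γ.horiz i) = 0 := by
  have h := (Symb.isSuperDer_contr (B := Smooth (cyl W)) (timeIdx : Idx (n + 1) m)).leibniz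
    (Symb.ofBase (liftFun (Γ.trace i))) (Symb.xi timeIdx)
  rw [Symb.contr_ofBase, zero_mul, zero_add, Symb.contr_xi, if_pos rfl, parity_timeIdx, invol_zero,
    mul_one] at h
  rw [contrVert_apply]
  simp only [contr_base_horiz]
  rw [horiz, map_sub, h, Symb.contr_xi, if_neg (baseIdx_ne_timeIdx i).symm]
  simp [liftHom_apply]

theorem IsSymmetric.contrVert_liftTensor (hΓ : Γ.IsSymmetric) (S : Symb n m (Smooth W)) :
    Γ.contrVert (hΓ.liftTensor S) = 0 := by
  have h1 := hΓ.isSuperDer_contrVert.comp_hom hΓ.preservesParity_liftTensor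
  refine DFunLike.congr_fun (Symb.superDer_ext h1 IsSuperDer.zero (fun f => ?_) fun i => ?_) S
  · change Γ.contrVert (hΓ.liftTensor (Symb.ofBase f)) = 0
    rw [hΓ.liftTensor_ofBase, contrVert_ofBase]
  · change Γ.contrVert (hΓ.liftTensor (Symb.xi i)) = 0
    rw [hΓ.liftTensor_xi, contrVert_horiz]

end Christoffel

/-! ### The divergence of horizontal lifts -/

open Grassmann

theorem Symb.contr_smul {N m : ℕ} {B : Type*} [CommRing B] [Algebra ℝ B] (i : Idx N m) (r : ℝ)
    (S : Symb N m B) : Symb.contr i (r • S) = r • Symb.contr i S := by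
  have e (T : Symb N m B) : r • T = Symb.ofBase (r • 1) * T := by
    rw [Symb.ofBase_smul, Symb.ofBase_one, smul_mul_assoc, one_mul]
  rw [e, e, Symb.contr_ofBase_mul i (isParity_one.smul r), ksign_zero_right, one_smul]

namespace Christoffel

variable {n m : ℕ} {W : Opens (Eu n)} {Γ : Christoffel m W}

theorem IsSymmetric.isParity_defect (hΓ : Γ.IsSymmetric) (j i : Idx n m) :
    (Γ.defect j i).IsParity (j.parity + i.parity) := by
  refine IsParity.sub (IsParity.add (IsParity.sub ?_ ?_) (isParity_sum _ fun k _ => ?_)) ?_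
  · exact (isParity_contraction hΓ.isParity_descriptive j i).smul _
  · exact SuperFun.pd_parity j (hΓ.isParity_trace i)
  · exact ((hΓ.parity j i k).mul (hΓ.isParity_trace k)).congr (by
      rw [add_assoc, CharTwo.add_self_eq_zero, add_zero])
  · exact ((hΓ.isParity_trace j).mul (hΓ.isParity_trace i)).smul _

variable (Γ) in
/-- The superderivation `∑ i, Q_{ji} i(dx^i)`, with `Q` the coefficients `Γ.defect`. -/
def defectOp (j : Idx n m) : Symb n m (Smooth W) →+ Symb n m (Smooth W) :=
  ∑ i : Idx n m, (AddMonoidHom.mulLeft (Symb.ofBase (Γ.defect j i))).comp (Symb.contr i)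

theorem defectOp_apply (j : Idx n m) (S : Symb n m (Smooth W)) :
    Γ.defectOp j S = ∑ i, Symb.ofBase (Γ.defect j i) * Symb.contr i S := by
  rw [defectOp, AddMonoidHom.finsetSum_apply]; rfl

theorem IsSymmetric.isSuperDer_defectOp (hΓ : Γ.IsSymmetric) (j : Idx n m) :
    IsSuperDer (RingHom.id (Symb n m (Smooth W))) j.parity (Γ.defectOp j) :=
  IsSuperDer.sum _ fun i _ => ((Symb.isSuperDer_contr i).mulLeft preservesParity_id
    (Symb.isParity_ofBase (hΓ.isParity_defect j i))).congr_parity (by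
      rw [add_assoc, CharTwo.add_self_eq_zero, add_zero])

/-- Only the supersymmetric part of `Γ.defect`, a multiple of `r`, contributes to the divergence. -/
theorem IsSymmetric.sum_contr_defectOp (hΓ : Γ.IsSymmetric) (h1 : (n : ℝ) - m - 1 ≠ 0)
    (h2 : (n : ℝ) - m + 1 ≠ 0) (S : Symb n m (Smooth W)) :
    ∑ j : Idx n m, psign j.parity • Symb.contr j (Γ.defectOp j S) =
      (2 * ((n : ℝ) - m + 1)) • Γ.contrR S := by
  have hX : ∑ j : Idx n m, psign j.parity • Symb.contr j (Γ.defectOp j S) =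
      ∑ j : Idx n m, ∑ i : Idx n m, ksign i.parity j.parity •
        (Symb.ofBase (Γ.defect j i) * Symb.contr j (Symb.contr i S)) := by
    refine Finset.sum_congr rfl fun j _ => ?_
    rw [defectOp_apply, map_sum, Finset.smul_sum]
    refine Finset.sum_congr rfl fun i _ => ?_
    rw [Symb.contr_ofBase_mul j (hΓ.isParity_defect j i), smul_smul, psign_eq, ksign_add_right,
      ← mul_assoc, ksign_mul_self, one_mul, ksign_comm]
  -- Since interior products supercommute, the same sum can be written with `Q_{ij}` instead of
  -- `Q_{ji}`; the average of both involves only the supersymmetric part of `Q`.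
  have hX' : ∑ j : Idx n m, psign j.parity • Symb.contr j (Γ.defectOp j S) =
      ∑ j : Idx n m, ∑ i : Idx n m,
        Symb.ofBase (Γ.defect i j) * Symb.contr j (Symb.contr i S) := by
    rw [hX, Finset.sum_comm]
    refine Finset.sum_congr rfl fun i _ => Finset.sum_congr rfl fun j _ => ?_
    rw [Symb.contr_contr j i, mul_smul_comm, smul_smul, ksign_comm i.parity, ksign_mul_self,
      one_smul]
  have h2X : (2 : ℝ) • ∑ j : Idx n m, psign j.parity • Symb.contr j (Γ.defectOp j S) =
      (2 * ((n : ℝ) - m + 1)) • ∑ a : Idx n m, ∑ b : Idx n m,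
        Symb.ofBase (Γ.rTensor b a) * Symb.contr a (Symb.contr b S) := by
    rw [two_smul]
    nth_rw 1 [hX']
    rw [hX, ← Finset.sum_add_distrib, Finset.smul_sum]
    refine Finset.sum_congr rfl fun j _ => ?_
    rw [← Finset.sum_add_distrib, Finset.smul_sum]
    refine Finset.sum_congr rfl fun i _ => ?_
    rw [← smul_mul_assoc (2 * ((n : ℝ) - m + 1)), ← Symb.ofBase_smul,
      ← hΓ.defect_symm h1 h2 i j, Symb.ofBase_add, add_mul, Symb.ofBase_zsmul, smul_mul_assoc,
      ksign_comm j.parity]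
  rw [contrR, smul_comm, ← h2X, smul_smul]
  norm_num

variable (Γ) in
/-- The covariant derivative `∇̃` along `∂_j^h`. -/
def horizNabla (j : Idx n m) :
    Symb (n + 1) m (Smooth (cyl W)) →+ Symb (n + 1) m (Smooth (cyl W)) :=
  Γ.thomas.nabla (baseIdx j) + (AddMonoidHom.mulLeft (Symb.ofBase (-liftHom (Γ.trace j)))).comp
    (Γ.thomas.nabla timeIdx)

theorem horizNabla_apply (j : Idx n m) (S : Symb (n + 1) m (Smooth (cyl W))) :
    Γ.horizNabla j S = Γ.thomas.nabla (baseIdx j) S -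
      Symb.ofBase (liftHom (Γ.trace j)) * Γ.thomas.nabla timeIdx S := by
  rw [horizNabla, Symb.ofBase_neg, AddMonoidHom.add_apply, AddMonoidHom.comp_apply,
    AddMonoidHom.coe_mulLeft, neg_mul, ← sub_eq_add_neg]

theorem IsSymmetric.isSuperDer_horizNabla (hΓ : Γ.IsSymmetric) (j : Idx n m) :
    IsSuperDer (RingHom.id (Symb (n + 1) m (Smooth (cyl W)))) j.parity (Γ.horizNabla j) := by
  refine ((isSuperDer_nabla hΓ.isParity_thomas _).congr_parity (parity_baseIdx j)).add
    (((isSuperDer_nabla hΓ.isParity_thomas _).mulLeft preservesParity_id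
      (Symb.isParity_ofBase (preservesParity_liftHom _ _ (hΓ.isParity_trace j)).neg)).congr_parity ?_)
  rw [parity_timeIdx, add_zero]

theorem horizNabla_eulerField (j : Idx n m) :
    Γ.horizNabla j eulerField = (-1 / ((n : ℝ) - m + 1)) • Γ.horiz j := by
  rw [horizNabla_apply, eulerField, nabla_base_time, nabla_time_xi, horiz, smul_sub, mul_smul_comm]
  rfl

theorem horizNabla_expTime (δ : ℝ) (j : Idx n m) :
    Γ.horizNabla j (Symb.ofBase (expTime δ)) =
      -(δ • (Symb.ofBase (liftHom (Γ.trace j)) * Symb.ofBase (expTime δ))) := by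
  rw [horizNabla_apply, nabla_ofBase, nabla_ofBase, pd_base_expTime, pd_time_expTime,
    Symb.ofBase_zero, zero_sub, Symb.ofBase_smul, mul_smul_comm]

theorem sum_descriptive_xi (j i : Idx n m) :
    ∑ k : Idx n m, Symb.ofBase (liftHom (Γ.descriptive j i k)) *
        (Symb.xi (baseIdx k) : Symb (n + 1) m (Smooth (cyl W))) =
      ∑ k : Idx n m, Symb.ofBase (liftHom (Γ j i k)) * Symb.xi (baseIdx k) -
        (1 / ((n : ℝ) - m + 1)) • (Symb.ofBase (liftHom (Γ.trace j)) * Symb.xi (baseIdx i) +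
          ksign j.parity i.parity •
            (Symb.ofBase (liftHom (Γ.trace i)) * Symb.xi (baseIdx j))) := by
  have e1 (i : Idx n m) (f : SuperFun m W) :
      ∑ k : Idx n m, Symb.ofBase (liftHom (if i = k then f else 0)) *
        (Symb.xi (baseIdx k) : Symb (n + 1) m (Smooth (cyl W))) =
      Symb.ofBase (liftHom f) * Symb.xi (baseIdx i) := by
    rw [Finset.sum_eq_single i (fun k _ hk => by
      rw [if_neg hk.symm, map_zero, Symb.ofBase_zero, zero_mul]) (by simp), if_pos rfl]
  rw [← e1 i, ← e1 j, Finset.smul_sum, ← Finset.sum_add_distrib, Finset.smul_sum,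
    ← Finset.sum_sub_distrib]
  refine Finset.sum_congr rfl fun k _ => ?_
  rw [descriptive, map_sub, liftHom_smul, map_add, map_zsmul, Symb.ofBase_sub, Symb.ofBase_smul,
    Symb.ofBase_add, Symb.ofBase_zsmul, sub_mul, smul_mul_assoc, add_mul, smul_mul_assoc]

/-- The expansion of `∇̃^h_j ∂_i^h`, with its Christoffel symbols and derivatives replaced by
indeterminates. -/
theorem horizontal_expand {R : Type*} [Ring R] [Algebra ℝ R] (r : ℝ) (s : ℤ)
    (C P E d L ti tj xi xj : R) :
    C * E + (P - r • (tj * xi + s • (ti * xj))) - (d * E + s • (ti * (-r) • xj)) -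
        tj * (-r) • (xi - ti * E) = P - L * E + (C - d + L - r • (tj * ti)) * E := by
  simp only [add_mul, sub_mul, mul_sub, smul_sub, smul_add, mul_smul_comm, smul_mul_assoc,
    neg_smul, mul_neg, smul_neg, mul_assoc, smul_comm s r]
  abel

set_option maxHeartbeats 1000000 in
/-- The derivative `∇̃^h_j ∂_i^h` is `(∇_j ∂_i)^h + Q_{ji} ℰ`. -/
theorem IsSymmetric.horizNabla_horiz (hΓ : Γ.IsSymmetric) (j i : Idx n m) :
    Γ.horizNabla j (Γ.horiz i) = ∑ k, Symb.ofBase (liftHom (Γ j i k)) * Γ.horiz k +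
      Symb.ofBase (liftHom (Γ.defect j i)) * eulerField := by
  have hD := (isSuperDer_nabla hΓ.isParity_thomas (baseIdx j)).congr_parity (parity_baseIdx j)
  have e1 : ∑ k, Symb.ofBase (liftHom (Γ j i k)) * Γ.horiz k =
      ∑ k, Symb.ofBase (liftHom (Γ j i k)) * Symb.xi (baseIdx k) -
        Symb.ofBase (liftHom (∑ k, Γ j i k * Γ.trace k)) * eulerField := by
    rw [map_sum, Symb.ofBase_sum, Finset.sum_mul, ← Finset.sum_sub_distrib]
    refine Finset.sum_congr rfl fun k _ => ?_
    rw [horiz, mul_sub, map_mul, Symb.ofBase_mul, mul_assoc]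
    rfl
  rw [horizNabla_apply, hΓ.nabla_time_horiz, e1]
  nth_rw 1 [horiz]
  rw [map_sub, ← liftHom_apply, hD.leibniz_of_isParity (Symb.isParity_ofBase
      (preservesParity_liftHom _ _ (hΓ.isParity_trace i))), nabla_base_base, sum_descriptive_xi,
    nabla_ofBase, pd_base_lift, nabla_base_time, defect, horiz]
  rw [liftHom_apply (Γ.trace i), map_sub, map_add, map_sub, liftHom_smul _ (_ * _), map_mul,
    Symb.ofBase_sub, Symb.ofBase_add, Symb.ofBase_sub, Symb.ofBase_smul, Symb.ofBase_mul, neg_div]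
  exact horizontal_expand _ _ _ _ _ _ _ _ _ _ _

/-- The derivative along `∂_j^h` of a horizontal lift is the lift of the derivative, up to a
vertical term of coefficients `Γ.defect`. -/
theorem IsSymmetric.horizNabla_liftTensor (hΓ : Γ.IsSymmetric) (j : Idx n m)
    (S : Symb n m (Smooth W)) : Γ.horizNabla j (hΓ.liftTensor S) =
      hΓ.liftTensor (Γ.nabla j S) + eulerField * hΓ.liftTensor (Γ.defectOp j S) := by
  have h1 := (hΓ.isSuperDer_horizNabla j).comp_hom hΓ.preservesParity_liftTensor
  have h2 := (isSuperDer_nabla hΓ.parity j).hom_comp hΓ.preservesParity_liftTensor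
  have h3 := (((hΓ.isSuperDer_defectOp j).hom_comp hΓ.preservesParity_liftTensor).mulLeft
    hΓ.preservesParity_liftTensor (isParity_eulerField (m := m) (W := W))).congr_parity (zero_add _)
  refine DFunLike.congr_fun (Symb.superDer_ext h1 (h2.add h3) (fun f => ?_) fun i => ?_) S
  · change Γ.horizNabla j (hΓ.liftTensor (Symb.ofBase f)) =
      hΓ.liftTensor (Γ.nabla j (Symb.ofBase f)) + eulerField * hΓ.liftTensor (Γ.defectOp j _)
    rw [defectOp_apply, hΓ.liftTensor_ofBase, horizNabla_apply, nabla_ofBase, nabla_ofBase,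
      nabla_ofBase, pd_base_lift, pd_time_lift, hΓ.liftTensor_ofBase]
    simp
  · change Γ.horizNabla j (hΓ.liftTensor (Symb.xi i)) =
      hΓ.liftTensor (Γ.nabla j (Symb.xi i)) + eulerField * hΓ.liftTensor (Γ.defectOp j _)
    have e : Γ.defectOp j (Symb.xi i) = Symb.ofBase (Γ.defect j i) := by
      simp [defectOp_apply, Symb.contr_xi]
    rw [e, hΓ.liftTensor_xi, hΓ.horizNabla_horiz, nabla_xi, map_sum, hΓ.liftTensor_ofBase,
      isParity_eulerField.comm_even]
    simp only [map_mul, hΓ.liftTensor_xi, hΓ.liftTensor_ofBase]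

set_option maxHeartbeats 1000000 in
/-- The divergence computed in the horizontal frame. -/
theorem thomas_div_eq (S : Symb (n + 1) m (Smooth (cyl W)))
    (hΓ : Γ.IsSymmetric) : Γ.thomas.div 0 S = Γ.contrVert (Γ.thomas.nabla timeIdx S) +
      ∑ j : Idx n m, psign j.parity • Symb.contr (baseIdx j) (Γ.horizNabla j S) := by
  have h (j : Idx n m) : psign (baseIdx j).parity • Symb.contr (baseIdx j)
      (Γ.thomas.nabla (baseIdx j) S) =
      psign j.parity • Symb.contr (baseIdx j) (Γ.horizNabla j S) +
        Symb.ofBase (liftHom (Γ.trace j)) *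
          Symb.contr (baseIdx j) (Γ.thomas.nabla timeIdx S) := by
    rw [horizNabla_apply, map_sub, Symb.contr_ofBase_mul _
      (preservesParity_liftHom _ _ (hΓ.isParity_trace j)), parity_baseIdx, smul_sub, smul_smul,
      psign_eq, ksign_mul_self, one_smul, sub_add_cancel]
  have hp : psign (timeIdx : Idx (n + 1) m).parity = 1 := rfl
  have h0 : Γ.thomas.div 0 S =
      ∑ a, psign a.parity • Symb.contr a (Γ.thomas.nabla a S) := by
    rw [div_eq]
    simp only [zero_smul, sub_zero]
  rw [h0, sum_idx, hp, one_smul, Finset.sum_congr rfl fun j _ => h j, Finset.sum_add_distrib,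
    contrVert_apply]
  abel

/-- The tensor `A^h ∨ ℰ^k`, additively in `A`. -/
def IsSymmetric.hliftPow (hΓ : Γ.IsSymmetric) (δ : ℝ) (k : ℕ) :
    Symb n m (Smooth W) →+ Symb (n + 1) m (Smooth (cyl W)) :=
  ((AddMonoidHom.mulRight (eulerField ^ k)).comp
    (AddMonoidHom.mulLeft (Symb.ofBase (expTime δ)))).comp hΓ.liftTensor.toAddMonoidHom

theorem IsSymmetric.hliftPow_apply (hΓ : Γ.IsSymmetric) (δ : ℝ) (k : ℕ) (A : Symb n m (Smooth W)) :
    hΓ.hliftPow δ k A = Symb.ofBase (expTime δ) * hΓ.liftTensor A * eulerField ^ k := rfl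

theorem IsSymmetric.hliftPow_smul (hΓ : Γ.IsSymmetric) (δ : ℝ) (k : ℕ) (r : ℝ)
    (A : Symb n m (Smooth W)) : hΓ.hliftPow δ k (r • A) = r • hΓ.hliftPow δ k A := by
  rw [hliftPow_apply, hliftPow_apply, hΓ.liftTensor_smul, mul_smul_comm, smul_mul_assoc]

set_option maxHeartbeats 1000000 in
/-- The vertical interior product acts on the terms `A^h ∨ ℰ^k` like the derivative with respect to
`ℰ`. -/
theorem IsSymmetric.contrVert_hliftPow (hΓ : Γ.IsSymmetric) (δ : ℝ) (k : ℕ)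
    (A : Symb n m (Smooth W)) :
    Γ.contrVert (hΓ.hliftPow δ k A) = (k : ℝ) • hΓ.hliftPow δ (k - 1) A := by
  have hD := hΓ.isSuperDer_contrVert
  have hk : Γ.contrVert (eulerField ^ k) = (k : ℝ) • (eulerField ^ (k - 1) : Symb (n + 1) m (Smooth (cyl W))) := by
    rcases k with - | k
    · rw [pow_zero, hD.map_one, Nat.cast_zero, zero_smul]
    · rw [hD.map_pow isParity_eulerField, eulerField, contrVert_time, Symb.nsmul_eq_real_smul]
      rw [mul_one]
      rfl
  rw [hliftPow_apply, hD.leibniz, hD.leibniz, contrVert_ofBase, hΓ.contrVert_liftTensor, hk,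
    invol_zero, mul_zero, zero_mul, add_zero, zero_mul, zero_add, invol_zero, RingHom.id_apply,
    mul_smul_comm]
  rfl

theorem IsSymmetric.contr_base_hliftPow (hΓ : Γ.IsSymmetric) (δ : ℝ) (k : ℕ) (j : Idx n m)
    (A : Symb n m (Smooth W)) :
    Symb.contr (baseIdx j) (hΓ.hliftPow δ k A) = hΓ.hliftPow δ k (Symb.contr j A) := by
  have hD := Symb.isSuperDer_contr (B := Smooth (cyl W)) (baseIdx j)
  have hk : Symb.contr (baseIdx j) (eulerField ^ k : Symb (n + 1) m (Smooth (cyl W))) = 0 := by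
    induction k with
    | zero => rw [pow_zero, hD.map_one]
    | succ k ih =>
      rw [pow_succ, hD.leibniz, ih, eulerField, Symb.contr_xi, if_neg (baseIdx_ne_timeIdx j),
        zero_mul, mul_zero, add_zero]
  rw [hliftPow_apply, hliftPow_apply, hD.leibniz, hk, mul_zero, add_zero, RingHom.id_apply,
    Symb.contr_ofBase_mul _ (isParity_expTime δ), ksign_zero_right, one_smul,
    hΓ.contr_base_liftTensor]

set_option maxHeartbeats 1000000 in
/-- The operator `∇̃_0` acts on the terms `A^h ∨ ℰ^k`, with `A` of degree `j`, as multiplication by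
`δ - (j + k) / (n - m + 1)`. -/
theorem IsSymmetric.nabla_time_hliftPow (hΓ : Γ.IsSymmetric) (δ : ℝ) (k : ℕ)
    (A : Symb n m (Smooth W)) : Γ.thomas.nabla timeIdx (hΓ.hliftPow δ k A) =
      (δ - (1 / ((n : ℝ) - m + 1)) * k) • hΓ.hliftPow δ k A -
        (1 / ((n : ℝ) - m + 1)) • hΓ.hliftPow δ k (Symb.euler A) := by
  have hD := (isSuperDer_nabla hΓ.isParity_thomas timeIdx).congr_parity parity_timeIdx
  have hk : Γ.thomas.nabla timeIdx (eulerField ^ k) =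
      (-(1 / ((n : ℝ) - m + 1)) * k) • (eulerField ^ k : Symb (n + 1) m (Smooth (cyl W))) := by
    rcases k with - | k
    · rw [pow_zero, hD.map_one, Nat.cast_zero, mul_zero, zero_smul]
    · rw [hD.map_pow isParity_eulerField, eulerField, nabla_time_xi, Symb.nsmul_eq_real_smul,
        mul_smul_comm, smul_smul, ← pow_succ, mul_comm, neg_div]
  rw [hliftPow_apply, hD.leibniz, hD.leibniz, hk, hΓ.nabla_time_liftTensor, nabla_ofBase,
    pd_time_expTime, invol_zero, invol_zero, Symb.ofBase_smul, hliftPow_apply]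
  simp only [RingHom.id_apply, smul_mul_assoc, mul_smul_comm, add_mul]
  rw [neg_div, neg_smul]
  module

set_option maxHeartbeats 1000000 in
/-- The three terms of `∇̃^h_j (A^h ∨ ℰ^k)` come from `∇_j` on densities, from the vertical part of
the derivative of `A^h`, and from `∇̃^h_j ℰ = -∂_j^h / (n - m + 1)`. -/
theorem IsSymmetric.horizNabla_hliftPow (hΓ : Γ.IsSymmetric) (δ : ℝ) (k : ℕ) (j : Idx n m)
    (A : Symb n m (Smooth W)) : Γ.horizNabla j (hΓ.hliftPow δ k A) =
      hΓ.hliftPow δ k (Γ.nabla j A - δ • (Symb.ofBase (Γ.trace j) * A)) +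
        hΓ.hliftPow δ (k + 1) (Γ.defectOp j A) -
        ((1 / ((n : ℝ) - m + 1)) * k) • hΓ.hliftPow δ (k - 1) (Symb.xi j * A) := by
  have hD := hΓ.isSuperDer_horizNabla j
  have hE (X : Symb (n + 1) m (Smooth (cyl W))) (l : ℕ) :
      X * eulerField ^ l = eulerField ^ l * X :=
    (isParity_eulerField.pow l).comm_even X
  have hk : Γ.horizNabla j (eulerField ^ k) =
      (-(1 / ((n : ℝ) - m + 1)) * k) • (Γ.horiz j * eulerField ^ (k - 1)) := by
    rcases k with - | k
    · rw [pow_zero, hD.map_one, Nat.cast_zero, mul_zero, zero_smul]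
    · rw [hD.map_pow isParity_eulerField, horizNabla_eulerField, Symb.nsmul_eq_real_smul,
        mul_smul_comm, smul_smul, ← hE, mul_comm (_ : ℝ), neg_div]
      rfl
  have e1 : invol j.parity (hΓ.liftTensor A) * Γ.horiz j = hΓ.liftTensor (Symb.xi j * A) := by
    rw [map_mul, hΓ.liftTensor_xi]
    exact (((hΓ.isParity_horiz j).mul_comm' _)).symm
  have e2 : Symb.ofBase (liftHom (Γ.trace j)) * Symb.ofBase (expTime δ) =
      Symb.ofBase (expTime δ) * hΓ.liftTensor (Symb.ofBase (Γ.trace j)) := by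
    rw [hΓ.liftTensor_ofBase]
    exact (Symb.isParity_ofBase (isParity_expTime δ)).comm_even _
  have e3 : invol j.parity (Symb.ofBase (expTime δ) : Symb (n + 1) m (Smooth (cyl W))) =
      Symb.ofBase (expTime δ) := by
    rw [(Symb.isParity_ofBase (isParity_expTime δ)).invol, ksign_zero_right, one_smul]
  have e4 : hΓ.hliftPow δ k (Γ.nabla j A - δ • (Symb.ofBase (Γ.trace j) * A)) =
      hΓ.hliftPow δ k (Γ.nabla j A) -
        δ • (Symb.ofBase (liftHom (Γ.trace j)) * Symb.ofBase (expTime δ) * hΓ.liftTensor A *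
          eulerField ^ k) := by
    rw [map_sub, hliftPow_smul, e2, hliftPow_apply hΓ δ k (_ * _), map_mul]
    simp only [mul_assoc]
  have e5 : hΓ.hliftPow δ (k + 1) (Γ.defectOp j A) =
      Symb.ofBase (expTime δ) * (eulerField * hΓ.liftTensor (Γ.defectOp j A)) * eulerField ^ k := by
    rw [hliftPow_apply, pow_succ', ← mul_assoc, mul_assoc _ _ eulerField, ← pow_one eulerField,
      hE _ 1]
  rw [e4, e5, hliftPow_apply hΓ δ (k - 1), ← e1, hliftPow_apply hΓ δ k A, hD.leibniz, hD.leibniz,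
    hk, hΓ.horizNabla_liftTensor, horizNabla_expTime, map_mul (invol _), e3, hliftPow_apply]
  simp only [RingHom.id_apply, mul_assoc, add_mul, mul_add, neg_mul, smul_mul_assoc, neg_smul,
    mul_neg, mul_smul_comm]
  abel

set_option maxHeartbeats 1000000 in
/-- The divergence of `A^h ∨ ℰ^l`, in graded coordinates. -/
theorem IsSymmetric.thomas_div_hliftPow (hΓ : Γ.IsSymmetric) (h1 : (n : ℝ) - m - 1 ≠ 0)
    (h2 : (n : ℝ) - m + 1 ≠ 0) (δ : ℝ) (j l : ℕ) {A : Symb n m (Smooth W)} (hA : A.IsHomog j) :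
    Γ.thomas.div 0 (hΓ.hliftPow δ l A) = hΓ.hliftPow δ l (Γ.div δ A) +
      (2 * ((n : ℝ) - m + 1)) • hΓ.hliftPow δ (l + 1) (Γ.contrR A) -
        ((l : ℝ) * gammaCoeff n m δ (2 * j + l)) • hΓ.hliftPow δ (l - 1) A := by
  have hA' := Symb.isHomog_iff.1 hA
  -- The horizontal part of the divergence.
  have hs : ∑ i : Idx n m, psign i.parity • Symb.contr (baseIdx i)
        (Γ.horizNabla i (hΓ.hliftPow δ l A)) =
      hΓ.hliftPow δ l (Γ.div δ A) +
        (2 * ((n : ℝ) - m + 1)) • hΓ.hliftPow δ (l + 1) (Γ.contrR A) -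
        ((1 / ((n : ℝ) - m + 1)) * l * ((n : ℝ) - m + j)) • hΓ.hliftPow δ (l - 1) A := by
    have e (i : Idx n m) : psign i.parity • Symb.contr (baseIdx i)
        (Γ.horizNabla i (hΓ.hliftPow δ l A)) =
        hΓ.hliftPow δ l (psign i.parity • Symb.contr i
          (Γ.nabla i A - δ • (Symb.ofBase (Γ.trace i) * A))) +
        hΓ.hliftPow δ (l + 1) (psign i.parity • Symb.contr i (Γ.defectOp i A)) -
        hΓ.hliftPow δ (l - 1) (((1 / ((n : ℝ) - m + 1)) * l) •
          (psign i.parity • Symb.contr i (Symb.xi i * A))) := by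
      rw [hΓ.horizNabla_hliftPow, ← hΓ.hliftPow_smul, map_sub, map_add, hΓ.contr_base_hliftPow,
        hΓ.contr_base_hliftPow, hΓ.contr_base_hliftPow, smul_sub, smul_add,
        map_zsmul (hΓ.hliftPow δ l), map_zsmul (hΓ.hliftPow δ (l + 1)), Symb.contr_smul,
        smul_comm (_ : ℝ) (psign i.parity), map_zsmul (hΓ.hliftPow δ (l - 1))]
    rw [Finset.sum_congr rfl fun i _ => e i, Finset.sum_sub_distrib, Finset.sum_add_distrib,
      ← map_sum, ← map_sum, ← map_sum, ← div_eq, hΓ.sum_contr_defectOp h1 h2, ← Finset.smul_sum,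
      Symb.sum_contr_xi_mul, hA', ← add_smul, smul_smul, hΓ.hliftPow_smul, hΓ.hliftPow_smul]
  have hγ : (l : ℝ) * gammaCoeff n m δ (2 * j + l) =
      (1 / ((n : ℝ) - m + 1)) * l * ((n : ℝ) - m + j) -
        (δ - (1 / ((n : ℝ) - m + 1)) * l - (1 / ((n : ℝ) - m + 1)) * j) * l := by
    rw [gammaCoeff]
    push_cast
    field_simp
    ring
  -- The vertical part of the divergence.
  have hv : Γ.contrVert (Γ.thomas.nabla timeIdx (hΓ.hliftPow δ l A)) =
      ((δ - (1 / ((n : ℝ) - m + 1)) * l - (1 / ((n : ℝ) - m + 1)) * j) * l) •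
        hΓ.hliftPow δ (l - 1) A := by
    rw [hΓ.nabla_time_hliftPow, hA', ← hΓ.hliftPow_smul, ← hΓ.hliftPow_smul, ← map_sub, smul_smul,
      ← sub_smul, hΓ.contrVert_hliftPow, hΓ.hliftPow_smul, smul_smul, mul_comm]
  rw [thomas_div_eq _ hΓ, hs, hv, hγ, sub_smul]
  abel

end Christoffel

/-! ### Naturality of the divergence and of the Ricci contraction -/

open Grassmann

namespace Christoffel

variable {N m : ℕ} {W : Opens (Eu N)} {Γ : Christoffel m W}

variable (Γ) in
/-- The curvature operator `[∇_{∂_q}, ∇_{∂_j}]` on tensors. -/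
def curvOp (q j : Idx N m) : Symb N m (Smooth W) →+ Symb N m (Smooth W) :=
  (Γ.nabla q).comp (Γ.nabla j) - ksign q.parity j.parity • (Γ.nabla j).comp (Γ.nabla q)

theorem curvOp_apply (q j : Idx N m) (S : Symb N m (Smooth W)) : Γ.curvOp q j S =
    Γ.nabla q (Γ.nabla j S) - ksign q.parity j.parity • Γ.nabla j (Γ.nabla q S) := rfl

theorem IsSymmetric.isSuperDer_curvOp (hΓ : Γ.IsSymmetric) (q j : Idx N m) :
    IsSuperDer (RingHom.id (Symb N m (Smooth W))) (q.parity + j.parity) (Γ.curvOp q j) :=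
  (isSuperDer_nabla hΓ.parity q).commutator (isSuperDer_nabla hΓ.parity j)

theorem curvOp_ofBase (q j : Idx N m) (f : SuperFun m W) :
    Γ.curvOp q j (Symb.ofBase f) = 0 := by
  rw [curvOp_apply, nabla_ofBase, nabla_ofBase, nabla_ofBase, nabla_ofBase, SuperFun.pd_comm,
    Symb.ofBase_zsmul, sub_self]

theorem IsSymmetric.nabla_nabla_xi (hΓ : Γ.IsSymmetric) (q j i : Idx N m) :
    Γ.nabla q (Γ.nabla j (Symb.xi i)) = ∑ k, Symb.ofBase (SuperFun.pd q (Γ j i k) +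
      ∑ l, invol q.parity (Γ j i l) * Γ q l k) * Symb.xi k := by
  have hD := isSuperDer_nabla hΓ.parity q
  rw [nabla_xi, map_sum, Finset.sum_congr rfl fun l _ => hD.leibniz (Symb.ofBase (Γ j i l)) _]
  simp only [nabla_ofBase, nabla_xi, RingHom.id_apply, Symb.invol_ofBase, Finset.mul_sum,
    Symb.ofBase_add, Symb.ofBase_sum, add_mul, Finset.sum_add_distrib, Finset.sum_mul,
    Symb.ofBase_mul, mul_assoc]
  rw [Finset.sum_comm (f := fun k l => Symb.ofBase (invol q.parity (Γ j i l)) *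
    (Symb.ofBase (Γ q l k) * (Symb.xi k : Symb N m (Smooth W))))]

/-- The curvature operator on vector fields is the curvature. -/
theorem IsSymmetric.curvOp_xi (hΓ : Γ.IsSymmetric) (q j i : Idx N m) :
    Γ.curvOp q j (Symb.xi i) = ∑ k, Symb.ofBase (Γ.curv q j i k) * Symb.xi k := by
  rw [curvOp_apply, hΓ.nabla_nabla_xi, hΓ.nabla_nabla_xi, Finset.smul_sum,
    ← Finset.sum_sub_distrib]
  refine Finset.sum_congr rfl fun k _ => ?_
  rw [curv, Symb.ofBase_sub, Symb.ofBase_zsmul, sub_mul, smul_mul_assoc]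

theorem IsSymmetric.isParity_curv (hΓ : Γ.IsSymmetric) (q j i k : Idx N m) :
    (Γ.curv q j i k).IsParity (q.parity + j.parity + i.parity + k.parity) := by
  have h (q j : Idx N m) : (SuperFun.pd q (Γ j i k) +
      ∑ l, invol q.parity (Γ j i l) * Γ q l k).IsParity
        (q.parity + j.parity + i.parity + k.parity) := by
    refine IsParity.add ((SuperFun.pd_parity q (hΓ.parity j i k)).congr (by ring))
      (isParity_sum _ fun l _ => ?_)
    rw [(hΓ.parity j i l).invol]
    refine (((hΓ.parity j i l).zsmul _).mul (hΓ.parity q l k)).congr ?_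
    generalize q.parity = q; generalize j.parity = j; generalize i.parity = i
    generalize k.parity = k; generalize l.parity = l
    revert q j i k l; decide
  exact (h q j).sub (((h j q).congr (by ring)).zsmul _)

theorem IsSymmetric.isParity_ricci (hΓ : Γ.IsSymmetric) (i j : Idx N m) :
    (Γ.ricci i j).IsParity (i.parity + j.parity) := by
  refine isParity_sum _ fun q _ => ((hΓ.isParity_curv q j i q).congr ?_).zsmul _
  generalize q.parity = q; generalize j.parity = j; generalize i.parity = i
  revert q j i; decide

variable (Γ) in
/-- The superderivation `∑ i, Ric(∂_i, ∂_j) i(dx^i)`. -/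
def ricciOp (j : Idx N m) : Symb N m (Smooth W) →+ Symb N m (Smooth W) :=
  ∑ i : Idx N m, (AddMonoidHom.mulLeft (Symb.ofBase (Γ.ricci i j))).comp (Symb.contr i)

theorem ricciOp_apply (j : Idx N m) (S : Symb N m (Smooth W)) :
    Γ.ricciOp j S = ∑ i, Symb.ofBase (Γ.ricci i j) * Symb.contr i S := by
  rw [ricciOp, AddMonoidHom.finsetSum_apply]; rfl

theorem IsSymmetric.isSuperDer_ricciOp (hΓ : Γ.IsSymmetric) (j : Idx N m) :
    IsSuperDer (RingHom.id (Symb N m (Smooth W))) j.parity (Γ.ricciOp j) :=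
  IsSuperDer.sum _ fun i _ => ((Symb.isSuperDer_contr i).mulLeft preservesParity_id
    (Symb.isParity_ofBase (hΓ.isParity_ricci i j))).congr_parity (by
      rw [add_right_comm, CharTwo.add_self_eq_zero, zero_add])

theorem ricciOp_ofBase (j : Idx N m) (f : SuperFun m W) : Γ.ricciOp j (Symb.ofBase f) = 0 := by
  simp [ricciOp_apply]

/-- On vector fields, `Γ.ricciOp j` is a supertrace of the curvature. -/
theorem IsSymmetric.ricciOp_ofBase_mul_xi (hΓ : Γ.IsSymmetric) (j i : Idx N m) {p : ZMod 2}
    {f : SuperFun m W} (hf : f.IsParity p) : Γ.ricciOp j (Symb.ofBase f * Symb.xi i) =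
      ∑ q, psign q.parity • Symb.contr q (Γ.curvOp q j (Symb.ofBase f * Symb.xi i)) := by
  have h1 : Γ.ricciOp j (Symb.xi i) = Symb.ofBase (Γ.ricci i j) := by
    simp [ricciOp_apply, Symb.contr_xi]
  have h2 (q : Idx N m) : psign q.parity • Symb.contr q (Γ.curvOp q j (Symb.xi i)) =
      Symb.ofBase (ksign q.parity (q.parity + j.parity + i.parity) • Γ.curv q j i q) := by
    rw [hΓ.curvOp_xi, map_sum, Finset.sum_eq_single q (fun k _ hk => ?_) (by simp),
      Symb.contr_ofBase_mul _ (hΓ.isParity_curv q j i q), Symb.contr_xi, if_pos rfl, mul_one,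
      smul_smul, Symb.ofBase_zsmul]
    · congr 1
      generalize q.parity = q; generalize j.parity = j; generalize i.parity = i
      revert q j i; unfold psign; decide
    · rw [Symb.contr_ofBase_mul _ (hΓ.isParity_curv q j i k), Symb.contr_xi, if_neg hk.symm,
        mul_zero, smul_zero]
  rw [(hΓ.isSuperDer_ricciOp j).leibniz_of_isParity (Symb.isParity_ofBase hf), ricciOp_ofBase,
    zero_mul, zero_add, h1, ricci, Symb.ofBase_sum, ← Finset.sum_congr rfl fun q _ => h2 q,
    Finset.mul_sum, Finset.smul_sum]
  refine Finset.sum_congr rfl fun q _ => ?_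
  rw [(hΓ.isSuperDer_curvOp q j).leibniz_of_isParity (Symb.isParity_ofBase hf), curvOp_ofBase,
    zero_mul, zero_add, map_zsmul, RingHom.id_apply, Symb.contr_ofBase_mul _ hf,
    mul_smul_comm]
  simp only [smul_smul]
  congr 1
  generalize q.parity = q; generalize j.parity = j
  clear hf
  revert q j p; unfold psign; decide

/-- The interior product `i(r)`, by means of the unsymmetrized Ricci tensor. -/
theorem IsSymmetric.contrR_eq_sum_ricciOp (hΓ : Γ.IsSymmetric) (S : Symb N m (Smooth W)) :
    Γ.contrR S = (1 / (2 * ((N : ℝ) - m - 1))) •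
      ∑ j, psign j.parity • Symb.contr j (Γ.ricciOp j S) := by
  have h1 : ∑ j, psign j.parity • Symb.contr j (Γ.ricciOp j S) =
      ∑ a, ∑ b, Symb.ofBase (Γ.ricci a b) * Symb.contr a (Symb.contr b S) := by
    rw [Finset.sum_comm]
    refine Finset.sum_congr rfl fun j _ => ?_
    rw [ricciOp_apply, map_sum, Finset.smul_sum]
    refine Finset.sum_congr rfl fun i _ => ?_
    rw [Symb.contr_ofBase_mul _ (hΓ.isParity_ricci i j), Symb.contr_contr i j, mul_smul_comm,
      smul_smul, psign_eq, ksign_add_right, ksign_comm i.parity, mul_left_comm, ksign_mul_self,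
      mul_one]
  have h2 : ∑ a, ∑ b, Symb.ofBase (ksign b.parity a.parity • Γ.ricci b a) *
      Symb.contr a (Symb.contr b S) =
      ∑ a, ∑ b, Symb.ofBase (Γ.ricci a b) * Symb.contr a (Symb.contr b S) := by
    rw [Finset.sum_comm]
    refine Finset.sum_congr rfl fun b _ => Finset.sum_congr rfl fun a _ => ?_
    rw [Symb.contr_contr b a, mul_smul_comm, Symb.ofBase_zsmul, smul_mul_assoc]
  rw [contrR, h1]
  simp only [rTensor, Symb.ofBase_smul, smul_mul_assoc, Symb.ofBase_add, add_mul,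
    ← Finset.smul_sum, Finset.sum_add_distrib, h2]
  module

end Christoffel

open Grassmann

namespace ChartChange

variable {n m : ℕ} {W' V : Opens (Eu n)} {Γ' : Christoffel m W'} {Γ : Christoffel m V}
  (C : ChartChange Γ' Γ)

theorem isParity_sum_K (b : Idx n m) :
    (∑ i, Symb.ofBase (C.K b i) * (Symb.xi i : Symb n m (Smooth V))).IsParity b.parity :=
  isParity_sum _ fun i _ => ((Symb.isParity_ofBase (C.K_parity b i)).mul
    (Symb.isParity_xi i)).congr (by rw [add_assoc, CharTwo.add_self_eq_zero, add_zero])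

/-- The rewriting of tensors of weight zero in the coordinates `x`; it sends `∂̄_b` to
`∑ i, K b i ∂_i`. -/
def tensor : Symb n m (Smooth W') →+* Symb n m (Smooth V) :=
  Symb.substHom C.pull C.pull_parity (fun b => ∑ i, Symb.ofBase (C.K b i) * Symb.xi i)
    C.isParity_sum_K

theorem tensor_ofBase (f : SuperFun m W') : C.tensor (Symb.ofBase f) = Symb.ofBase (C.pull f) :=
  Symb.substHom_ofBase f

theorem tensor_xi (b : Idx n m) :
    C.tensor (Symb.xi b) = ∑ i, Symb.ofBase (C.K b i) * Symb.xi i := Symb.substHom_xi b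

theorem tensor_smul (r : ℝ) (S : Symb n m (Smooth W')) : C.tensor (r • S) = r • C.tensor S :=
  Symb.substHom_smul (fun r => by rw [C.pull_smul, map_one]) r S

theorem preservesParity_tensor : PreservesParity C.tensor := Symb.preservesParity_substHom

/-- Covariant derivatives are natural: both sides are superderivations along `C.tensor`, and on the
`∂̄_b` they agree by the transformation law of the Christoffel symbols. -/
theorem nabla_tensor (hΓ : Γ.IsSymmetric) (hΓ' : Γ'.IsSymmetric) (i : Idx n m)
    (S : Symb n m (Smooth W')) :
    Γ.nabla i (C.tensor S) = ∑ a, Symb.ofBase (C.J i a) * C.tensor (Γ'.nabla a S) := by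
  have hD := Christoffel.isSuperDer_nabla hΓ.parity i
  have h1 := hD.comp_hom C.preservesParity_tensor
  have h2 : IsSuperDer C.tensor i.parity (∑ a, (AddMonoidHom.mulLeft (Symb.ofBase (C.J i a))).comp
      (C.tensor.toAddMonoidHom.comp (Γ'.nabla a))) :=
    IsSuperDer.sum _ fun a _ => (((Christoffel.isSuperDer_nabla hΓ'.parity a).hom_comp
      C.preservesParity_tensor).mulLeft C.preservesParity_tensor
        (Symb.isParity_ofBase (C.J_parity i a))).congr_parity (by
          rw [add_assoc, CharTwo.add_self_eq_zero, add_zero])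
  have h := DFunLike.congr_fun (Symb.superDer_ext h1 h2 (fun f => ?_) fun b => ?_) S
  · rw [AddMonoidHom.finsetSum_apply] at h
    exact h
  · rw [AddMonoidHom.finsetSum_apply]
    change Γ.nabla i (C.tensor (Symb.ofBase f)) =
      ∑ a, Symb.ofBase (C.J i a) * C.tensor (Γ'.nabla a (Symb.ofBase f))
    simp only [C.tensor_ofBase, Christoffel.nabla_ofBase, C.pd_pull, Symb.ofBase_sum,
      Symb.ofBase_mul]
  · rw [AddMonoidHom.finsetSum_apply]
    change Γ.nabla i (C.tensor (Symb.xi b)) =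
      ∑ a, Symb.ofBase (C.J i a) * C.tensor (Γ'.nabla a (Symb.xi b))
    have e1 : Γ.nabla i (C.tensor (Symb.xi b)) = ∑ k, Symb.ofBase (SuperFun.pd i (C.K b k) +
        ∑ l, invol i.parity (C.K b l) * Γ i l k) * Symb.xi k := by
      rw [C.tensor_xi, map_sum, Finset.sum_congr rfl fun l _ => hD.leibniz (Symb.ofBase (C.K b l)) _]
      simp only [Christoffel.nabla_ofBase, Christoffel.nabla_xi, RingHom.id_apply,
        Symb.invol_ofBase, Finset.mul_sum, Symb.ofBase_add, Symb.ofBase_sum, add_mul,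
        Finset.sum_add_distrib, Finset.sum_mul, Symb.ofBase_mul, mul_assoc]
      rw [Finset.sum_comm (f := fun k l => Symb.ofBase (invol i.parity (C.K b l)) *
        (Symb.ofBase (Γ i l k) * (Symb.xi k : Symb n m (Smooth V))))]
    rw [e1]
    simp only [C.transform, Christoffel.nabla_xi, map_sum, map_mul, C.tensor_ofBase, C.tensor_xi,
      Symb.ofBase_sum, Symb.ofBase_mul, Finset.sum_mul, Finset.mul_sum, mul_assoc]
    rw [Finset.sum_comm]
    refine Finset.sum_congr rfl fun a _ => ?_
    rw [Finset.sum_comm]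

/-- The interior product `i(dx̄^b)`, in the coordinates `x`. -/
def contr (b : Idx n m) : Symb n m (Smooth V) →+ Symb n m (Smooth V) :=
  ∑ i : Idx n m, (AddMonoidHom.mulLeft
    (Symb.ofBase (ksign b.parity (i.parity + b.parity) • C.J i b))).comp (Symb.contr i)

theorem contr_apply (b : Idx n m) (S : Symb n m (Smooth V)) : C.contr b S =
    ∑ i, ksign b.parity (i.parity + b.parity) • (Symb.ofBase (C.J i b) * Symb.contr i S) := by
  rw [contr, AddMonoidHom.finsetSum_apply]
  refine Finset.sum_congr rfl fun i _ => ?_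
  rw [AddMonoidHom.comp_apply, AddMonoidHom.coe_mulLeft, Symb.ofBase_zsmul, smul_mul_assoc]

theorem isSuperDer_contr (b : Idx n m) :
    IsSuperDer (RingHom.id (Symb n m (Smooth V))) b.parity (C.contr b) :=
  IsSuperDer.sum _ fun i _ => ((Symb.isSuperDer_contr i).mulLeft preservesParity_id
    (Symb.isParity_ofBase ((C.J_parity i b).zsmul _))).congr_parity (by
      rw [add_right_comm, CharTwo.add_self_eq_zero, zero_add])

theorem contr_ofBase_mul (b : Idx n m) {f : SuperFun m V} {p : ZMod 2} (hf : f.IsParity p)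
    (S : Symb n m (Smooth V)) :
    C.contr b (Symb.ofBase f * S) = ksign b.parity p • (Symb.ofBase f * C.contr b S) := by
  rw [(C.isSuperDer_contr b).leibniz_of_isParity (Symb.isParity_ofBase hf)]
  simp [contr_apply]

/-- The operator `C.contr b` corresponds to the interior product `i(dx̄^b)`. -/
theorem contr_tensor (b : Idx n m) (S : Symb n m (Smooth W')) :
    C.contr b (C.tensor S) = C.tensor (Symb.contr b S) := by
  have h1 := (C.isSuperDer_contr b).comp_hom C.preservesParity_tensor
  have h2 := (Symb.isSuperDer_contr b).hom_comp C.preservesParity_tensor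
  refine DFunLike.congr_fun (Symb.superDer_ext h1 h2 (fun f => ?_) fun d => ?_) S
  · change C.contr b (C.tensor (Symb.ofBase f)) = C.tensor (Symb.contr b (Symb.ofBase f))
    rw [C.tensor_ofBase, Symb.contr_ofBase, map_zero]
    simp [contr_apply]
  · change C.contr b (C.tensor (Symb.xi d)) = C.tensor (Symb.contr b (Symb.xi d))
    have e (i : Idx n m) : Symb.contr i (C.tensor (Symb.xi d)) =
        ksign i.parity (d.parity + i.parity) • Symb.ofBase (C.K d i) := by
      rw [C.tensor_xi, map_sum, Finset.sum_eq_single i (fun k _ hk => ?_) (by simp),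
        Symb.contr_ofBase_mul i (C.K_parity d i), Symb.contr_xi, if_pos rfl, mul_one]
      rw [Symb.contr_ofBase_mul i (C.K_parity d k), Symb.contr_xi, if_neg hk.symm, mul_zero,
        smul_zero]
    have e2 (i : Idx n m) : ksign b.parity (i.parity + b.parity) •
        (Symb.ofBase (C.J i b) * Symb.contr i (C.tensor (Symb.xi d))) =
        ksign b.parity (b.parity + d.parity) •
          (Symb.ofBase (C.K d i * C.J i b) : Symb n m (Smooth V)) := by
      rw [e, mul_smul_comm, ← Symb.ofBase_mul, (C.J_parity i b).comm (C.K_parity d i),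
        Symb.ofBase_zsmul, smul_smul, smul_smul]
      congr 1
      generalize b.parity = b; generalize d.parity = d; generalize i.parity = i
      revert b d i; decide
    rw [contr_apply, Finset.sum_congr rfl fun i _ => e2 i, ← Finset.smul_sum, ← Symb.ofBase_sum,
      C.K_mul_J, Symb.contr_xi]
    by_cases h : b = d
    · subst h
      rw [if_pos rfl, if_pos rfl, CharTwo.add_self_eq_zero, ksign_zero_right, one_smul,
        Symb.ofBase_one, map_one]
    · rw [if_neg h, if_neg (Ne.symm h), Symb.ofBase_zero, smul_zero, map_zero]

/-- The change of frame in a contraction. -/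
theorem sum_contr_eq (T : Idx n m → Symb n m (Smooth V)) :
    ∑ q, psign q.parity • Symb.contr q (∑ b, Symb.ofBase (C.J q b) * T b) =
      ∑ b, psign b.parity • C.contr b (T b) := by
  simp only [map_sum, Finset.smul_sum, contr_apply]
  rw [Finset.sum_comm]
  refine Finset.sum_congr rfl fun b _ => Finset.sum_congr rfl fun q _ => ?_
  rw [Symb.contr_ofBase_mul _ (C.J_parity q b), smul_smul, smul_smul]
  congr 1
  generalize b.parity = b; generalize q.parity = q
  revert b q; unfold psign; decide

set_option maxHeartbeats 1000000 in
/-- The divergence of symbols does not depend on the coordinates: `lam` is the factor `|Ber|^δ` by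
which densities change, and `ℓ` is `log |Ber|`. -/
theorem div_tensor (hΓ : Γ.IsSymmetric) (hΓ' : Γ'.IsSymmetric) {δ : ℝ} {lam ℓ : SuperFun m V}
    (hlam : lam.IsParity 0) (hpd : ∀ q, SuperFun.pd q lam = δ • (lam * SuperFun.pd q ℓ))
    (htr : ∀ i, Γ.trace i = SuperFun.pd i ℓ + ∑ a, C.J i a * C.pull (Γ'.trace a))
    (A : Symb n m (Smooth W')) : Γ.div δ (Symb.ofBase lam * C.tensor A) =
      Symb.ofBase lam * C.tensor (Γ'.div δ A) := by
  have hl (X : Symb n m (Smooth V)) : X * Symb.ofBase lam = Symb.ofBase lam * X :=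
    ((Symb.isParity_ofBase hlam).comm_even X)
  -- The derivative of `lam` and the inhomogeneous term in the law of the trace cancel.
  have e (i : Idx n m) : Γ.nabla i (Symb.ofBase lam * C.tensor A) -
      δ • (Symb.ofBase (Γ.trace i) * (Symb.ofBase lam * C.tensor A)) =
      ∑ a, Symb.ofBase (C.J i a) * (Symb.ofBase lam *
        C.tensor (Γ'.nabla a A - δ • (Symb.ofBase (Γ'.trace a) * A))) := by
    have e1 (a : Idx n m) : Symb.ofBase (C.J i a) * (Symb.ofBase lam *
        C.tensor (Γ'.nabla a A - δ • (Symb.ofBase (Γ'.trace a) * A))) =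
        Symb.ofBase lam * (Symb.ofBase (C.J i a) * C.tensor (Γ'.nabla a A)) -
        δ • (Symb.ofBase lam * (Symb.ofBase (C.J i a * C.pull (Γ'.trace a)) * C.tensor A)) := by
      have : C.tensor (δ • (Symb.ofBase (Γ'.trace a) * A)) =
          δ • (Symb.ofBase (C.pull (Γ'.trace a)) * C.tensor A) := by
        rw [C.tensor_smul, map_mul, C.tensor_ofBase]
      rw [map_sub, this, ← mul_assoc, hl, mul_assoc, mul_sub, mul_sub, mul_smul_comm,
        mul_smul_comm, Symb.ofBase_mul, mul_assoc (Symb.ofBase (C.J i a))]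
    rw [(Christoffel.isSuperDer_nabla hΓ.parity i).leibniz_of_isParity
      (Symb.isParity_ofBase hlam), ksign_zero_right, one_smul, Christoffel.nabla_ofBase, hpd,
      RingHom.id_apply, RingHom.id_apply, C.nabla_tensor hΓ hΓ', Finset.sum_congr rfl fun a _ => e1 a,
      Finset.sum_sub_distrib, ← Finset.mul_sum, ← Finset.smul_sum, ← Finset.mul_sum,
      ← Finset.sum_mul, ← Symb.ofBase_sum, htr i, ← mul_assoc, hl, Symb.ofBase_add,
      Symb.ofBase_smul, Symb.ofBase_mul, mul_add, add_mul, smul_add, smul_mul_assoc]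
    simp only [mul_assoc]
    abel
  rw [Christoffel.div_eq, Christoffel.div_eq, Finset.sum_congr rfl fun j _ => by rw [e j],
    C.sum_contr_eq, map_sum, Finset.mul_sum]
  refine Finset.sum_congr rfl fun a _ => ?_
  rw [C.contr_ofBase_mul a hlam, ksign_zero_right, one_smul, C.contr_tensor, map_zsmul,
    mul_smul_comm]

/-- Symmetry of the second derivatives of the change of coordinates. -/
theorem pd_J (q j b : Idx n m) :
    SuperFun.pd q (C.J j b) = ksign q.parity j.parity • SuperFun.pd j (C.J q b) := by
  have h (i : Idx n m) : C.J i b = SuperFun.pd i (C.pull (SuperFun.coord b)) := by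
    rw [C.pd_pull, Finset.sum_eq_single b (fun a _ ha => by
      rw [SuperFun.pd_coord, if_neg ha, map_zero, mul_zero]) (by simp), SuperFun.pd_coord,
      if_pos rfl, map_one, mul_one]
  rw [h, h, SuperFun.pd_comm]

/-- Naturality of the curvature. -/
theorem curvOp_tensor (hΓ : Γ.IsSymmetric) (hΓ' : Γ'.IsSymmetric) (q j : Idx n m)
    (S : Symb n m (Smooth W')) : Γ.curvOp q j (C.tensor S) =
      ∑ a, Symb.ofBase (C.J q a) * ∑ b, ksign a.parity (j.parity + b.parity) •
        (Symb.ofBase (C.J j b) * C.tensor (Γ'.curvOp a b S)) := by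
  have h2 (q j : Idx n m) : Γ.nabla q (Γ.nabla j (C.tensor S)) =
      ∑ b, Symb.ofBase (SuperFun.pd q (C.J j b)) * C.tensor (Γ'.nabla b S) +
      ∑ b, ∑ a, ksign q.parity (j.parity + b.parity) • (Symb.ofBase (C.J j b * C.J q a) *
        C.tensor (Γ'.nabla a (Γ'.nabla b S))) := by
    rw [C.nabla_tensor hΓ hΓ', map_sum, ← Finset.sum_add_distrib]
    refine Finset.sum_congr rfl fun b _ => ?_
    rw [(Christoffel.isSuperDer_nabla hΓ.parity q).leibniz_of_isParity
      (Symb.isParity_ofBase (C.J_parity j b)), Christoffel.nabla_ofBase, RingHom.id_apply,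
      RingHom.id_apply, C.nabla_tensor hΓ hΓ', Finset.mul_sum, Finset.smul_sum]
    simp only [Symb.ofBase_mul, mul_assoc]
  rw [Christoffel.curvOp_apply, h2 q j, h2 j q, smul_add, add_sub_add_comm]
  -- The terms with second derivatives of the coordinates cancel.
  have e0 : ∑ b, Symb.ofBase (SuperFun.pd q (C.J j b)) * C.tensor (Γ'.nabla b S) -
      ksign q.parity j.parity •
        ∑ b, Symb.ofBase (SuperFun.pd j (C.J q b)) * C.tensor (Γ'.nabla b S) = 0 := by
    rw [sub_eq_zero, Finset.smul_sum]
    refine Finset.sum_congr rfl fun b _ => ?_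
    rw [C.pd_J q j, Symb.ofBase_zsmul, smul_mul_assoc]
  rw [e0, zero_add, Finset.sum_comm, Finset.smul_sum, ← Finset.sum_sub_distrib]
  refine Finset.sum_congr rfl fun a _ => ?_
  rw [Finset.smul_sum, ← Finset.sum_sub_distrib, Finset.mul_sum]
  refine Finset.sum_congr rfl fun b _ => ?_
  rw [(C.J_parity j b).comm (C.J_parity q a), Symb.ofBase_zsmul, Symb.ofBase_mul,
    Christoffel.curvOp_apply, map_sub, map_zsmul]
  simp only [smul_mul_assoc, mul_smul_comm, smul_smul, mul_sub, smul_sub, mul_assoc]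
  congr 2
  · generalize a.parity = a; generalize b.parity = b; generalize q.parity = q
    generalize j.parity = j
    revert a b q j; decide
  · generalize a.parity = a; generalize b.parity = b; generalize q.parity = q
    generalize j.parity = j
    revert a b q j; decide

/-- Naturality of the Ricci tensor. -/
theorem ricciOp_tensor (hΓ : Γ.IsSymmetric) (hΓ' : Γ'.IsSymmetric) (j : Idx n m)
    (S : Symb n m (Smooth W')) :
    Γ.ricciOp j (C.tensor S) = ∑ b, Symb.ofBase (C.J j b) * C.tensor (Γ'.ricciOp b S) := by
  have h1 := (hΓ.isSuperDer_ricciOp j).comp_hom C.preservesParity_tensor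
  have h2 : IsSuperDer C.tensor j.parity (∑ a, (AddMonoidHom.mulLeft (Symb.ofBase (C.J j a))).comp
      (C.tensor.toAddMonoidHom.comp (Γ'.ricciOp a))) :=
    IsSuperDer.sum _ fun a _ => (((hΓ'.isSuperDer_ricciOp a).hom_comp
      C.preservesParity_tensor).mulLeft C.preservesParity_tensor
        (Symb.isParity_ofBase (C.J_parity j a))).congr_parity (by
          rw [add_assoc, CharTwo.add_self_eq_zero, add_zero])
  have h := DFunLike.congr_fun (Symb.superDer_ext h1 h2 (fun f => ?_) fun d => ?_) S
  · rw [AddMonoidHom.finsetSum_apply] at h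
    exact h
  · rw [AddMonoidHom.finsetSum_apply]
    change Γ.ricciOp j (C.tensor (Symb.ofBase f)) =
      ∑ a, Symb.ofBase (C.J j a) * C.tensor (Γ'.ricciOp a (Symb.ofBase f))
    simp only [C.tensor_ofBase, Christoffel.ricciOp_ofBase, map_zero, mul_zero,
      Finset.sum_const_zero]
  · rw [AddMonoidHom.finsetSum_apply]
    change Γ.ricciOp j (C.tensor (Symb.xi d)) =
      ∑ a, Symb.ofBase (C.J j a) * C.tensor (Γ'.ricciOp a (Symb.xi d))
    -- On vector fields the Ricci tensor is a supertrace of the curvature, which is natural.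
    have e1 : Γ.ricciOp j (C.tensor (Symb.xi d)) =
        ∑ q, psign q.parity • Symb.contr q (Γ.curvOp q j (C.tensor (Symb.xi d))) := by
      simp only [C.tensor_xi, map_sum, Finset.smul_sum]
      rw [Finset.sum_comm]
      exact Finset.sum_congr rfl fun i _ => hΓ.ricciOp_ofBase_mul_xi j i (C.K_parity d i)
    have e2 (b : Idx n m) : Γ'.ricciOp b (Symb.xi d) =
        ∑ q, psign q.parity • Symb.contr q (Γ'.curvOp q b (Symb.xi d)) := by
      have := hΓ'.ricciOp_ofBase_mul_xi b d (isParity_one)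
      rwa [Symb.ofBase_one, one_mul] at this
    rw [e1]
    simp only [C.curvOp_tensor hΓ hΓ', e2]
    rw [C.sum_contr_eq]
    simp only [map_sum, map_zsmul, C.contr_ofBase_mul _ (C.J_parity _ _), smul_smul, ksign_mul_self,
      one_smul, C.contr_tensor, Finset.smul_sum, Finset.mul_sum, mul_smul_comm]
    rw [Finset.sum_comm]

/-- Naturality of the interior product `i(r)`. -/
theorem contrR_tensor (hΓ : Γ.IsSymmetric) (hΓ' : Γ'.IsSymmetric) {lam : SuperFun m V}
    (hlam : lam.IsParity 0) (A : Symb n m (Smooth W')) :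
    Γ.contrR (Symb.ofBase lam * C.tensor A) = Symb.ofBase lam * C.tensor (Γ'.contrR A) := by
  have hl (X : Symb n m (Smooth V)) : X * Symb.ofBase lam = Symb.ofBase lam * X :=
    ((Symb.isParity_ofBase hlam).comm_even X)
  have e (j : Idx n m) : Γ.ricciOp j (Symb.ofBase lam * C.tensor A) =
      ∑ b, Symb.ofBase (C.J j b) * (Symb.ofBase lam * C.tensor (Γ'.ricciOp b A)) := by
    rw [(hΓ.isSuperDer_ricciOp j).leibniz_of_isParity (Symb.isParity_ofBase hlam), ksign_zero_right,
      one_smul, Christoffel.ricciOp_ofBase, zero_mul, zero_add, RingHom.id_apply,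
      C.ricciOp_tensor hΓ hΓ', Finset.mul_sum]
    refine Finset.sum_congr rfl fun b _ => ?_
    rw [← mul_assoc, ← hl, mul_assoc]
  rw [hΓ.contrR_eq_sum_ricciOp, hΓ'.contrR_eq_sum_ricciOp, Finset.sum_congr rfl fun j _ => by
    rw [e j], C.sum_contr_eq]
  rw [C.tensor_smul, mul_smul_comm, map_sum, Finset.mul_sum]
  congr 1
  refine Finset.sum_congr rfl fun a _ => ?_
  rw [C.contr_ofBase_mul a hlam, ksign_zero_right, one_smul, C.contr_tensor, map_zsmul,
    mul_smul_comm]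

end ChartChange

/-! ### Symbols on a supermanifold -/

open Grassmann

namespace SuperFun

variable {N m : ℕ}

theorem preservesParity_evalHom {W : Opens (Eu N)} (x : W) :
    PreservesParity (evalHom (m := m) x) := preservesParity_mapHom _

end SuperFun

/-- The restriction to a smaller open set, as a change of coordinates. -/
def ChartChange.restrict {n m : ℕ} {W V : Opens (Eu n)} (h : V ≤ W) (Γ : Christoffel m W) :
    ChartChange Γ (fun i j k => SuperFun.res h (Γ i j k)) where
  pull := SuperFun.resHom h
  pull_parity := preservesParity_mapHom _
  pull_smul _ _ := rfl
  J i a := if i = a then 1 else 0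
  K a i := if a = i then 1 else 0
  J_parity i a := by
    split_ifs with h
    · rw [h, CharTwo.add_self_eq_zero]; exact isParity_one
    · exact isParity_zero _
  K_parity a i := by
    split_ifs with h
    · rw [h, CharTwo.add_self_eq_zero]; exact isParity_one
    · exact isParity_zero _
  J_mul_K i k := by simp
  K_mul_J a b := by simp
  pd_pull i f := by
    simp only [ite_mul, one_mul, zero_mul, Finset.sum_ite_eq, Finset.mem_univ, if_true]
    exact SuperFun.pd_res h i f
  transform i b k := by
    simp only [apply_ite (SuperFun.pd i), SuperFun.pd_one, map_zero, ite_self, apply_ite (invol _),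
      map_one, ite_mul, one_mul, zero_mul, Finset.sum_ite_eq, Finset.mem_univ, if_true, mul_ite,
      mul_one, mul_zero, zero_add, Finset.sum_ite_eq']
    rfl

theorem Christoffel.IsSymmetric.res {n m : ℕ} {W V : Opens (Eu n)} (h : V ≤ W)
    {Γ : Christoffel m W} (hΓ : Γ.IsSymmetric) :
    Christoffel.IsSymmetric (fun i j k => SuperFun.res h (Γ i j k)) where
  parity i j k := preservesParity_mapHom (Smooth.res h) _ _ (hΓ.parity i j k)
  symm i j k := by rw [hΓ.symm, map_zsmul]

namespace Symb

variable {N m : ℕ} {W : Opens (Eu N)}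

/-- The value at a point of a tensor field. -/
def evalHom (x : W) : Symb N m (Smooth W) →+* Symb N m ℝ :=
  substHom (SuperFun.evalHom x) (SuperFun.preservesParity_evalHom x) xi isParity_xi

theorem evalHom_ofBase (x : W) (f : SuperFun m W) :
    evalHom x (ofBase f : Symb N m (Smooth W)) = ofBase (SuperFun.evalHom x f) := substHom_ofBase f

theorem evalHom_xi (x : W) (i : Idx N m) : evalHom x (xi i) = xi i := substHom_xi i

theorem coef_subst_xi {B B' : Type*} [CommRing B] [Module ℝ B] [CommRing B'] [Module ℝ B']
    (g : Grassmann (Fin m) B →+ Grassmann (Fin m) B') (S : Symb N m B) (α : Fin N →₀ ℕ)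
    (K : Finset (Fin m)) : (S.subst g xi).coef α K = g (S.coef α K) := by
  induction S using nmon_induction with
  | hadd S T hS hT => rw [subst_add, coef_add, coef_add, map_add, hS, hT]
  | h f β L =>
    rw [subst_ofBase_mul_nmon, monom_xi, coef_ofBase_mul_nmon, coef_ofBase_mul_nmon]
    split_ifs
    · rfl
    · rw [map_zero]

/-- Tensor fields are determined by their values at points. -/
theorem ext_eval {S T : Symb N m (Smooth W)} (h : ∀ x, evalHom x S = evalHom x T) : S = T := by
  refine ext_coef fun α K => SuperFun.ext_eval fun x => ?_
  have e (S : Symb N m (Smooth W)) : (evalHom x S).coef α K = SuperFun.eval x (S.coef α K) :=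
    coef_subst_xi (SuperFun.evalHom x).toAddMonoidHom S α K
  rw [← e, ← e, h]

end Symb

namespace SuperChart

variable {n m : ℕ} {M₀ : TopCat.{u}} [ChartedSpace (Eu n) M₀] {A : SuperalgebraSheaf M₀}
  (c c' : SuperChart n m A) (D : Superconnection A)

/-- The restriction from the chart `c` to its overlap with `c'`. -/
def overlapRestrict : ChartChange (D.christoffel c) (c.overlapChristoffel D c') :=
  ChartChange.restrict (c.overlap_le c') (D.christoffel c)

theorem isParity_jacobian (x : c.overlap c') (i : Idx n m) :
    (∑ j, Symb.ofBase (c.jacobian c' x i j) * (Symb.xi j : Symb n m ℝ)).IsParity i.parity :=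
  isParity_sum _ fun j _ => ((Symb.isParity_ofBase (preservesParity_mapHom (Smooth.eval x) _ _
    (c.isParity_overlapJ c' i j))).mul (Symb.isParity_xi j)).congr (by
      rw [add_assoc, CharTwo.add_self_eq_zero, add_zero])

theorem isParity_evalK (x : c.overlap c') (i : Idx n m) : (∑ j, Symb.ofBase (SuperFun.evalHom x
    (c.overlapK c' i j)) * (Symb.xi j : Symb n m ℝ)).IsParity i.parity :=
  isParity_sum _ fun j _ => ((Symb.isParity_ofBase (preservesParity_mapHom (Smooth.eval x) _ _
    (c.isParity_overlapK c' i j))).mul (Symb.isParity_xi j)).congr (by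
      rw [add_assoc, CharTwo.add_self_eq_zero, add_zero])

/-- The value at a point of a tensor field written in the coordinates of `c`, rewritten by means of
the vector fields `∂̄_j`. -/
def evalJac (x : c.overlap c') : Symb n m (Smooth (c.overlap c')) →+* Symb n m ℝ :=
  Symb.substHom (SuperFun.evalHom x) (SuperFun.preservesParity_evalHom x) _ (c.isParity_jacobian c' x)

/-- The inverse of the change of frame in `evalJac`. -/
def evalInv (x : c.overlap c') : Symb n m ℝ →+* Symb n m ℝ :=
  Symb.substHom (RingHom.id _) preservesParity_id _ (c.isParity_evalK c' x)

theorem evalJac_ofBase (x : c.overlap c') (f : SuperFun m (c.overlap c')) :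
    c.evalJac c' x (Symb.ofBase f) = Symb.ofBase (SuperFun.evalHom x f) := Symb.substHom_ofBase f

theorem evalJac_xi (x : c.overlap c') (i : Idx n m) : c.evalJac c' x (Symb.xi i) =
    ∑ j, Symb.ofBase (c.jacobian c' x i j) * Symb.xi j := Symb.substHom_xi i

theorem jacobian_eq (x : c.overlap c') (i j : Idx n m) :
    c.jacobian c' x i j = SuperFun.evalHom x (c.overlapJ c' i j) := rfl

theorem sum_ite_mul_xi (x : c.overlap c') (b : Idx n m) :
    ∑ j, Symb.ofBase (SuperFun.evalHom x (if b = j then 1 else 0)) * (Symb.xi j : Symb n m ℝ) =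
      Symb.xi b := by
  rw [Finset.sum_eq_single b (fun k _ hk => by
    rw [if_neg hk.symm, map_zero, Symb.ofBase_zero, zero_mul]) (by simp), if_pos rfl, map_one,
    Symb.ofBase_one, one_mul]

theorem sum_mul_sum_xi (x : c.overlap c') (f : Idx n m → SuperFun m (c.overlap c'))
    (g : Idx n m → Idx n m → SuperFun m (c.overlap c')) :
    ∑ i, Symb.ofBase (SuperFun.evalHom x (f i)) *
        ∑ j, Symb.ofBase (SuperFun.evalHom x (g i j)) * (Symb.xi j : Symb n m ℝ) =
      ∑ j, Symb.ofBase (SuperFun.evalHom x (∑ i, f i * g i j)) * Symb.xi j := by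
  simp only [Finset.mul_sum, map_sum, map_mul, Symb.ofBase_sum, Symb.ofBase_mul, Finset.sum_mul,
    mul_assoc]
  rw [Finset.sum_comm]

theorem overlapRestrict_xi (i : Idx n m) :
    (c.overlapRestrict c' D).tensor (Symb.xi i) = Symb.xi i := by
  rw [ChartChange.tensor_xi]
  change ∑ k, Symb.ofBase (if i = k then 1 else 0) * Symb.xi k = _
  rw [Finset.sum_eq_single i (fun k _ hk => by
    rw [if_neg hk.symm, Symb.ofBase_zero, zero_mul]) (by simp), if_pos rfl, Symb.ofBase_one,
    one_mul]

/-- The left-hand side of the gluing condition of symbols. -/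
theorem evalJac_overlapRestrict (x : c.overlap c') (S : Symb n m (Smooth c.range)) :
    c.evalJac c' x ((c.overlapRestrict c' D).tensor S) =
      S.subst (SuperFun.eval ⟨x, c.overlap_le c' x.2⟩)
        (fun i => ∑ j, Symb.ofBase (c.jacobian c' x i j) * Symb.xi j) := by
  let ψ : Symb n m (Smooth c.range) →+* Symb n m ℝ := Symb.substHom
    (SuperFun.evalHom ⟨x, c.overlap_le c' x.2⟩) (SuperFun.preservesParity_evalHom _) _
      (c.isParity_jacobian c' x)
  have h0 (f : SuperFun m c.range) : ψ (Symb.ofBase f) =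
      Symb.ofBase (SuperFun.evalHom ⟨x, c.overlap_le c' x.2⟩ f) := Symb.substHom_ofBase f
  have h1 (i : Idx n m) : ψ (Symb.xi i) =
      ∑ j, Symb.ofBase (c.jacobian c' x i j) * Symb.xi j := Symb.substHom_xi i
  refine DFunLike.congr_fun (Symb.ringHom_ext
    (φ := (c.evalJac c' x).comp (c.overlapRestrict c' D).tensor) (ψ := ψ)
      (fun f => ?_) fun i => ?_) S
  · rw [RingHom.comp_apply, ChartChange.tensor_ofBase, evalJac_ofBase, h0]
    rfl
  · rw [RingHom.comp_apply, overlapRestrict_xi, evalJac_xi, h1]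

/-- The right-hand side of the gluing condition of symbols, up to the Berezinian: the change of frame in
`evalJac` undoes that of `chartChange`. -/
theorem evalJac_chartChange (x : c.overlap c') (S : Symb n m (Smooth c'.range)) :
    c.evalJac c' x ((c.chartChange D c').tensor S) =
      S.subst (fun f => SuperFun.eval x (c.pull c' f)) Symb.xi := by
  let ψ : Symb n m (Smooth c'.range) →+* Symb n m ℝ := Symb.substHom
    ((SuperFun.evalHom x).comp (c.pullHom c')) ((SuperFun.preservesParity_evalHom x).comp
      (c.preservesParity_pullHom c')) Symb.xi Symb.isParity_xi
  have h0 (f : SuperFun m c'.range) : ψ (Symb.ofBase f) =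
      Symb.ofBase (SuperFun.evalHom x (c.pullHom c' f)) := Symb.substHom_ofBase f
  have h1 (b : Idx n m) : ψ (Symb.xi b) = Symb.xi b := Symb.substHom_xi b
  have hK (b : Idx n m) : (c.chartChange D c').tensor (Symb.xi b) =
      ∑ i, Symb.ofBase (c.overlapK c' b i) * Symb.xi i := ChartChange.tensor_xi _ b
  refine DFunLike.congr_fun (Symb.ringHom_ext
    (φ := (c.evalJac c' x).comp (c.chartChange D c').tensor) (ψ := ψ)
      (fun f => ?_) fun b => ?_) S
  · rw [RingHom.comp_apply, ChartChange.tensor_ofBase, evalJac_ofBase, h0]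
    rfl
  · rw [h1, RingHom.comp_apply, hK, map_sum,
      Finset.sum_congr rfl fun i _ => by
        rw [map_mul, evalJac_ofBase, evalJac_xi,
          Finset.sum_congr rfl fun j _ => by rw [jacobian_eq]]]
    refine (c.sum_mul_sum_xi c' x _ _).trans ?_
    rw [Finset.sum_congr rfl fun j _ => by rw [c.overlapK_mul_overlapJ c' b j]]
    exact c.sum_ite_mul_xi c' x b

theorem evalInv_comp_evalJac (x : c.overlap c') :
    (c.evalInv c' x).comp (c.evalJac c' x) = Symb.evalHom x := by
  refine Symb.ringHom_ext (fun f => ?_) fun i => ?_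
  · rw [RingHom.comp_apply, evalJac_ofBase, Symb.evalHom_ofBase]
    exact Symb.substHom_ofBase _
  · rw [RingHom.comp_apply, evalJac_xi, Symb.evalHom_xi, map_sum,
      Finset.sum_congr rfl fun j _ => by
        rw [map_mul, evalInv, Symb.substHom_ofBase, Symb.substHom_xi, jacobian_eq,
          RingHom.id_apply]]
    refine (c.sum_mul_sum_xi c' x _ _).trans ?_
    rw [Finset.sum_congr rfl fun j _ => by rw [c.overlapJ_mul_overlapK c' i j]]
    exact c.sum_ite_mul_xi c' x i

/-- The families of local expressions `S` and `S'` in the charts `c` and `c'` satisfy the gluing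
condition of `δ`-density-valued symbols if and only if `S = |Ber|^δ S'` once `S'` is rewritten in
the coordinates of `c`. -/
theorem isSymbol_iff {δ : ℝ} {lam : SuperFun m (c.overlap c')}
    (hlam : ∀ x, gabsPow (berezinian (c.jacobian c' x)) δ = SuperFun.eval x lam)
    (S : Symb n m (Smooth c.range)) (S' : Symb n m (Smooth c'.range)) :
    (∀ x : c.overlap c', S.subst (SuperFun.eval ⟨x, c.overlap_le c' x.2⟩)
        (fun i => ∑ j, Symb.ofBase (c.jacobian c' x i j) * Symb.xi j) =
      Symb.ofBase (gabsPow (berezinian (c.jacobian c' x)) δ) *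
        S'.subst (fun f => SuperFun.eval x (c.pull c' f)) Symb.xi) ↔
    (c.overlapRestrict c' D).tensor S =
      Symb.ofBase lam * (c.chartChange D c').tensor S' := by
  have h (x : c.overlap c') : Symb.ofBase (gabsPow (berezinian (c.jacobian c' x)) δ) *
        S'.subst (fun f => SuperFun.eval x (c.pull c' f)) Symb.xi =
      c.evalJac c' x (Symb.ofBase lam * (c.chartChange D c').tensor S') := by
    rw [map_mul, evalJac_chartChange, evalJac_ofBase, hlam]
    rfl
  simp only [h, ← c.evalJac_overlapRestrict c' D]
  refine ⟨fun h => Symb.ext_eval fun x => ?_, fun h x => by rw [h]⟩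
  rw [← c.evalInv_comp_evalJac c', RingHom.comp_apply, RingHom.comp_apply, h x]

end SuperChart

namespace Christoffel

variable {N m : ℕ} {W : Opens (Eu N)} {Γ : Christoffel m W}

theorem IsSymmetric.euler_nabla (hΓ : Γ.IsSymmetric) (i : Idx N m) (S : Symb N m (Smooth W)) :
    Symb.euler (Γ.nabla i S) = Γ.nabla i (Symb.euler S) := by
  have h := (isSuperDer_nabla hΓ.parity i).commutator Symb.isSuperDer_euler
  have h0 := Symb.superDer_ext h IsSuperDer.zero (fun f => by
    simp [nabla_ofBase]) fun l => by
      simp [nabla_xi, Symb.euler_mul]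
  have := DFunLike.congr_fun h0 S
  simp only [AddMonoidHom.sub_apply, AddMonoidHom.comp_apply, ksign_zero_right, one_smul,
    AddMonoidHom.zero_apply] at this
  exact (sub_eq_zero.1 this).symm

theorem euler_ofBase_mul (f : SuperFun m W) (S : Symb N m (Smooth W)) :
    Symb.euler (Symb.ofBase f * S) = Symb.ofBase f * Symb.euler S := by
  rw [Symb.euler_mul, Symb.euler_ofBase, zero_mul, zero_add]

theorem euler_smul (r : ℝ) (S : Symb N m (Smooth W)) : Symb.euler (r • S) = r • Symb.euler S := by
  simp only [Symb.euler_apply, Symb.contr_smul, mul_smul_comm, Finset.smul_sum]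

theorem nabla_smul (hΓ : Γ.IsSymmetric) (i : Idx N m) (r : ℝ) (S : Symb N m (Smooth W)) :
    Γ.nabla i (r • S) = r • Γ.nabla i S := by
  have e (T : Symb N m (Smooth W)) : r • T = Symb.ofBase (r • 1) * T := by
    rw [Symb.ofBase_smul, Symb.ofBase_one, smul_mul_assoc, one_mul]
  have h : SuperFun.pd i (r • (1 : SuperFun m W)) = 0 :=
    (map_smul _ r _).trans ((congrArg _ (SuperFun.pd_one i)).trans (smul_zero r))
  rw [e, e, (isSuperDer_nabla hΓ.parity i).leibniz_of_isParity
    (Symb.isParity_ofBase (isParity_one.smul r)), nabla_ofBase, h, Symb.ofBase_zero, zero_mul,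
    zero_add, ksign_zero_right, one_smul, RingHom.id_apply]

/-- The divergence lowers the degree by one. -/
theorem IsSymmetric.euler_div (hΓ : Γ.IsSymmetric) (δ : ℝ) {r : ℝ} {S : Symb N m (Smooth W)}
    (hS : Symb.euler S = r • S) : Symb.euler (Γ.div δ S) = (r - 1) • Γ.div δ S := by
  rw [div_eq, map_sum, Finset.smul_sum]
  refine Finset.sum_congr rfl fun j _ => ?_
  rw [map_zsmul, Symb.euler_contr, map_sub Symb.euler, hΓ.euler_nabla, euler_smul, euler_ofBase_mul,
    hS, nabla_smul hΓ, mul_smul_comm, smul_comm δ r, ← smul_sub r, Symb.contr_smul, sub_smul,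
    one_smul, smul_sub, smul_comm]

/-- The interior product by `r` lowers the degree by two. -/
theorem euler_contrR {r : ℝ} {S : Symb N m (Smooth W)}
    (hS : Symb.euler S = r • S) : Symb.euler (Γ.contrR S) = (r - 2) • Γ.contrR S := by
  rw [contrR, euler_smul, smul_comm (r - 2)]
  refine congrArg (fun T : Symb N m (Smooth W) => (1 / 2 : ℝ) • T) ?_
  rw [map_sum, Finset.smul_sum]
  refine Finset.sum_congr rfl fun a _ => ?_
  rw [map_sum, Finset.smul_sum]
  refine Finset.sum_congr rfl fun b _ => ?_
  rw [euler_ofBase_mul, Symb.euler_contr, Symb.euler_contr, hS, Symb.contr_smul, map_sub,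
    Symb.contr_smul, ← mul_smul_comm]
  congr 1
  module

end Christoffel

section SymbolOfDegree

variable {n m : ℕ} {M₀ : TopCat.{u}} [ChartedSpace (Eu n) M₀] {A : SuperalgebraSheaf M₀}

/-- Symbols of weight `δ` on which the Euler operator acts by `r`; the degree `r` is a real number,
so that degrees may be lowered without case distinctions. -/
structure IsSymbolOfDegree (D : Superconnection A) (δ r : ℝ)
    (S : SymbolFamily (n := n) (m := m) A) : Prop where
  euler : ∀ c, Symb.euler (S c) = r • S c
  change : ∀ (c c' : SuperChart n m A) (lam : SuperFun m (c.overlap c')),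
    (∀ x, gabsPow (berezinian (c.jacobian c' x)) δ = SuperFun.eval x lam) →
    (c.overlapRestrict c' D).tensor (S c) = Symb.ofBase lam * (c.chartChange D c').tensor (S c')

variable {D : Superconnection A} {δ r : ℝ} {S T : SymbolFamily (n := n) (m := m) A}

theorem isSymbol_iff_isSymbolOfDegree {k : ℕ} : IsSymbol δ k S ↔ IsSymbolOfDegree D δ k S := by
  refine ⟨fun h => ⟨fun c => Symb.isHomog_iff.1 (h.1 c), fun c c' lam hlam =>
    (c.isSymbol_iff c' D hlam _ _).1 (h.2 c c')⟩, fun h => ⟨fun c => Symb.isHomog_iff.2 (h.euler c),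
    fun c c' => ?_⟩⟩
  obtain ⟨ℓ, -, -, -, hlam⟩ := c.exists_logBer c'
  obtain ⟨lam, -, hlam, -⟩ := hlam δ
  exact (c.isSymbol_iff c' D hlam _ _).2 (h.change c c' lam hlam)

namespace IsSymbolOfDegree

theorem add (hS : IsSymbolOfDegree D δ r S) (hT : IsSymbolOfDegree D δ r T) :
    IsSymbolOfDegree D δ r (fun c => S c + T c) where
  euler c := by rw [map_add, hS.euler, hT.euler, smul_add]
  change c c' lam h := by rw [map_add, map_add, hS.change c c' lam h, hT.change c c' lam h, mul_add]

theorem smul (hS : IsSymbolOfDegree D δ r S) (s : ℝ) :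
    IsSymbolOfDegree D δ r (fun c => s • S c) where
  euler c := by rw [Christoffel.euler_smul, hS.euler, smul_comm]
  change c c' lam h := by
    rw [ChartChange.tensor_smul, ChartChange.tensor_smul, hS.change c c' lam h, mul_smul_comm]

theorem congr (hS : IsSymbolOfDegree D δ r S) {s : ℝ} (h : r = s) : IsSymbolOfDegree D δ s S := h ▸ hS

theorem eq_zero (hS : IsSymbolOfDegree D δ r S) (hr : r < 0) (c) : S c = 0 :=
  Symb.eq_zero_of_euler_neg hr (hS.euler c)

/-- The divergence of a symbol is a symbol: it is natural under the restriction to the overlap and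
under the change of coordinates. -/
theorem div (hD : D.IsTorsionFree) (hS : IsSymbolOfDegree D δ r S) :
    IsSymbolOfDegree D δ (r - 1) (fun c => D.div c δ (S c)) where
  euler c := (c.isSymmetric_christoffel D hD).euler_div δ (hS.euler c)
  change c c' lam h := by
    have hc := c.isSymmetric_christoffel D hD
    have hc' := c'.isSymmetric_christoffel D hD
    have hV : (c.overlapChristoffel D c').IsSymmetric := hc.res (c.overlap_le c')
    obtain ⟨ℓ, -, -, hℓ, hl⟩ := c.exists_logBer c'
    obtain ⟨lam', hlam', hl, hpd⟩ := hl δ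
    have hll : lam' = lam := SuperFun.ext_eval fun x => by rw [← hl, h]
    subst hll
    have h1 := (c.overlapRestrict c' D).div_tensor hV hc (δ := δ) (lam := 1) (ℓ := 0) isParity_one
      (fun q => by
        rw [SuperFun.pd_one, map_zero, mul_zero]
        exact (smul_zero (A := SuperFun m (c.overlap c')) δ).symm)
      (fun i => by
        rw [map_zero, zero_add, Finset.sum_eq_single i (fun a _ ha => ?_) (by simp)]
        · change _ = (if i = i then 1 else 0) * SuperFun.res _ _
          rw [if_pos rfl, one_mul, Christoffel.trace, Christoffel.trace, map_sum]
          exact Finset.sum_congr rfl fun s _ => (map_zsmul _ _ _).symm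
        · change (if i = a then 1 else 0) * _ = 0
          rw [if_neg ha.symm, zero_mul]) (S c)
    have h2 := (c.chartChange D c').div_tensor hV hc' hlam' hpd
      ((c.chartChange D c').trace_eq hℓ hc'.parity) (S c')
    rw [Symb.ofBase_one, one_mul, one_mul, hS.change c c' _ h] at h1
    exact h1.symm.trans h2

/-- The interior product of a symbol by `r` is a symbol. -/
theorem contrR (hD : D.IsTorsionFree) (hS : IsSymbolOfDegree D δ r S) :
    IsSymbolOfDegree D δ (r - 2) (fun c => D.contrR c (S c)) where
  euler c := by
    rw [SuperChart.contrR_eq]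
    exact Christoffel.euler_contrR (hS.euler c)
  change c c' lam h := by
    have hc := c.isSymmetric_christoffel D hD
    have hc' := c'.isSymmetric_christoffel D hD
    have hV : (c.overlapChristoffel D c').IsSymmetric := hc.res (c.overlap_le c')
    obtain ⟨ℓ, -, -, -, hl⟩ := c.exists_logBer c'
    obtain ⟨lam', hlam', hl, -⟩ := hl δ
    have hll : lam' = lam := SuperFun.ext_eval fun x => by rw [← hl, h]
    subst hll
    have h1 := (c.overlapRestrict c' D).contrR_tensor hV hc (lam := 1) isParity_one (S c)
    have h2 := (c.chartChange D c').contrR_tensor hV hc' hlam' (S c')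
    rw [Symb.ofBase_one, one_mul, one_mul, hS.change c c' _ h] at h1
    rw [SuperChart.contrR_eq, SuperChart.contrR_eq]
    exact h1.symm.trans h2

end IsSymbolOfDegree

end SymbolOfDegree

/-! ### Equivariant tensors on the Thomas bundle -/

open Grassmann

theorem Symb.coef_ofBase_mul {N m : ℕ} {B : Type*} [CommRing B] (f : Grassmann (Fin m) B)
    (S : Symb N m B) (α : Fin N →₀ ℕ) (K : Finset (Fin m)) :
    (Symb.ofBase f * S).coef α K = f * S.coef α K := by
  induction S using Symb.nmon_induction with
  | hadd S T hS hT => rw [mul_add, Symb.coef_add, Symb.coef_add, hS, hT, mul_add]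
  | h g β L =>
    rw [← mul_assoc, ← Symb.ofBase_mul, Symb.coef_ofBase_mul_nmon, Symb.coef_ofBase_mul_nmon]
    split_ifs
    · rfl
    · rw [mul_zero]

section Equivariant

variable {n m : ℕ} {W : Opens (Eu n)}

/-- The ring homomorphism `slice`. -/
def sliceHom (s : ℝ) : SuperFun m (cyl W) →+* SuperFun m W :=
  mapHom (Smooth.comp (insertTime s) (contDiff_insertTime s) fun _ hx => hx)

theorem sliceHom_apply (s : ℝ) (f : SuperFun m (cyl W)) : sliceHom s f = slice s f := rfl

theorem sliceHom_smul (s r : ℝ) (f : SuperFun m (cyl W)) :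
    sliceHom s (r • f) = r • sliceHom s f := rfl

theorem preservesParity_sliceHom (s : ℝ) : PreservesParity (sliceHom (m := m) (W := W) s) :=
  preservesParity_mapHom _

theorem slice_lift (s : ℝ) (f : SuperFun m W) : sliceHom s (liftHom f) = f := rfl

theorem slice_expTime_mul (δ s : ℝ) (f : SuperFun m (cyl W)) :
    slice s (expTime δ * f) = Real.exp (δ * s) • slice s f := by
  refine Grassmann.ext (funext fun K => ?_)
  change Smooth.comp (insertTime s) (contDiff_insertTime s) (fun _ hx => hx)
    ((expTime δ * f).coeff K) = _
  rw [expTime, SuperFun.ofScalar_mul]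
  rfl

theorem hasDerivAt_insertTime (x : Eu n) (s : ℝ) :
    HasDerivAt (fun s => insertTime s x) (EuclideanSpace.single (0 : Fin (n + 1)) (1 : ℝ)) s := by
  have h : (fun s => insertTime s x) = fun s : ℝ =>
      s • EuclideanSpace.single (0 : Fin (n + 1)) (1 : ℝ) + insertTime 0 x := by
    ext s i
    refine Fin.cases ?_ (fun i => ?_) i <;> simp [insertTime]
  rw [h]
  simpa using ((hasDerivAt_id s).smul_const
    (EuclideanSpace.single (0 : Fin (n + 1)) (1 : ℝ))).add_const (insertTime 0 x)

theorem insertTime_dropTime (y : Eu (n + 1)) : insertTime (y 0) (dropTime y) = y := by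
  ext i
  refine Fin.cases rfl (fun i => rfl) i

/-- A solution of `∂_0 f = δ f` on a cylinder is determined by its values at `x^0 = 0`. -/
theorem Smooth.eq_exp_mul_of_dirDeriv {δ : ℝ} {f : Smooth (cyl W)}
    (hf : Smooth.dirDeriv (EuclideanSpace.single (0 : Fin (n + 1)) (1 : ℝ)) f = δ • f)
    (y : cyl W) : f.1 y = Real.exp (δ * y.1 0) * f.1 ⟨insertTime 0 (dropTime y.1), y.2⟩ := by
  -- Along the fibre, `exp (-δ s) f` is constant.
  have hd (s : ℝ) : HasDerivAt (fun s => Real.exp (-δ * s) *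
      zeroExt f.1 (insertTime s (dropTime y.1))) 0 s := by
    have hm : insertTime s (dropTime y.1) ∈ cyl W := y.2
    have h1 := (Smooth.hasFDerivAt f ⟨_, hm⟩).comp_hasDerivAt s (hasDerivAt_insertTime _ s)
    have h2 : fderiv ℝ (zeroExt f.1) (insertTime s (dropTime y.1))
        (EuclideanSpace.single (0 : Fin (n + 1)) (1 : ℝ)) =
          δ * zeroExt f.1 (insertTime s (dropTime y.1)) := by
      rw [zeroExt_of_mem _ hm]
      exact congrArg (fun g : Smooth (cyl W) => g.1 ⟨_, hm⟩) hf
    rw [h2] at h1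
    have h3 := (((hasDerivAt_id s).const_mul (-δ)).exp).mul h1
    refine h3.congr_deriv ?_
    simp
    ring
  have hc := is_const_of_deriv_eq_zero (fun s => (hd s).differentiableAt) (fun s => (hd s).deriv)
    (y.1 0) 0
  simp only [mul_zero, Real.exp_zero, one_mul, insertTime_dropTime] at hc
  rw [zeroExt_apply] at hc
  have h0 : f.1 ⟨insertTime 0 (dropTime y.1), y.2⟩ = zeroExt f.1 (insertTime 0 (dropTime y.1)) :=
    (zeroExt_of_mem f.1 _).symm
  rw [h0, ← hc, ← mul_assoc, ← Real.exp_add]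
  simp

/-- A solution of `∂_0 f = δ f` is `exp (δ x^0)` times a superfunction which does not depend on `x^0`. -/
theorem SuperFun.eq_expTime_mul_lift {δ : ℝ} {f : SuperFun m (cyl W)}
    (hf : SuperFun.pd timeIdx f = δ • f) : f = expTime δ * liftHom (slice 0 f) := by
  refine Grassmann.ext (funext fun K => ?_)
  rw [expTime, SuperFun.ofScalar_mul]
  ext y
  exact Smooth.eq_exp_mul_of_dirDeriv (congrFun (congrArg coeff hf) K) y

theorem Symb.coef_pd_time (S : Symb (n + 1) m (Smooth (cyl W))) (α : Fin (n + 1) →₀ ℕ)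
    (K : Finset (Fin m)) : (Symb.pd timeIdx S).coef α K = SuperFun.pd timeIdx (S.coef α K) := rfl

/-- An equivariant tensor is `exp (δ x^0)` times a tensor which does not depend on `x^0`. -/
theorem Symb.eq_expTime_mul_lift {δ : ℝ} {S : Symb (n + 1) m (Smooth (cyl W))}
    (hS : Symb.pd timeIdx S = δ • S) :
    S = Symb.ofBase (expTime δ) * (S.subst (slice 0) Symb.xi).subst liftFun Symb.xi := by
  refine Symb.ext_coef fun α K => ?_
  rw [Symb.coef_ofBase_mul, Symb.coef_subst_xi, Symb.coef_subst_xi]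
  refine SuperFun.eq_expTime_mul_lift ?_
  rw [← Symb.coef_pd_time, hS, Symb.coef_smul]

theorem pd_time_expTime_mul_lift (δ : ℝ) (f : SuperFun m W) :
    SuperFun.pd timeIdx (expTime δ * liftFun f) = δ • (expTime δ * liftFun f) := by
  rw [SuperFun.pd_mul _ (isParity_expTime δ), ← liftHom_apply, pd_time_lift, pd_time_expTime,
    mul_zero, smul_zero, add_zero, smul_mul_assoc]

theorem iterate_pd_time_expTime_mul_lift (δ : ℝ) (f : SuperFun m W) (k : ℕ) :
    (SuperFun.pd timeIdx)^[k] (expTime δ * liftFun f) = δ ^ k • (expTime δ * liftFun f) := by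
  induction k with
  | zero => simp
  | succ k ih =>
    rw [Function.iterate_succ_apply', ih, map_smul, pd_time_expTime_mul_lift, smul_smul, pow_succ]

end Equivariant

namespace SuperChart

variable {n m : ℕ} {M₀ : TopCat.{u}} [ChartedSpace (Eu n) M₀] {A : SuperalgebraSheaf M₀}
  (c c' : SuperChart n m A)

theorem pullCyl_add (y : cyl (c.overlap c')) (f g : SuperFun m (cyl c'.range)) :
    c.pullCyl c' y (f + g) = c.pullCyl c' y f + c.pullCyl c' y g := by
  simp only [pullCyl, ← Finset.sum_add_distrib]
  refine Finset.sum_congr rfl fun k _ => ?_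
  have h : (SuperFun.pd timeIdx)^[k] (f + g) =
      (SuperFun.pd timeIdx)^[k] f + (SuperFun.pd timeIdx)^[k] g :=
    iterate_map_add (SuperFun.pd timeIdx) k f g
  rw [h, map_add (slice _), ← pullHom_apply, map_add (c.pullHom c'), map_add (SuperFun.eval _),
    mul_add, smul_add]
  rfl

/-- The map `pullCyl`, as an additive map. -/
def pullCylHom (y : cyl (c.overlap c')) : SuperFun m (cyl c'.range) →+ Grassmann (Fin m) ℝ :=
  AddMonoidHom.mk' (c.pullCyl c' y) (c.pullCyl_add c' y)

/-- Under a change of coordinates, `exp (δ x^0)` is multiplied by `|Ber|^δ`. -/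
theorem pullCyl_expTime_mul_lift (y : cyl (c.overlap c')) (δ : ℝ) (f : SuperFun m c'.range) :
    c.pullCyl c' y (expTime δ * liftFun f) =
      (Real.exp (δ * y.1 0) • gabsPow (berezinian (c.jacobian c' (c.basePoint c' y))) δ) *
        SuperFun.eval (c.basePoint c' y) (c.pull c' f) := by
  have hs (r : ℝ) (b : Grassmann (Fin m) ℝ) : gsoul (r • b) = r • gsoul b := by
    refine Grassmann.ext (funext fun K => ?_)
    simp only [gsoul, gbody, ofScalar, coeff_sub, coeff_smul, smul_sub]
    split_ifs <;> simp
  have hb (r : ℝ) (b : Grassmann (Fin m) ℝ) : gbody (r • b) = r * gbody b := rfl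
  rw [pullCyl, gabsPow, gexp]
  change _ = (Real.exp (δ * y.1 0) • Real.exp (gbody (δ • c.logBer c' (c.basePoint c' y))) •
    ∑ k ∈ Finset.range (m + 1), (1 / (k.factorial : ℝ)) •
      gsoul (δ • c.logBer c' (c.basePoint c' y)) ^ k) * _
  rw [hs, hb, smul_smul, ← Real.exp_add, ← mul_add, smul_mul_assoc, Finset.sum_mul,
    Finset.smul_sum]
  refine Finset.sum_congr rfl fun k _ => ?_
  have h1 (t : ℝ) : slice t (δ ^ k • (expTime δ * liftFun f)) =
      (δ ^ k * Real.exp (δ * t)) • f := by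
    rw [← sliceHom_apply, sliceHom_smul, sliceHom_apply, slice_expTime_mul, mul_smul]
    rfl
  -- Each derivative with respect to `x^0` gives a factor `δ`, so that the Taylor expansion in the
  -- nilpotent part of `log |Ber|` is the exponential series of `δ log |Ber|`.
  rw [iterate_pd_time_expTime_mul_lift, h1, ← pullHom_apply, pullHom_smul, SuperFun.eval_smul,
    pullHom_apply, smul_pow, smul_mul_assoc, smul_mul_assoc, mul_smul_comm, smul_smul, smul_smul,
    smul_smul]
  congr 1
  ring

/-- The gluing condition of tensors on the Thomas bundle, for equivariant tensors. -/
theorem glue_equivariant_iff (y : cyl (c.overlap c')) (δ : ℝ)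
    (T : Symb (n + 1) m (Smooth c.range)) (T' : Symb (n + 1) m (Smooth c'.range)) :
    ((Symb.ofBase (expTime δ) * T.subst liftFun Symb.xi).subst
        (SuperFun.eval ⟨y, c.cyl_overlap_le c' y.2⟩)
        (fun a => ∑ b, Symb.ofBase (c.jacobianCyl c' y a b) * Symb.xi b) =
      (Symb.ofBase (expTime δ) * T'.subst liftFun Symb.xi).subst (c.pullCyl c' y)
        (Symb.xi (N := n + 1))) ↔
    T.subst (SuperFun.eval ⟨c.basePoint c' y, c.overlap_le c' (c.basePoint c' y).2⟩)
        (fun a => ∑ b, Symb.ofBase (c.jacobianCyl c' y a b) * Symb.xi b) =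
      Symb.ofBase (gabsPow (berezinian (c.jacobian c' (c.basePoint c' y))) δ) *
        T'.subst (fun f => SuperFun.eval (c.basePoint c' y) (c.pull c' f)) Symb.xi := by
  have h1 := Symb.subst_ofBase_mul_subst (SuperFun.eval ⟨y, c.cyl_overlap_le c' y.2⟩)
    (fun a => ∑ b, Symb.ofBase (c.jacobianCyl c' y a b) * (Symb.xi b : Symb (n + 1) m ℝ))
      (expTime δ) liftFun T
  have h2 := Symb.subst_ofBase_mul_subst (c.pullCylHom c' y) (Symb.xi (N := n + 1)) (expTime δ)
    liftFun T'
  have h3 (f : SuperFun m c.range) :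
      SuperFun.eval ⟨y, c.cyl_overlap_le c' y.2⟩ (expTime δ * liftFun f) =
      (Real.exp (δ * y.1 0) • 1) * SuperFun.eval
        ⟨c.basePoint c' y, c.overlap_le c' (c.basePoint c' y).2⟩ f := by
    rw [← SuperFun.evalHom_apply, map_mul, smul_mul_assoc, one_mul, ← ofScalar_mul_eq_smul,
      SuperFun.evalHom_apply, expTime, SuperFun.eval_ofScalar]
    rfl
  have h4 (f : SuperFun m c'.range) := c.pullCyl_expTime_mul_lift c' y δ f
  change _ ↔ _
  rw [h1]
  simp only [h3]
  change _ = Symb.subst (c.pullCylHom c' y) _ _ ↔ _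
  rw [h2]
  change _ = Symb.subst (fun f => c.pullCyl c' y (expTime δ * liftFun f)) _ _ ↔ _
  simp only [h4]
  -- Cancel the factor `exp (δ x^0)`.
  rw [Symb.subst_mul_left, Symb.subst_mul_left, Symb.ofBase_smul, Symb.ofBase_smul,
    Symb.ofBase_one, smul_mul_assoc, smul_mul_assoc, one_mul]
  exact (smul_right_injective _ (Real.exp_pos _).ne').eq_iff

end SuperChart

/-! ### Descent and the vertical expansion of equivariant tensors -/

open Grassmann

section DropBase

variable {n m : ℕ} {B : Type*} [CommRing B] [Algebra ℝ B]

/-- The images of the `ξ_a` under `dropBase`. -/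
def dropVec (a : Idx (n + 1) m) : Symb n m B :=
  match toBase a with
  | none => 0
  | some i => Symb.xi i

theorem dropVec_timeIdx : (dropVec timeIdx : Symb n m B) = 0 := rfl

theorem dropVec_baseIdx (i : Idx n m) : (dropVec (baseIdx i) : Symb n m B) = Symb.xi i := by
  rw [dropVec, toBase_baseIdx]

theorem isParity_dropVec (a : Idx (n + 1) m) : (dropVec a : Symb n m B).IsParity a.parity := by
  induction a using idx_cases with
  | h0 => exact isParity_zero _
  | h i => rw [dropVec_baseIdx, parity_baseIdx]; exact Symb.isParity_xi i

/-- The ring homomorphism which sends `ξ_0` to `0`. -/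
def dropBase : Symb (n + 1) m B →+* Symb n m B :=
  Symb.substHom (RingHom.id _) preservesParity_id dropVec isParity_dropVec

theorem dropBase_ofBase (f : Grassmann (Fin m) B) :
    (dropBase (Symb.ofBase f) : Symb n m B) = Symb.ofBase f := Symb.substHom_ofBase f

theorem dropBase_time : (dropBase (Symb.xi timeIdx) : Symb n m B) = 0 := Symb.substHom_xi _

theorem dropBase_base (i : Idx n m) : (dropBase (Symb.xi (baseIdx i)) : Symb n m B) = Symb.xi i :=
  (Symb.substHom_xi _).trans (dropVec_baseIdx i)

end DropBase

section Descent

variable {n m : ℕ} {W : Opens (Eu n)}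

/-- The restriction of a tensor to the slice `x^0 = 0`. -/
def sliceTensor : Symb (n + 1) m (Smooth (cyl W)) →+* Symb (n + 1) m (Smooth W) :=
  Symb.substHom (sliceHom 0) (preservesParity_sliceHom 0) Symb.xi Symb.isParity_xi

theorem sliceTensor_ofBase (f : SuperFun m (cyl W)) :
    sliceTensor (Symb.ofBase f) = Symb.ofBase (sliceHom 0 f) := Symb.substHom_ofBase f

theorem sliceTensor_xi (a : Idx (n + 1) m) :
    sliceTensor (Symb.xi a : Symb (n + 1) m (Smooth (cyl W))) = Symb.xi a := Symb.substHom_xi a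

theorem sliceHom_expTime (δ : ℝ) : sliceHom 0 (expTime δ : SuperFun m (cyl W)) = 1 := by
  have h := slice_expTime_mul (m := m) (W := W) δ 0 1
  rw [mul_one, mul_zero, Real.exp_zero, one_smul, ← sliceHom_apply, ← sliceHom_apply, map_one] at h
  exact h

/-- The descent of tensors, as a ring homomorphism: it depends neither on the Christoffel symbols nor
on the weight. -/
def descentHom : Symb (n + 1) m (Smooth (cyl W)) →+* Symb n m (Smooth W) :=
  dropBase.comp sliceTensor

theorem descentHom_ofBase (f : SuperFun m (cyl W)) :
    descentHom (Symb.ofBase f) = Symb.ofBase (sliceHom 0 f) := by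
  rw [descentHom, RingHom.comp_apply, sliceTensor_ofBase, dropBase_ofBase]

theorem descentHom_time : descentHom (eulerField : Symb (n + 1) m (Smooth (cyl W))) = 0 := by
  rw [descentHom, RingHom.comp_apply, eulerField, sliceTensor_xi, dropBase_time]

theorem descentHom_base (i : Idx n m) :
    descentHom (Symb.xi (baseIdx i) : Symb (n + 1) m (Smooth (cyl W))) = Symb.xi i := by
  rw [descentHom, RingHom.comp_apply, sliceTensor_xi, dropBase_base]

theorem preservesParity_descentHom : PreservesParity (descentHom (n := n) (m := m) (W := W)) :=
  Symb.preservesParity_substHom.comp Symb.preservesParity_substHom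

theorem euler_descentHom (S : Symb (n + 1) m (Smooth (cyl W))) :
    Symb.euler (descentHom S) = descentHom (Symb.euler S) := by
  have h1 := (Symb.isSuperDer_euler (B := Smooth W)).comp_hom
    (preservesParity_descentHom (n := n) (m := m) (W := W))
  have h2 := (Symb.isSuperDer_euler (B := Smooth (cyl W))).hom_comp
    (preservesParity_descentHom (n := n) (m := m) (W := W))
  refine DFunLike.congr_fun (Symb.superDer_ext h1 h2 (fun f => ?_) fun a => ?_) S
  · change Symb.euler (descentHom (Symb.ofBase f)) = descentHom (Symb.euler (Symb.ofBase f))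
    rw [descentHom_ofBase, Symb.euler_ofBase, Symb.euler_ofBase, map_zero]
  · change Symb.euler (descentHom (Symb.xi a)) = descentHom (Symb.euler (Symb.xi a))
    rw [Symb.euler_xi]
    induction a using idx_cases with
    | h0 =>
      have h := descentHom_time (n := n) (m := m) (W := W)
      rw [eulerField] at h
      rw [h, map_zero]
    | h i => rw [descentHom_base, Symb.euler_xi]

namespace Christoffel

variable {Γ : Christoffel m W}

variable (Γ) in
/-- The images of the `ξ_a` under `toHorizontalFrame`. -/
def frameVec (a : Idx (n + 1) m) : Symb (n + 1) m (Smooth (cyl W)) :=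
  match toBase a with
  | none => Symb.xi timeIdx
  | some i => Symb.xi a + Symb.ofBase (liftFun (Γ.trace i)) * Symb.xi timeIdx

theorem frameVec_timeIdx : Γ.frameVec timeIdx = Symb.xi timeIdx := rfl

theorem frameVec_baseIdx (i : Idx n m) : Γ.frameVec (baseIdx i) =
    Symb.xi (baseIdx i) + Symb.ofBase (liftFun (Γ.trace i)) * Symb.xi timeIdx := by
  rw [frameVec, toBase_baseIdx]

theorem IsSymmetric.isParity_frameVec (hΓ : Γ.IsSymmetric) (a : Idx (n + 1) m) :
    (Γ.frameVec a).IsParity a.parity := by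
  induction a using idx_cases with
  | h0 => exact Symb.isParity_xi timeIdx
  | h i =>
    rw [frameVec_baseIdx]
    refine (Symb.isParity_xi (baseIdx i)).add ?_
    rw [parity_baseIdx]
    exact ((Symb.isParity_ofBase (preservesParity_liftHom _ _ (hΓ.isParity_trace i))).mul
      (Symb.isParity_xi timeIdx)).congr (add_zero _)

/-- The two changes of frame in the descent, to the horizontal frame and dropping `ℰ`, amount to dropping
`∂_0` in the coordinate frame. -/
theorem IsSymmetric.descent_eq (hΓ : Γ.IsSymmetric) (δ : ℝ)
    (S : Symb (n + 1) m (Smooth (cyl W))) : Γ.descent δ S = descentHom S := by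
  let φ : Symb (n + 1) m (Smooth (cyl W)) →+* Symb (n + 1) m (Smooth (cyl W)) :=
    Symb.substHom (RingHom.id _) preservesParity_id Γ.frameVec hΓ.isParity_frameVec
  have φ0 (f : SuperFun m (cyl W)) : φ (Symb.ofBase f) = Symb.ofBase f := Symb.substHom_ofBase f
  have φ1 (a : Idx (n + 1) m) : φ (Symb.xi a) = Γ.frameVec a := Symb.substHom_xi a
  let ψ : Symb (n + 1) m (Smooth (cyl W)) →+* Symb n m (Smooth W) :=
    Symb.substHom (sliceHom 0) (preservesParity_sliceHom 0) dropVec isParity_dropVec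
  have ψ0 (f : SuperFun m (cyl W)) : ψ (Symb.ofBase f) = Symb.ofBase (sliceHom 0 f) :=
    Symb.substHom_ofBase f
  have ψ1 (a : Idx (n + 1) m) : ψ (Symb.xi a) = dropVec a := Symb.substHom_xi a
  -- At `x^0 = 0` the factor `exp (-δ x^0)` is `1`.
  have h (T : Symb (n + 1) m (Smooth (cyl W))) :
      T.subst (fun f => slice 0 (expTime (-δ) * f)) dropVec = ψ T := by
    have : (fun f : SuperFun m (cyl W) => slice 0 (expTime (-δ) * f)) = sliceHom 0 := by
      funext f
      rw [slice_expTime_mul, mul_zero, Real.exp_zero, one_smul, sliceHom_apply]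
    rw [this]
    rfl
  refine (h (φ S)).trans (DFunLike.congr_fun (Symb.ringHom_ext (φ := ψ.comp φ)
    (ψ := descentHom) (fun f => ?_) fun a => ?_) S)
  · rw [RingHom.comp_apply, φ0, ψ0, descentHom_ofBase]
  · rw [RingHom.comp_apply, φ1]
    induction a using idx_cases with
    | h0 =>
      rw [frameVec_timeIdx, ψ1, dropVec_timeIdx]
      exact descentHom_time.symm
    | h i =>
      rw [frameVec_baseIdx, map_add, map_mul, ψ1, ψ1, dropVec_timeIdx, mul_zero, add_zero,
        dropVec_baseIdx, descentHom_base]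

theorem IsSymmetric.descentHom_liftTensor (hΓ : Γ.IsSymmetric) (A : Symb n m (Smooth W)) :
    descentHom (hΓ.liftTensor A) = A := by
  refine DFunLike.congr_fun (Symb.ringHom_ext (φ := descentHom.comp hΓ.liftTensor)
    (ψ := RingHom.id _) (fun f => ?_) fun i => ?_) A
  · rw [RingHom.comp_apply, hΓ.liftTensor_ofBase, descentHom_ofBase, slice_lift]
    rfl
  · have h := descentHom_time (n := n) (m := m) (W := W)
    rw [eulerField] at h
    rw [RingHom.comp_apply, hΓ.liftTensor_xi, horiz, map_sub, map_mul, h, mul_zero, sub_zero,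
      descentHom_base]
    rfl

theorem IsSymmetric.descentHom_hliftPow (hΓ : Γ.IsSymmetric) (δ : ℝ) (l : ℕ)
    (A : Symb n m (Smooth W)) :
    descentHom (hΓ.hliftPow δ l A) = if l = 0 then A else 0 := by
  rw [hliftPow_apply, map_mul, map_mul, map_pow, descentHom_ofBase, sliceHom_expTime,
    Symb.ofBase_one, one_mul, hΓ.descentHom_liftTensor, descentHom_time]
  split_ifs with h
  · rw [h, pow_zero, mul_one]
  · rw [zero_pow h, mul_zero]

theorem IsSymmetric.euler_liftTensor (hΓ : Γ.IsSymmetric) (A : Symb n m (Smooth W)) :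
    Symb.euler (hΓ.liftTensor A) = hΓ.liftTensor (Symb.euler A) := by
  have h1 := (Symb.isSuperDer_euler (B := Smooth (cyl W))).comp_hom hΓ.preservesParity_liftTensor
  have h2 := (Symb.isSuperDer_euler (B := Smooth W)).hom_comp hΓ.preservesParity_liftTensor
  refine DFunLike.congr_fun (Symb.superDer_ext h1 h2 (fun f => ?_) fun i => ?_) A
  · change Symb.euler (hΓ.liftTensor (Symb.ofBase f)) = hΓ.liftTensor (Symb.euler (Symb.ofBase f))
    rw [hΓ.liftTensor_ofBase, Symb.euler_ofBase, Symb.euler_ofBase, map_zero]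
  · change Symb.euler (hΓ.liftTensor (Symb.xi i)) = hΓ.liftTensor (Symb.euler (Symb.xi i))
    rw [Symb.euler_xi, hΓ.liftTensor_xi, horiz, map_sub, euler_ofBase_mul, Symb.euler_xi,
      Symb.euler_xi]

set_option maxHeartbeats 1000000 in
theorem IsSymmetric.euler_hliftPow (hΓ : Γ.IsSymmetric) (δ : ℝ) (l : ℕ) {r : ℝ}
    {A : Symb n m (Smooth W)} (hA : Symb.euler A = r • A) :
    Symb.euler (hΓ.hliftPow δ l A) = (r + l) • hΓ.hliftPow δ l A := by
  induction l with
  | zero =>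
    rw [hliftPow_apply, pow_zero, mul_one, euler_ofBase_mul, hΓ.euler_liftTensor, hA,
      hΓ.liftTensor_smul, mul_smul_comm, Nat.cast_zero, add_zero]
  | succ l ih =>
    have h : hΓ.hliftPow δ (l + 1) A = hΓ.hliftPow δ l A * eulerField := by
      rw [hliftPow_apply, hliftPow_apply, pow_succ, mul_assoc _ _ eulerField]
    have h' : Symb.euler (eulerField : Symb (n + 1) m (Smooth (cyl W))) = eulerField :=
      Symb.euler_xi _
    rw [h, Symb.euler_mul, ih, h', smul_mul_assoc, Nat.cast_succ, ← add_assoc, add_smul _ (1 : ℝ),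
      one_smul]

set_option maxHeartbeats 1000000 in
theorem IsSymmetric.pd_time_hliftPow (hΓ : Γ.IsSymmetric) (δ : ℝ) (l : ℕ)
    (A : Symb n m (Smooth W)) :
    Symb.pd timeIdx (hΓ.hliftPow δ l A) = δ • hΓ.hliftPow δ l A := by
  have hD := Symb.isSuperDer_pd (W := cyl W) (timeIdx : Idx (n + 1) m)
  rw [parity_timeIdx] at hD
  have hθ (A : Symb n m (Smooth W)) : Symb.pd timeIdx (hΓ.liftTensor A) = 0 := by
    refine DFunLike.congr_fun (Symb.superDer_ext (hD.comp_hom hΓ.preservesParity_liftTensor)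
      IsSuperDer.zero (fun f => ?_) fun i => ?_) A
    · change Symb.pd timeIdx (hΓ.liftTensor (Symb.ofBase f)) = 0
      rw [hΓ.liftTensor_ofBase, Symb.pd_ofBase, pd_time_lift, Symb.ofBase_zero]
    · change Symb.pd timeIdx (hΓ.liftTensor (Symb.xi i)) = 0
      rw [hΓ.liftTensor_xi, horiz, map_sub, hD.leibniz, ← liftHom_apply, Symb.pd_ofBase,
        pd_time_lift, Symb.pd_xi, Symb.pd_xi, Symb.ofBase_zero, mul_zero, zero_mul, add_zero,
        sub_zero]
  have hE (l : ℕ) : Symb.pd timeIdx (eulerField ^ l : Symb (n + 1) m (Smooth (cyl W))) = 0 := by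
    induction l with
    | zero => rw [pow_zero, hD.map_one]
    | succ l ih => rw [pow_succ, hD.leibniz, ih, eulerField, Symb.pd_xi, mul_zero, zero_mul, add_zero]
  rw [hliftPow_apply, hD.leibniz, hD.leibniz, hE, hθ, Symb.pd_ofBase, pd_time_expTime, mul_zero,
    mul_zero, add_zero, add_zero, Symb.ofBase_smul, smul_mul_assoc]
  exact smul_mul_assoc _ _ _

end Christoffel

end Descent

/-! ### The expansion in the horizontal frame -/

open Grassmann

namespace Christoffel

variable {n m : ℕ} {W : Opens (Eu n)} {Γ : Christoffel m W}

variable (Γ) in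
/-- The coefficient of `ℰ^l` in the horizontal frame, at `x^0 = 0`: it is obtained by `l` interior
products and descent. -/
def vertCoef (l : ℕ) : Symb (n + 1) m (Smooth (cyl W)) →+ Symb n m (Smooth W) :=
  AddMonoidHom.mk' (fun S => ((l.factorial : ℝ)⁻¹) • descentHom (Γ.contrVert^[l] S)) fun S T => by
    rw [iterate_map_add, map_add, smul_add]

theorem vertCoef_apply (l : ℕ) (S : Symb (n + 1) m (Smooth (cyl W))) :
    Γ.vertCoef l S = ((l.factorial : ℝ)⁻¹) • descentHom (Γ.contrVert^[l] S) := rfl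

theorem vertCoef_zero_index (S : Symb (n + 1) m (Smooth (cyl W))) :
    Γ.vertCoef 0 S = descentHom S := by
  rw [vertCoef_apply, Nat.factorial_zero, Nat.cast_one, inv_one, one_smul]
  rfl

theorem contrVert_smul (r : ℝ) (S : Symb (n + 1) m (Smooth (cyl W))) :
    Γ.contrVert (r • S) = r • Γ.contrVert S := by
  simp only [contrVert_apply, Symb.contr_smul, mul_smul_comm, smul_add, Finset.smul_sum]

theorem iterate_contrVert_smul (r : ℝ) (k : ℕ) (S : Symb (n + 1) m (Smooth (cyl W))) :
    Γ.contrVert^[k] (r • S) = r • Γ.contrVert^[k] S := by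
  induction k generalizing S with
  | zero => rfl
  | succ k ih => rw [Function.iterate_succ_apply, Function.iterate_succ_apply, contrVert_smul, ih]

theorem descentHom_smul (r : ℝ) (S : Symb (n + 1) m (Smooth (cyl W))) :
    descentHom (r • S) = r • descentHom S := by
  have e (T : Symb (n + 1) m (Smooth (cyl W))) : r • T = Symb.ofBase (r • 1) * T := by
    rw [Symb.ofBase_smul, Symb.ofBase_one, smul_mul_assoc, one_mul]
  rw [e, map_mul, descentHom_ofBase, sliceHom_smul, map_one, Symb.ofBase_smul, Symb.ofBase_one,
    smul_mul_assoc, one_mul]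

theorem vertCoef_smul (l : ℕ) (r : ℝ) (S : Symb (n + 1) m (Smooth (cyl W))) :
    Γ.vertCoef l (r • S) = r • Γ.vertCoef l S := by
  rw [vertCoef_apply, vertCoef_apply, iterate_contrVert_smul, descentHom_smul, smul_comm]

theorem IsSymmetric.iterate_contrVert_hliftPow (hΓ : Γ.IsSymmetric) (δ : ℝ) (k l : ℕ)
    (A : Symb n m (Smooth W)) : Γ.contrVert^[k] (hΓ.hliftPow δ l A) =
      (l.descFactorial k : ℝ) • hΓ.hliftPow δ (l - k) A := by
  induction k with
  | zero => rw [Nat.descFactorial_zero, Nat.cast_one, one_smul, Nat.sub_zero]; rfl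
  | succ k ih =>
    rw [Function.iterate_succ_apply', ih, contrVert_smul, hΓ.contrVert_hliftPow, smul_smul,
      Nat.descFactorial_succ, Nat.cast_mul, mul_comm, Nat.sub_sub]

/-- The maps `vertCoef k` read off the components of a sum of terms `A^h ∨ ℰ^l`. -/
theorem IsSymmetric.vertCoef_hliftPow (hΓ : Γ.IsSymmetric) (δ : ℝ) (k l : ℕ)
    (A : Symb n m (Smooth W)) :
    Γ.vertCoef k (hΓ.hliftPow δ l A) = if l = k then A else 0 := by
  rw [vertCoef_apply, hΓ.iterate_contrVert_hliftPow, descentHom_smul, hΓ.descentHom_hliftPow,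
    smul_smul]
  rcases lt_trichotomy l k with h | rfl | h
  · rw [Nat.descFactorial_of_lt h, Nat.cast_zero, mul_zero, zero_smul, if_neg h.ne]
  · rw [Nat.sub_self, if_pos rfl, if_pos rfl, Nat.descFactorial_self,
      inv_mul_cancel₀ (Nat.cast_ne_zero.2 l.factorial_ne_zero), one_smul]
  · rw [if_neg (Nat.sub_ne_zero_of_lt h), if_neg h.ne', smul_zero]

theorem euler_contrVert (S : Symb (n + 1) m (Smooth (cyl W))) :
    Symb.euler (Γ.contrVert S) = Γ.contrVert (Symb.euler S) - Γ.contrVert S := by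
  simp only [contrVert_apply, map_add, map_sum, euler_ofBase_mul, Symb.euler_contr, mul_sub,
    Finset.sum_sub_distrib]
  abel

/-- The coefficient of `ℰ^l` of a tensor of degree `r` has degree `r - l`. -/
theorem euler_vertCoef {r : ℝ} {S : Symb (n + 1) m (Smooth (cyl W))}
    (hS : Symb.euler S = r • S) (l : ℕ) :
    Symb.euler (Γ.vertCoef l S) = (r - l) • Γ.vertCoef l S := by
  have h : Symb.euler (Γ.contrVert^[l] S) = (r - l) • Γ.contrVert^[l] S := by
    induction l with
    | zero => rw [Nat.cast_zero, sub_zero]; exact hS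
    | succ l ih =>
      rw [Function.iterate_succ_apply', euler_contrVert, ih, contrVert_smul]
      push_cast
      module
  rw [vertCoef_apply, euler_smul, euler_descentHom, h, descentHom_smul, smul_comm]

variable (Γ) in
/-- The tensors which are, for all large `L`, the sum of their first `L` terms in the horizontal frame. -/
def IsExpansion (hΓ : Γ.IsSymmetric) (δ : ℝ) (S : Symb (n + 1) m (Smooth (cyl W))) : Prop :=
  ∃ L : ℕ, ∀ L' ≥ L, S = ∑ l ∈ Finset.range L', hΓ.hliftPow δ l (Γ.vertCoef l S)

theorem IsExpansion.add {hΓ : Γ.IsSymmetric} {δ : ℝ} {S T : Symb (n + 1) m (Smooth (cyl W))}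
    (hS : Γ.IsExpansion hΓ δ S) (hT : Γ.IsExpansion hΓ δ T) : Γ.IsExpansion hΓ δ (S + T) := by
  obtain ⟨L, hL⟩ := hS
  obtain ⟨M, hM⟩ := hT
  refine ⟨max L M, fun L' h => ?_⟩
  simp only [map_add, Finset.sum_add_distrib]
  rw [← hL L' (le_of_max_le_left h), ← hM L' (le_of_max_le_right h)]

theorem IsSymmetric.isExpansion_hliftPow (hΓ : Γ.IsSymmetric) (δ : ℝ) (l : ℕ)
    (A : Symb n m (Smooth W)) : Γ.IsExpansion hΓ δ (hΓ.hliftPow δ l A) := by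
  refine ⟨l + 1, fun L' h => ?_⟩
  rw [Finset.sum_eq_single l]
  · rw [hΓ.vertCoef_hliftPow, if_pos rfl]
  · intro k _ hk
    rw [hΓ.vertCoef_hliftPow, if_neg hk.symm, map_zero]
  · intro hl
    exact absurd (Finset.mem_range.2 (Nat.lt_of_succ_le h)) hl

theorem IsSymmetric.hliftPow_mul_time (hΓ : Γ.IsSymmetric) (δ : ℝ) (l : ℕ)
    (A : Symb n m (Smooth W)) :
    hΓ.hliftPow δ l A * eulerField = hΓ.hliftPow δ (l + 1) A := by
  rw [hliftPow_apply, hliftPow_apply, pow_succ, mul_assoc _ _ eulerField]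

theorem IsSymmetric.hliftPow_mul_liftTensor (hΓ : Γ.IsSymmetric) (δ : ℝ) (l : ℕ)
    (A B : Symb n m (Smooth W)) :
    hΓ.hliftPow δ l A * hΓ.liftTensor B = hΓ.hliftPow δ l (A * B) := by
  have h := IsParity.comm_even ((isParity_eulerField (n := n) (m := m) (W := W)).pow l)
    (hΓ.liftTensor B)
  rw [hliftPow_apply, hliftPow_apply, mul_assoc, ← h, map_mul]
  simp only [mul_assoc]

/-- The coordinate vector fields are combinations of the horizontal frame and of `ℰ`. -/
theorem IsExpansion.mul_xi {hΓ : Γ.IsSymmetric} {δ : ℝ} {S : Symb (n + 1) m (Smooth (cyl W))}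
    (hS : Γ.IsExpansion hΓ δ S) (a : Idx (n + 1) m) : Γ.IsExpansion hΓ δ (S * Symb.xi a) := by
  have hzero : Γ.IsExpansion hΓ δ 0 := by
    have := hΓ.isExpansion_hliftPow δ 0 0
    rwa [map_zero] at this
  obtain ⟨L, hL⟩ := hS
  rw [hL L le_rfl, Finset.sum_mul]
  refine Finset.sum_induction _ (Γ.IsExpansion hΓ δ) (fun _ _ => IsExpansion.add) hzero
    fun l _ => ?_
  generalize Γ.vertCoef l S = A
  induction a using idx_cases with
  | h0 =>
    have h := hΓ.hliftPow_mul_time δ l A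
    rw [eulerField] at h
    rw [h]
    exact hΓ.isExpansion_hliftPow δ _ _
  | h i =>
    have h : (Symb.xi (baseIdx i) : Symb (n + 1) m (Smooth (cyl W))) = hΓ.liftTensor (Symb.xi i) +
        hΓ.liftTensor (Symb.ofBase (Γ.trace i)) * eulerField := by
      rw [hΓ.liftTensor_xi, hΓ.liftTensor_ofBase, horiz, eulerField, liftHom_apply, sub_add_cancel]
    rw [h, mul_add, ← mul_assoc, hΓ.hliftPow_mul_liftTensor, hΓ.hliftPow_mul_liftTensor,
      hΓ.hliftPow_mul_time]
    exact (hΓ.isExpansion_hliftPow δ _ _).add (hΓ.isExpansion_hliftPow δ _ _)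

/-- Equivariant tensors are sums of terms `A^h ∨ ℰ^l`. -/
theorem IsSymmetric.isExpansion (hΓ : Γ.IsSymmetric) {δ : ℝ}
    {S : Symb (n + 1) m (Smooth (cyl W))} (hS : Symb.pd timeIdx S = δ • S) :
    Γ.IsExpansion hΓ δ S := by
  -- The tensor is `exp (δ x^0) φ T` for a tensor `T` with coefficients on `W`.
  let φ : Symb (n + 1) m (Smooth W) →+* Symb (n + 1) m (Smooth (cyl W)) :=
    Symb.substHom liftHom preservesParity_liftHom Symb.xi Symb.isParity_xi
  have φ0 (f : SuperFun m W) : φ (Symb.ofBase f) = Symb.ofBase (liftHom f) := Symb.substHom_ofBase f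
  have φ1 (a : Idx (n + 1) m) : φ (Symb.xi a) = Symb.xi a := Symb.substHom_xi a
  have key (T : Symb (n + 1) m (Smooth W)) :
      Γ.IsExpansion hΓ δ (Symb.ofBase (expTime δ) * φ T) := by
    induction T using Symb.xi_induction with
    | hadd S T hS hT => rw [map_add, mul_add]; exact hS.add hT
    | hbase f =>
      have h := hΓ.isExpansion_hliftPow δ 0 (Symb.ofBase f)
      rw [hliftPow_apply, pow_zero, mul_one, hΓ.liftTensor_ofBase] at h
      rw [φ0]
      exact h
    | hmul S i hS => rw [map_mul, φ1, ← mul_assoc]; exact hS.mul_xi i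
  rw [Symb.eq_expTime_mul_lift hS]
  exact key _

/-- An equivariant tensor of degree `k`, in the horizontal frame. -/
theorem IsSymmetric.eq_sum_hliftPow (hΓ : Γ.IsSymmetric) {δ : ℝ} {k : ℕ}
    {S : Symb (n + 1) m (Smooth (cyl W))} (hS : Symb.pd timeIdx S = δ • S)
    (hk : Symb.euler S = (k : ℝ) • S) :
    S = ∑ l ∈ Finset.range (k + 1), hΓ.hliftPow δ l (Γ.vertCoef l S) := by
  obtain ⟨L, hL⟩ := hΓ.isExpansion hS
  refine (hL (max L (k + 1)) (le_max_left _ _)).trans ?_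
  refine (Finset.sum_subset (Finset.range_subset_range.2 (le_max_right _ _)) fun l _ hl => ?_).symm
  -- The components with `l > k` have negative degree.
  have hlt : (k : ℝ) - l < 0 := by
    rw [Finset.mem_range, not_lt] at hl
    have : (k : ℝ) + 1 ≤ l := by exact_mod_cast hl
    linarith
  rw [Symb.eq_zero_of_euler_neg hlt (euler_vertCoef hk l), map_zero]

variable (Γ) in
/-- The divergence, as an additive map. -/
def divHom (δ : ℝ) : Symb n m (Smooth W) →+ Symb n m (Smooth W) :=
  AddMonoidHom.mk' (Γ.div δ) fun S T => by
    simp only [div_eq, map_add, mul_add, smul_add, map_sub, Finset.sum_add_distrib,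
      Finset.sum_sub_distrib, smul_sub]
    abel

theorem divHom_apply (δ : ℝ) (S : Symb n m (Smooth W)) : Γ.divHom δ S = Γ.div δ S := rfl

end Christoffel

/-! ### Solving the divergence equation -/

open Grassmann

namespace Christoffel

variable {n m : ℕ} {W : Opens (Eu n)} {Γ : Christoffel m W}

theorem contrR_zero : Γ.contrR (0 : Symb n m (Smooth W)) = 0 := by
  rw [contrR]
  simp

set_option maxHeartbeats 1000000 in
/-- The divergence of a term `A^h ∨ ℰ^l` of total degree `k`. -/
theorem IsSymmetric.thomas_divHom_hliftPow (hΓ : Γ.IsSymmetric) (h1 : (n : ℝ) - m - 1 ≠ 0)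
    (h2 : (n : ℝ) - m + 1 ≠ 0) (δ : ℝ) (k l : ℕ) {A : Symb n m (Smooth W)}
    (hA : Symb.euler A = ((k : ℝ) - l) • A) :
    Γ.thomas.divHom 0 (hΓ.hliftPow δ l A) = hΓ.hliftPow δ l (Γ.div δ A) +
      (2 * ((n : ℝ) - m + 1)) • hΓ.hliftPow δ (l + 1) (Γ.contrR A) -
        ((l : ℝ) * gammaCoeff n m δ (2 * k - l)) • hΓ.hliftPow δ (l - 1) A := by
  rcases le_or_gt l k with h | h
  · obtain ⟨j, rfl⟩ := Nat.exists_eq_add_of_le h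
    have hj : Symb.euler A = (j : ℝ) • A := by
      rw [hA]
      congr 1
      push_cast
      ring
    rw [divHom_apply, hΓ.thomas_div_hliftPow h1 h2 δ j l (Symb.isHomog_iff.2 hj)]
    congr 4
    push_cast
    ring
  -- For `l > k` the tensor `A` has negative degree.
  · have h0 : A = 0 := Symb.eq_zero_of_euler_neg (by
      have : (k : ℝ) < l := by exact_mod_cast h
      linarith) hA
    rw [h0, ← divHom_apply, contrR_zero]
    simp only [map_zero, smul_zero, add_zero, sub_zero]

/-- An equivariant tensor with vanishing divergence is determined by its descent, if no coefficient
`γ_{2k-l}` vanishes: the component of `ℰ^l` in its divergence gives the component of `ℰ^(l+1)` of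
the tensor. -/
theorem IsSymmetric.eq_zero_of_div_eq_zero (hΓ : Γ.IsSymmetric) (h1 : (n : ℝ) - m - 1 ≠ 0)
    (h2 : (n : ℝ) - m + 1 ≠ 0) {δ : ℝ} {k : ℕ}
    (hγ : ∀ l : ℕ, 1 ≤ l → l ≤ k → gammaCoeff n m δ (2 * k - l) ≠ 0)
    {S : Symb (n + 1) m (Smooth (cyl W))} (hS : Symb.pd timeIdx S = δ • S)
    (hk : Symb.euler S = (k : ℝ) • S) (hdiv : Γ.thomas.divHom 0 S = 0)
    (hdesc : descentHom S = 0) : S = 0 := by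
  have hexp := hΓ.eq_sum_hliftPow hS hk
  have hA (l : ℕ) := euler_vertCoef (Γ := Γ) hk l
  suffices h : ∀ l ≤ k, Γ.vertCoef l S = 0 by
    rw [hexp]
    refine Finset.sum_eq_zero fun l hl => ?_
    rw [h l (Nat.lt_succ_iff.1 (Finset.mem_range.1 hl)), map_zero]
  intro l
  induction l using Nat.strong_induction_on with
  | _ l ih =>
    intro hl
    rcases l with - | K
    · rw [vertCoef_zero_index, hdesc]
    -- The components up to `K` vanish by induction, and those after `K + 1` do not contribute to the
    -- coefficient of `ℰ^K` in the divergence.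
    have hK : Γ.vertCoef K (Γ.thomas.divHom 0 S) =
        -((((K + 1 : ℕ) : ℝ) * gammaCoeff n m δ (2 * k - (K + 1 : ℕ))) • Γ.vertCoef (K + 1) S) := by
      conv_lhs => rw [hexp]
      rw [map_sum, map_sum, Finset.sum_eq_single (K + 1)]
      · rw [hΓ.thomas_divHom_hliftPow h1 h2 δ k _ (hA _), map_sub, map_add, vertCoef_smul,
          vertCoef_smul, hΓ.vertCoef_hliftPow, hΓ.vertCoef_hliftPow, hΓ.vertCoef_hliftPow,
          if_neg (by omega), if_neg (by omega), if_pos (by omega), smul_zero, add_zero, zero_sub]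
      · intro l _ hlK
        rcases lt_or_gt_of_ne hlK with h | h
        · rw [ih l h (by omega), map_zero, map_zero, map_zero]
        · rw [hΓ.thomas_divHom_hliftPow h1 h2 δ k _ (hA _), map_sub, map_add, vertCoef_smul,
            vertCoef_smul, hΓ.vertCoef_hliftPow, hΓ.vertCoef_hliftPow, hΓ.vertCoef_hliftPow,
            if_neg (by omega), if_neg (by omega), if_neg (by omega), smul_zero, smul_zero, add_zero,
            sub_zero]
      · intro h
        exact absurd (Finset.mem_range.2 (by omega)) h
    rw [hdiv, map_zero] at hK
    refine (smul_eq_zero.1 (neg_eq_zero.1 hK.symm)).resolve_left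
      (mul_ne_zero (Nat.cast_ne_zero.2 K.succ_ne_zero) ?_)
    exact hγ (K + 1) (by omega) hl

set_option maxHeartbeats 1000000 in
/-- If the components `A l` satisfy the recursion, then only one line is left of the
divergence of each partial sum. -/
theorem IsSymmetric.div_sum_hliftPow (hΓ : Γ.IsSymmetric) (h1 : (n : ℝ) - m - 1 ≠ 0)
    (h2 : (n : ℝ) - m + 1 ≠ 0) {δ : ℝ} {k : ℕ} {A A' : ℕ → Symb n m (Smooth W)}
    (hA : ∀ l, Symb.euler (A l) = ((k : ℝ) - l) • A l) (h0 : A' 0 = 0)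
    (hA' : ∀ l, A' (l + 1) = A l)
    (hrec : ∀ l : ℕ, (((l + 1 : ℕ) : ℝ) * gammaCoeff n m δ (2 * k - (l + 1 : ℕ))) • A (l + 1) =
      Γ.div δ (A l) + (2 * ((n : ℝ) - m + 1)) • Γ.contrR (A' l)) (K : ℕ) :
    Γ.thomas.divHom 0 (∑ l ∈ Finset.range (K + 1), hΓ.hliftPow δ l (A l)) =
      hΓ.hliftPow δ K
        ((((K + 1 : ℕ) : ℝ) * gammaCoeff n m δ (2 * k - (K + 1 : ℕ))) • A (K + 1)) +
      (2 * ((n : ℝ) - m + 1)) • hΓ.hliftPow δ (K + 1) (Γ.contrR (A K)) := by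
  induction K with
  | zero =>
    rw [Finset.sum_range_one, hΓ.thomas_divHom_hliftPow h1 h2 δ k 0 (hA 0), hrec, h0, contrR_zero, smul_zero,
      add_zero, Nat.cast_zero, zero_mul, zero_smul, sub_zero]
  | succ K ih =>
    rw [Finset.sum_range_succ, map_add, ih, hΓ.thomas_divHom_hliftPow h1 h2 δ k _ (hA (K + 1)),
      hrec (K + 1), hA', map_add (hΓ.hliftPow δ (K + 1)), hΓ.hliftPow_smul, hΓ.hliftPow_smul,
      Nat.add_sub_cancel]
    abel

end Christoffel

/-! ### Gluing of horizontal lifts and of descents -/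

open Grassmann

section Shift

variable {n m : ℕ} {B : Type*} [CommRing B] [Algebra ℝ B]

/-- The frame vector `∂_i - t_i ∂_0`. -/
def shiftVec (t : Idx n m → Grassmann (Fin m) B) (i : Idx n m) : Symb (n + 1) m B :=
  Symb.xi (baseIdx i) - Symb.ofBase (t i) * Symb.xi timeIdx

theorem isParity_shiftVec {t : Idx n m → Grassmann (Fin m) B} (ht : ∀ i, (t i).IsParity i.parity)
    (i : Idx n m) : (shiftVec t i).IsParity i.parity := by
  refine ((Symb.isParity_xi (baseIdx i)).congr (parity_baseIdx i)).sub ?_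
  exact ((Symb.isParity_ofBase (ht i)).mul (Symb.isParity_xi timeIdx)).congr (add_zero _)

/-- The ring homomorphism which replaces `∂_i` by `∂_i - t_i ∂_0`. -/
def shiftHom {t : Idx n m → Grassmann (Fin m) B} (ht : ∀ i, (t i).IsParity i.parity) :
    Symb n m B →+* Symb (n + 1) m B :=
  Symb.substHom (RingHom.id _) preservesParity_id (shiftVec t) (isParity_shiftVec ht)

theorem shiftHom_ofBase {t : Idx n m → Grassmann (Fin m) B} (ht : ∀ i, (t i).IsParity i.parity)
    (f : Grassmann (Fin m) B) : shiftHom ht (Symb.ofBase f) = Symb.ofBase f := Symb.substHom_ofBase f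

theorem shiftHom_xi {t : Idx n m → Grassmann (Fin m) B} (ht : ∀ i, (t i).IsParity i.parity)
    (i : Idx n m) : shiftHom ht (Symb.xi i) =
      Symb.xi (baseIdx i) - Symb.ofBase (t i) * Symb.xi timeIdx := Symb.substHom_xi i

end Shift

/-- The tensor `A^h ∨ ℰ^l` is `exp (δ x^0)` times a tensor which does not depend on `x^0`. -/
theorem Christoffel.IsSymmetric.hliftPow_eq_lift {n m : ℕ} {W : Opens (Eu n)} {Γ : Christoffel m W}
    (hΓ : Γ.IsSymmetric) (δ : ℝ) (l : ℕ) (A : Symb n m (Smooth W)) :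
    hΓ.hliftPow δ l A = Symb.ofBase (expTime δ) *
      (shiftHom hΓ.isParity_trace A * Symb.xi timeIdx ^ l).subst liftFun Symb.xi := by
  let φ : Symb (n + 1) m (Smooth W) →+* Symb (n + 1) m (Smooth (cyl W)) :=
    Symb.substHom liftHom preservesParity_liftHom Symb.xi Symb.isParity_xi
  have φ0 (f : SuperFun m W) : φ (Symb.ofBase f) = Symb.ofBase (liftHom f) := Symb.substHom_ofBase f
  have φ1 (a : Idx (n + 1) m) : φ (Symb.xi a) = Symb.xi a := Symb.substHom_xi a
  have h : hΓ.liftTensor A = φ (shiftHom hΓ.isParity_trace A) := by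
    refine DFunLike.congr_fun (Symb.ringHom_ext (φ := hΓ.liftTensor)
      (ψ := φ.comp (shiftHom hΓ.isParity_trace)) (fun f => ?_) fun i => ?_) A
    · rw [RingHom.comp_apply, shiftHom_ofBase, φ0, hΓ.liftTensor_ofBase]
    · rw [RingHom.comp_apply, shiftHom_xi, map_sub, map_mul, φ0, φ1, φ1, hΓ.liftTensor_xi, horiz,
        liftHom_apply]
  change _ = _ * φ _
  rw [hliftPow_apply, map_mul, map_pow, φ1, h, eulerField, mul_assoc]

namespace SuperChart

variable {n m : ℕ} {M₀ : TopCat.{u}} [ChartedSpace (Eu n) M₀] {A : SuperalgebraSheaf M₀}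
  (c c' : SuperChart n m A)

/-- The value at a point of a tensor written in the coordinates of `c`, rewritten by means of the
vector fields `∂̄_j`. -/
def pushHom (x : c.overlap c') : Symb n m (Smooth c.range) →+* Symb n m ℝ :=
  Symb.substHom (SuperFun.evalHom ⟨x, c.overlap_le c' x.2⟩) (SuperFun.preservesParity_evalHom _) _
    (c.isParity_jacobian c' x)

theorem pushHom_ofBase (x : c.overlap c') (f : SuperFun m c.range) :
    c.pushHom c' x (Symb.ofBase f) =
      Symb.ofBase (SuperFun.evalHom ⟨x, c.overlap_le c' x.2⟩ f) := Symb.substHom_ofBase f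

theorem pushHom_xi (x : c.overlap c') (i : Idx n m) :
    c.pushHom c' x (Symb.xi i) = ∑ j, Symb.ofBase (c.jacobian c' x i j) * Symb.xi j :=
  Symb.substHom_xi i

/-- The value at a point of a tensor written in the coordinates of `c'`. -/
def valueHom (N : ℕ) (x : c.overlap c') : Symb N m (Smooth c'.range) →+* Symb N m ℝ :=
  Symb.substHom ((SuperFun.evalHom x).comp (c.pullHom c')) ((SuperFun.preservesParity_evalHom x).comp
    (c.preservesParity_pullHom c')) Symb.xi Symb.isParity_xi

theorem valueHom_ofBase {N : ℕ} (x : c.overlap c') (f : SuperFun m c'.range) :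
    c.valueHom c' N x (Symb.ofBase f) = Symb.ofBase (SuperFun.evalHom x (c.pullHom c' f)) :=
  Symb.substHom_ofBase f

theorem valueHom_xi {N : ℕ} (x : c.overlap c') (i : Idx N m) :
    c.valueHom c' N x (Symb.xi i) = Symb.xi i := Symb.substHom_xi i

theorem sum_jacobianCyl_time (y : cyl (c.overlap c')) :
    ∑ b, Symb.ofBase (c.jacobianCyl c' y timeIdx b) * (Symb.xi b : Symb (n + 1) m ℝ) =
      Symb.xi timeIdx := by
  rw [sum_idx, Finset.sum_eq_zero, add_zero]
  · change Symb.ofBase 1 * _ = _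
    rw [Symb.ofBase_one, one_mul]
  · intro i _
    rw [jacobianCyl, toBase_timeIdx, toBase_baseIdx]
    change Symb.ofBase 0 * _ = 0
    rw [Symb.ofBase_zero, zero_mul]

theorem sum_jacobianCyl_base {ℓ : SuperFun m (c.overlap c')}
    (hℓ : ∀ x, c.logBer c' x = SuperFun.eval x ℓ) (y : cyl (c.overlap c')) (i : Idx n m) :
    ∑ b, Symb.ofBase (c.jacobianCyl c' y (baseIdx i) b) * (Symb.xi b : Symb (n + 1) m ℝ) =
      Symb.ofBase (SuperFun.evalHom (c.basePoint c' y) (SuperFun.pd i ℓ)) * Symb.xi timeIdx +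
      ∑ j, Symb.ofBase (c.jacobian c' (c.basePoint c' y) i j) * Symb.xi (baseIdx j) := by
  rw [sum_idx]
  congr 1
  · rw [jacobianCyl, toBase_timeIdx, toBase_baseIdx]
    change Symb.ofBase (SuperFun.rawPd i (c.logBer c') (c.basePoint c' y)) * _ = _
    rw [c.rawPd_logBer c' hℓ]
    rfl
  · refine Finset.sum_congr rfl fun j _ => ?_
    rw [jacobianCyl, toBase_baseIdx, toBase_baseIdx]

theorem isParity_jacobianCyl (y : cyl (c.overlap c')) (a : Idx (n + 1) m) :
    (∑ b, Symb.ofBase (c.jacobianCyl c' y a b) * (Symb.xi b : Symb (n + 1) m ℝ)).IsParity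
      a.parity := by
  obtain ⟨ℓ, hev, hℓ, -⟩ := c.exists_logBer c'
  induction a using idx_cases with
  | h0 => rw [sum_jacobianCyl_time]; exact Symb.isParity_xi timeIdx
  | h i =>
    rw [c.sum_jacobianCyl_base c' hℓ, parity_baseIdx]
    refine IsParity.add ?_ (isParity_sum _ fun j _ => ?_)
    · exact ((Symb.isParity_ofBase (SuperFun.preservesParity_evalHom _ _ _
        (SuperFun.pd_parity i hev))).mul (Symb.isParity_xi timeIdx)).congr (by
          rw [parity_timeIdx, add_zero, add_zero])
    · exact ((Symb.isParity_ofBase (SuperFun.preservesParity_evalHom _ _ _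
        (c.isParity_overlapJ c' i j))).mul (Symb.isParity_xi (baseIdx j))).congr (by
          rw [parity_baseIdx, add_assoc, CharTwo.add_self_eq_zero, add_zero])

/-- The value at a point of a tensor on the cylinder over `c` which does not depend on `x^0`,
rewritten by means of the vector fields `∂̄_b`. -/
def pushCylHom (y : cyl (c.overlap c')) : Symb (n + 1) m (Smooth c.range) →+* Symb (n + 1) m ℝ :=
  Symb.substHom (SuperFun.evalHom ⟨c.basePoint c' y, c.overlap_le c' (c.basePoint c' y).2⟩)
    (SuperFun.preservesParity_evalHom _) _ (c.isParity_jacobianCyl c' y)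

theorem pushCylHom_ofBase (y : cyl (c.overlap c')) (f : SuperFun m c.range) :
    c.pushCylHom c' y (Symb.ofBase f) = Symb.ofBase
      (SuperFun.evalHom ⟨c.basePoint c' y, c.overlap_le c' (c.basePoint c' y).2⟩ f) :=
  Symb.substHom_ofBase f

theorem pushCylHom_time (y : cyl (c.overlap c')) :
    c.pushCylHom c' y (Symb.xi timeIdx) = Symb.xi timeIdx :=
  (Symb.substHom_xi _).trans (c.sum_jacobianCyl_time c' y)

theorem pushCylHom_base {ℓ : SuperFun m (c.overlap c')}
    (hℓ : ∀ x, c.logBer c' x = SuperFun.eval x ℓ) (y : cyl (c.overlap c')) (i : Idx n m) :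
    c.pushCylHom c' y (Symb.xi (baseIdx i)) =
      Symb.ofBase (SuperFun.evalHom (c.basePoint c' y) (SuperFun.pd i ℓ)) * Symb.xi timeIdx +
      ∑ j, Symb.ofBase (c.jacobian c' (c.basePoint c' y) i j) * Symb.xi (baseIdx j) :=
  (Symb.substHom_xi _).trans (c.sum_jacobianCyl_base c' hℓ y i)

/-- Gluing of equivariant tensors, in terms of ring homomorphisms. -/
theorem glue_iff (y : cyl (c.overlap c')) (δ : ℝ)
    (T : Symb (n + 1) m (Smooth c.range)) (T' : Symb (n + 1) m (Smooth c'.range)) :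
    ((Symb.ofBase (expTime δ) * T.subst liftFun Symb.xi).subst
        (SuperFun.eval ⟨y, c.cyl_overlap_le c' y.2⟩)
        (fun a => ∑ b, Symb.ofBase (c.jacobianCyl c' y a b) * Symb.xi b) =
      (Symb.ofBase (expTime δ) * T'.subst liftFun Symb.xi).subst (c.pullCyl c' y)
        (Symb.xi (N := n + 1))) ↔
    c.pushCylHom c' y T = Symb.ofBase (gabsPow (berezinian (c.jacobian c' (c.basePoint c' y))) δ) *
      c.valueHom c' (n + 1) (c.basePoint c' y) T' := c.glue_equivariant_iff c' y δ T T'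

/-- Dropping `∂_0` is compatible with changes of coordinates, since `∂̄_0 = ∂_0`. -/
theorem dropBase_pushCylHom (y : cyl (c.overlap c')) (T : Symb (n + 1) m (Smooth c.range)) :
    dropBase (c.pushCylHom c' y T) = c.pushHom c' (c.basePoint c' y) (dropBase T) := by
  obtain ⟨ℓ, -, hℓ, -⟩ := c.exists_logBer c'
  refine DFunLike.congr_fun (Symb.ringHom_ext (φ := dropBase.comp (c.pushCylHom c' y))
    (ψ := (c.pushHom c' (c.basePoint c' y)).comp dropBase) (fun f => ?_) fun a => ?_) T
  · rw [RingHom.comp_apply, RingHom.comp_apply, pushCylHom_ofBase, dropBase_ofBase, dropBase_ofBase,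
      pushHom_ofBase]
  · rw [RingHom.comp_apply, RingHom.comp_apply]
    induction a using idx_cases with
    | h0 => rw [pushCylHom_time, dropBase_time, dropBase_time, map_zero]
    | h i =>
      rw [c.pushCylHom_base c' hℓ, dropBase_base, pushHom_xi, map_add, map_mul, dropBase_time,
        mul_zero, zero_add, map_sum]
      exact Finset.sum_congr rfl fun j _ => by rw [map_mul, dropBase_ofBase, dropBase_base]

theorem dropBase_valueHom (x : c.overlap c') (T : Symb (n + 1) m (Smooth c'.range)) :
    dropBase (c.valueHom c' (n + 1) x T) = c.valueHom c' n x (dropBase T) := by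
  refine DFunLike.congr_fun (Symb.ringHom_ext (φ := dropBase.comp (c.valueHom c' (n + 1) x))
    (ψ := (c.valueHom c' n x).comp dropBase) (fun f => ?_) fun a => ?_) T
  · rw [RingHom.comp_apply, RingHom.comp_apply, valueHom_ofBase, dropBase_ofBase, dropBase_ofBase,
      valueHom_ofBase]
  · rw [RingHom.comp_apply, RingHom.comp_apply, valueHom_xi]
    induction a using idx_cases with
    | h0 => rw [dropBase_time, dropBase_time, map_zero]
    | h i => rw [dropBase_base, dropBase_base, valueHom_xi]

variable (D : Superconnection A)

theorem isParity_eval_pull_trace (hD : D.IsTorsionFree) (x : c.overlap c') (j : Idx n m) :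
    (SuperFun.evalHom x (c.pullHom c' ((D.christoffel c').trace j))).IsParity j.parity :=
  SuperFun.preservesParity_evalHom x _ _ (c.preservesParity_pullHom c' _ _
    ((c'.isSymmetric_christoffel D hD).isParity_trace j))

theorem valueHom_shiftHom (hD : D.IsTorsionFree) (x : c.overlap c')
    (S : Symb n m (Smooth c'.range)) :
    c.valueHom c' (n + 1) x (shiftHom (c'.isSymmetric_christoffel D hD).isParity_trace S) =
      shiftHom (c.isParity_eval_pull_trace c' D hD x) (c.valueHom c' n x S) := by
  refine DFunLike.congr_fun (Symb.ringHom_ext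
    (φ := (c.valueHom c' (n + 1) x).comp (shiftHom (c'.isSymmetric_christoffel D hD).isParity_trace))
    (ψ := (shiftHom (c.isParity_eval_pull_trace c' D hD x)).comp (c.valueHom c' n x))
      (fun f => ?_) fun i => ?_) S
  · rw [RingHom.comp_apply, RingHom.comp_apply, shiftHom_ofBase, valueHom_ofBase, valueHom_ofBase,
      shiftHom_ofBase]
  · rw [RingHom.comp_apply, RingHom.comp_apply, shiftHom_xi, valueHom_xi, shiftHom_xi, map_sub,
      map_mul, valueHom_xi, valueHom_xi, valueHom_ofBase]

/-- The horizontal frame vectors of two charts correspond to each other like the coordinate vector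
fields of `M`, by the transformation law of the traces of the Christoffel symbols. -/
theorem pushCylHom_shiftHom (hD : D.IsTorsionFree) (y : cyl (c.overlap c'))
    (S : Symb n m (Smooth c.range)) :
    c.pushCylHom c' y (shiftHom (c.isSymmetric_christoffel D hD).isParity_trace S) =
      shiftHom (c.isParity_eval_pull_trace c' D hD (c.basePoint c' y))
        (c.pushHom c' (c.basePoint c' y) S) := by
  obtain ⟨ℓ, -, hℓ, hpd, -⟩ := c.exists_logBer c'
  refine DFunLike.congr_fun (Symb.ringHom_ext
    (φ := (c.pushCylHom c' y).comp (shiftHom (c.isSymmetric_christoffel D hD).isParity_trace))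
    (ψ := (shiftHom (c.isParity_eval_pull_trace c' D hD _)).comp (c.pushHom c' (c.basePoint c' y)))
      (fun f => ?_) fun i => ?_) S
  · rw [RingHom.comp_apply, RingHom.comp_apply, shiftHom_ofBase, pushCylHom_ofBase, pushHom_ofBase,
      shiftHom_ofBase]
  -- The transformation law of the trace: its inhomogeneous term cancels the term `∂_i log |Ber| ∂̄_0`
  -- in `∂_i`.
  · have ht : SuperFun.evalHom ⟨c.basePoint c' y, c.overlap_le c' (c.basePoint c' y).2⟩
        ((D.christoffel c).trace i) =
        SuperFun.evalHom (c.basePoint c' y) (SuperFun.pd i ℓ) +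
          ∑ j, c.jacobian c' (c.basePoint c' y) i j *
            SuperFun.evalHom (c.basePoint c' y) (c.pullHom c' ((D.christoffel c').trace j)) := by
      have h := (c.chartChange D c').trace_eq hpd (c'.isSymmetric_christoffel D hD).parity i
      have h' : (c.overlapChristoffel D c').trace i =
          SuperFun.res (c.overlap_le c') ((D.christoffel c).trace i) := by
        rw [Christoffel.trace, Christoffel.trace, map_sum]
        exact Finset.sum_congr rfl fun s _ => (map_zsmul _ _ _).symm
      rw [h'] at h
      have h2 := congrArg (SuperFun.evalHom (c.basePoint c' y)) h
      rw [map_add, map_sum, Finset.sum_congr rfl fun j _ => map_mul _ _ _] at h2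
      exact h2
    rw [RingHom.comp_apply, RingHom.comp_apply, shiftHom_xi, map_sub, map_mul, pushCylHom_time,
      c.pushCylHom_base c' hℓ, pushCylHom_ofBase, ht, pushHom_xi, map_sum, Symb.ofBase_add,
      Symb.ofBase_sum, add_mul, Finset.sum_mul]
    simp only [map_mul, shiftHom_ofBase, shiftHom_xi, mul_sub, Finset.sum_sub_distrib,
      Symb.ofBase_mul, mul_assoc]
    abel

/-- If `S` and `S'` are glued as symbols, then `S^h ∨ ℰ^l` and `S'^h ∨ ℰ^l` are glued as tensors on
the Thomas bundle. -/
theorem glue_hliftPow (hD : D.IsTorsionFree) (y : cyl (c.overlap c')) (δ : ℝ) (l : ℕ)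
    {S : Symb n m (Smooth c.range)} {S' : Symb n m (Smooth c'.range)}
    (h : c.pushHom c' (c.basePoint c' y) S =
      Symb.ofBase (gabsPow (berezinian (c.jacobian c' (c.basePoint c' y))) δ) *
        c.valueHom c' n (c.basePoint c' y) S') :
    ((c.isSymmetric_christoffel D hD).hliftPow δ l S).subst
        (SuperFun.eval ⟨y, c.cyl_overlap_le c' y.2⟩)
        (fun a => ∑ b, Symb.ofBase (c.jacobianCyl c' y a b) * Symb.xi b) =
      ((c'.isSymmetric_christoffel D hD).hliftPow δ l S').subst (c.pullCyl c' y) Symb.xi := by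
  rw [Christoffel.IsSymmetric.hliftPow_eq_lift, Christoffel.IsSymmetric.hliftPow_eq_lift,
    glue_iff, map_mul, map_mul, map_pow, map_pow, pushCylHom_time, valueHom_xi,
    c.valueHom_shiftHom c' D hD, c.pushCylHom_shiftHom c' D hD, h, map_mul, shiftHom_ofBase, mul_assoc]

end SuperChart

/-! ### The divergence-free lift of a symbol -/

open Grassmann

section Lift

variable {n m : ℕ} {M₀ : TopCat.{u}} [ChartedSpace (Eu n) M₀] {A : SuperalgebraSheaf M₀}
  {D : Superconnection A} {δ : ℝ}

theorem IsSymbolOfDegree.zero (r : ℝ) :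
    IsSymbolOfDegree D δ r (0 : SymbolFamily (n := n) (m := m) A) where
  euler c := by rw [Pi.zero_apply, map_zero]; exact (smul_zero r).symm
  change c c' lam _ := by rw [Pi.zero_apply, Pi.zero_apply, map_zero, map_zero, mul_zero]

/-- The descent of an equivariant tensor is a symbol. -/
theorem IsTensor.isSymbol_descent (hD : D.IsTorsionFree) {k : ℕ}
    {S : TensorFamily (n := n) (m := m) A} (hS : IsTensor k S) (hδ : IsEquivariant δ S) :
    IsSymbol δ k (D.descent δ S) := by
  have hd (c) : D.descent δ S c = descentHom (S c) :=
    (c.isSymmetric_christoffel D hD).descent_eq δ (S c)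
  refine ⟨fun c => ?_, fun c c' x => ?_⟩
  · rw [hd, Symb.isHomog_iff, euler_descentHom, Symb.isHomog_iff.1 (hS.1 c),
      Christoffel.descentHom_smul]
  -- Evaluate the gluing condition on the slice `x^0 = 0` and drop `∂_0`.
  · have hx : insertTime 0 x.1 ∈ cyl (c.overlap c') := x.2
    have h := hS.2 c c' ⟨insertTime 0 x.1, hx⟩
    rw [Symb.eq_expTime_mul_lift (hδ c), Symb.eq_expTime_mul_lift (hδ c'), c.glue_iff c'] at h
    have h2 := congrArg dropBase h
    rw [map_mul, dropBase_ofBase, c.dropBase_pushCylHom, c.dropBase_valueHom] at h2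
    rw [hd, hd]
    exact h2

/-- The pair of the components `A_(l-1)` and `A_l` of the divergence-free lift of the symbol `A` of
degree `k`: the components are determined by `A_0 = A` and
`(l + 1) γ_(2k-l-1) A_(l+1) = Div A_l + 2 (n - m + 1) i(r) A_(l-1)`. -/
def liftSeq (D : Superconnection A) (δ : ℝ) (k : ℕ) (S : SymbolFamily (n := n) (m := m) A) :
    ℕ → SymbolFamily (n := n) (m := m) A × SymbolFamily (n := n) (m := m) A
  | 0 => (0, S)
  | l + 1 => ((liftSeq D δ k S l).2, fun c =>
      (((l + 1 : ℕ) : ℝ) * gammaCoeff n m δ (2 * k - (l + 1 : ℕ)))⁻¹ •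
        (D.div c δ ((liftSeq D δ k S l).2 c) +
          (2 * ((n : ℝ) - m + 1)) • D.contrR c ((liftSeq D δ k S l).1 c)))

/-- The components of the divergence-free lift are symbols, of degrees decreasing with `l`. -/
theorem isSymbolOfDegree_liftSeq (hD : D.IsTorsionFree) {k : ℕ}
    {S : SymbolFamily (n := n) (m := m) A} (hS : IsSymbolOfDegree D δ k S) (l : ℕ) :
    IsSymbolOfDegree D δ ((k : ℝ) - l + 1) (liftSeq D δ k S l).1 ∧
      IsSymbolOfDegree D δ ((k : ℝ) - l) (liftSeq D δ k S l).2 := by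
  induction l with
  | zero => exact ⟨.zero _, hS.congr (by simp)⟩
  | succ l ih =>
    refine ⟨ih.2.congr (by push_cast; ring), ?_⟩
    exact (((ih.2.div hD).congr (by push_cast; ring)).add
      (((ih.1.contrR hD).congr (by push_cast; ring)).smul _)).smul _

/-- The recursion of the components, without division: for `l ≥ k` both sides vanish because of the
degree. -/
theorem liftSeq_succ (hD : D.IsTorsionFree) {k : ℕ}
    (hγ : ∀ l : ℕ, 1 ≤ l → l ≤ k → gammaCoeff n m δ (2 * k - l) ≠ 0)
    {S : SymbolFamily (n := n) (m := m) A} (hS : IsSymbolOfDegree D δ k S) (l : ℕ) (c) :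
    (((l + 1 : ℕ) : ℝ) * gammaCoeff n m δ (2 * k - (l + 1 : ℕ))) • (liftSeq D δ k S (l + 1)).2 c =
      D.div c δ ((liftSeq D δ k S l).2 c) +
        (2 * ((n : ℝ) - m + 1)) • D.contrR c ((liftSeq D δ k S l).1 c) := by
  rcases lt_or_ge l k with h | h
  · have hne := mul_ne_zero (Nat.cast_ne_zero.2 l.succ_ne_zero : ((l + 1 : ℕ) : ℝ) ≠ 0)
      (hγ (l + 1) (by omega) h)
    exact smul_inv_smul₀ hne _
  · -- all the terms have negative degree
    have hlt : (k : ℝ) ≤ l := by exact_mod_cast h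
    obtain ⟨h1, h2⟩ := isSymbolOfDegree_liftSeq hD hS l
    rw [(isSymbolOfDegree_liftSeq hD hS (l + 1)).2.eq_zero (by push_cast; linarith) c, smul_zero,
      (h2.div hD).eq_zero (by linarith) c, (h1.contrR hD).eq_zero (by linarith) c, smul_zero,
      add_zero]

/-- The divergence-free lift of a symbol of degree `k`. -/
def divergenceFreeLift (hD : D.IsTorsionFree) (δ : ℝ) (k : ℕ)
    (S : SymbolFamily (n := n) (m := m) A) : TensorFamily (n := n) (m := m) A :=
  fun c => ∑ l ∈ Finset.range (k + 1),
    (c.isSymmetric_christoffel D hD).hliftPow δ l ((liftSeq D δ k S l).2 c)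

theorem descent_divergenceFreeLift (hD : D.IsTorsionFree) (k : ℕ)
    (S : SymbolFamily (n := n) (m := m) A) :
    D.descent δ (divergenceFreeLift hD δ k S) = S := by
  funext c
  refine ((c.isSymmetric_christoffel D hD).descent_eq δ _).trans ?_
  rw [divergenceFreeLift, map_sum, Finset.sum_eq_single 0]
  · rw [Christoffel.IsSymmetric.descentHom_hliftPow, if_pos rfl]
    rfl
  · intro l _ hl
    rw [Christoffel.IsSymmetric.descentHom_hliftPow, if_neg hl]
  · intro h
    exact absurd (Finset.mem_range.2 k.succ_pos) h

theorem isTensor_divergenceFreeLift (hD : D.IsTorsionFree) {k : ℕ}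
    {S : SymbolFamily (n := n) (m := m) A} (hS : IsSymbolOfDegree D δ k S) :
    IsTensor k (divergenceFreeLift hD δ k S) := by
  refine ⟨fun c => ?_, fun c c' y => ?_⟩
  · rw [Symb.isHomog_iff, divergenceFreeLift, map_sum, Finset.smul_sum]
    refine Finset.sum_congr rfl fun l _ => ?_
    rw [(c.isSymmetric_christoffel D hD).euler_hliftPow δ l
      ((isSymbolOfDegree_liftSeq hD hS l).2.euler c), sub_add_cancel]
  · have h1 := map_sum (Symb.substAdd (SuperFun.eval ⟨y, c.cyl_overlap_le c' y.2⟩)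
        (fun a => ∑ b, Symb.ofBase (c.jacobianCyl c' y a b) * (Symb.xi b : Symb (n + 1) m ℝ)))
      (fun l => (c.isSymmetric_christoffel D hD).hliftPow δ l ((liftSeq D δ k S l).2 c))
      (Finset.range (k + 1))
    have h2 := map_sum (Symb.substAdd (c.pullCylHom c' y) (Symb.xi (N := n + 1)))
      (fun l => (c'.isSymmetric_christoffel D hD).hliftPow δ l ((liftSeq D δ k S l).2 c'))
      (Finset.range (k + 1))
    refine h1.trans (Eq.trans (Finset.sum_congr rfl fun l _ => ?_) h2.symm)
    refine c.glue_hliftPow c' D hD y δ l ?_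
    obtain ⟨ℓ, -, -, -, hlam⟩ := c.exists_logBer c'
    obtain ⟨lam, -, hlam, -⟩ := hlam δ
    exact (c.isSymbol_iff c' D hlam _ _).2
      ((isSymbolOfDegree_liftSeq hD hS l).2.change c c' lam hlam) (c.basePoint c' y)

theorem isEquivariant_divergenceFreeLift (hD : D.IsTorsionFree) (k : ℕ)
    (S : SymbolFamily (n := n) (m := m) A) : IsEquivariant δ (divergenceFreeLift hD δ k S) := by
  intro c
  rw [divergenceFreeLift, map_sum, Finset.smul_sum]
  exact Finset.sum_congr rfl fun l _ => Christoffel.IsSymmetric.pd_time_hliftPow _ δ l _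

theorem thomasDiv_divergenceFreeLift (hD : D.IsTorsionFree) (h1 : (n : ℝ) - m - 1 ≠ 0)
    (h2 : (n : ℝ) - m + 1 ≠ 0) {k : ℕ}
    (hγ : ∀ l : ℕ, 1 ≤ l → l ≤ k → gammaCoeff n m δ (2 * k - l) ≠ 0)
    {S : SymbolFamily (n := n) (m := m) A} (hS : IsSymbolOfDegree D δ k S) (c) :
    D.thomasDiv c (divergenceFreeLift hD δ k S c) = 0 := by
  have hc := c.isSymmetric_christoffel D hD
  have h := hc.div_sum_hliftPow h1 h2 (δ := δ) (k := k)
    (A := fun l => (liftSeq D δ k S l).2 c) (A' := fun l => (liftSeq D δ k S l).1 c)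
    (fun l => (isSymbolOfDegree_liftSeq hD hS l).2.euler c) rfl (fun l => rfl) (fun l => by
      have := liftSeq_succ hD hγ hS l c
      rw [SuperChart.contrR_eq] at this
      exact this) k
  refine h.trans ?_
  -- The two remaining terms have negative degree.
  have e1 : (liftSeq D δ k S (k + 1)).2 c = 0 :=
    (isSymbolOfDegree_liftSeq hD hS (k + 1)).2.eq_zero (by push_cast; linarith) c
  have e2 : (D.christoffel c).contrR ((liftSeq D δ k S k).2 c) = 0 := by
    rw [← SuperChart.contrR_eq]
    exact ((isSymbolOfDegree_liftSeq hD hS k).2.contrR hD).eq_zero (by linarith) c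
  rw [e1, e2, smul_zero, map_zero, map_zero, smul_zero, add_zero]

/-- The descent is injective on divergence-free equivariant tensors. -/
theorem injOn_descent (hD : D.IsTorsionFree) (h1 : (n : ℝ) - m - 1 ≠ 0)
    (h2 : (n : ℝ) - m + 1 ≠ 0) {k : ℕ}
    (hγ : ∀ l : ℕ, 1 ≤ l → l ≤ k → gammaCoeff n m δ (2 * k - l) ≠ 0) :
    Set.InjOn (D.descent δ) (D.divergenceFree n m δ k) := by
  rintro S ⟨hS, hSδ, hSd⟩ T ⟨hT, hTδ, hTd⟩ h
  funext c
  have hc := c.isSymmetric_christoffel D hD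
  have hd (S : TensorFamily (n := n) (m := m) A) : D.descent δ S c = descentHom (S c) :=
    hc.descent_eq δ (S c)
  have h' := congrFun h c
  rw [hd, hd] at h'
  refine sub_eq_zero.1 (hc.eq_zero_of_div_eq_zero h1 h2 hγ (δ := δ) (k := k) ?_ ?_ ?_ ?_)
  · rw [map_sub, hSδ, hTδ, smul_sub]
  · rw [map_sub, Symb.isHomog_iff.1 (hS.1 c), Symb.isHomog_iff.1 (hT.1 c), smul_sub]
  · rw [map_sub]
    exact sub_eq_zero.2 ((hSd c).trans (hTd c).symm)
  · rw [map_sub, h', sub_self]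

end Lift

end SuperGeometry

end

open SuperGeometry

theorem mainTheorem2 {n m : ℕ} (hnm1 : (n : ℤ) - m ≠ 1) (hnm2 : (n : ℤ) - m ≠ -1)
    {M₀ : TopCat.{u}} [T2Space M₀] [SecondCountableTopology M₀] [ChartedSpace (Eu n) M₀]
    [IsManifold (𝓡 n) ∞ M₀] (M : Supermanifold n m M₀)
    (D : Superconnection M.toSuperalgebraSheaf) (hD : D.IsTorsionFree) (δ : ℝ) :
    (∀ (j l : ℕ) (A : SymbolFamily (n := n) (m := m) M.toSuperalgebraSheaf), IsSymbol δ j A →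
      ∀ c : SuperChart n m M.toSuperalgebraSheaf,
        D.thomasDiv c (D.hlift c δ (A c) * eulerField ^ l) =
          D.hlift c δ (D.div c δ (A c)) * eulerField ^ l
          + (2 * ((n : ℝ) - m + 1)) • (D.hlift c δ (D.contrR c (A c)) * eulerField ^ (l + 1))
          - ((l : ℝ) * gammaCoeff n m δ (2 * j + l)) • (D.hlift c δ (A c) * eulerField ^ (l - 1))) ∧
    (¬ IsCritical n m δ → ∀ k : ℕ,
      Set.BijOn (D.descent δ) (D.divergenceFree n m δ k)
        {A : SymbolFamily (n := n) (m := m) M.toSuperalgebraSheaf | IsSymbol δ k A}) := by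
  have h1 : (n : ℝ) - m - 1 ≠ 0 := fun h => hnm1 (by
    have : (n : ℝ) - m = 1 := by linarith
    exact_mod_cast this)
  have h2 : (n : ℝ) - m + 1 ≠ 0 := fun h => hnm2 (by
    have : (n : ℝ) - m = -1 := by linarith
    exact_mod_cast this)
  refine ⟨fun j l A hA c => ?_, fun hδ k => ?_⟩
  · have hc := c.isSymmetric_christoffel D hD
    rw [SuperChart.contrR_eq]
    exact hc.thomas_div_hliftPow h1 h2 δ j l (hA.1 c)
  · have hγ : ∀ l : ℕ, 1 ≤ l → l ≤ k → gammaCoeff n m δ (2 * k - l) ≠ 0 :=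
      fun l hl hlk h => hδ ⟨k, l, hl, hlk, h⟩
    refine ⟨fun S hS => hS.1.isSymbol_descent hD hS.2.1, injOn_descent hD h1 h2 hγ, fun A hA => ?_⟩
    have hA' := isSymbol_iff_isSymbolOfDegree (D := D).1 hA
    exact ⟨divergenceFreeLift hD δ k A, ⟨isTensor_divergenceFreeLift hD hA',
      isEquivariant_divergenceFreeLift hD k A, thomasDiv_divergenceFreeLift hD h1 h2 hγ hA'⟩,
      descent_divergenceFreeLift hD k A⟩
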